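/- **Conventions.** Let $p$ be an odd prime, $\Lambda=\mathbb Z_p$, and let $\pi\subset\Sigma_p$ be the cyclic group of order $p$ generated by the cycle $\alpha: i\mapsto i+1$. A complex is a $\mathbb Z$-graded cochain complex of $\Lambda$-modules with differential of degree $1$; a chain complex is regarded as one by placing degree $n$ in degree $-n$. Tensor products carry $d(x\otimes y)=dx\otimes y+(-1)^{\deg x}x\otimes dy$, and $\pi$ acts on $K^p=K\otimes\cdots\otimes K$ by permuting factors with Koszul signs, $\alpha(u_1\otimes\cdots\otimes u_p)=\pm u_p\otimes u_1\otimes\cdots\otimes u_{p-1}$. $W$ is the standard $\Lambda\pi$-free resolution of $\Lambda$, with one generator $e_i$ in each degree $i\ge 0$, $d e_{2i+1}=(\alpha-1)e_{2i}$, $d e_{2i}=(1+\alpha+\cdots+\alpha^{p-1})e_{2i-1}$, augmentation $\epsilon(\alpha^je_0)=1$, and coproduct the $\Lambda\pi$-map $\psi:W\to W\otimes W$ with $$\psi(e_{2i+1})=\sum_{j+k=i}e_{2j}\otimes e_{2k+1}+\sum_{j+k=i}e_{2j+1}\otimes\alpha e_{2k},$$ $$\psi(e_{2i})=\sum_{j+k=i}e_{2j}\otimes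 e_{2k}+\sum_{j+k=i-1}\ \sum_{0\le r<s<p}\alpha^re_{2j+1}\otimes\alpha^se_{2k+1}.$$ A morphism of $\Lambda\pi$-complexes is a degree-preserving $\Lambda\pi$-linear map commuting with differentials; two maps are $\Lambda\pi$-homotopic if their difference is $dH+Hd$ with $H$ a $\Lambda\pi$-linear map of degree $-1$. For simplicial sets, $C(L)$ denotes normalized chains over $\Lambda$ and $\xi$ the Alexander–Whitney map (for two or for $p$ factors). Consider families of chain maps $$\Phi: W\otimes C(L_1\times\cdots\times L_p)\to W\otimes C(L_1)\otimes\cdots\otimes C(L_p),$$ defined for all simplicial sets $L_1,\dots,L_p$, such that $\Phi$ is natural in the $L_i$; is compatible with the action of each $\sigma\in\pi$ on $W$ and by permutation of factors; is the identity on $W\otimes C_0(L_1\times\cdots\times L_p)$; satisfies $\Phi(e_0\otimes x)=e_0\otimes\xi(x)$; and satisfies $\Phi(W\otimes C_j(L_1\times\cdots\times L_p))\subseteq\sum_{k\le pj}W\otimes[C(L_1)\otimes\cdots\otimes C(L_p)]_k$. Let $\Delta: W\otimes C(L)\to C(L)^p$ be the composite of the map induced by the diagonal $L\to L^p$, $\Phi$,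 and $\epsilon\otimes\mathrm{id}$. Let $G$ be a discrete group and $O_G$ its category of canonical orbits (objects $G/H$, $H\subseteq G$ a subgroup; morphisms the $G$-maps). The objects of $\mathcal A_\Lambda$ are the triples $(T,M_0,\rho)$ of contravariant functors from $O_G$ to simplicial sets, to commutative unital $\Lambda$-algebras, and to groups, with natural actions of $\rho$ on $T$ and on $M_0$. For such a triple, $C^n_\rho(T;M_0)$ is the module of natural transformations $f:C_n(T(G/H))\to M_0(G/H)$ respecting the action of $\rho$, with $\delta f=(-1)^{n+1}f\circ\partial$. Define $$\theta: W\otimes C^*_\rho(T;M_0)^p\to C^*_\rho(T;M_0),\qquad \theta(w\otimes F)(G/H)(x)=(-1)^{\deg w\deg F}\,\alpha(F)(G/H)(\Delta(w\otimes x)),$$ $$\alpha(f_1\otimes\cdots\otimes f_p)(G/H)(x_1\otimes\cdots\otimes x_p)=(-1)^{\sum_{i<j}\deg x_i\deg x_j}f_1(G/H)(x_1)\cdots f_p(G/H)(x_p).$$ Let $(T,M_0,\rho)$ and $(T',M_0',\rho')$ be objects of $\mathcal A_\Lambda$ (for the same $G$); then $(T\times T',M_0\otimes M_0',\rho\times\rho')$,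 with the product actions, is one too. Put $K=C_\rho^*(T;M_0)$, $K'=C_{\rho'}^*(T';M_0')$, $K''=C_{\rho\times\rho'}^*(T\times T';M_0\otimes M_0')$. Write $\theta$ for the structure map of each of these, and let $\tilde\theta$ be the composite $$W\otimes(K\otimes K')^p\xrightarrow{\psi\otimes\tilde U}W\otimes W\otimes K^p\otimes K'^p\xrightarrow{\mathrm{id}\otimes\tilde t\otimes\mathrm{id}}W\otimes K^p\otimes W\otimes K'^p\xrightarrow{\theta\otimes\theta}K\otimes K',$$ where $\tilde U$ is the shuffling isomorphism and $\tilde t$ the interchange, both with Koszul signs. Let $\underline\xi^*\tilde\alpha:K\otimes K'\to K''$ be $$\underline\xi^*\tilde\alpha(f\otimes g)(G/H)=\tilde\alpha(f\otimes g)(G/H)\circ\xi,\qquad \tilde\alpha(f\otimes g)(G/H)(x\otimes y)=(-1)^{\deg x\deg y}f(G/H)(x)\otimes g(G/H)(y).$$ **Lemma 5.10.** Maps $\Phi$ as above exist. For every such $\Phi$, used to define all the structure maps, $\theta:W\otimes K''^p\to K''$ and $\tilde\theta:W\otimes(K\otimes K')^p\to K\otimes K'$ are morphisms of $\Lambda\pi$-complexes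 ($\pi$ acting diagonally on the sources and trivially on the targets), $\underline\xi^*\tilde\alpha$ is a morphism of complexes, and the diagram $$\begin{array}{ccc} W\otimes K''^p&\xrightarrow{\ \theta\ }&K''\\ {\scriptstyle \mathrm{id}\otimes(\underline\xi^*\tilde\alpha)^p}\uparrow&&\uparrow{\scriptstyle\underline\xi^*\tilde\alpha}\\ W\otimes(K\otimes K')^p&\xrightarrow{\ \tilde\theta\ }&K\otimes K'\end{array}$$ is $\Lambda\pi$-homotopy commutative: $\underline\xi^*\tilde\alpha\circ\tilde\theta$ and $\theta\circ(\mathrm{id}\otimes(\underline\xi^*\tilde\alpha)^p)$ are $\Lambda\pi$-homotopic. Thus $\underline\xi^*\tilde\alpha$ satisfies the definition of a morphism $(K\otimes K',\tilde\theta)\to(K'',\theta)$ in the category $\mathfrak C(p)$: a morphism of complexes for which this diagram is $\Lambda\pi$-homotopy commutative. -/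

import Mathlib

open CategoryTheory TensorProduct Opposite

universe u v w g u₁ u₂ v₁ v₂ w₁ w₂

noncomputable section

namespace Bredon

/-! ### Graded complexes -/

/-- A `ℤ`-graded cochain complex of `Λ`-modules, given by its total module, the (internal direct sum)
decomposition into homogeneous parts, and a differential of degree `1`.  A chain complex is regarded
as such a complex by placing its degree `n` part in degree `-n`. -/
structure Cx (Λ : Type) [CommRing Λ] where
  carrier : Type v
  [addCommGroup : AddCommGroup carrier]
  [module : Module Λ carrier]
  deg : ℤ → Submodule Λ carrier
  isInternal : DirectSum.IsInternal deg
  d : carrier →ₗ[Λ] carrier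
  d_mem : ∀ {n : ℤ} {x : carrier}, x ∈ deg n → d x ∈ deg (n + 1)
  d_d : ∀ x, d (d x) = 0

instance {Λ : Type} [CommRing Λ] : CoeSort (Cx.{v} Λ) (Type v) := ⟨Cx.carrier⟩

attribute [instance] Cx.addCommGroup Cx.module

variable {Λ : Type} [CommRing Λ]

namespace Cx

lemma parity_cases (s : ZMod 2) : s = 0 ∨ s = 1 := by
  revert s
  decide

lemma induction (K : Cx.{v} Λ) {P : K → Prop} (h : ∀ n, ∀ x ∈ K.deg n, P x)
    (ha : ∀ x y, P x → P y → P (x + y)) (x : K) : P x := by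
  have hx : x ∈ iSup K.deg := by rw [K.isInternal.submodule_iSup_eq_top]; trivial
  exact Submodule.iSup_induction (motive := P) K.deg hx h (h 0 0 (zero_mem _)) ha

lemma hom_ext (K : Cx.{v} Λ) {N : Type w} [AddCommMonoid N] [Module Λ N] {f f' : K →ₗ[Λ] N}
    (h : ∀ n, ∀ x ∈ K.deg n, f x = f' x) : f = f' :=
  LinearMap.ext (K.induction h (fun x y hx hy => by rw [map_add, map_add, hx, hy]))

/-- The decomposition of a complex into its homogeneous parts. -/
def decomp (K : Cx.{v} Λ) : K ≃ₗ[Λ] DirectSum ℤ (fun n => K.deg n) :=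
  (LinearEquiv.ofBijective (DirectSum.coeLinearMap K.deg) K.isInternal).symm

/-- Projection onto the part of degree `n`. -/
def proj (K : Cx.{v} Λ) (n : ℤ) : K →ₗ[Λ] K :=
  (K.deg n).subtype ∘ₗ DirectSum.component Λ ℤ (fun n => K.deg n) n ∘ₗ K.decomp.toLinearMap

/-- Projection onto the part of even (`s = 0`) or odd (`s = 1`) degree. -/
def par (K : Cx.{v} Λ) (s : ZMod 2) : K →ₗ[Λ] K :=
  DirectSum.toModule Λ ℤ K (fun n => if (n : ZMod 2) = s then (K.deg n).subtype else 0) ∘ₗ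
    K.decomp.toLinearMap

/-- The degree involution `x ↦ (-1)^{deg x} x`. -/
def sgn (K : Cx.{v} Λ) : K →ₗ[Λ] K := K.par 0 - K.par 1

lemma decomp_of_mem (K : Cx.{v} Λ) {n : ℤ} {x : K} (hx : x ∈ K.deg n) :
    K.decomp x = DirectSum.lof Λ ℤ (fun n => K.deg n) n ⟨x, hx⟩ := by
  rw [decomp, LinearEquiv.symm_apply_eq]
  exact (DirectSum.coeLinearMap_lof K.deg n ⟨x, hx⟩).symm

lemma proj_of_mem (K : Cx.{v} Λ) {n : ℤ} {x : K} (hx : x ∈ K.deg n) (m : ℤ) :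
    K.proj m x = if n = m then x else 0 := by
  simp only [proj, LinearMap.comp_apply, LinearEquiv.coe_coe, K.decomp_of_mem hx]
  split_ifs with h
  · subst h
    rw [DirectSum.component.lof_self]
    rfl
  · rw [DirectSum.component.of, dif_neg h]
    rfl

lemma proj_mem (K : Cx.{v} Λ) (m : ℤ) (x : K) : K.proj m x ∈ K.deg m := by
  simp only [proj, LinearMap.comp_apply]
  exact Subtype.coe_prop _

lemma par_of_mem (K : Cx.{v} Λ) {n : ℤ} {x : K} (hx : x ∈ K.deg n) (s : ZMod 2) :
    K.par s x = if (n : ZMod 2) = s then x else 0 := by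
  simp only [par, LinearMap.comp_apply, LinearEquiv.coe_coe, K.decomp_of_mem hx,
    DirectSum.toModule_lof]
  split_ifs <;> rfl

lemma sgn_of_mem (K : Cx.{v} Λ) {n : ℤ} {x : K} (hx : x ∈ K.deg n) :
    K.sgn x = if (n : ZMod 2) = 0 then x else -x := by
  simp only [sgn, LinearMap.sub_apply, K.par_of_mem hx]
  rcases parity_cases (n : ZMod 2) with h | h <;> simp [h]

lemma sgn_mem (K : Cx.{v} Λ) {n : ℤ} {x : K} (hx : x ∈ K.deg n) : K.sgn x ∈ K.deg n := by
  rw [K.sgn_of_mem hx]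
  split_ifs
  exacts [hx, neg_mem hx]

lemma sgn_sgn (K : Cx.{v} Λ) (x : K) : K.sgn (K.sgn x) = x := by
  have : K.sgn ∘ₗ K.sgn = LinearMap.id := K.hom_ext (fun n x hx => by
    rw [LinearMap.comp_apply, K.sgn_of_mem (K.sgn_mem hx), K.sgn_of_mem hx]
    split_ifs <;> simp)
  exact LinearMap.congr_fun this x

lemma d_sgn (K : Cx.{v} Λ) (x : K) : K.d (K.sgn x) = -K.sgn (K.d x) := by
  have : K.d ∘ₗ K.sgn = -(K.sgn ∘ₗ K.d) := K.hom_ext (fun n x hx => by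
    simp only [LinearMap.comp_apply, LinearMap.neg_apply]
    rw [K.sgn_of_mem (K.d_mem hx), K.sgn_of_mem hx]
    push_cast
    rcases parity_cases (n : ZMod 2) with h | h <;> simp [h, show (1 + 1 : ZMod 2) = 0 from rfl])
  exact LinearMap.congr_fun this x

lemma isInternal_of_separating {M : Type v} [AddCommGroup M] [Module Λ M] {A : Type w}
    (S : ℤ → Submodule Λ M) (Z : A → Submodule Λ M) (a : A → ℤ) (hspan : ∀ x, x ∈ iSup S)
    (hker : ∀ n k, a k ≠ n → S n ≤ Z k) (hsep : ∀ x, (∀ k, x ∈ Z k) → x = 0) :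
    DirectSum.IsInternal S := by
  refine DirectSum.isInternal_submodule_of_iSupIndep_of_iSup_eq_top (fun n => ?_)
    (eq_top_iff.2 fun x _ => hspan x)
  rw [Submodule.disjoint_def]
  intro x hx hx'
  refine hsep x (fun k => ?_)
  by_cases h : a k = n
  · exact (iSup₂_le (fun m hm => hker m k (by rw [h]; exact Ne.symm hm)) :
      (⨆ m, ⨆ (_ : m ≠ n), S m) ≤ Z k) hx'
  · exact hker n k h hx

/-- A complex which is free on a set `ι` of homogeneous generators. -/
def ofBasis {ι : Type v} (a : ι → ℤ) (d : (ι →₀ Λ) →ₗ[Λ] (ι →₀ Λ))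
    (hd : ∀ i, d (Finsupp.single i 1) ∈ Finsupp.supported Λ Λ {j | a j = a i + 1})
    (hdd : ∀ i, d (d (Finsupp.single i 1)) = 0) : Cx.{v} Λ where
  carrier := ι →₀ Λ
  deg n := Finsupp.supported Λ Λ {j | a j = n}
  isInternal := isInternal_of_separating _ (fun i => LinearMap.ker (Finsupp.lapply (R := Λ) i)) a
    (fun x => by
      induction x using Finsupp.induction_linear with
      | zero => exact zero_mem _
      | add f g hf hg => exact add_mem hf hg
      | single i r =>
        exact Submodule.mem_iSup_of_mem (a i) (Finsupp.single_mem_supported Λ r rfl))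
    (fun n i h x hx => by
      by_contra hne
      exact h (hx (by simpa using! hne)))
    (fun x hx => Finsupp.ext (fun i => by simpa using hx i))
  d := d
  d_mem := by
    intro n x hx
    rw [Finsupp.mem_supported] at hx
    rw [← Finsupp.sum_single x, Finsupp.sum, map_sum]
    refine Submodule.sum_mem _ (fun i hi => ?_)
    have h := hd i
    rw [show a i = n from hx hi] at h
    rw [show Finsupp.single i (x i) = x i • Finsupp.single i (1 : Λ) by simp, map_smul]
    exact Submodule.smul_mem _ _ h
  d_d := by
    intro x
    have : d ∘ₗ d = 0 := by
      ext i : 2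
      simpa using! hdd i
    exact LinearMap.congr_fun this x

lemma isInternal_of_generators {M : Type v} [AddCommGroup M] [Module Λ M] {A : Type w}
    [DecidableEq A] (q : A → M →ₗ[Λ] M) (a : A → ℤ) (gen : A → Set M)
    (htop : ∀ P : Submodule Λ M, (∀ k, gen k ⊆ P) → ∀ z, z ∈ P)
    (hq : ∀ k, ∀ z ∈ gen k, ∀ k', q k' z = if k = k' then z else 0) :
    DirectSum.IsInternal fun n : ℤ => Submodule.span Λ {z | ∃ k, a k = n ∧ z ∈ gen k} := by
  refine isInternal_of_separating _ (fun k => LinearMap.ker (q k)) a (htop _ fun k z hz => ?_)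
    (fun n k h => ?_) (fun z hz => ?_)
  · exact Submodule.mem_iSup_of_mem (a k) (Submodule.subset_span ⟨k, rfl, hz⟩)
  · rw [Submodule.span_le]
    rintro z ⟨k', rfl, hz⟩
    rw [SetLike.mem_coe, LinearMap.mem_ker, hq k' z hz, if_neg]
    rintro rfl
    exact h rfl
  · let P : Submodule Λ M :=
      { carrier := {z | ∃ S : Finset A, ∀ S', S ⊆ S' → ∑ k ∈ S', q k z = z}
        zero_mem' := ⟨∅, fun _ _ => by simp⟩
        add_mem' := by
          rintro z z' ⟨S, hS⟩ ⟨S', hS'⟩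
          refine ⟨S ∪ S', fun T hT => ?_⟩
          simp only [map_add, Finset.sum_add_distrib]
          rw [hS T (Finset.union_subset_left hT), hS' T (Finset.union_subset_right hT)]
        smul_mem' := by
          rintro r z ⟨S, hS⟩
          refine ⟨S, fun T hT => ?_⟩
          simp only [map_smul, ← Finset.smul_sum]
          rw [hS T hT] }
    obtain ⟨S, hS⟩ : z ∈ P := htop P (fun k z hz => ⟨{k}, fun T hT => by
      rw [Finset.sum_congr rfl (fun k' _ => hq k z hz k'), Finset.sum_ite_eq, if_pos]
      exact hT (by simp)⟩) z
    rw [← hS S subset_rfl]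
    exact Finset.sum_eq_zero (fun k _ => hz k)

lemma tensor_span (K : Cx.{u₁} Λ) (L : Cx.{u₂} Λ) (P : Submodule Λ (K ⊗[Λ] L))
    (h : ∀ i j, ∀ x ∈ K.deg i, ∀ y ∈ L.deg j, x ⊗ₜ[Λ] y ∈ P) (z : K ⊗[Λ] L) : z ∈ P := by
  induction z with
  | zero => exact zero_mem _
  | add z z' hz hz' => exact add_mem hz hz'
  | tmul x y =>
    refine K.induction (P := fun x => x ⊗ₜ[Λ] y ∈ P) (fun i x hx => ?_) (fun x x' hx hx' => by
      rw [TensorProduct.add_tmul]; exact add_mem hx hx') x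
    exact L.induction (P := fun y => x ⊗ₜ[Λ] y ∈ P) (fun j y hy => h i j x hx y hy)
      (fun y y' hy hy' => by rw [TensorProduct.tmul_add]; exact add_mem hy hy') y

/-- Pure tensors of homogeneous elements of given degrees. -/
def tensorGen (K : Cx.{u₁} Λ) (L : Cx.{u₂} Λ) (e : ℤ × ℤ) : Set (K ⊗[Λ] L) :=
  {z | ∃ x ∈ K.deg e.1, ∃ y ∈ L.deg e.2, z = x ⊗ₜ[Λ] y}

/-- The part of degree `n` of a tensor product. -/
def tensorDeg (K : Cx.{u₁} Λ) (L : Cx.{u₂} Λ) (n : ℤ) : Submodule Λ (K ⊗[Λ] L) :=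
  Submodule.span Λ {z | ∃ e : ℤ × ℤ, e.1 + e.2 = n ∧ z ∈ tensorGen K L e}

lemma tensor_isInternal (K : Cx.{u₁} Λ) (L : Cx.{u₂} Λ) : DirectSum.IsInternal (tensorDeg K L) := by
  refine isInternal_of_generators (M := K ⊗[Λ] L) (A := ℤ × ℤ)
    (fun e => TensorProduct.map (K.proj e.1) (L.proj e.2))
    (fun e => e.1 + e.2) (tensorGen K L) (fun P hP z => ?_) ?_
  · exact tensor_span K L P (fun i j x hx y hy => hP (i, j) ⟨x, hx, y, hy, rfl⟩) z
  · rintro ⟨i, j⟩ _ ⟨x, hx, y, hy, rfl⟩ ⟨i', j'⟩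
    rw [TensorProduct.map_tmul, K.proj_of_mem hx, L.proj_of_mem hy]
    simp only [Prod.mk.injEq]
    by_cases h1 : i = i' <;> by_cases h2 : j = j' <;> simp [h1, h2]

/-- `d (x ⊗ y) = d x ⊗ y + (-1)^{deg x} x ⊗ d y`. -/
def tensorD (K : Cx.{u₁} Λ) (L : Cx.{u₂} Λ) : K ⊗[Λ] L →ₗ[Λ] K ⊗[Λ] L :=
  TensorProduct.map K.d LinearMap.id + TensorProduct.map K.sgn L.d

lemma tensorD_mem (K : Cx.{u₁} Λ) (L : Cx.{u₂} Λ) {n : ℤ} {z : K ⊗[Λ] L}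
    (hz : z ∈ tensorDeg K L n) : tensorD K L z ∈ tensorDeg K L (n + 1) := by
  induction hz using Submodule.span_induction with
  | mem z hz =>
    obtain ⟨⟨i, j⟩, hij, x, hx, y, hy, rfl⟩ := hz
    dsimp only at hij
    have h1 : K.d x ⊗ₜ[Λ] y ∈ tensorDeg K L (n + 1) :=
      Submodule.subset_span ⟨(i + 1, j), by dsimp only; lia, K.d x, K.d_mem hx, y, hy, rfl⟩
    have h2 : K.sgn x ⊗ₜ[Λ] L.d y ∈ tensorDeg K L (n + 1) :=
      Submodule.subset_span ⟨(i, j + 1), by dsimp only; lia, K.sgn x, K.sgn_mem hx, L.d y,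
        L.d_mem hy, rfl⟩
    simpa [tensorD] using! add_mem h1 h2
  | zero => rw [map_zero]; exact zero_mem _
  | add x y _ _ hx hy => rw [map_add]; exact add_mem hx hy
  | smul r x _ hx => rw [map_smul]; exact Submodule.smul_mem _ _ hx

lemma tensorD_tensorD (K : Cx.{u₁} Λ) (L : Cx.{u₂} Λ) (z : K ⊗[Λ] L) :
    tensorD K L (tensorD K L z) = 0 := by
  induction z with
  | zero => rw [map_zero, map_zero]
  | add x y hx hy => rw [map_add, map_add, hx, hy, add_zero]
  | tmul x y =>
    simp only [tensorD, LinearMap.add_apply, TensorProduct.map_tmul, map_add, K.d_d, L.d_d,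
      K.d_sgn, TensorProduct.neg_tmul, TensorProduct.tmul_zero, TensorProduct.zero_tmul,
      LinearMap.id_apply]
    abel

/-- Tensor product of complexes. -/
abbrev tensor (K : Cx.{u₁} Λ) (L : Cx.{u₂} Λ) : Cx.{max u₁ u₂} Λ where
  carrier := K ⊗[Λ] L
  deg := tensorDeg K L
  isInternal := tensor_isInternal K L
  d := tensorD K L
  d_mem := tensorD_mem K L
  d_d := tensorD_tensorD K L

variable {n : ℕ}

lemma piTensor_span (K : Fin n → Cx.{v} Λ) (P : Submodule Λ (⨂[Λ] i, K i))
    (h : ∀ (e : Fin n → ℤ) (x : ∀ i, K i), (∀ i, x i ∈ (K i).deg (e i)) →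
      PiTensorProduct.tprod Λ x ∈ P) (z : ⨂[Λ] i, K i) : z ∈ P := by
  have key : ∀ (s : Finset (Fin n)) (x : ∀ i, K i), (∀ i, i ∉ s → ∃ e, x i ∈ (K i).deg e) →
      PiTensorProduct.tprod Λ x ∈ P := by
    intro s
    induction s using Finset.induction_on with
    | empty =>
      intro x hx
      choose e he using fun i => hx i (Finset.notMem_empty i)
      exact h e x he
    | insert i s hi ih =>
      intro x hx
      have := (K i).induction
        (P := fun y => PiTensorProduct.tprod Λ (Function.update x i y) ∈ P)
        (fun m y hy => ih _ (fun j hj => by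
          by_cases hji : j = i
          · subst hji; exact ⟨m, by simpa using hy⟩
          · simpa [hji] using hx j (by simp [hji, hj])))
        (fun y y' hy hy' => by rw [MultilinearMap.map_update_add]; exact add_mem hy hy') (x i)
      simpa using this
  induction z using PiTensorProduct.induction_on with
  | smul_tprod r x => exact Submodule.smul_mem _ _ (key Finset.univ x (by simp))
  | add x y hx hy => exact add_mem hx hy

/-- The operator `ε ⊗ ⋯ ⊗ ε ⊗ d ⊗ 1 ⊗ ⋯ ⊗ 1` with `d` in position `i`, where `ε` is the degree
involution. -/
def piD (K : Fin n → Cx.{v} Λ) (i : Fin n) : (⨂[Λ] i, K i) →ₗ[Λ] (⨂[Λ] i, K i) :=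
  PiTensorProduct.map fun j => if j < i then (K j).sgn else if j = i then (K j).d else LinearMap.id

lemma piD_self (K : Fin n → Cx.{v} Λ) (i : Fin n) (z) : piD K i (piD K i z) = 0 := by
  have : piD K i ∘ₗ piD K i = 0 := by
    rw [piD, ← PiTensorProduct.map_comp]
    ext x
    simp only [LinearMap.compMultilinearMap_apply, PiTensorProduct.map_tprod, LinearMap.zero_apply]
    exact MultilinearMap.map_coord_zero _ i (by simp [(K i).d_d])
  exact LinearMap.congr_fun this z

lemma tprod_update_neg {M : Fin n → Type v} [∀ i, AddCommGroup (M i)] [∀ i, Module Λ (M i)]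
    (x : ∀ i, M i) (i : Fin n) :
    PiTensorProduct.tprod Λ (Function.update x i (-x i)) = -PiTensorProduct.tprod Λ x := by
  rw [MultilinearMap.map_update_neg, Function.update_eq_self]

lemma piD_comm (K : Fin n → Cx.{v} Λ) {i k : Fin n} (h : i < k) (z) :
    piD K i (piD K k z) = - piD K k (piD K i z) := by
  have : piD K i ∘ₗ piD K k = - (piD K k ∘ₗ piD K i) := by
    rw [piD, piD, ← PiTensorProduct.map_comp, ← PiTensorProduct.map_comp]
    ext x
    simp only [LinearMap.compMultilinearMap_apply, PiTensorProduct.map_tprod, LinearMap.neg_apply]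
    rw [← tprod_update_neg _ i]
    congr 1
    funext j
    by_cases hj : j = i
    · subst hj
      simp [h, (K j).d_sgn]
    · rw [Function.update_of_ne hj]
      rcases lt_or_gt_of_ne hj with h1 | h1
      · simp [h1, h1.trans h]
      · rcases lt_trichotomy j k with h2 | h2 | h2
        · simp [h2, h1.ne', h1.not_gt]
        · subst h2
          simp [h1.ne', h1.not_gt]
        · simp [h1.ne', h1.not_gt, h2.ne', h2.not_gt]
  exact LinearMap.congr_fun this z

/-- Pure tensors of homogeneous elements of given degrees. -/
def piGen (K : Fin n → Cx.{v} Λ) (e : Fin n → ℤ) : Set (⨂[Λ] i, K i) :=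
  {z | ∃ x : ∀ i, K i, (∀ i, x i ∈ (K i).deg (e i)) ∧ z = PiTensorProduct.tprod Λ x}

/-- The part of degree `m` of a tensor product of a finite family. -/
def piDeg (K : Fin n → Cx.{v} Λ) (m : ℤ) : Submodule Λ (⨂[Λ] i, K i) :=
  Submodule.span Λ {z | ∃ e : Fin n → ℤ, ∑ i, e i = m ∧ z ∈ piGen K e}

lemma pi_isInternal (K : Fin n → Cx.{v} Λ) : DirectSum.IsInternal (piDeg K) := by
  refine isInternal_of_generators (M := ⨂[Λ] i, K i) (A := Fin n → ℤ)
    (fun e => PiTensorProduct.map fun i => (K i).proj (e i))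
    (fun e => ∑ i, e i) (piGen K) (fun P hP z => ?_) ?_
  · exact piTensor_span K P (fun e x hx => hP e ⟨x, hx, rfl⟩) z
  · rintro e _ ⟨x, hx, rfl⟩ e'
    rw [PiTensorProduct.map_tprod]
    simp only [fun i => (K i).proj_of_mem (hx i)]
    by_cases h : e = e'
    · subst h
      simp
    · rw [if_neg h]
      obtain ⟨i, hi⟩ := Function.ne_iff.1 h
      exact MultilinearMap.map_coord_zero _ i (if_neg hi)

lemma piD_mem (K : Fin n → Cx.{v} Λ) {m : ℤ} {z : ⨂[Λ] i, K i} (hz : z ∈ piDeg K m) :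
    (∑ i, piD K i) z ∈ piDeg K (m + 1) := by
  induction hz using Submodule.span_induction with
  | mem z hz =>
    obtain ⟨e, he, x, hx, rfl⟩ := hz
    rw [LinearMap.sum_apply]
    refine Submodule.sum_mem _ (fun i _ => Submodule.subset_span
      ⟨Function.update e i (e i + 1), ?_, _, fun j => ?_, PiTensorProduct.map_tprod _ _⟩)
    · rw [Finset.sum_update_of_mem (Finset.mem_univ i), ← he,
        ← Finset.add_sum_erase _ _ (Finset.mem_univ i), Finset.sdiff_singleton_eq_erase]
      ring
    · rcases lt_trichotomy j i with h | h | h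
      · simpa [h, h.ne] using (K j).sgn_mem (hx j)
      · subst h
        simpa using (K j).d_mem (hx j)
      · simpa [h.not_gt, h.ne'] using hx j
  | zero => rw [map_zero]; exact zero_mem _
  | add x y _ _ hx hy => rw [map_add]; exact add_mem hx hy
  | smul r x _ hx => rw [map_smul]; exact Submodule.smul_mem _ _ hx

lemma piD_piD (K : Fin n → Cx.{v} Λ) (z : ⨂[Λ] i, K i) :
    (∑ i, piD K i) ((∑ i, piD K i) z) = 0 := by
  simp only [LinearMap.sum_apply, map_sum]
  rw [← Finset.sum_product']
  refine Finset.sum_involution (fun a _ => (a.2, a.1)) ?_ ?_ ?_ ?_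
  · rintro ⟨i, k⟩ _
    dsimp only
    rcases lt_trichotomy i k with h | h | h
    · rw [piD_comm K h]; exact add_neg_cancel (G := ⨂[Λ] i, K i) _
    · subst h
      rw [piD_self, add_zero]
    · rw [piD_comm K h]; exact neg_add_cancel (G := ⨂[Λ] i, K i) _
  · rintro ⟨i, k⟩ _ hne h
    simp only [Prod.mk.injEq] at h
    obtain ⟨rfl, -⟩ := h
    exact hne (piD_self K _ z)
  · simp
  · simp

/-- The tensor product `K_1 ⊗ ⋯ ⊗ K_n` of a finite family of complexes, with
`d (x_1 ⊗ ⋯ ⊗ x_n) = ∑_i (-1)^{deg x_1 + ⋯ + deg x_{i-1}} x_1 ⊗ ⋯ ⊗ d x_i ⊗ ⋯ ⊗ x_n`. -/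
abbrev piTensor (K : Fin n → Cx.{v} Λ) : Cx.{v} Λ where
  carrier := ⨂[Λ] i, K i
  deg := piDeg K
  isInternal := pi_isInternal K
  d := ∑ i, piD K i
  d_mem := piD_mem K
  d_d := piD_piD K

/-- The tensor power `K^n`. -/
abbrev pow (n : ℕ) (K : Cx.{v} Λ) : Cx.{v} Λ := piTensor fun _ : Fin n => K

/-! ### Koszul signs -/

/-- `x ⊗ y ↦ (-1)^{deg x deg y} x ⊗ y`. -/
def koszul (K : Cx.{u₁} Λ) (L : Cx.{u₂} Λ) : K ⊗[Λ] L →ₗ[Λ] K ⊗[Λ] L :=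
  ∑ a : ZMod 2, ∑ b : ZMod 2, (-1 : ℤ) ^ (a.val * b.val) • TensorProduct.map (K.par a) (L.par b)

/-- `x_1 ⊗ ⋯ ⊗ x_n ↦ c(deg x_1, …, deg x_n) x_1 ⊗ ⋯ ⊗ x_n`, for `c` depending on parities only. -/
def twist (K : Fin n → Cx.{v} Λ) (c : (Fin n → ZMod 2) → ℤ) :
    (⨂[Λ] i, K i) →ₗ[Λ] (⨂[Λ] i, K i) :=
  ∑ s : Fin n → ZMod 2, c s • PiTensorProduct.map fun i => (K i).par (s i)

/-- The Koszul sign of the permutation `σ` on factors of parities `s`: the product of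
`(-1)^{s_i s_j}` over the pairs that `σ` brings out of order. -/
def permSign (σ : Equiv.Perm (Fin n)) (s : Fin n → ZMod 2) : ℤ :=
  ∏ i, ∏ j, if i < j ∧ σ j < σ i then (-1) ^ ((s i).val * (s j).val) else 1

/-- The signed permutation of factors: the `i`-th factor is moved to position `σ i`, so that
`σ (x_1 ⊗ ⋯ ⊗ x_n) = ± x_{σ⁻¹ 1} ⊗ ⋯ ⊗ x_{σ⁻¹ n}` with the Koszul sign. -/
def perm (σ : Equiv.Perm (Fin n)) (K : Fin n → Cx.{v} Λ) :
    piTensor K →ₗ[Λ] piTensor fun i => K (σ.symm i) :=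
  (PiTensorProduct.reindex Λ (fun i => (K i).carrier) σ).toLinearMap ∘ₗ twist K (permSign σ)

/-- The sign of the reordering `x_1 y_1 x_2 y_2 ⋯ x_n y_n ↦ x_1 ⋯ x_n y_1 ⋯ y_n`. -/
def shuffleSign (s t : Fin n → ZMod 2) : ℤ :=
  ∏ i, ∏ j, if j < i then (-1) ^ ((s i).val * (t j).val) else 1

/-- `x ⊗ (x_1 ⊗ ⋯ ⊗ x_n) ↦ x ⊗ x_1 ⊗ ⋯ ⊗ x_n`. -/
def cons (M : Type v) [AddCommGroup M] [Module Λ M] (n : ℕ) :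
    M →ₗ[Λ] (⨂[Λ] _ : Fin n, M) →ₗ[Λ] (⨂[Λ] _ : Fin (n + 1), M) :=
  PiTensorProduct.lift.toLinearMap ∘ₗ
    multilinearCurryLeftEquiv Λ (fun _ : Fin (n + 1) => M) (⨂[Λ] _ : Fin (n + 1), M)
      (PiTensorProduct.tprod Λ)

lemma cons_tprod (M : Type v) [AddCommGroup M] [Module Λ M] (n : ℕ) (a : M) (x : Fin n → M) :
    cons (Λ := Λ) M n a (PiTensorProduct.tprod Λ x) =
      PiTensorProduct.tprod Λ (Fin.cons a x : Fin (n + 1) → M) := by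
  simp only [cons, LinearMap.comp_apply, LinearEquiv.coe_coe]
  exact PiTensorProduct.lift.tprod _

/-- The unsigned shuffle `⨂ (x_i ⊗ y_i) ↦ (⨂ x_i) ⊗ (⨂ y_i)`. -/
def unshuffle (M : Type u₁) (N : Type u₂) [AddCommGroup M] [Module Λ M] [AddCommGroup N]
    [Module Λ N] (n : ℕ) :
    (⨂[Λ] _ : Fin n, M ⊗[Λ] N) →ₗ[Λ] (⨂[Λ] _ : Fin n, M) ⊗[Λ] (⨂[Λ] _ : Fin n, N) :=
  match n with
  | 0 => PiTensorProduct.lift <| MultilinearMap.constOfIsEmpty Λ _ <|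
      (PiTensorProduct.tprod Λ fun i => i.elim0) ⊗ₜ[Λ] PiTensorProduct.tprod Λ fun i => i.elim0
  | n + 1 => PiTensorProduct.lift <|
      (multilinearCurryLeftEquiv Λ (fun _ : Fin (n + 1) => M ⊗[Λ] N) _).symm <|
        PiTensorProduct.lift.symm.toLinearMap ∘ₗ LinearMap.lcomp Λ _ (unshuffle M N n) ∘ₗ
          TensorProduct.homTensorHomMap (RingHom.id Λ) (⨂[Λ] _ : Fin n, M) (⨂[Λ] _ : Fin n, N)
            (⨂[Λ] _ : Fin (n + 1), M) (⨂[Λ] _ : Fin (n + 1), N) ∘ₗ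
            TensorProduct.map (cons M n) (cons N n)

lemma unshuffle_tprod (M : Type u₁) (N : Type u₂) [AddCommGroup M] [Module Λ M] [AddCommGroup N]
    [Module Λ N] (n : ℕ) (x : Fin n → M) (y : Fin n → N) :
    unshuffle M N n (PiTensorProduct.tprod Λ fun i => x i ⊗ₜ[Λ] y i) =
      PiTensorProduct.tprod Λ x ⊗ₜ PiTensorProduct.tprod Λ y := by
  induction n with
  | zero =>
    simp only [unshuffle, PiTensorProduct.lift.tprod]
    exact congrArg₂ (fun a b => PiTensorProduct.tprod Λ a ⊗ₜ[Λ] PiTensorProduct.tprod Λ b)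
      (Subsingleton.elim _ _) (Subsingleton.elim _ _)
  | succ n ih =>
    simp only [unshuffle, PiTensorProduct.lift.tprod]
    change TensorProduct.homTensorHomMap (RingHom.id Λ) _ _ _ _
      (TensorProduct.map (cons M n) (cons N n) (x 0 ⊗ₜ[Λ] y 0))
      (unshuffle M N n (PiTensorProduct.tprod Λ fun i => x i.succ ⊗ₜ[Λ] y i.succ)) = _
    rw [ih, TensorProduct.map_tmul, TensorProduct.homTensorHomMap_apply, TensorProduct.map_tmul,
      cons_tprod, cons_tprod]
    exact congrArg₂ (fun a b => PiTensorProduct.tprod Λ a ⊗ₜ[Λ] PiTensorProduct.tprod Λ b)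
      (Fin.cons_self_tail x) (Fin.cons_self_tail y)

/-- The shuffling isomorphism `(K ⊗ L)^n → K^n ⊗ L^n`, with the Koszul sign. -/
def shuffle (n : ℕ) (K : Cx.{u₁} Λ) (L : Cx.{u₂} Λ) :
    pow n (tensor K L) →ₗ[Λ] tensor (pow n K) (pow n L) :=
  (∑ s : Fin n → ZMod 2, ∑ t : Fin n → ZMod 2, shuffleSign s t •
    TensorProduct.map (PiTensorProduct.map (R := Λ) fun i => K.par (s i))
      (PiTensorProduct.map (R := Λ) fun i => L.par (t i))) ∘ₗ
    unshuffle (Λ := Λ) K.carrier L.carrier n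

/-- `(a ⊗ b) ⊗ (x ⊗ y) ↦ (-1)^{deg b deg x} (a ⊗ x) ⊗ (b ⊗ y)`. -/
def interchange (A : Cx.{u₁} Λ) (B : Cx.{u₂} Λ) (K : Cx.{v} Λ) (L : Cx.{w} Λ) :
    tensor (tensor A B) (tensor K L) →ₗ[Λ] tensor (tensor A K) (tensor B L) :=
  ∑ a : ZMod 2, ∑ b : ZMod 2, (-1 : ℤ) ^ (a.val * b.val) •
    (TensorProduct.tensorTensorTensorComm Λ A B K L).toLinearMap ∘ₗ
      TensorProduct.map (TensorProduct.map LinearMap.id (B.par a))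
        (TensorProduct.map (K.par b) LinearMap.id)

end Cx

/-! ### Normalized chains of simplicial sets -/

section Chains

/-- The set of `n`-simplices. -/
abbrev Splx (L : SSet.{u}) (n : ℕ) : Type u := L.obj (op (SimplexCategory.mk n))

variable (Λ) in
/-- The free module on the nondegenerate simplices of `L`. -/
abbrev ChainMod (L : SSet.{u}) : Type u := (Σ n : ℕ, L.nonDegenerate n) →₀ Λ

open Classical in
variable (Λ) in
/-- The normalized chain of a simplex: a basis element, or `0` if the simplex is degenerate. -/
def chain {L : SSet.{u}} {n : ℕ} (x : Splx L n) : ChainMod Λ L :=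
  if h : x ∈ L.nonDegenerate n then Finsupp.single ⟨n, x, h⟩ 1 else 0

lemma chain_nonDegenerate {L : SSet.{u}} (b : Σ n : ℕ, L.nonDegenerate n) :
    chain Λ b.2.1 = Finsupp.single b 1 := by
  rw [chain, dif_pos b.2.2]

lemma chain_degenerate {L : SSet.{u}} {n : ℕ} {x : Splx L n} (h : x ∈ L.degenerate n) :
    chain Λ x = 0 := by
  rw [chain, dif_neg (by simpa [SSet.nonDegenerate] using h)]

/-- The linear map on normalized chains given by a function on simplices. -/
def chainLift {N : Type w} [AddCommGroup N] [Module Λ N] {L : SSet.{u}}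
    (f : ∀ n : ℕ, Splx L n → N) : ChainMod Λ L →ₗ[Λ] N :=
  Finsupp.lift N Λ _ (fun b => f b.1 b.2.1)

lemma chainLift_chain {N : Type w} [AddCommGroup N] [Module Λ N] {L : SSet.{u}}
    (f : ∀ n : ℕ, Splx L n → N) (hf : ∀ n, ∀ x ∈ L.degenerate n, f n x = 0) {n : ℕ} (x : Splx L n) :
    chainLift (Λ := Λ) f (chain Λ x) = f n x := by
  by_cases h : x ∈ L.nonDegenerate n
  · rw [chain, dif_pos h]
    simp [chainLift]
  · have h' : x ∈ L.degenerate n := by simpa [SSet.nonDegenerate] using h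
    rw [chain_degenerate h', map_zero, hf n x h']

lemma chain_hom_ext {N : Type w} [AddCommGroup N] [Module Λ N] {L : SSet.{u}}
    {f f' : ChainMod Λ L →ₗ[Λ] N} (h : ∀ (n : ℕ) (x : Splx L n), f (chain Λ x) = f' (chain Λ x)) :
    f = f' := by
  ext b
  simpa [chain_nonDegenerate] using! h b.1 b.2.1

lemma map_degenerate_of_not_injective {L : SSet.{u}} {k m : ℕ} (h : SimplexCategory.mk k ⟶ SimplexCategory.mk m)
    (hh : ¬ Function.Injective h.toOrderHom) (x : Splx L m) : L.map h.op x ∈ L.degenerate k := by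
  cases k with
  | zero => exact absurd (fun a b _ => Subsingleton.elim (α := Fin 1) a b) hh
  | succ k =>
    obtain ⟨i, θ, rfl⟩ := SimplexCategory.eq_σ_comp_of_not_injective h hh
    rw [op_comp, Functor.map_comp]
    exact SSet.σ_mem_degenerate L i (L.map θ.op x)

variable (Λ) in
/-- The alternating sum of the faces of a simplex. -/
def boundary {L : SSet.{u}} : (n : ℕ) → Splx L n → ChainMod Λ L
  | 0, _ => 0
  | n + 1, x => ∑ i : Fin (n + 2), (-1 : ℤ) ^ (i : ℕ) • chain Λ (L.δ i x)

lemma boundary_degenerate {L : SSet.{u}} (n : ℕ) (x : Splx L n) (hx : x ∈ L.degenerate n) :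
    boundary Λ n x = 0 := by
  cases n with
  | zero => simp at hx
  | succ n =>
    rw [SSet.degenerate_eq_iUnion_range_σ, Set.mem_iUnion] at hx
    obtain ⟨j, y, rfl⟩ := hx
    rw [boundary, ← Finset.add_sum_erase _ _ (Finset.mem_univ j.castSucc),
      ← Finset.add_sum_erase _ _ (show j.succ ∈ Finset.univ.erase j.castSucc by
        simp [Fin.ext_iff])]
    rw [Finset.sum_eq_zero]
    · rw [SSet.δ_comp_σ_self_apply, SSet.δ_comp_σ_succ_apply]
      simp [pow_succ]
    · intro i hi
      simp only [Finset.mem_erase, Finset.mem_univ, and_true, ne_eq] at hi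
      have : L.δ i (L.σ j y) = L.map (SimplexCategory.δ i ≫ SimplexCategory.σ j).op y := by
        rw [op_comp, Functor.map_comp]
        rfl
      rw [this, chain_degenerate, smul_zero]
      apply map_degenerate_of_not_injective
      intro hinj
      obtain ⟨a, ha⟩ := Fin.exists_succAbove_eq (Ne.symm hi.2)
      obtain ⟨b, hb⟩ := Fin.exists_succAbove_eq (Ne.symm hi.1)
      have hab : a ≠ b := by
        rintro rfl
        rw [ha] at hb
        simp [Fin.ext_iff] at hb
      refine hab (hinj ?_)
      change Fin.predAbove j (Fin.succAbove i a) = Fin.predAbove j (Fin.succAbove i b)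
      rw [ha, hb]
      simp

/-- The boundary operator on normalized chains. -/
def chainD (L : SSet.{u}) : ChainMod Λ L →ₗ[Λ] ChainMod Λ L := chainLift (boundary Λ)

lemma chainD_chain {L : SSet.{u}} {n : ℕ} (x : Splx L n) : chainD L (chain Λ x) = boundary Λ n x :=
  chainLift_chain _ boundary_degenerate x

lemma chainD_chainD_chain {L : SSet.{u}} {n : ℕ} (x : Splx L n) :
    chainD L (chainD L (chain Λ x)) = 0 := by
  rw [chainD_chain]
  match n, x with
  | 0, x => simp [boundary]
  | 1, x => simp [boundary, chainD_chain]
  | n + 2, x =>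
    simp only [boundary, map_sum, map_zsmul, chainD_chain, Finset.smul_sum, smul_smul]
    rw [← Finset.sum_product']
    let P := Fin (n + 3) × Fin (n + 2)
    let S : Finset P := {ij : P | (ij.1 : ℕ) ≤ (ij.2 : ℕ)}
    rw [Finset.univ_product_univ, ← Finset.sum_add_sum_compl S, ← eq_neg_iff_add_eq_zero,
      ← Finset.sum_neg_distrib]
    let φ : ∀ ij : P, ij ∈ S → P := fun ij hij =>
      (ij.2.succ, Fin.castLT ij.1 (lt_of_le_of_lt (Finset.mem_filter.mp hij).right (Fin.is_lt ij.2)))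
    apply Finset.sum_bij φ
    · intro ij hij
      simp_rw [S, φ, Finset.compl_filter, Finset.mem_filter_univ, Fin.val_succ,
        Fin.val_castLT] at hij ⊢
      lia
    · rintro ⟨j, i⟩ hij ⟨j', i'⟩ hij' h
      rw [Prod.mk_inj]
      exact ⟨by simpa [φ, Fin.castSucc_castLT] using! congr_arg Fin.castSucc (congr_arg Prod.snd h),
        by simpa [φ] using! congr_arg Prod.fst h⟩
    · rintro ⟨j', i'⟩ hij'
      simp_rw [S, Finset.compl_filter, Finset.mem_filter_univ, not_le] at hij'
      refine ⟨(Fin.castSucc i', j'.pred <| ?_), ?_, ?_⟩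
      · rintro rfl
        simp only [Fin.val_zero, not_lt_zero] at hij'
      · simpa [S] using! Nat.le_sub_one_of_lt hij'
      · simp only [φ, Fin.castLT_castSucc, Fin.succ_pred]
    · rintro ⟨j, i⟩ hij
      dsimp
      rw [← neg_smul]
      congr 1
      · simp only [φ, Fin.val_succ, pow_add, pow_one, mul_neg, neg_neg, mul_one, neg_mul]
        apply mul_comm
      · have := ConcreteCategory.congr_hom
          (CategoryTheory.SimplicialObject.δ_comp_δ'' L (i := j) (j := i)
            (by simpa [S] using! hij)) x
        exact congrArg (chain Λ) this.symm

lemma boundary_mem {L : SSet.{u}} (n : ℕ) (x : Splx L n) :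
    boundary Λ n x ∈ Finsupp.supported Λ Λ
      {b | -(b.1 : ℤ) = -(n : ℤ) + 1} := by
  cases n with
  | zero => exact zero_mem _
  | succ n =>
    refine Submodule.sum_mem _ (fun i _ => zsmul_mem ?_ _)
    rw [chain]
    split_ifs
    · exact Finsupp.single_mem_supported Λ _ (by simp)
    · exact zero_mem _

variable (Λ) in
/-- The normalized chain complex `C(L)`, with its degree `n` part placed in degree `-n`. -/
def chains (L : SSet.{u}) : Cx.{u} Λ :=
  Cx.ofBasis (fun b : Σ n : ℕ, L.nonDegenerate n => -(b.1 : ℤ)) (chainD L)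
    (fun b => by rw [← chain_nonDegenerate, chainD_chain]; exact boundary_mem b.1 b.2.1)
    (fun b => by rw [← chain_nonDegenerate, chainD_chainD_chain])

variable (Λ) in
/-- The element of `C(L)` given by a simplex; it vanishes if the simplex is degenerate. -/
def cell {L : SSet.{u}} {n : ℕ} (x : Splx L n) : chains Λ L := chain Λ x

/-- The linear map on `C(L)` given by a function on simplices. -/
def chainsLift {N : Type w} [AddCommGroup N] [Module Λ N] {L : SSet.{u}}
    (f : ∀ n : ℕ, Splx L n → N) : chains Λ L →ₗ[Λ] N := chainLift f

lemma chainsLift_cell {N : Type w} [AddCommGroup N] [Module Λ N] {L : SSet.{u}}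
    (f : ∀ n : ℕ, Splx L n → N) (hf : ∀ n, ∀ x ∈ L.degenerate n, f n x = 0) {n : ℕ} (x : Splx L n) :
    chainsLift (Λ := Λ) f (cell Λ x) = f n x :=
  chainLift_chain f hf x

lemma cell_degenerate {L : SSet.{u}} {n : ℕ} {x : Splx L n} (h : x ∈ L.degenerate n) :
    cell Λ x = 0 :=
  chain_degenerate h

lemma chains_hom_ext {N : Type w} [AddCommGroup N] [Module Λ N] {L : SSet.{u}}
    {f f' : chains Λ L →ₗ[Λ] N} (h : ∀ (n : ℕ) (x : Splx L n), f (cell Λ x) = f' (cell Λ x)) :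
    f = f' :=
  chain_hom_ext (L := L) h

lemma d_cell_zero {L : SSet.{u}} (x : Splx L 0) : (chains Λ L).d (cell Λ x) = 0 :=
  chainD_chain x

lemma d_cell_succ {L : SSet.{u}} {n : ℕ} (x : Splx L (n + 1)) :
    (chains Λ L).d (cell Λ x) = ∑ i : Fin (n + 2), (-1 : ℤ) ^ (i : ℕ) • cell Λ (L.δ i x) :=
  chainD_chain x

lemma cell_mem {L : SSet.{u}} {n : ℕ} (x : Splx L n) :
    cell Λ x ∈ (chains Λ L).deg (-(n : ℤ)) := by
  by_cases h : x ∈ L.nonDegenerate n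
  · have : cell Λ x = (Finsupp.single ⟨n, x, h⟩ 1 : ChainMod Λ L) := dif_pos h
    rw [this]
    exact Finsupp.single_mem_supported Λ _ rfl
  · have h' : x ∈ L.degenerate n := by simpa [SSet.nonDegenerate] using h
    rw [cell_degenerate h']
    exact zero_mem _

lemma chains_span {L : SSet.{u}} {m : ℤ} (P : Submodule Λ (chains Λ L))
    (h : ∀ (n : ℕ) (x : Splx L n), -(n : ℤ) = m → cell Λ x ∈ P) {z : chains Λ L}
    (hz : z ∈ (chains Λ L).deg m) : z ∈ P := by
  have key : ∀ z : ChainMod Λ L, (∀ b ∈ z.support, -(b.1 : ℤ) = m) →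
      z ∈ (show Submodule Λ (ChainMod Λ L) from P) := by
    intro z hz'
    rw [← Finsupp.sum_single z, Finsupp.sum]
    refine Submodule.sum_mem _ (fun b hb => ?_)
    have h1 : chain Λ b.2.1 ∈ (show Submodule Λ (ChainMod Λ L) from P) := h b.1 b.2.1 (hz' b hb)
    rw [chain_nonDegenerate] at h1
    simpa using! Submodule.smul_mem _ (z b) h1
  exact key z (fun b hb => hz hb)

/-- The chain map induced by a simplicial map. -/
def chainsMap {L S : SSet.{u}} (f : L ⟶ S) : chains Λ L →ₗ[Λ] chains Λ S :=
  chainsLift (fun _ x => cell Λ (f.app _ x))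

lemma chainsMap_cell {L S : SSet.{u}} (f : L ⟶ S) {n : ℕ} (x : Splx L n) :
    chainsMap f (cell Λ x) = cell Λ (f.app _ x) :=
  chainsLift_cell _ (fun _ _ hx => cell_degenerate (SSet.degenerate_app_apply hx f)) x

lemma chainsMap_mem {L S : SSet.{u}} (f : L ⟶ S) {m : ℤ} {z : chains Λ L}
    (hz : z ∈ (chains Λ L).deg m) : chainsMap f z ∈ (chains Λ S).deg m := by
  refine chains_span (((chains Λ S).deg m).comap (chainsMap f)) (fun n x hn => ?_) hz
  rw [Submodule.mem_comap, chainsMap_cell, ← hn]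
  exact cell_mem _

lemma chainsMap_d {L S : SSet.{u}} (f : L ⟶ S) (z : chains Λ L) :
    chainsMap f ((chains Λ L).d z) = (chains Λ S).d (chainsMap f z) := by
  have : chainsMap (Λ := Λ) f ∘ₗ (chains Λ L).d = (chains Λ S).d ∘ₗ chainsMap f := by
    refine chains_hom_ext (fun n x => ?_)
    rw [LinearMap.comp_apply, LinearMap.comp_apply, chainsMap_cell]
    cases n with
    | zero => rw [d_cell_zero, d_cell_zero, map_zero]
    | succ n =>
      rw [d_cell_succ, d_cell_succ]
      simp only [map_sum, map_zsmul, chainsMap_cell, SSet.δ_naturality_apply]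
  exact LinearMap.congr_fun this z

/-- The binary product of simplicial sets. -/
abbrev prod (L S : SSet.{u}) : SSet.{u} := MonoidalCategoryStruct.tensorObj L S

/-- The map of binary products induced by simplicial maps. -/
abbrev prodMap {L L' S S' : SSet.{u}} (f : L ⟶ L') (f' : S ⟶ S') : prod L S ⟶ prod L' S' :=
  MonoidalCategoryStruct.tensorHom f f'

variable {n : ℕ}

/-- The product `L_1 × ⋯ × L_n` of a finite family of simplicial sets. -/
def piProd (L : Fin n → SSet.{u}) : SSet.{u} where
  obj m := ∀ i, (L i).obj m
  map f := TypeCat.ofHom fun x i => (L i).map f (x i)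

/-- The map of products induced by a family of simplicial maps. -/
def piProdMap {L S : Fin n → SSet.{u}} (f : ∀ i, L i ⟶ S i) : piProd L ⟶ piProd S where
  app m := TypeCat.ofHom fun x i => (f i).app m (x i)
  naturality m m' h := by
    ext x
    funext i
    exact ConcreteCategory.congr_hom ((f i).naturality h) (x i)

/-- The permutation of factors moving the `i`-th factor to position `σ i`. -/
def piProdPerm (σ : Equiv.Perm (Fin n)) (L : Fin n → SSet.{u}) :
    piProd L ⟶ piProd fun i => L (σ.symm i) where
  app m := TypeCat.ofHom fun x i => x (σ.symm i)

variable (n) in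
/-- The diagonal `L → L^n`. -/
def diag (L : SSet.{u}) : L ⟶ piProd fun _ : Fin n => L where
  app m := TypeCat.ofHom fun x _ => x

/-! ### Alexander-Whitney maps -/

variable (Λ) in
/-- The chain of the face of an `n`-simplex `x` with vertices `a, a + 1, …, a + k`. -/
def seg {L : SSet.{u}} {n : ℕ} (x : Splx L n) (a k : ℕ) : chains Λ L :=
  if h : a + k ≤ n then cell Λ (L.map (SimplexCategory.subinterval a k h).op x) else 0

variable (Λ) in
/-- The Alexander-Whitney image `∑_{i} x|[0..i] ⊗ y|[i..n]` of a simplex `(x, y)`. -/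
def awFun {L S : SSet.{u}} (n : ℕ) (z : Splx (prod L S) n) : chains Λ L ⊗[Λ] chains Λ S :=
  ∑ i ∈ Finset.range (n + 1), seg Λ (L := L) z.1 0 i ⊗ₜ seg Λ (L := S) z.2 i (n - i)

/-- The Alexander-Whitney map `ξ : C(L × S) → C(L) ⊗ C(S)`. -/
def aw (L S : SSet.{u}) : chains Λ (prod L S) →ₗ[Λ] (chains Λ L).tensor (chains Λ S) :=
  chainsLift (N := chains Λ L ⊗[Λ] chains Λ S) (awFun Λ)

/-- The Alexander-Whitney map `ξ : C(L_1 × ⋯ × L_n) → C(L_1) ⊗ ⋯ ⊗ C(L_n)`, sending an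
`m`-simplex `(x_1, …, x_n)` to the sum over `k_1 + ⋯ + k_n = m` of the tensors of the
consecutive faces of the `x_i` of dimensions `k_i`. -/
def awPi (L : Fin n → SSet.{u}) :
    chains Λ (piProd L) →ₗ[Λ] Cx.piTensor fun i => chains Λ (L i) :=
  chainsLift (N := ⨂[Λ] i, chains Λ (L i)) fun m x =>
    ∑ k ∈ Finset.piAntidiag (Finset.univ : Finset (Fin n)) m,
      PiTensorProduct.tprod Λ fun i =>
        seg Λ (L := L i) (x i) (∑ j ∈ Finset.univ.filter (· < i), k j) (k i)

lemma seg_naturality {L S : SSet.{u}} (f : L ⟶ S) {n : ℕ} (x : Splx L n) (a k : ℕ) :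
    chainsMap f (seg Λ x a k) = seg Λ (f.app _ x) a k := by
  rw [seg, seg]
  split_ifs with h
  · rw [chainsMap_cell]
    exact congrArg (cell Λ) (ConcreteCategory.congr_hom (f.naturality _) x)
  · rw [map_zero]

lemma seg_mem {L : SSet.{u}} {n : ℕ} (x : Splx L n) (a k : ℕ) :
    seg Λ x a k ∈ (chains Λ L).deg (-(k : ℤ)) := by
  rw [seg]
  split_ifs
  · exact cell_mem _
  · exact zero_mem _

lemma awFun_degenerate {L S : SSet.{u}} (n : ℕ) (z : Splx (prod L S) n)
    (hz : z ∈ (prod L S).degenerate n) : awFun Λ n z = 0 := by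
  obtain ⟨m, hm, f, y, rfl⟩ := hz
  have hf : ∃ j : ℕ, ∃ h : j + 1 < n + 1, f.toOrderHom ⟨j, by lia⟩ = f.toOrderHom ⟨j + 1, h⟩ := by
    by_contra! hne
    have hs : StrictMono f.toOrderHom := by
      rw [Fin.strictMono_iff_lt_succ]
      intro i
      refine lt_of_le_of_ne (f.toOrderHom.monotone (Fin.castSucc_le_succ i)) ?_
      exact hne i.1 (by lia)
    have := Fintype.card_le_of_injective _ hs.injective
    simp at this
    lia
  obtain ⟨j, hj, hjf⟩ := hf
  have key : ∀ (T : SSet.{u}) (t : Splx T m) (a k : ℕ), a ≤ j → j + 1 ≤ a + k →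
      seg Λ (T.map f.op t) a k = 0 := by
    intro T t a k ha hk
    rw [seg]
    split_ifs with h
    · have : T.map (SimplexCategory.subinterval a k h).op (T.map f.op t) =
          T.map (SimplexCategory.subinterval a k h ≫ f).op t := by
        rw [op_comp, Functor.map_comp]
        rfl
      rw [this]
      refine cell_degenerate (map_degenerate_of_not_injective _ (fun hinj => ?_) t)
      have := @hinj ⟨j - a, by lia⟩ ⟨j + 1 - a, by lia⟩ (by
        change f.toOrderHom ⟨j - a + a, _⟩ = f.toOrderHom ⟨j + 1 - a + a, _⟩
        simpa [show j - a + a = j by lia, show j + 1 - a + a = j + 1 by lia] using! hjf)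
      simp only [Fin.mk.injEq] at this
      lia
    · rfl
  refine Finset.sum_eq_zero (fun i hi => ?_)
  rw [Finset.mem_range] at hi
  by_cases hij : j + 1 ≤ i
  · rw [show ((prod L S).map f.op y).1 = L.map f.op y.1 from rfl, key L y.1 0 i (by lia) (by lia),
      TensorProduct.zero_tmul]
  · rw [show ((prod L S).map f.op y).2 = S.map f.op y.2 from rfl,
      key S y.2 i (n - i) (by lia) (by lia), TensorProduct.tmul_zero]

lemma aw_cell {L S : SSet.{u}} {n : ℕ} (z : Splx (prod L S) n) :
    aw L S (cell Λ z) = awFun Λ n z :=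
  chainsLift_cell _ awFun_degenerate z

lemma aw_naturality {L L' S S' : SSet.{u}} (f : L ⟶ L') (f' : S ⟶ S') (z : chains Λ (prod L S)) :
    aw L' S' (chainsMap (prodMap f f') z) =
      TensorProduct.map (chainsMap f) (chainsMap f') (aw L S z) := by
  have : aw (Λ := Λ) L' S' ∘ₗ chainsMap (prodMap f f') =
      TensorProduct.map (chainsMap f) (chainsMap f') ∘ₗ aw L S := by
    refine chains_hom_ext (fun n x => ?_)
    rw [LinearMap.comp_apply, LinearMap.comp_apply, chainsMap_cell, aw_cell, aw_cell, awFun,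
      awFun, map_sum]
    refine Finset.sum_congr rfl (fun i _ => ?_)
    exact (congrArg₂ (fun a b => a ⊗ₜ[Λ] b) (seg_naturality f _ _ _)
      (seg_naturality f' _ _ _)).symm
  exact LinearMap.congr_fun this z

end Chains

/-! ### The cyclic group and its standard resolution -/

section Resolution

/-- The cyclic group of order `p`, as the subgroup of the symmetric group on `p` letters generated
by the cycle `i ↦ i + 1`. -/
abbrev Cyc (p : ℕ) : Subgroup (Equiv.Perm (Fin p)) := Subgroup.zpowers (finRotate p)

/-- The generator of the cyclic group. -/
def cycGen (p : ℕ) : Cyc p := ⟨finRotate p, Subgroup.mem_zpowers _⟩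

lemma cycGen_pow (p : ℕ) : cycGen p ^ p = 1 := by
  have h : finRotate p ^ p = 1 := by
    match p with
    | 0 => rfl
    | 1 => exact Subsingleton.elim _ _
    | p + 2 =>
      have := (isCycle_finRotate (n := p)).orderOf
      rw [support_finRotate, Finset.card_univ, Fintype.card_fin] at this
      have h := pow_orderOf_eq_one (finRotate (p + 2))
      rwa [this] at h
  exact Subtype.ext h

variable (Λ) in
/-- The differential of the standard resolution on the basis element `g e_i`:
`d (g e_{2j+1}) = g (α - 1) e_{2j}` and `d (g e_{2j+2}) = g (1 + α + ⋯ + α^{p-1}) e_{2j+1}`. -/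
def resD (p : ℕ) : ℕ → Cyc p → ((ℕ × Cyc p) →₀ Λ)
  | 0, _ => 0
  | i + 1, g =>
    if Even i then Finsupp.single (i, g * cycGen p) 1 - Finsupp.single (i, g) 1
    else ∑ r ∈ Finset.range p, Finsupp.single (i, g * cycGen p ^ r) 1

lemma resD_resD (p i : ℕ) (g : Cyc p) :
    Finsupp.lift _ Λ _ (fun b : ℕ × Cyc p => resD Λ p b.1 b.2) (resD Λ p i g) = 0 := by
  match i with
  | 0 => simp [resD]
  | 1 =>
    rw [resD, if_pos (by simp), map_sub]
    simp [Finsupp.lift_apply, Finsupp.sum_single_index, resD]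
  | i + 2 =>
    rw [resD]
    by_cases h : Even i
    · rw [if_neg (by rw [Nat.even_add_one]; simpa using h)]
      simp only [map_sum, Finsupp.lift_apply, Finsupp.sum_single_index, zero_smul, one_smul, resD,
        if_pos h]
      simp only [mul_assoc, ← pow_succ]
      rw [Finset.sum_range_sub (fun r => Finsupp.single (i, g * cycGen p ^ r) (1 : Λ)), cycGen_pow]
      simp
    · rw [if_pos (by rw [Nat.even_add_one]; simpa using h), map_sub]
      simp only [Finsupp.lift_apply, Finsupp.sum_single_index, zero_smul, one_smul, resD,
        if_neg h]
      rw [← Finset.sum_sub_distrib]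
      simp only [mul_assoc, ← pow_succ']
      rw [Finset.sum_range_sub (fun r => Finsupp.single (i, g * cycGen p ^ r) (1 : Λ)), cycGen_pow]
      simp

variable (Λ) in
/-- The standard free resolution `W` of `Λ` over the group ring of the cyclic group of order `p`:
in homological degree `i ≥ 0` it is free over `Λ` on the elements `g e_i`, hence free over the
group ring on the single generator `e_i`.  It is placed in non-positive degrees. -/
def res (p : ℕ) : Cx.{0} Λ :=
  Cx.ofBasis (fun b : ℕ × Cyc p => -(b.1 : ℤ))
    (Finsupp.lift _ Λ _ (fun b : ℕ × Cyc p => resD Λ p b.1 b.2))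
    (fun b => by
      obtain ⟨i, g⟩ := b
      simp only [Finsupp.lift_apply, Finsupp.sum_single_index, zero_smul, one_smul]
      cases i with
      | zero => exact zero_mem _
      | succ i =>
        rw [resD]
        split_ifs
        · exact sub_mem (Finsupp.single_mem_supported Λ _ (by simp))
            (Finsupp.single_mem_supported Λ _ (by simp))
        · exact Submodule.sum_mem _ (fun r _ => Finsupp.single_mem_supported Λ _ (by simp)))
    (fun b => by
      simp only [Finsupp.lift_apply, Finsupp.sum_single_index, zero_smul, one_smul]
      simpa [Finsupp.lift_apply] using resD_resD p b.1 b.2)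

variable (Λ) in
/-- The basis element `g e_i`. -/
def resBasis {p : ℕ} (i : ℕ) (g : Cyc p) : res Λ p :=
  (Finsupp.single (i, g) 1 : (ℕ × Cyc p) →₀ Λ)

/-- The linear map on `W` with given values on the elements `g e_i`. -/
def resLift {p : ℕ} {N : Type w} [AddCommGroup N] [Module Λ N] (f : ℕ → Cyc p → N) :
    res Λ p →ₗ[Λ] N :=
  Finsupp.lift N Λ (ℕ × Cyc p) (fun b => f b.1 b.2)

lemma resLift_basis {p : ℕ} {N : Type w} [AddCommGroup N] [Module Λ N] (f : ℕ → Cyc p → N)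
    (i : ℕ) (g : Cyc p) : resLift f (resBasis Λ i g) = f i g := by
  have : Finsupp.lift N Λ (ℕ × Cyc p) (fun b => f b.1 b.2) (Finsupp.single (i, g) 1) = f i g := by
    simp
  exact this

lemma res_span {p : ℕ} {m : ℤ} (P : Submodule Λ (res Λ p))
    (h : ∀ (i : ℕ) (g : Cyc p), -(i : ℤ) = m → resBasis Λ i g ∈ P) {z : res Λ p}
    (hz : z ∈ (res Λ p).deg m) : z ∈ P := by
  have key : ∀ z : (ℕ × Cyc p) →₀ Λ, (∀ b ∈ z.support, -(b.1 : ℤ) = m) →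
      z ∈ (show Submodule Λ ((ℕ × Cyc p) →₀ Λ) from P) := by
    intro z hz'
    rw [← Finsupp.sum_single z, Finsupp.sum]
    refine Submodule.sum_mem _ (fun b hb => ?_)
    have h1 : Finsupp.single b 1 ∈ (show Submodule Λ ((ℕ × Cyc p) →₀ Λ) from P) :=
      h b.1 b.2 (hz' b hb)
    simpa using! Submodule.smul_mem _ (z b) h1
  exact key z (fun b hb => hz hb)

/-- The action of the cyclic group on `W`. -/
def resAct {p : ℕ} (σ : Cyc p) : res Λ p →ₗ[Λ] res Λ p := resLift fun i g => resBasis Λ i (σ * g)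

variable (Λ) in
/-- The augmentation `ε : W → Λ`. -/
def aug (p : ℕ) : res Λ p →ₗ[Λ] Λ := resLift fun i _ => if i = 0 then 1 else 0

variable (Λ) in
/-- The value of the coproduct on `e_i`:
`ψ(e_{2m}) = ∑_{j+k=m} e_{2j} ⊗ e_{2k} + ∑_{j+k=m-1} ∑_{0≤r<s<p} α^r e_{2j+1} ⊗ α^s e_{2k+1}`,
`ψ(e_{2m+1}) = ∑_{j+k=m} (e_{2j} ⊗ e_{2k+1} + e_{2j+1} ⊗ α e_{2k})`. -/
def coprodGen (p i : ℕ) : res Λ p ⊗[Λ] res Λ p :=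
  if Even i then
    (∑ jk ∈ Finset.HasAntidiagonal.antidiagonal (i / 2), resBasis Λ (2 * jk.1) 1 ⊗ₜ resBasis Λ (2 * jk.2) 1) +
      ∑ jk ∈ (Finset.range (i / 2) ×ˢ Finset.range (i / 2)).filter
          (fun jk => jk.1 + jk.2 + 1 = i / 2),
        ∑ s ∈ Finset.range p, ∑ r ∈ Finset.range s,
          resBasis Λ (2 * jk.1 + 1) (cycGen p ^ r) ⊗ₜ resBasis Λ (2 * jk.2 + 1) (cycGen p ^ s)
  else
    ∑ jk ∈ Finset.HasAntidiagonal.antidiagonal (i / 2),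
      (resBasis Λ (2 * jk.1) 1 ⊗ₜ resBasis Λ (2 * jk.2 + 1) 1 +
        resBasis Λ (2 * jk.1 + 1) 1 ⊗ₜ resBasis Λ (2 * jk.2) (cycGen p))

variable (Λ) in
/-- The coproduct `ψ : W → W ⊗ W`, equivariant for the diagonal action on `W ⊗ W`. -/
def coprod (p : ℕ) : res Λ p →ₗ[Λ] (res Λ p).tensor (res Λ p) :=
  resLift fun i g => TensorProduct.map (resAct g) (resAct g) (coprodGen Λ p i)

end Resolution

/-! ### Morphisms and homotopies -/

/-- `f` is a morphism of complexes: it preserves degrees and commutes with the differentials. -/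
structure IsCxHom {K : Cx.{u₁} Λ} {L : Cx.{u₂} Λ} (f : K →ₗ[Λ] L) : Prop where
  mem : ∀ {n : ℤ} {x : K}, x ∈ K.deg n → f x ∈ L.deg n
  comm : ∀ x, f (K.d x) = L.d (f x)

/-- The diagonal action of the cyclic group of order `p` on `W ⊗ K^p`. -/
def piAct {p : ℕ} (K : Cx.{v} Λ) (σ : Cyc p) :
    (res Λ p).tensor (K.pow p) →ₗ[Λ] (res Λ p).tensor (K.pow p) :=
  TensorProduct.map (resAct σ) (Cx.perm σ.1 fun _ => K)

/-- `f : W ⊗ K^p → L` is a morphism of complexes over the group ring of the cyclic group of order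
`p`, which acts diagonally on `W ⊗ K^p` and trivially on `L`. -/
structure IsPiHom {p : ℕ} {K : Cx.{u₁} Λ} {L : Cx.{u₂} Λ}
    (f : (res Λ p).tensor (K.pow p) →ₗ[Λ] L) : Prop extends IsCxHom f where
  act : ∀ (σ : Cyc p) z, f (piAct K σ z) = f z

/-- `f, f' : W ⊗ K^p → L` are equivariantly homotopic: `f - f' = d H + H d` for an equivariant
linear map `H` lowering cohomological degrees by one. -/
def PiHomotopic {p : ℕ} {K : Cx.{u₁} Λ} {L : Cx.{u₂} Λ}
    (f f' : (res Λ p).tensor (K.pow p) →ₗ[Λ] L) : Prop :=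
  ∃ H : (res Λ p).tensor (K.pow p) →ₗ[Λ] L,
    (∀ (n : ℤ), ∀ z ∈ ((res Λ p).tensor (K.pow p)).deg n, H z ∈ L.deg (n - 1)) ∧
    (∀ (σ : Cyc p) z, H (piAct K σ z) = H z) ∧
    ∀ z, f z - f' z = L.d (H z) + H (((res Λ p).tensor (K.pow p)).d z)

/-! ### The natural maps `W ⊗ C(L_1 × ⋯ × L_p) → W ⊗ C(L_1) ⊗ ⋯ ⊗ C(L_p)` -/

variable (Λ) in
/-- A natural equivariant chain map
`Φ : W ⊗ C(L_1 × ⋯ × L_p) → W ⊗ C(L_1) ⊗ ⋯ ⊗ C(L_p)`, which is the identity in simplicial degree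
`0`, extends the Alexander-Whitney map on `e_0`, and satisfies
`Φ(W ⊗ C_j) ⊆ ∑_{k ≤ pj} W ⊗ [C(L_1) ⊗ ⋯ ⊗ C(L_p)]_k`. -/
structure DiagApprox (p : ℕ) where
  toFun : ∀ L : Fin p → SSet.{u}, (res Λ p).tensor (chains Λ (piProd L)) →ₗ[Λ]
    (res Λ p).tensor (Cx.piTensor fun i => chains Λ (L i))
  isCxHom : ∀ L, IsCxHom (toFun L)
  natural : ∀ {L S : Fin p → SSet.{u}} (f : ∀ i, L i ⟶ S i) z,
    toFun S (TensorProduct.map LinearMap.id (chainsMap (piProdMap f)) z) =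
      TensorProduct.map LinearMap.id (PiTensorProduct.map fun i => chainsMap (f i)) (toFun L z)
  equivariant : ∀ (σ : Cyc p) (L : Fin p → SSet.{u}) z,
    toFun (fun i => L (σ.1.symm i))
        (TensorProduct.map (resAct σ) (chainsMap (piProdPerm σ.1 L)) z) =
      TensorProduct.map (resAct σ) (Cx.perm σ.1 fun i => chains Λ (L i)) (toFun L z)
  vertices : ∀ (L : Fin p → SSet.{u}) (w : res Λ p) (x : Splx (piProd L) 0),
    toFun L (w ⊗ₜ cell Λ x) = w ⊗ₜ PiTensorProduct.tprod Λ fun i => cell Λ (L := L i) (x i)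
  bottom : ∀ (L : Fin p → SSet.{u}) (z : chains Λ (piProd L)),
    toFun L (resBasis Λ 0 1 ⊗ₜ z) = resBasis Λ 0 1 ⊗ₜ awPi L z
  filtration : ∀ (L : Fin p → SSet.{u}) (w : res Λ p) (j : ℕ) (x : Splx (piProd L) j),
    toFun L (w ⊗ₜ cell Λ x) ∈ Submodule.span Λ {y | ∃ (k : ℕ) (w' : res Λ p),
      ∃ z ∈ (Cx.piTensor fun i => chains Λ (L i)).deg (-(k : ℤ)), k ≤ p * j ∧ y = w' ⊗ₜ[Λ] z}

namespace DiagApprox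

variable {p : ℕ} (Φ : DiagApprox.{u} Λ p)

/-- The composite `Δ : W ⊗ C(L) → W ⊗ C(L^p) → W ⊗ C(L)^p → C(L)^p` of the diagonal, `Φ` and the
augmentation. -/
def delta (L : SSet.{u}) : (res Λ p).tensor (chains Λ L) →ₗ[Λ] (chains Λ L).pow p :=
  (TensorProduct.lid Λ ((chains Λ L).pow p)).toLinearMap ∘ₗ
    TensorProduct.map (aug Λ p) LinearMap.id ∘ₗ
      Φ.toFun (fun _ => L) ∘ₗ TensorProduct.map LinearMap.id (chainsMap (diag p L))

lemma delta_naturality {L S : SSet.{u}} (f : L ⟶ S) (w : res Λ p) (x : chains Λ L) :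
    Φ.delta S (w ⊗ₜ chainsMap f x) =
      PiTensorProduct.map (fun _ => chainsMap f) (Φ.delta L (w ⊗ₜ x)) := by
  have h1 : chainsMap (Λ := Λ) (diag p S) ∘ₗ chainsMap f =
      chainsMap (piProdMap fun _ : Fin p => f) ∘ₗ chainsMap (diag p L) := by
    refine chains_hom_ext (fun n x => ?_)
    simp only [LinearMap.comp_apply, chainsMap_cell]
    rfl
  have h2 : ∀ y : res Λ p ⊗[Λ] (⨂[Λ] _ : Fin p, (chains Λ L).carrier),
      TensorProduct.lid Λ ((chains Λ S).pow p) (TensorProduct.map (aug Λ p) LinearMap.id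
        (TensorProduct.map LinearMap.id (PiTensorProduct.map fun _ => chainsMap f) y)) =
      PiTensorProduct.map (fun _ => chainsMap f) (TensorProduct.lid Λ ((chains Λ L).pow p)
        (TensorProduct.map (aug Λ p) LinearMap.id y)) := by
    intro y
    induction y with
    | zero => simp only [map_zero]
    | add y y' hy hy' => simp only [map_add, hy, hy']
    | tmul a b => simp
  have h3 := Φ.natural (fun _ => f) (TensorProduct.map LinearMap.id (chainsMap (diag p L)) (w ⊗ₜ x))
  simp only [delta, LinearMap.comp_apply, TensorProduct.map_tmul, LinearMap.id_apply,
    LinearEquiv.coe_coe] at h3 ⊢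
  have h1' := LinearMap.congr_fun h1 x
  simp only [LinearMap.comp_apply] at h1'
  rw [← h2, ← h3, h1']

lemma delta_mem {L : SSet.{u}} {i m : ℤ} {w : res Λ p} (hw : w ∈ (res Λ p).deg i)
    {x : chains Λ L} (hx : x ∈ (chains Λ L).deg m) :
    Φ.delta L (w ⊗ₜ x) ∈ ((chains Λ L).pow p).deg (i + m) := by
  have h1 : w ⊗ₜ[Λ] chainsMap (diag p L) x ∈
      ((res Λ p).tensor (chains Λ (piProd fun _ : Fin p => L))).deg (i + m) :=
    Submodule.subset_span ⟨(i, m), rfl, w, hw, _, chainsMap_mem _ hx, rfl⟩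
  have h2 := (Φ.isCxHom fun _ => L).mem h1
  have h3 : ∀ y ∈ ((res Λ p).tensor ((chains Λ L).pow p)).deg (i + m),
      TensorProduct.lid Λ ((chains Λ L).pow p) (TensorProduct.map (aug Λ p) LinearMap.id y) ∈
        ((chains Λ L).pow p).deg (i + m) := by
    intro y hy
    induction hy using Submodule.span_induction with
    | zero => simp only [map_zero]; exact zero_mem _
    | add y y' _ _ hy hy' => simp only [map_add]; exact add_mem hy hy'
    | smul r y _ hy => simp only [map_smul]; exact Submodule.smul_mem _ _ hy
    | mem y hy =>
      obtain ⟨⟨a, b⟩, hab, w', hw', z, hz, rfl⟩ := hy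
      dsimp only at hab hw' hz
      rw [TensorProduct.map_tmul, TensorProduct.lid_tmul, LinearMap.id_apply]
      by_cases ha : a = 0
      · subst ha
        rw [zero_add] at hab
        rw [← hab]
        exact Submodule.smul_mem _ _ hz
      · have : aug Λ p w' = 0 := by
          have : w' ∈ LinearMap.ker (aug Λ p) := res_span _ (fun i g hi => by
            rw [LinearMap.mem_ker, aug, resLift_basis, if_neg]
            rintro rfl
            exact ha (by simpa using hi.symm)) hw'
          exact this
        rw [this, zero_smul]
        exact zero_mem _
  exact h3 _ h2

end DiagApprox

/-! ### Systems indexed by the orbit category -/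

/-- The category of canonical orbits of `G`; the object `H` stands for the coset space `G/H`. -/
structure OrbitCat (G : Type g) [Group G] where
  H : Subgroup G

/-- Morphisms `G/H → G/K` of the orbit category are the `G`-maps. -/
instance (G : Type g) [Group G] : Category (OrbitCat G) where
  Hom A B := (G ⧸ A.H) →[G] (G ⧸ B.H)
  id A := MulActionHom.id G
  comp f f' := f'.comp f

/-- A triple `(T, M, ρ)` of a contravariant functor `T` from the orbit category of `G` to simplicial
sets, a contravariant functor `M` to commutative `Λ`-algebras, and a contravariant functor `ρ` to
groups, with natural actions of `ρ` on `T` and on `M`. -/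
structure Triple (G : Type g) [Group G] (Λ : Type) [CommRing Λ] where
  T : (OrbitCat G)ᵒᵖ ⥤ SSet.{u}
  M : (OrbitCat G)ᵒᵖ ⥤ CommAlgCat.{v} Λ
  ρ : (OrbitCat G)ᵒᵖ ⥤ GrpCat.{w}
  actT : ∀ X, ρ.obj X →* End (T.obj X)
  actT_natural : ∀ {X Y} (a : X ⟶ Y) (r : ρ.obj X),
    actT X r ≫ T.map a = T.map a ≫ actT Y (ρ.map a r)
  actM : ∀ X, ρ.obj X →* End (M.obj X)
  actM_natural : ∀ {X Y} (a : X ⟶ Y) (r : ρ.obj X),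
    actM X r ≫ M.map a = M.map a ≫ actM Y (ρ.map a r)

/-- The tensor product of homomorphisms of commutative algebras. -/
abbrev algTensor {M M' : CommAlgCat.{v₁} Λ} {N N' : CommAlgCat.{v₂} Λ} (f : M ⟶ M') (f' : N ⟶ N') :
    CommAlgCat.of Λ (M ⊗[Λ] N) ⟶ CommAlgCat.of Λ (M' ⊗[Λ] N') :=
  CommAlgCat.ofHom (Algebra.TensorProduct.map f.hom f'.hom)

lemma algTensor_id (M : CommAlgCat.{v₁} Λ) (N : CommAlgCat.{v₂} Λ) :
    algTensor (𝟙 M) (𝟙 N) = 𝟙 _ :=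
  CommAlgCat.hom_ext Algebra.TensorProduct.map_id

lemma algTensor_comp {M M' M'' : CommAlgCat.{v₁} Λ} {N N' N'' : CommAlgCat.{v₂} Λ}
    (f : M ⟶ M') (h : M' ⟶ M'') (f' : N ⟶ N') (h' : N' ⟶ N'') :
    algTensor (f ≫ h) (f' ≫ h') = algTensor f f' ≫ algTensor h h' :=
  CommAlgCat.hom_ext (Algebra.TensorProduct.map_comp _ _ _ _)

lemma prodMap_comp {L L' L'' S S' S'' : SSet.{u}} (f : L ⟶ L') (h : L' ⟶ L'') (f' : S ⟶ S')
    (h' : S' ⟶ S'') : prodMap (f ≫ h) (f' ≫ h') = prodMap f f' ≫ prodMap h h' :=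
  rfl

lemma prodMap_id (L S : SSet.{u}) : prodMap (𝟙 L) (𝟙 S) = 𝟙 _ :=
  rfl

namespace Triple

variable {G : Type g} [Group G]

variable (A : Triple.{u, v₁, w₁, g} G Λ) (B : Triple.{u, v₂, w₂, g} G Λ)

/-- `G/H ↦ T(G/H) × T'(G/H)`. -/
abbrev prodT : (OrbitCat G)ᵒᵖ ⥤ SSet.{u} where
  obj X := Bredon.prod (A.T.obj X) (B.T.obj X)
  map a := prodMap (A.T.map a) (B.T.map a)
  map_id X := by rw [CategoryTheory.Functor.map_id, CategoryTheory.Functor.map_id, prodMap_id]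
  map_comp a b := by rw [Functor.map_comp, Functor.map_comp, prodMap_comp]

/-- `G/H ↦ M(G/H) ⊗ M'(G/H)`. -/
abbrev prodM : (OrbitCat G)ᵒᵖ ⥤ CommAlgCat.{max v₁ v₂} Λ where
  obj X := CommAlgCat.of Λ (A.M.obj X ⊗[Λ] B.M.obj X)
  map a := algTensor (A.M.map a) (B.M.map a)
  map_id X := by rw [CategoryTheory.Functor.map_id, CategoryTheory.Functor.map_id, algTensor_id]
  map_comp a b := by rw [Functor.map_comp, Functor.map_comp, algTensor_comp]

/-- `G/H ↦ ρ(G/H) × ρ'(G/H)`. -/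
abbrev prodρ : (OrbitCat G)ᵒᵖ ⥤ GrpCat.{max w₁ w₂} where
  obj X := GrpCat.of (A.ρ.obj X × B.ρ.obj X)
  map a := GrpCat.ofHom (MonoidHom.prodMap (A.ρ.map a).hom (B.ρ.map a).hom)
  map_id X := by ext x <;> simp
  map_comp a b := by ext x <;> simp

/-- The product action on `T × T'`. -/
def prodActT (X : (OrbitCat G)ᵒᵖ) : (A.ρ.obj X × B.ρ.obj X) →* End ((prodT A B).obj X) where
  toFun r := prodMap (A.actT X r.1) (B.actT X r.2)
  map_one' := by
    rw [Prod.fst_one, Prod.snd_one, map_one, map_one]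
    rfl
  map_mul' r s := by
    rw [Prod.fst_mul, Prod.snd_mul, map_mul, map_mul]
    rfl

/-- The product action on `M ⊗ M'`. -/
def prodActM (X : (OrbitCat G)ᵒᵖ) : (A.ρ.obj X × B.ρ.obj X) →* End ((prodM A B).obj X) where
  toFun r := algTensor (A.actM X r.1) (B.actM X r.2)
  map_one' := by
    rw [Prod.fst_one, Prod.snd_one, map_one, map_one]
    exact algTensor_id _ _
  map_mul' r s := by
    rw [Prod.fst_mul, Prod.snd_mul, map_mul, map_mul]
    exact algTensor_comp (A.actM X s.1) (A.actM X r.1) (B.actM X s.2) (B.actM X r.2)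

lemma prodActT_natural {X Y : (OrbitCat G)ᵒᵖ} (a : X ⟶ Y) (r : A.ρ.obj X) (r' : B.ρ.obj X) :
    prodMap (A.actT X r) (B.actT X r') ≫ prodMap (A.T.map a) (B.T.map a) =
      prodMap (A.T.map a) (B.T.map a) ≫
        prodMap (A.actT Y (A.ρ.map a r)) (B.actT Y (B.ρ.map a r')) := by
  rw [← prodMap_comp, ← prodMap_comp, A.actT_natural, B.actT_natural]

lemma prodActM_natural {X Y : (OrbitCat G)ᵒᵖ} (a : X ⟶ Y) (r : A.ρ.obj X) (r' : B.ρ.obj X) :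
    algTensor (A.actM X r) (B.actM X r') ≫ algTensor (A.M.map a) (B.M.map a) =
      algTensor (A.M.map a) (B.M.map a) ≫
        algTensor (A.actM Y (A.ρ.map a r)) (B.actM Y (B.ρ.map a r')) := by
  rw [← algTensor_comp, ← algTensor_comp, A.actM_natural, B.actM_natural]

/-- The product `(T × T', M ⊗ M', ρ × ρ')` of two triples, with the product actions. -/
def prod : Triple.{u, max v₁ v₂, max w₁ w₂, g} G Λ where
  T := prodT A B
  M := prodM A B
  ρ := prodρ A B
  actT := prodActT A B
  actT_natural a r := prodActT_natural A B a r.1 r.2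
  actM := prodActM A B
  actM_natural a r := prodActM_natural A B a r.1 r.2

end Triple

/-! ### Equivariant cochains -/

namespace Cx

lemma par_comm {K : Cx.{u₁} Λ} {L : Cx.{u₂} Λ} {h : K →ₗ[Λ] L}
    (hh : ∀ {n x}, x ∈ K.deg n → h x ∈ L.deg n) (s : ZMod 2) (x : K) :
    h (K.par s x) = L.par s (h x) := by
  have : h ∘ₗ K.par s = L.par s ∘ₗ h := K.hom_ext (fun n x hx => by
    rw [LinearMap.comp_apply, LinearMap.comp_apply, K.par_of_mem hx, L.par_of_mem (hh hx)]
    split_ifs <;> simp)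
  exact LinearMap.congr_fun this x

lemma sgn_comm {K : Cx.{u₁} Λ} {L : Cx.{u₂} Λ} {h : K →ₗ[Λ] L}
    (hh : ∀ {n x}, x ∈ K.deg n → h x ∈ L.deg n) (x : K) : h (K.sgn x) = L.sgn (h x) := by
  simp only [sgn, LinearMap.sub_apply, map_sub, par_comm hh]

lemma proj_comm {K : Cx.{u₁} Λ} {L : Cx.{u₂} Λ} {h : K →ₗ[Λ] L}
    (hh : ∀ {n x}, x ∈ K.deg n → h x ∈ L.deg n) (m : ℤ) (x : K) :
    h (K.proj m x) = L.proj m (h x) := by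
  have : h ∘ₗ K.proj m = L.proj m ∘ₗ h := K.hom_ext (fun n x hx => by
    rw [LinearMap.comp_apply, LinearMap.comp_apply, K.proj_of_mem hx, L.proj_of_mem (hh hx)]
    split_ifs <;> simp)
  exact LinearMap.congr_fun this x

lemma par_mem (K : Cx.{v} Λ) {n : ℤ} {x : K} (hx : x ∈ K.deg n) (s : ZMod 2) :
    K.par s x ∈ K.deg n := by
  rw [K.par_of_mem hx]
  split_ifs
  exacts [hx, zero_mem _]

end Cx

lemma chains_deg_eq_zero {L : SSet.{u}} {m : ℤ} (hm : 0 < m) {x : chains Λ L}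
    (hx : x ∈ (chains Λ L).deg m) : x = 0 := by
  have : x ∈ (⊥ : Submodule Λ (chains Λ L)) := chains_span _ (fun n _ hn => by lia) hx
  exact this

section Cochains

variable {G : Type g} [Group G]

/-- The module of cochains: families of linear maps `f(G/H) : C(T(G/H)) → M(G/H)` which are natural
in `G/H`, respect the actions of `ρ`, and vanish on chains of large degree.  (Homological degree `n`
is degree `-n`.) -/
def cochainModule (A : Triple.{u, v, w, g} G Λ) :
    Submodule Λ (∀ X, chains Λ (A.T.obj X) →ₗ[Λ] A.M.obj X) where
  carrier := {f | (∀ {X Y} (a : X ⟶ Y) (x : chains Λ (A.T.obj X)),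
      f Y (chainsMap (A.T.map a) x) = (A.M.map a).hom (f X x)) ∧
    (∀ X (r : A.ρ.obj X) (x : chains Λ (A.T.obj X)),
      f X (chainsMap (A.actT X r) x) = (CommAlgCat.Hom.hom (A.actM X r)) (f X x)) ∧
    ∃ N : ℤ, ∀ X, ∀ m < N, ∀ x ∈ (chains Λ (A.T.obj X)).deg m, f X x = 0}
  zero_mem' := by
    refine ⟨fun a x => ?_, fun X r x => ?_, 0, fun X m _ x _ => rfl⟩
    · simp
    · simp
  add_mem' := by
    rintro f f' ⟨h1, h2, N, h3⟩ ⟨h1', h2', N', h3'⟩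
    refine ⟨fun a x => ?_, fun X r x => ?_, min N N', fun X m hm x hx => ?_⟩
    · simp only [Pi.add_apply, LinearMap.add_apply, map_add, h1, h1']
    · simp only [Pi.add_apply, LinearMap.add_apply, map_add, h2, h2']
    · simp only [Pi.add_apply, LinearMap.add_apply]
      rw [h3 X m (by lia) x hx, h3' X m (by lia) x hx, add_zero]
  smul_mem' := by
    rintro c f ⟨h1, h2, N, h3⟩
    refine ⟨fun a x => ?_, fun X r x => ?_, N, fun X m hm x hx => ?_⟩
    · simp only [Pi.smul_apply, LinearMap.smul_apply, map_smul, h1]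
    · simp only [Pi.smul_apply, LinearMap.smul_apply, map_smul, h2]
    · simp only [Pi.smul_apply, LinearMap.smul_apply, h3 X m hm x hx, smul_zero]

/-- The type of cochains. -/
def Cochain (A : Triple.{u, v, w, g} G Λ) : Type (max u v g) := cochainModule A

instance (A : Triple.{u, v, w, g} G Λ) : AddCommGroup (Cochain A) :=
  inferInstanceAs (AddCommGroup (cochainModule A))

instance (A : Triple.{u, v, w, g} G Λ) : Module Λ (Cochain A) :=
  inferInstanceAs (Module Λ (cochainModule A))

variable (A : Triple.{u, v, w, g} G Λ)

/-- Evaluation of cochains at an object of the orbit category. -/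
def cochainEv (X : (OrbitCat G)ᵒᵖ) : Cochain A →ₗ[Λ] chains Λ (A.T.obj X) →ₗ[Λ] A.M.obj X where
  toFun f := f.1 X
  map_add' _ _ := rfl
  map_smul' _ _ := rfl

/-- Composition of a cochain with a natural endomorphism of chains. -/
def cochainComp (h : ∀ L : SSet.{u}, chains Λ L →ₗ[Λ] chains Λ L)
    (hnat : ∀ {L S : SSet.{u}} (f : L ⟶ S) x, h S (chainsMap f x) = chainsMap f (h L x))
    (c : ℤ) (hdeg : ∀ (L : SSet.{u}) (m : ℤ) (x : chains Λ L),
      x ∈ (chains Λ L).deg m → h L x ∈ (chains Λ L).deg (m + c)) :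
    Cochain A →ₗ[Λ] Cochain A where
  toFun f := ⟨fun X => f.1 X ∘ₗ h (A.T.obj X), fun a x => by
      rw [LinearMap.comp_apply, LinearMap.comp_apply, hnat, f.2.1], fun X r x => by
      rw [LinearMap.comp_apply, LinearMap.comp_apply, hnat, f.2.2.1], by
      obtain ⟨N, hN⟩ := f.2.2.2
      exact ⟨N - c, fun X m hm x hx => hN X (m + c) (by lia) _ (hdeg _ _ _ hx)⟩⟩
  map_add' _ _ := rfl
  map_smul' _ _ := rfl

/-- The coboundary: `δ f = (-1)^{n+1} f ∘ ∂` for `f` of degree `n`, which is `f ∘ ∂ ∘ ε` for the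
degree involution `ε` of chains. -/
def cochainD : Cochain A →ₗ[Λ] Cochain A :=
  cochainComp A (fun L => (chains Λ L).d ∘ₗ (chains Λ L).sgn)
    (fun f x => by
      rw [LinearMap.comp_apply, LinearMap.comp_apply, chainsMap_d, Cx.sgn_comm (chainsMap_mem f)])
    1 (fun L m x hx => (chains Λ L).d_mem ((chains Λ L).sgn_mem hx))

/-- The component of degree `-m` of a cochain. -/
def cochainProj (m : ℤ) : Cochain A →ₗ[Λ] Cochain A :=
  cochainComp A (fun L => (chains Λ L).proj m)
    (fun f x => (Cx.proj_comm (chainsMap_mem f) m x).symm)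
    0 (fun L m' x hx => by
      rw [Cx.proj_of_mem _ hx, add_zero]
      split_ifs
      exacts [hx, zero_mem _])

/-- The cochains of degree `n`: those vanishing on chains of homological degree other than `n`. -/
def cochainDeg (n : ℤ) : Submodule Λ (Cochain A) where
  carrier := {f | ∀ X, ∀ m ≠ -n, ∀ x ∈ (chains Λ (A.T.obj X)).deg m, f.1 X x = 0}
  zero_mem' X m _ x _ := rfl
  add_mem' {f f'} h h' X m hm x hx := by
    change f.1 X x + f'.1 X x = 0
    rw [h X m hm x hx, h' X m hm x hx, add_zero]
  smul_mem' c f h X m hm x hx := by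
    change c • f.1 X x = 0
    rw [h X m hm x hx, smul_zero]

/-- The cochains vanishing on chains of degree `m`. -/
def cochainKer (m : ℤ) : Submodule Λ (Cochain A) where
  carrier := {f | ∀ X, ∀ x ∈ (chains Λ (A.T.obj X)).deg m, f.1 X x = 0}
  zero_mem' X x _ := rfl
  add_mem' {f f'} h h' X x hx := by
    change f.1 X x + f'.1 X x = 0
    rw [h X x hx, h' X x hx, add_zero]
  smul_mem' c f h X x hx := by
    change c • f.1 X x = 0
    rw [h X x hx, smul_zero]

lemma cochainProj_apply (m : ℤ) (f : Cochain A) (X) (x : chains Λ (A.T.obj X)) :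
    (cochainProj A m f).1 X x = f.1 X ((chains Λ (A.T.obj X)).proj m x) :=
  rfl

lemma cochain_ext {f f' : Cochain A} (h : ∀ X m, ∀ x ∈ (chains Λ (A.T.obj X)).deg m,
    f.1 X x = f'.1 X x) : f = f' :=
  Subtype.ext (funext fun X => (chains Λ (A.T.obj X)).hom_ext (h X))

lemma cochainDeg_le {n m : ℤ} (h : m ≠ -n) : cochainDeg A n ≤ cochainKer A m :=
  fun _ hf X x hx => hf X m h x hx

lemma cochainProj_mem (m : ℤ) (f : Cochain A) : cochainProj A m f ∈ cochainDeg A (-m) := by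
  intro X k hk x hx
  rw [cochainProj_apply, Cx.proj_of_mem _ hx, if_neg (by lia), map_zero]

lemma cochain_span (f : Cochain A) : f ∈ iSup (cochainDeg A) := by
  obtain ⟨N, hN⟩ := f.2.2.2
  have : f = ∑ m ∈ Finset.Icc N 0, cochainProj A m f := by
    refine cochain_ext A fun X m x hx => ?_
    have hs : (∑ m ∈ Finset.Icc N 0, cochainProj A m f).1 X x =
        ∑ m ∈ Finset.Icc N 0, (cochainProj A m f).1 X x := by
      have := LinearMap.congr_fun
        (map_sum (cochainEv A X) (fun m => cochainProj A m f) (Finset.Icc N 0)) x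
      rwa [LinearMap.sum_apply] at this
    rw [hs]
    simp only [cochainProj_apply, Cx.proj_of_mem _ hx]
    by_cases hm : m ∈ Finset.Icc N 0
    · rw [Finset.sum_eq_single_of_mem m hm (fun k _ hk => by rw [if_neg hk.symm, map_zero]),
        if_pos rfl]
    · rw [Finset.sum_eq_zero (fun k hk => by
        rw [if_neg (by rintro rfl; exact hm hk), map_zero])]
      rw [Finset.mem_Icc, not_and_or, not_le, not_le] at hm
      rcases hm with hm | hm
      · exact hN X m hm x hx
      · rw [chains_deg_eq_zero hm hx, map_zero]
  rw [this]
  refine Submodule.sum_mem _ fun m _ => Submodule.mem_iSup_of_mem (-m) (cochainProj_mem A m f)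

lemma cochain_isInternal : DirectSum.IsInternal (cochainDeg A) :=
  Cx.isInternal_of_separating (cochainDeg A) (cochainKer A) (fun m => -m) (cochain_span A)
    (fun _ _ hm => cochainDeg_le A (by lia))
    (fun _ hf => cochain_ext A fun X m x hx => hf m X x hx)

lemma cochainD_mem {n : ℤ} {f : Cochain A} (hf : f ∈ cochainDeg A n) :
    cochainD A f ∈ cochainDeg A (n + 1) := by
  intro X m hm x hx
  exact hf X (m + 1) (by lia) _ (Cx.d_mem _ (Cx.sgn_mem _ hx))

lemma cochainD_cochainD (f : Cochain A) : cochainD A (cochainD A f) = 0 := by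
  refine cochain_ext A fun X m x _ => ?_
  change f.1 X (Cx.d _ (Cx.sgn _ (Cx.d _ (Cx.sgn _ x)))) = 0
  rw [Cx.d_sgn, Cx.d_d, map_zero, neg_zero, map_zero]

/-- The complex of equivariant cochains `C_ρ^*(T; M)`. -/
def cochains : Cx.{max u v g} Λ where
  carrier := Cochain A
  deg := cochainDeg A
  isInternal := cochain_isInternal A
  d := cochainD A
  d_mem := cochainD_mem A
  d_d := cochainD_cochainD A

/-- Evaluation of cochains at an object of the orbit category. -/
def ev (X : (OrbitCat G)ᵒᵖ) : cochains A →ₗ[Λ] chains Λ (A.T.obj X) →ₗ[Λ] A.M.obj X :=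
  cochainEv A X

/-- The cochain with given values. -/
def mkCochain (f : ∀ X, chains Λ (A.T.obj X) →ₗ[Λ] A.M.obj X) (h : f ∈ cochainModule A) :
    cochains A :=
  (⟨f, h⟩ : cochainModule A)

end Cochains

/-! ### The operations `θ` and the external product -/

namespace Cx

lemma koszul_of_mem {K : Cx.{u₁} Λ} {L : Cx.{u₂} Λ} (P : Submodule Λ (K ⊗[Λ] L)) {i j : ℤ} {x : K}
    {y : L} (hx : x ∈ K.deg i) (hy : y ∈ L.deg j)
    (h : ∀ x' ∈ K.deg i, ∀ y' ∈ L.deg j, x' ⊗ₜ[Λ] y' ∈ P) : koszul K L (x ⊗ₜ y) ∈ P := by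
  simp only [koszul, LinearMap.sum_apply, LinearMap.smul_apply, TensorProduct.map_tmul]
  exact Submodule.sum_mem _ fun a _ => Submodule.sum_mem _ fun b _ =>
    zsmul_mem (h _ (par_mem K hx a) _ (par_mem L hy b)) _

lemma koszul_map {K K' : Cx.{u₁} Λ} {L L' : Cx.{u₂} Λ} {h : K →ₗ[Λ] K'} {h' : L →ₗ[Λ] L'}
    (hh : ∀ {n x}, x ∈ K.deg n → h x ∈ K'.deg n) (hh' : ∀ {n x}, x ∈ L.deg n → h' x ∈ L'.deg n)
    (z : K ⊗[Λ] L) :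
    koszul K' L' (TensorProduct.map h h' z) = TensorProduct.map h h' (koszul K L z) := by
  induction z with
  | zero => simp only [map_zero]
  | add z z' hz hz' => simp only [map_add, hz, hz']
  | tmul x y =>
    simp only [koszul, LinearMap.sum_apply, LinearMap.smul_apply, TensorProduct.map_tmul, map_sum,
      map_zsmul, par_comm hh, par_comm hh']

variable {n : ℕ}

lemma twist_tprod (K : Fin n → Cx.{v} Λ) (c : (Fin n → ZMod 2) → ℤ) (x : ∀ i, K i) :
    twist K c (PiTensorProduct.tprod Λ x) =
      ∑ s, c s • PiTensorProduct.tprod Λ fun i => (K i).par (s i) (x i) := by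
  rw [twist, LinearMap.sum_apply]
  refine Finset.sum_congr rfl fun s _ => ?_
  rw [← PiTensorProduct.map_tprod]
  exact map_zsmul (LinearMap.applyₗ (R := Λ) (PiTensorProduct.tprod Λ x)) (c s)
    (PiTensorProduct.map (R := Λ) fun i => (K i).par (s i))

lemma twist_map {K : Fin n → Cx.{u₁} Λ} {K' : Fin n → Cx.{u₂} Λ} (c : (Fin n → ZMod 2) → ℤ)
    {h : ∀ i, K i →ₗ[Λ] K' i} (hh : ∀ i {m x}, x ∈ (K i).deg m → h i x ∈ (K' i).deg m)
    (z : ⨂[Λ] i, K i) :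
    twist K' c (PiTensorProduct.map h z) = PiTensorProduct.map h (twist K c z) := by
  induction z using PiTensorProduct.induction_on with
  | smul_tprod r x =>
    rw [map_smul, map_smul, map_smul, map_smul, PiTensorProduct.map_tprod, twist_tprod, twist_tprod,
      map_sum]
    simp only [map_zsmul, PiTensorProduct.map_tprod, par_comm (hh _)]
  | add z z' hz hz' => simp only [map_add, hz, hz']

/-- `(-1)^a` with `a = ∑_{i<j} s_i s_j`. -/
def pairSign (s : Fin n → ZMod 2) : ℤ :=
  ∏ i, ∏ j, if i < j then (-1) ^ ((s i).val * (s j).val) else 1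

end Cx

section Operations

variable {G : Type g} [Group G] (A : Triple.{u, v, w, g} G Λ)

/-- The map `α : C_ρ^*(T; M)^p → Hom(C(T)^p, M)`, at an object of the orbit category:
`α(f_1 ⊗ ⋯ ⊗ f_p)(x_1 ⊗ ⋯ ⊗ x_p) = (-1)^a f_1(x_1) ⋯ f_p(x_p)`, where
`a = ∑_{i<j} deg x_i deg x_j`. -/
def alpha (p : ℕ) (X : (OrbitCat G)ᵒᵖ) :
    (cochains A).pow p →ₗ[Λ] (chains Λ (A.T.obj X)).pow p →ₗ[Λ] A.M.obj X :=
  LinearMap.lcomp Λ _ (Cx.twist (fun _ => chains Λ (A.T.obj X)) Cx.pairSign) ∘ₗ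
    LinearMap.compRight Λ
      (PiTensorProduct.lift (MultilinearMap.mkPiAlgebra Λ (Fin p) (A.M.obj X))) ∘ₗ
      PiTensorProduct.piTensorHomMap ∘ₗ PiTensorProduct.map fun _ => ev A X

variable {p : ℕ}

lemma alpha_tprod (X : (OrbitCat G)ᵒᵖ) (f : Fin p → cochains A) (z) :
    alpha A p X (PiTensorProduct.tprod Λ f) z =
      PiTensorProduct.lift (MultilinearMap.mkPiAlgebra Λ (Fin p) (A.M.obj X))
        (PiTensorProduct.map (fun i => ev A X (f i))
          (Cx.twist (fun _ => chains Λ (A.T.obj X)) Cx.pairSign z)) := by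
  simp only [alpha, LinearMap.comp_apply, PiTensorProduct.map_tprod,
    PiTensorProduct.piTensorHomMap_tprod_eq_map]
  rfl

lemma alpha_map {X Y : (OrbitCat G)ᵒᵖ} {h : chains Λ (A.T.obj X) →ₗ[Λ] chains Λ (A.T.obj Y)}
    (hh : ∀ {n x}, x ∈ (chains Λ (A.T.obj X)).deg n → h x ∈ (chains Λ (A.T.obj Y)).deg n)
    (m : A.M.obj X →ₐ[Λ] A.M.obj Y)
    (hm : ∀ (f : cochains A) (x : chains Λ (A.T.obj X)), ev A Y f (h x) = m (ev A X f x)) (F) (z) :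
    alpha A p Y F (PiTensorProduct.map (fun _ => h) z) = m (alpha A p X F z) := by
  induction F using PiTensorProduct.induction_on with
  | add F F' hF hF' => simp only [map_add, LinearMap.add_apply, hF, hF']
  | smul_tprod r f =>
    simp only [map_smul, LinearMap.smul_apply]
    congr 1
    rw [alpha_tprod, alpha_tprod, Cx.twist_map _ (fun _ => hh)]
    generalize Cx.twist (fun _ => chains Λ (A.T.obj X)) Cx.pairSign z = y
    induction y using PiTensorProduct.induction_on with
    | add y y' hy hy' => simp only [map_add, hy, hy']
    | smul_tprod r x =>
      simp only [map_smul, PiTensorProduct.map_tprod, PiTensorProduct.lift.tprod,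
        MultilinearMap.mkPiAlgebra_apply, map_prod, hm]

lemma alpha_eq_zero (X : (OrbitCat G)ᵒᵖ) (f : Fin p → cochains A) (N : Fin p → ℤ)
    (hN : ∀ i, ∀ m < N i, ∀ x ∈ (chains Λ (A.T.obj X)).deg m, ev A X (f i) x = 0) {k : ℤ}
    (hk : k < ∑ i, N i) {z} (hz : z ∈ ((chains Λ (A.T.obj X)).pow p).deg k) :
    alpha A p X (PiTensorProduct.tprod Λ f) z = 0 := by
  induction hz using Submodule.span_induction with
  | zero => simp only [map_zero]
  | add y y' _ _ hy hy' => simp only [map_add, hy, hy', add_zero]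
  | smul r y _ hy => simp only [map_smul, hy, smul_zero]
  | mem z hz =>
    obtain ⟨e, he, x, hx, rfl⟩ := hz
    obtain ⟨i, -, hi⟩ : ∃ i ∈ Finset.univ, e i < N i :=
      Finset.exists_lt_of_sum_lt (by rw [he]; exact hk)
    rw [alpha_tprod, Cx.twist_tprod, map_sum, map_sum]
    refine Finset.sum_eq_zero fun s _ => ?_
    rw [map_zsmul, map_zsmul, PiTensorProduct.map_tprod, PiTensorProduct.lift.tprod,
      MultilinearMap.mkPiAlgebra_apply,
      Finset.prod_eq_zero (Finset.mem_univ i) (hN i _ hi _ (Cx.par_mem _ (hx i) _)), smul_zero]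

variable (Φ : DiagApprox.{u} Λ p)

/-- The pairing `w ⊗ F ↦ (x ↦ α(F)(Δ(w ⊗ x)))`, at an object of the orbit category. -/
def thetaPre (X : (OrbitCat G)ᵒᵖ) :
    (res Λ p).tensor ((cochains A).pow p) →ₗ[Λ] chains Λ (A.T.obj X) →ₗ[Λ] A.M.obj X :=
  TensorProduct.lift (LinearMap.mk₂ Λ
    (fun w F => alpha A p X F ∘ₗ Φ.delta (A.T.obj X) ∘ₗ TensorProduct.mk Λ _ _ w)
    (fun w w' F => by ext x; simp)
    (fun c w F => by
      ext x
      simp only [LinearMap.comp_apply, LinearMap.smul_apply, map_smul])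
    (fun w F F' => by ext x; simp)
    (fun c w F => by ext x; simp))

lemma thetaPre_tmul (X : (OrbitCat G)ᵒᵖ) (w : res Λ p) (F : (cochains A).pow p)
    (x : chains Λ (A.T.obj X)) :
    thetaPre A Φ X (w ⊗ₜ F) x = alpha A p X F (Φ.delta (A.T.obj X) (w ⊗ₜ x)) :=
  rfl

lemma thetaPre_mem (z : (res Λ p).tensor ((cochains A).pow p)) :
    (fun X => thetaPre A Φ X z) ∈ cochainModule A := by
  let P : Submodule Λ ((res Λ p).tensor ((cochains A).pow p)) :=
    (cochainModule A).comap (LinearMap.pi fun X => thetaPre A Φ X)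
  refine Cx.tensor_span _ _ P (fun i j w hw F _ => ?_) z
  refine Cx.piTensor_span (fun _ => cochains A)
    (P.comap (TensorProduct.mk Λ (res Λ p) ((cochains A).pow p) w)) (fun _ f _ => ?_) F
  choose N hN using fun k => (f k).2.2.2
  refine ⟨fun {X Y} a x => ?_, fun X r x => ?_, ∑ k, N k - i, fun X m hm x hx => ?_⟩
  · change thetaPre A Φ Y (w ⊗ₜ _) _ = (A.M.map a).hom (thetaPre A Φ X (w ⊗ₜ _) x)
    rw [thetaPre_tmul, thetaPre_tmul, DiagApprox.delta_naturality]
    exact alpha_map A (chainsMap_mem _) (A.M.map a).hom (fun f x => f.2.1 a x) _ _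
  · change thetaPre A Φ X (w ⊗ₜ _) _ =
      (CommAlgCat.Hom.hom (A.actM X r)) (thetaPre A Φ X (w ⊗ₜ _) x)
    rw [thetaPre_tmul, thetaPre_tmul, DiagApprox.delta_naturality]
    exact alpha_map A (chainsMap_mem _) (CommAlgCat.Hom.hom (A.actM X r))
      (fun f x => f.2.2.1 X r x) _ _
  · change thetaPre A Φ X (w ⊗ₜ _) x = 0
    rw [thetaPre_tmul]
    exact alpha_eq_zero A X f N (fun k => hN k X) (by lia) (Φ.delta_mem hw hx)

/-- The structure map `θ : W ⊗ C_ρ^*(T; M)^p → C_ρ^*(T; M)`,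
`θ(w ⊗ F)(x) = (-1)^{deg w deg F} α(F)(Δ(w ⊗ x))`. -/
def theta : (res Λ p).tensor ((cochains A).pow p) →ₗ[Λ] cochains A :=
  LinearMap.codRestrict (cochainModule A) (LinearMap.pi fun X => thetaPre A Φ X)
    (thetaPre_mem A Φ) ∘ₗ Cx.koszul (res Λ p) ((cochains A).pow p)

variable (B : Triple.{u, v₂, w₂, g} G Λ)

/-- The structure map `θ̃` of the tensor product: the composite
`W ⊗ (K ⊗ K')^p → W ⊗ W ⊗ K^p ⊗ K'^p → W ⊗ K^p ⊗ W ⊗ K'^p → K ⊗ K'`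
of `ψ` and the shuffle, the signed interchange of factors, and `θ ⊗ θ'`. -/
def thetaTensor : (res Λ p).tensor (((cochains A).tensor (cochains B)).pow p) →ₗ[Λ]
    (cochains A).tensor (cochains B) :=
  TensorProduct.map (theta A Φ) (theta B Φ) ∘ₗ
    Cx.interchange (res Λ p) (res Λ p) ((cochains A).pow p) ((cochains B).pow p) ∘ₗ
      TensorProduct.map (coprod Λ p) (Cx.shuffle p (cochains A) (cochains B))

/-- `α̃ : C_ρ^*(T; M) ⊗ C_ρ'^*(T'; M') → Hom(C(T) ⊗ C(T'), M ⊗ M')`, at an object of the orbit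
category: `α̃(f ⊗ h)(x ⊗ y) = (-1)^{deg x deg y} f(x) ⊗ h(y)`. -/
def alphaTensor (X : (OrbitCat G)ᵒᵖ) :
    (cochains A).tensor (cochains B) →ₗ[Λ]
      (chains Λ (A.T.obj X)).tensor (chains Λ (B.T.obj X)) →ₗ[Λ] A.M.obj X ⊗[Λ] B.M.obj X :=
  LinearMap.lcomp Λ _ (Cx.koszul (chains Λ (A.T.obj X)) (chains Λ (B.T.obj X))) ∘ₗ
    TensorProduct.homTensorHomMap (RingHom.id Λ) _ _ _ _ ∘ₗ TensorProduct.map (ev A X) (ev B X)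

lemma alphaTensor_tmul (X : (OrbitCat G)ᵒᵖ) (f : cochains A) (h : cochains B) (z) :
    alphaTensor A B X (f ⊗ₜ h) z = TensorProduct.map (ev A X f) (ev B X h)
      (Cx.koszul (chains Λ (A.T.obj X)) (chains Λ (B.T.obj X)) z) :=
  rfl

lemma alphaTensor_map {X Y : (OrbitCat G)ᵒᵖ} {k : chains Λ (A.T.obj X) →ₗ[Λ] chains Λ (A.T.obj Y)}
    {k' : chains Λ (B.T.obj X) →ₗ[Λ] chains Λ (B.T.obj Y)}
    (hk : ∀ {n x}, x ∈ (chains Λ (A.T.obj X)).deg n → k x ∈ (chains Λ (A.T.obj Y)).deg n)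
    (hk' : ∀ {n x}, x ∈ (chains Λ (B.T.obj X)).deg n → k' x ∈ (chains Λ (B.T.obj Y)).deg n)
    (m : A.M.obj X →ₐ[Λ] A.M.obj Y) (m' : B.M.obj X →ₐ[Λ] B.M.obj Y) (f : cochains A)
    (h : cochains B) (hm : ∀ x : chains Λ (A.T.obj X), ev A Y f (k x) = m (ev A X f x))
    (hm' : ∀ x : chains Λ (B.T.obj X), ev B Y h (k' x) = m' (ev B X h x)) (z) :
    alphaTensor A B Y (f ⊗ₜ h) (TensorProduct.map k k' z) =
      Algebra.TensorProduct.map m m' (alphaTensor A B X (f ⊗ₜ h) z) := by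
  rw [alphaTensor_tmul, alphaTensor_tmul, Cx.koszul_map hk hk']
  generalize Cx.koszul (chains Λ (A.T.obj X)) (chains Λ (B.T.obj X)) z = y
  induction y with
  | zero => simp only [map_zero]
  | add y y' hy hy' => simp only [map_add, hy, hy']
  | tmul a b => simp only [TensorProduct.map_tmul, Algebra.TensorProduct.map_tmul, hm, hm']

/-- The composite of `α̃` and the map induced by the Alexander-Whitney map `ξ`, at an object of the
orbit category. -/
def alphaTensorAw (X : (OrbitCat G)ᵒᵖ) :
    (cochains A).tensor (cochains B) →ₗ[Λ]
      chains Λ (Bredon.prod (A.T.obj X) (B.T.obj X)) →ₗ[Λ] A.M.obj X ⊗[Λ] B.M.obj X :=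
  LinearMap.lcomp Λ (A.M.obj X ⊗[Λ] B.M.obj X) (aw (A.T.obj X) (B.T.obj X)) ∘ₗ alphaTensor A B X

/-- The same map with values in the coefficients of the product triple. -/
def xiAlphaPre (X : (OrbitCat G)ᵒᵖ) :
    (cochains A).tensor (cochains B) →ₗ[Λ]
      chains Λ ((A.prod B).T.obj X) →ₗ[Λ] (A.prod B).M.obj X :=
  alphaTensorAw A B X

lemma xiAlpha_mem (z : (cochains A).tensor (cochains B)) :
    (fun X => xiAlphaPre A B X z) ∈ cochainModule (A.prod B) := by
  let P : Submodule Λ ((cochains A).tensor (cochains B)) :=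
    (cochainModule (A.prod B)).comap
      (LinearMap.pi fun X => xiAlphaPre A B X)
  refine Cx.tensor_span _ _ P (fun _ _ f _ h _ => ?_) z
  · clear z
    obtain ⟨N, hN⟩ := f.2.2.2
    obtain ⟨N', hN'⟩ := h.2.2.2
    refine ⟨fun {X Y} a x => ?_, fun X r x => ?_, N + N', fun X m hm x hx => ?_⟩
    · exact (congrArg _ (aw_naturality (A.T.map a) (B.T.map a) x)).trans
        (alphaTensor_map A B (chainsMap_mem _) (chainsMap_mem _) (A.M.map a).hom (B.M.map a).hom
          f h (f.2.1 a) (h.2.1 a) _)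
    · exact (congrArg _ (aw_naturality (A.actT X r.1) (B.actT X r.2) x)).trans
        (alphaTensor_map A B (chainsMap_mem _) (chainsMap_mem _)
          (CommAlgCat.Hom.hom (A.actM X r.1)) (CommAlgCat.Hom.hom (B.actM X r.2))
          f h (f.2.2.1 X r.1) (h.2.2.1 X r.2) _)
    · have key : x ∈ LinearMap.ker
          (alphaTensor A B X (f ⊗ₜ h) ∘ₗ aw (Λ := Λ) (A.T.obj X) (B.T.obj X)) := by
        refine chains_span (L := Bredon.prod (A.T.obj X) (B.T.obj X)) _ (fun n y hn => ?_) hx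
        rw [LinearMap.mem_ker, LinearMap.comp_apply, aw_cell, awFun, map_sum]
        refine Finset.sum_eq_zero fun i hi => ?_
        rw [Finset.mem_range] at hi
        rw [alphaTensor_tmul, ← LinearMap.mem_ker]
        refine Cx.koszul_of_mem _ (seg_mem _ _ _) (seg_mem _ _ _) fun a ha b hb => ?_
        rw [LinearMap.mem_ker, TensorProduct.map_tmul]
        by_cases hiN : -(i : ℤ) < N
        · rw [show ev A X f a = 0 from hN X _ hiN a ha, TensorProduct.zero_tmul]
        · rw [show ev B X h b = 0 from hN' X _ (by lia) b hb, TensorProduct.tmul_zero]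
      exact key

/-- The map `ξ^* α̃ : C_ρ^*(T; M) ⊗ C_ρ'^*(T'; M') → C_{ρ×ρ'}^*(T × T'; M ⊗ M')`, the external
product of cochains. -/
def xiAlpha : (cochains A).tensor (cochains B) →ₗ[Λ] cochains (A.prod B) :=
  LinearMap.codRestrict (cochainModule (A.prod B))
    (LinearMap.pi fun X => xiAlphaPre A B X)
    (xiAlpha_mem A B)

end Operations

end Bredon

end

/-! At an orbit G/H both composites of the square send w ⊗ F to a cochain of the form x ↦ ± a(F)(Ψ(w
⊗ x)), with one and the same pairing a of (K ⊗ K')^p with C(T)^p ⊗ C(T')^p, namely `shufflePairing`.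
They differ only in Ψ, which in both cases is a natural π-equivariant chain map W ⊗ C(L × S) →
C(L)^p ⊗ C(S)^p. Going through `thetaTensor` gives `awThenDelta`, which is ψ ⊗ ξ followed by the
interchange and Δ ⊗ Δ. Going through the structure map of the product gives `deltaThenAw`, which is
Δ of the product followed by ξ^p and the shuffle. These identifications are `ev_xiAlpha_thetaTensor`
and `ev_theta_xiAlpha`; the second rests on `powPairing_extPairing`.

It therefore suffices to compare two maps of chains. They agree on e_0 ⊗ x for vertices x, and
`exists_diagonal_homotopy` joins them by a natural equivariant homotopy H. The pairing turns H into
a homotopy of operations on cochains (`pairOp_homotopy`). Its values are again equivariant natural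
cochains because H is natural in both simplicial sets (`pairOp_shufflePairing_mem`), and it is
π-invariant because H is equivariant and the pairing is invariant.

The homotopy comes from acyclic models. Since W is free over Λπ, an equivariant map out of W ⊗ C(X)
is a sequence of natural operations C(X) → D(X), one for each e_i, and the equation for a chain map
or a homotopy becomes a system that is solved degree by degree (`bounding_spec`). Each stage is the
problem d S + (-1)^c S d = N, solved on the generic simplex of a standard simplex by a contraction
of D and extended by naturality (`d_primitive`). Chains are normalized, so the solution must vanish
on degenerate simplices. This holds because the cone contraction with vertex 0 commutes with all
simplicial operators fixing 0, in particular with degeneracies (`primitive_degenerate`); tensor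
products and powers inherit such contractions. The results are `exists_homotopy` and
`exists_extension`. They concern a single X: two factors L and S are reached through the diagonal of
L × S and its projections.

For the existence of Φ, the Alexander-Whitney diagonal C(X) → C(X)^p is a chain map, fixed by π on
vertices, so it extends to an equivariant Ψ : W ⊗ C(X) → C(X)^p. Projecting to the factors and
feeding one half of the coproduct into Ψ, w ⊗ x ↦ ∑ w' ⊗ Ψ(w'' ⊗ x), gives a map with values in W ⊗
C(L_1) ⊗ ⋯ ⊗ C(L_p) (`coextend`). The condition on vertices is the counit property of ψ, and the
filtration condition holds because the p-th tensor power of the chains of a j-simplex vanishes above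
dimension pj.

That the structure maps are morphisms follows from two general facts: a pairing composed with a
chain map is again compatible with differentials (`IsPairing.pairOp`), and ψ, the shuffle and the
interchange are equivariant chain maps. All signs are written as (-1) to a bilinear or quadratic
form in parities over the field with two elements. Pairings vanish unless degrees are opposite, so
signs may be computed from either argument. -/

noncomputable section

namespace Bredon

variable {Λ : Type} [CommRing Λ]

/-! ### Signs -/

/-- The sign `(-1)^s` attached to a parity. -/
def psign (s : ZMod 2) : ℤ := (-1) ^ s.val

lemma psign_add (s t : ZMod 2) : psign (s + t) = psign s * psign t := by
  revert s t; decide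

lemma psign_zero : psign 0 = 1 := rfl

lemma psign_one : psign 1 = -1 := rfl

lemma pow_val_mul (s t : ZMod 2) : (-1 : ℤ) ^ (s.val * t.val) = psign (s * t) := by
  revert s t; decide

lemma psign_sum {ι : Type*} (S : Finset ι) (f : ι → ZMod 2) :
    psign (∑ i ∈ S, f i) = ∏ i ∈ S, psign (f i) := by
  classical
  induction S using Finset.induction_on with
  | empty => rfl
  | insert a S ha ih => rw [Finset.sum_insert ha, Finset.prod_insert ha, psign_add, ih]

lemma psign_smul_psign_smul {M : Type*} [AddCommGroup M] (s t : ZMod 2) (x : M) :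
    psign s • psign t • x = psign (s + t) • x := by
  rw [smul_smul, psign_add]

lemma zsmul_linearMap_apply {M : Type*} {N : Type*} [AddCommGroup M] [Module Λ M] [AddCommGroup N]
    [Module Λ N] (c : ℤ) (f : M →ₗ[Λ] N) (x : M) : (c • f) x = c • f x :=
  map_zsmul (LinearMap.applyₗ (R := Λ) x) c f

lemma zsmul_tmul_left {M : Type*} {N : Type*} [AddCommGroup M] [Module Λ M] [AddCommGroup N]
    [Module Λ N] (c : ℤ) (x : M) (y : N) : (c • x) ⊗ₜ[Λ] y = c • x ⊗ₜ[Λ] y :=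
  map_zsmul ((TensorProduct.mk Λ M N).flip y) c x

lemma tmul_zsmul_right {M : Type*} {N : Type*} [AddCommGroup M] [Module Λ M] [AddCommGroup N]
    [Module Λ N] (c : ℤ) (x : M) (y : N) : x ⊗ₜ[Λ] (c • y) = c • x ⊗ₜ[Λ] y :=
  map_zsmul (TensorProduct.mk Λ M N x) c y

namespace Cx

/-! ### Koszul signs on tensors of two and of four homogeneous factors -/

section Homogeneous

variable {A : Cx.{u₁} Λ} {B : Cx.{u₂} Λ} {K : Cx.{v} Λ} {L : Cx.{w} Λ}

lemma sgn_eq_smul {n : ℤ} {x : K} (hx : x ∈ K.deg n) : K.sgn x = psign (n : ZMod 2) • x := by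
  rw [K.sgn_of_mem hx]
  rcases parity_cases (n : ZMod 2) with h | h <;> simp [h, psign_zero, psign_one]

/-- Of the summands over pairs of parities only the one at the parities of `x` and `y` survives; the
other projections annihilate `x` or `y`. -/
lemma koszul_tmul {m n : ℤ} {x : K} {y : L} (hx : x ∈ K.deg m) (hy : y ∈ L.deg n) :
    koszul K L (x ⊗ₜ y) = psign (m * n) • x ⊗ₜ y := by
  simp only [koszul, LinearMap.sum_apply, LinearMap.smul_apply, TensorProduct.map_tmul,
    par_of_mem K hx, par_of_mem L hy]
  rw [Finset.sum_eq_single (m : ZMod 2), Finset.sum_eq_single (n : ZMod 2)]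
  · rw [if_pos rfl, if_pos rfl, pow_val_mul]
  · intro b _ hb
    rw [if_neg (Ne.symm hb) (c := (n : ZMod 2) = b), tmul_zero, smul_zero]
  · simp
  · intro b _ hb
    simp [if_neg (Ne.symm hb)]
  · simp

lemma interchange_apply (z : (A ⊗[Λ] B) ⊗[Λ] (K ⊗[Λ] L)) :
    interchange A B K L z = ∑ a : ZMod 2, ∑ b : ZMod 2, (-1 : ℤ) ^ (a.val * b.val) •
      TensorProduct.tensorTensorTensorComm Λ A B K L
        (TensorProduct.map (TensorProduct.map LinearMap.id (B.par a))
          (TensorProduct.map (K.par b) LinearMap.id) z) :=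
  (LinearMap.sum_apply _ _ _).trans <| Finset.sum_congr rfl fun _ _ =>
    (LinearMap.sum_apply _ _ _).trans <| Finset.sum_congr rfl fun _ _ =>
      zsmul_linearMap_apply (M := (A ⊗[Λ] B) ⊗[Λ] (K ⊗[Λ] L)) (N := (A ⊗[Λ] K) ⊗[Λ] (B ⊗[Λ] L))
        _ _ z

lemma interchange_tmul {j k : ℤ} (a : A) {b : B} {x : K} (y : L) (hb : b ∈ B.deg j)
    (hx : x ∈ K.deg k) :
    interchange A B K L ((a ⊗ₜ b) ⊗ₜ (x ⊗ₜ y)) = psign (j * k) • (a ⊗ₜ x) ⊗ₜ (b ⊗ₜ y) := by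
  rw [interchange_apply]
  simp only [TensorProduct.map_tmul, LinearMap.id_apply, par_of_mem K hx, par_of_mem B hb,
    TensorProduct.tensorTensorTensorComm_tmul]
  rw [Finset.sum_eq_single (j : ZMod 2), Finset.sum_eq_single (k : ZMod 2)]
  · rw [if_pos rfl, if_pos rfl, pow_val_mul]
  · intro c _ hc
    rw [if_neg (Ne.symm hc) (c := (k : ZMod 2) = c), tmul_zero, zero_tmul]
    exact smul_zero _
  · simp
  · intro c _ hc
    refine Finset.sum_eq_zero fun d _ => ?_
    rw [if_neg (Ne.symm hc), zero_tmul, tmul_zero]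
    exact smul_zero _
  · simp

lemma tmul_mem {m n : ℤ} {x : K} {y : L} (hx : x ∈ K.deg m) (hy : y ∈ L.deg n) :
    x ⊗ₜ[Λ] y ∈ (K.tensor L).deg (m + n) :=
  Submodule.subset_span ⟨(m, n), rfl, x, hx, y, hy, rfl⟩

lemma tensorDeg_le {n : ℤ} (P : Submodule Λ (K ⊗[Λ] L))
    (h : ∀ i j, i + j = n → ∀ x ∈ K.deg i, ∀ y ∈ L.deg j, x ⊗ₜ[Λ] y ∈ P) :
    (K.tensor L).deg n ≤ P := by
  refine Submodule.span_le.2 ?_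
  rintro _ ⟨⟨i, j⟩, hij, x, hx, y, hy, rfl⟩
  exact h i j hij x hx y hy

lemma tensor_hom_ext {N : Type*} [AddCommGroup N] [Module Λ N] {f f' : K ⊗[Λ] L →ₗ[Λ] N}
    (h : ∀ i j, ∀ x ∈ K.deg i, ∀ y ∈ L.deg j, f (x ⊗ₜ y) = f' (x ⊗ₜ y)) : f = f' :=
  LinearMap.ext fun z => tensor_span K L (LinearMap.eqLocus f f') h z

lemma tensor_d_tmul {m : ℤ} {x : K} (y : L) (hx : x ∈ K.deg m) :
    (K.tensor L).d (x ⊗ₜ y) = K.d x ⊗ₜ y + psign (m : ZMod 2) • x ⊗ₜ L.d y := by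
  change TensorProduct.map K.d LinearMap.id (x ⊗ₜ y) + TensorProduct.map K.sgn L.d (x ⊗ₜ y) = _
  rw [TensorProduct.map_tmul, TensorProduct.map_tmul, sgn_eq_smul hx, LinearMap.id_apply,
    TensorProduct.smul_tmul']

lemma tensor4_hom_ext {N : Type*} [AddCommGroup N] [Module Λ N]
    {f f' : (A ⊗[Λ] B) ⊗[Λ] (K ⊗[Λ] L) →ₗ[Λ] N}
    (h : ∀ i j k l, ∀ a ∈ A.deg i, ∀ b ∈ B.deg j, ∀ x ∈ K.deg k, ∀ y ∈ L.deg l,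
      f ((a ⊗ₜ b) ⊗ₜ (x ⊗ₜ y)) = f' ((a ⊗ₜ b) ⊗ₜ (x ⊗ₜ y))) : f = f' := by
  refine TensorProduct.ext' fun s t => ?_
  refine tensor_span A B ((LinearMap.eqLocus f f').comap ((TensorProduct.mk Λ _ _).flip t))
    (fun i j a ha b hb => ?_) s
  refine tensor_span K L ((LinearMap.eqLocus f f').comap (TensorProduct.mk Λ _ _ (a ⊗ₜ b)))
    (fun k l x hx y hy => ?_) t
  exact h i j k l a ha b hb x hx y hy

/-- The sign depends on the degrees of the two middle factors alone, so only `fB` and `fK` have to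
preserve degrees. -/
lemma interchange_map {A' : Cx.{u₁} Λ} {B' : Cx.{u₂} Λ} {K' : Cx.{v₁} Λ} {L' : Cx.{w₁} Λ}
    {fA : A →ₗ[Λ] A'} {fB : B →ₗ[Λ] B'} {fK : K →ₗ[Λ] K'} {fL : L →ₗ[Λ] L'}
    (hB : ∀ {n x}, x ∈ B.deg n → fB x ∈ B'.deg n) (hK : ∀ {n x}, x ∈ K.deg n → fK x ∈ K'.deg n)
    (z : (A ⊗[Λ] B) ⊗[Λ] (K ⊗[Λ] L)) :
    interchange A' B' K' L'
        (TensorProduct.map (TensorProduct.map fA fB) (TensorProduct.map fK fL) z) =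
      TensorProduct.map (TensorProduct.map fA fK) (TensorProduct.map fB fL)
        (interchange A B K L z) := by
  have : interchange A' B' K' L' ∘ₗ
        TensorProduct.map (TensorProduct.map fA fB) (TensorProduct.map fK fL) =
      TensorProduct.map (TensorProduct.map fA fK) (TensorProduct.map fB fL) ∘ₗ
        interchange A B K L := by
    refine tensor4_hom_ext fun i j k l a ha b hb x hx y hy => ?_
    simp only [LinearMap.comp_apply, TensorProduct.map_tmul]
    rw [interchange_tmul a y hb hx, interchange_tmul _ _ (hB hb) (hK hx), map_zsmul]
    simp only [TensorProduct.map_tmul]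
  exact LinearMap.congr_fun this z

end Homogeneous

end Cx

/-! ### Morphisms of complexes -/

lemma IsCxHom.comp {K : Cx.{u₁} Λ} {L : Cx.{u₂} Λ} {M : Cx.{v} Λ} {f : L →ₗ[Λ] M}
    {f' : K →ₗ[Λ] L} (hf : IsCxHom f) (hf' : IsCxHom f') : IsCxHom (f ∘ₗ f') :=
  ⟨fun hx => hf.mem (hf'.mem hx), fun x => by
    rw [LinearMap.comp_apply, LinearMap.comp_apply, hf'.comm, hf.comm]⟩

lemma isCxHom_id (K : Cx.{v} Λ) : IsCxHom (LinearMap.id : K →ₗ[Λ] K) :=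
  ⟨fun hx => hx, fun _ => rfl⟩

lemma IsCxHom.tensorMap {K : Cx.{u₁} Λ} {K' : Cx.{u₂} Λ} {L : Cx.{v} Λ} {L' : Cx.{w} Λ}
    {f : K →ₗ[Λ] K'} {f' : L →ₗ[Λ] L'} (hf : IsCxHom f) (hf' : IsCxHom f') :
    IsCxHom (K := K.tensor L) (L := K'.tensor L') (TensorProduct.map f f') where
  mem {n z} hz := by
    refine Cx.tensorDeg_le (((K'.tensor L').deg n).comap (TensorProduct.map f f')) ?_ hz
    rintro i j rfl x hx y hy
    exact Cx.tmul_mem (hf.mem hx) (hf'.mem hy)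
  comm z := by
    have : TensorProduct.map f f' ∘ₗ (K.tensor L).d = (K'.tensor L').d ∘ₗ TensorProduct.map f f' :=
      Cx.tensor_hom_ext fun i j x hx y hy => by
        rw [LinearMap.comp_apply, LinearMap.comp_apply, Cx.tensor_d_tmul y hx, map_add, map_zsmul,
          TensorProduct.map_tmul, TensorProduct.map_tmul, TensorProduct.map_tmul,
          Cx.tensor_d_tmul _ (hf.mem hx), hf.comm, hf'.comm]
    exact LinearMap.congr_fun this z

lemma isCxHom_interchange (A : Cx.{u₁} Λ) (B : Cx.{u₂} Λ) (K : Cx.{v} Λ) (L : Cx.{w} Λ) :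
    IsCxHom (Cx.interchange A B K L) where
  mem {n z} hz := by
    have key : ∀ i j k l, i + j + (k + l) = n → ∀ a ∈ A.deg i, ∀ b ∈ B.deg j, ∀ x ∈ K.deg k,
        ∀ y ∈ L.deg l, Cx.interchange A B K L ((a ⊗ₜ b) ⊗ₜ (x ⊗ₜ y)) ∈
          ((A.tensor K).tensor (B.tensor L)).deg n := by
      rintro i j k l rfl a ha b hb x hx y hy
      rw [Cx.interchange_tmul a y hb hx, show i + j + (k + l) = (i + k) + (j + l) by ring]
      exact zsmul_mem (Cx.tmul_mem (Cx.tmul_mem ha hx) (Cx.tmul_mem hb hy)) _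
    let P : Submodule Λ ((A.tensor B) ⊗[Λ] (K.tensor L)) :=
      (((A.tensor K).tensor (B.tensor L)).deg n).comap (Cx.interchange A B K L)
    refine Cx.tensorDeg_le (K := A.tensor B) (L := K.tensor L) P ?_ hz
    intro r s hrs s₁ hs₁ t ht
    refine Cx.tensorDeg_le (P.comap ((TensorProduct.mk Λ _ _).flip t)) ?_ hs₁
    intro i j hij a ha b hb
    refine Cx.tensorDeg_le (P.comap (TensorProduct.mk Λ _ _ (a ⊗ₜ b))) ?_ ht
    intro k l hkl x hx y hy
    exact key i j k l (by rw [hij, hkl, hrs]) a ha b hb x hx y hy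
  comm z := by
    have : Cx.interchange A B K L ∘ₗ ((A.tensor B).tensor (K.tensor L)).d =
        ((A.tensor K).tensor (B.tensor L)).d ∘ₗ Cx.interchange A B K L := by
      refine Cx.tensor4_hom_ext fun i j k l a ha b hb x hx y hy => ?_
      rw [LinearMap.comp_apply, LinearMap.comp_apply, Cx.interchange_tmul a y hb hx, map_zsmul,
        Cx.tensor_d_tmul (K := A.tensor B) (L := K.tensor L) _ (Cx.tmul_mem ha hb),
        Cx.tensor_d_tmul (K := A.tensor K) (L := B.tensor L) _ (Cx.tmul_mem ha hx),
        Cx.tensor_d_tmul _ ha, Cx.tensor_d_tmul _ ha, Cx.tensor_d_tmul _ hb,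
        Cx.tensor_d_tmul _ hx]
      simp only [add_tmul, tmul_add, zsmul_tmul_left, tmul_zsmul_right, map_add, map_zsmul,
        Cx.interchange_tmul (A := A) (B := B) (K := K) (L := L) _ _ hb hx,
        Cx.interchange_tmul (A := A) (B := B) (K := K) (L := L) _ _ (B.d_mem hb) hx,
        Cx.interchange_tmul (A := A) (B := B) (K := K) (L := L) _ _ hb (K.d_mem hx),
        psign_smul_psign_smul]
      push_cast
      -- The four terms of the differential are replaced by arbitrary elements of a group, which
      -- leaves an identity of exponents modulo 2.
      have key : ∀ {X : Type (max u₁ u₂ v w)} [AddCommGroup X] (i j k : ZMod 2) (p q r s : X),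
          psign (j * k) • p + psign (i + (j + 1) * k) • q +
            psign (i + j) • (psign (j * (k + 1)) • r + psign (k + j * k) • s) =
          psign (j * k) • (p + psign i • r + psign (i + k) • (q + psign j • s)) := by
        intro X _ i j k p q r s
        simp only [smul_add, psign_smul_psign_smul]
        rw [show i + (j + 1) * k = j * k + (i + k) by ring,
          show i + j + j * (k + 1) = j * k + i + 2 * j by ring,
          show i + j + (k + j * k) = j * k + (i + k + j) by ring, show (2 : ZMod 2) = 0 from rfl]
        simp only [zero_mul, add_zero]
        abel
      exact key _ _ _ _ _ _ _
    exact LinearMap.congr_fun this z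

/-! ### Pairings of complexes -/

/-- A bilinear pairing of complexes with values in a module in degree `0`, compatible with the
differentials: `a (d f) y = (-1)^{deg f + 1} a f (d y)`. -/
structure IsPairing {K : Cx.{u₁} Λ} {D : Cx.{u₂} Λ} {M : Type v} [AddCommGroup M] [Module Λ M]
    (a : K →ₗ[Λ] D →ₗ[Λ] M) : Prop where
  deg : ∀ {n m : ℤ} {f : K} {y : D}, f ∈ K.deg n → y ∈ D.deg m → m ≠ -n → a f y = 0
  comm : ∀ f y, a (K.d f) y = a f (D.d (D.sgn y))

/-- The linear map `w ⊗ f ↦ (x ↦ a f (Ψ (w ⊗ x)))`. -/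
def pairOpPre {W : Cx.{u} Λ} {K : Cx.{u₁} Λ} {C : Cx.{u₂} Λ} {D : Cx.{v₁} Λ} {M : Type v}
    [AddCommGroup M] [Module Λ M] (a : K →ₗ[Λ] D →ₗ[Λ] M) (Ψ : W ⊗[Λ] C →ₗ[Λ] D) :
    W ⊗[Λ] K →ₗ[Λ] C →ₗ[Λ] M :=
  TensorProduct.lift (LinearMap.mk₂ Λ (fun w f => a f ∘ₗ Ψ ∘ₗ TensorProduct.mk Λ _ _ w)
    (fun w w' F => by ext x; simp) (fun c w F => by ext x; simp)
    (fun w F F' => by ext x; simp) (fun c w F => by ext x; simp))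

/-- The operation `w ⊗ f ↦ (x ↦ (-1)^{deg w deg f} a f (Ψ (w ⊗ x)))` given by a pairing `a` and a
map `Ψ : W ⊗ C → D`. -/
def pairOp {W : Cx.{u} Λ} {K : Cx.{u₁} Λ} {C : Cx.{u₂} Λ} {D : Cx.{v₁} Λ} {M : Type v}
    [AddCommGroup M] [Module Λ M] (a : K →ₗ[Λ] D →ₗ[Λ] M) (Ψ : W ⊗[Λ] C →ₗ[Λ] D) :
    W ⊗[Λ] K →ₗ[Λ] C →ₗ[Λ] M :=
  pairOpPre a Ψ ∘ₗ Cx.koszul W K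

/-- The exterior pairing `(f ⊗ g, x ⊗ y) ↦ (-1)^{deg x deg y} a f x ⊗ b g y`. -/
def extPairing {K : Cx.{u₁} Λ} {K' : Cx.{u₂} Λ} {D : Cx.{v₁} Λ} {D' : Cx.{v₂} Λ} {M : Type v}
    {N : Type w} [AddCommGroup M] [Module Λ M] [AddCommGroup N] [Module Λ N]
    (a : K →ₗ[Λ] D →ₗ[Λ] M) (b : K' →ₗ[Λ] D' →ₗ[Λ] N) :
    K ⊗[Λ] K' →ₗ[Λ] D ⊗[Λ] D' →ₗ[Λ] M ⊗[Λ] N :=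
  LinearMap.lcomp Λ _ (Cx.koszul D D') ∘ₗ
    TensorProduct.homTensorHomMap (RingHom.id Λ) _ _ _ _ ∘ₗ TensorProduct.map a b

section Pairing

variable {W : Cx.{u} Λ} {W' : Cx.{u} Λ} {K : Cx.{u₁} Λ} {K' : Cx.{u₂} Λ} {C : Cx.{w₁} Λ}
  {C' : Cx.{w₂} Λ} {D : Cx.{v₁} Λ} {D' : Cx.{v₂} Λ} {M : Type v} {N : Type w}
  [AddCommGroup M] [Module Λ M] [AddCommGroup N] [Module Λ N]
  {a : K →ₗ[Λ] D →ₗ[Λ] M} {b : K' →ₗ[Λ] D' →ₗ[Λ] N}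

lemma extPairing_tmul (f : K) (h : K') (z : D ⊗[Λ] D') :
    extPairing a b (f ⊗ₜ h) z = TensorProduct.map (a f) (b h) (Cx.koszul D D' z) :=
  rfl

lemma extPairing_tmul_tmul {m n : ℤ} (f : K) (h : K') {x : D} {y : D'} (hx : x ∈ D.deg m)
    (hy : y ∈ D'.deg n) :
    extPairing a b (f ⊗ₜ h) (x ⊗ₜ y) = psign (m * n) • a f x ⊗ₜ b h y := by
  rw [extPairing_tmul, Cx.koszul_tmul hx hy, map_zsmul, TensorProduct.map_tmul]

lemma pairOp_tmul {m n : ℤ} (Ψ : W ⊗[Λ] C →ₗ[Λ] D) {x : W} {f : K} (hx : x ∈ W.deg m)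
    (hf : f ∈ K.deg n) (y : C) : pairOp a Ψ (x ⊗ₜ f) y = psign (m * n) • a f (Ψ (x ⊗ₜ y)) := by
  rw [pairOp, LinearMap.comp_apply, Cx.koszul_tmul hx hf, map_zsmul, zsmul_linearMap_apply]
  rfl

lemma IsPairing.comp {K₀ : Cx.{g} Λ} {k : K₀ →ₗ[Λ] K} (ha : IsPairing a) (hk : IsCxHom k) :
    IsPairing (a ∘ₗ k) where
  deg hf hy h := ha.deg (hk.mem hf) hy h
  comm f y := by rw [LinearMap.comp_apply, hk.comm, ha.comm]; rfl

lemma Cx.d_sgn_of_mem {m : ℤ} {y : D} (hy : y ∈ D.deg m) :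
    D.d (D.sgn y) = psign (m : ZMod 2) • D.d y := by
  rw [Cx.sgn_eq_smul hy, map_zsmul]

lemma IsPairing.comm_of_mem (ha : IsPairing a) {m : ℤ} (f : K) {y : D} (hy : y ∈ D.deg m) :
    a (K.d f) y = psign (m : ZMod 2) • a f (D.d y) := by
  rw [ha.comm, Cx.d_sgn_of_mem hy, map_zsmul]

/-- Signs may be computed from the degree of either argument of a pairing. -/
lemma IsPairing.psign_smul (ha : IsPairing a) {n m : ℤ} {f : K} {y : D} (hf : f ∈ K.deg n)
    (hy : y ∈ D.deg m) (c c' : ZMod 2) (h : (m : ZMod 2) = n → c = c') :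
    psign c • a f y = psign c' • a f y := by
  by_cases hmn : m = -n
  · rw [h (by rw [hmn]; push_cast; exact ZMod.neg_eq_self_mod_two _)]
  · rw [ha.deg hf hy hmn]
    exact (smul_zero _).trans (smul_zero _).symm

/-- The two terms of the differential of `f ⊗ h` correspond to those of `x ⊗ y`. The signs of the
second pair agree when `f` and `x` have the same parity; when they have not, the value is zero. -/
lemma IsPairing.ext (ha : IsPairing a) (hb : IsPairing b) : IsPairing (K := K.tensor K')
    (D := D.tensor D') (extPairing a b) where
  deg {n m f y} hf hy h := by
    have h1 : ∀ i j, i + j = n → ∀ k l, k + l = m → ∀ f ∈ K.deg i, ∀ h ∈ K'.deg j, ∀ x ∈ D.deg k,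
        ∀ y ∈ D'.deg l, extPairing a b (f ⊗ₜ h) (x ⊗ₜ y) = 0 := by
      intro i j hij k l hkl f hf h hh x hx y hy
      rw [extPairing_tmul_tmul f h hx hy]
      -- The total degrees are not opposite, so in one of the two factors the degrees are not
      -- opposite either, and that factor of the value is zero.
      by_cases hik : k = -i
      · rw [hb.deg hh hy (by lia), tmul_zero]
        exact smul_zero _
      · rw [ha.deg hf hx hik, zero_tmul]
        exact smul_zero _
    have h2 : (K.tensor K').deg n ≤ LinearMap.ker ((extPairing a b).flip y) := by
      refine Cx.tensorDeg_le _ fun i j hij f hf h hh => ?_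
      rw [LinearMap.mem_ker, LinearMap.flip_apply, ← LinearMap.mem_ker]
      refine Cx.tensorDeg_le _ (fun k l hkl x hx y hy => ?_) hy
      exact h1 i j hij k l hkl f hf h hh x hx y hy
    exact h2 hf
  comm f y := by
    have : extPairing a b ∘ₗ (K.tensor K').d =
        LinearMap.lcomp Λ _ ((D.tensor D').d ∘ₗ (D.tensor D').sgn) ∘ₗ extPairing a b := by
      refine Cx.tensor_hom_ext fun i j f hf h hh => Cx.tensor_hom_ext fun k l x hx y hy => ?_
      have e1 := ha.comm_of_mem f hx
      have e2 := hb.comm_of_mem h hy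
      simp only [LinearMap.comp_apply, LinearMap.lcomp_apply]
      rw [Cx.sgn_eq_smul (K := D.tensor D') (Cx.tmul_mem hx hy), map_zsmul, map_zsmul,
        Cx.tensor_d_tmul _ hf, Cx.tensor_d_tmul _ hx, map_add, map_add, map_zsmul, map_zsmul,
        LinearMap.add_apply, zsmul_linearMap_apply, extPairing_tmul_tmul _ _ hx hy,
        extPairing_tmul_tmul _ _ hx hy, extPairing_tmul_tmul _ _ (D.d_mem hx) hy,
        extPairing_tmul_tmul _ _ hx (D'.d_mem hy), e1, e2, zsmul_tmul_left, tmul_zsmul_right]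
      have e3 : ∀ c c' : ZMod 2, ((k : ZMod 2) = i → c = c') →
          psign c • a f x ⊗ₜ[Λ] b h (D'.d y) = psign c' • a f x ⊗ₜ[Λ] b h (D'.d y) := by
        intro c c' hc
        rw [← zsmul_tmul_left, ha.psign_smul hf hx c c' hc, zsmul_tmul_left]
      push_cast
      rw [smul_add]
      simp only [psign_smul_psign_smul]
      congr 1
      · congr 2; grind
      · exact e3 _ _ fun hki => by grind
    exact LinearMap.congr_fun (LinearMap.congr_fun this f) y

lemma extPairing_map {K₀ : Cx.{g} Λ} {K₀' : Cx.{w₁} Λ} (k : K₀ →ₗ[Λ] K) (k' : K₀' →ₗ[Λ] K')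
    (z : K₀ ⊗[Λ] K₀') :
    extPairing a b (TensorProduct.map k k' z) = extPairing (a ∘ₗ k) (b ∘ₗ k') z := by
  induction z with
  | zero => simp only [map_zero]
  | add z z' hz hz' => simp only [map_add, hz, hz']
  | tmul x y => rfl

/-- The shift `c` is arbitrary because both cases are needed: `c = 0` for chain maps and `c = -1`
for homotopies. -/
lemma pairOp_eq_zero (ha : IsPairing a) (c : ℤ) {Ψ : W ⊗[Λ] C →ₗ[Λ] D}
    (hΨ : ∀ n, ∀ z ∈ (W.tensor C).deg n, Ψ z ∈ D.deg (n + c)) {n m : ℤ} {z : W ⊗[Λ] K} {x : C}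
    (hz : z ∈ (W.tensor K).deg n) (hx : x ∈ C.deg m) (h : m + c ≠ -n) : pairOp a Ψ z x = 0 := by
  have : (W.tensor K).deg n ≤ LinearMap.ker ((pairOp a Ψ).flip x) := by
    refine Cx.tensorDeg_le _ fun i j hij y hy f hf => ?_
    rw [LinearMap.mem_ker, LinearMap.flip_apply, pairOp_tmul Ψ hy hf,
      ha.deg hf (hΨ _ _ (Cx.tmul_mem hy hx)) (by lia)]
    exact smul_zero _
  exact this hz

/-- The value `a f (Ψ (d w ⊗ x))` occurs twice, once from the differential of `w ⊗ f` and once after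
`d f` has been moved across the pairing and through `Ψ`. The two occurrences have opposite signs and
cancel, which leaves the term with `d x`. -/
lemma IsPairing.pairOp (ha : IsPairing a) {Ψ : W ⊗[Λ] C →ₗ[Λ] D}
    (hΨ : IsCxHom (K := W.tensor C) Ψ) : IsPairing (K := W.tensor K) (pairOp a Ψ) where
  deg hf hy h := pairOp_eq_zero ha 0 (fun n z hz => by rw [add_zero]; exact hΨ.mem hz) hf hy
    (by rwa [add_zero])
  comm z x := by
    have : Bredon.pairOp a Ψ ∘ₗ (W.tensor K).d =
        LinearMap.lcomp Λ _ (C.d ∘ₗ C.sgn) ∘ₗ Bredon.pairOp a Ψ := by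
      refine Cx.tensor_hom_ext fun i j w hw f hf => C.hom_ext fun k x hx => ?_
      have hwx : w ⊗ₜ[Λ] x ∈ (W.tensor C).deg (i + k) := Cx.tmul_mem hw hx
      simp only [LinearMap.comp_apply, LinearMap.lcomp_apply]
      rw [Cx.d_sgn_of_mem hx, map_zsmul, Cx.tensor_d_tmul _ hw, map_add, map_zsmul,
        LinearMap.add_apply, zsmul_linearMap_apply, pairOp_tmul _ hw hf, pairOp_tmul _ (W.d_mem hw) hf,
        pairOp_tmul _ hw (K.d_mem hf), ha.comm_of_mem f (hΨ.mem hwx), ← hΨ.comm,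
        Cx.tensor_d_tmul _ hw, map_add, map_zsmul, map_add, map_zsmul]
      have e := fun c c' => ha.psign_smul hf (hΨ.mem (Cx.tmul_mem (W.d_mem hw) hx)) c c'
      have e' := fun c c' => ha.psign_smul hf (hΨ.mem (Cx.tmul_mem hw (C.d_mem hx))) c c'
      push_cast at e e' ⊢
      simp only [smul_add, psign_smul_psign_smul]
      rw [e (i + (i * (j + 1) + (i + k))) ((i + 1) * j + 1) fun h => by grind,
        psign_add ((i + 1) * j) 1, mul_smul, ← add_assoc, psign_one, neg_one_smul, smul_neg,
        add_neg_cancel, zero_add]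
      exact e' _ _ fun h => by grind
    exact LinearMap.congr_fun (LinearMap.congr_fun this z) x

/-- The dual homotopy is the operation of `H` twisted by the degree involution on `K`. The first
summand on the right is its coboundary evaluated at `x`, the second its value on the differential of
`z`. With the twist, the terms in `d (H (w ⊗ x))`, `H (d w ⊗ x)` and `H (w ⊗ d x)` match one by one.
-/
lemma pairOp_homotopy (ha : IsPairing a) {Ψ Ψ' H : W ⊗[Λ] C →ₗ[Λ] D}
    (hdeg : ∀ n, ∀ z ∈ (W.tensor C).deg n, H z ∈ D.deg (n - 1))
    (hH : ∀ z, Ψ z - Ψ' z = D.d (H z) + H ((W.tensor C).d z)) (z : W ⊗[Λ] K) (x : C) :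
    pairOp a Ψ z x - pairOp a Ψ' z x = pairOp a H (TensorProduct.map LinearMap.id K.sgn z) (C.d (C.sgn x)) +
      pairOp a H (TensorProduct.map LinearMap.id K.sgn ((W.tensor K).d z)) x := by
  have : pairOp a Ψ - pairOp a Ψ' =
      LinearMap.lcomp Λ _ (C.d ∘ₗ C.sgn) ∘ₗ pairOp a H ∘ₗ TensorProduct.map LinearMap.id K.sgn +
        pairOp a H ∘ₗ TensorProduct.map LinearMap.id K.sgn ∘ₗ (W.tensor K).d := by
    refine Cx.tensor_hom_ext fun i j w hw f hf => C.hom_ext fun k x hx => ?_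
    have hwx : w ⊗ₜ[Λ] x ∈ (W.tensor C).deg (i + k) := Cx.tmul_mem hw hx
    have e := hH (w ⊗ₜ x)
    simp only [LinearMap.comp_apply, LinearMap.lcomp_apply, LinearMap.sub_apply,
      LinearMap.add_apply]
    rw [Cx.d_sgn_of_mem hx, map_zsmul, Cx.tensor_d_tmul _ hw, map_add, map_zsmul,
      TensorProduct.map_tmul, TensorProduct.map_tmul, TensorProduct.map_tmul, LinearMap.id_apply,
      Cx.sgn_eq_smul hf, Cx.sgn_eq_smul (K.d_mem hf), LinearMap.id_apply, tmul_zsmul_right,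
      tmul_zsmul_right, tmul_zsmul_right, map_add, map_zsmul, map_zsmul, map_zsmul, map_zsmul,
      LinearMap.add_apply]
    simp only [zsmul_linearMap_apply]
    rw [pairOp_tmul _ hw hf, pairOp_tmul _ hw hf, pairOp_tmul _ hw hf, pairOp_tmul _ (W.d_mem hw) hf,
      pairOp_tmul _ hw (K.d_mem hf), ← smul_sub, ← map_sub, e, Cx.tensor_d_tmul _ hw, map_add,
      map_add, map_add, map_zsmul, map_zsmul, ha.comm_of_mem f (hdeg _ _ hwx)]
    have e1 := fun c c' => ha.psign_smul hf (D.d_mem (hdeg _ _ hwx)) c c'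
    have e2 := fun c c' => ha.psign_smul hf (hdeg _ _ (Cx.tmul_mem (W.d_mem hw) hx)) c c'
    have e3 := fun c c' => ha.psign_smul hf (hdeg _ _ (Cx.tmul_mem hw (C.d_mem hx))) c c'
    push_cast at e1 e2 e3 ⊢
    simp only [smul_add, psign_smul_psign_smul]
    rw [e1 _ (j + 1 + (i + (i * (j + 1) + (i + k - 1)))) fun h => by grind,
      e2 _ (j + (i + 1) * j) fun h => by grind, e3 _ (k + (j + i * j)) fun h => by grind]
    abel_nf
  have := LinearMap.congr_fun (LinearMap.congr_fun this z) x
  exact this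

lemma pairOp_map {W₀ : Cx.{u} Λ} {K₀ : Cx.{g} Λ} {r : W₀ →ₗ[Λ] W} {k : K₀ →ₗ[Λ] K}
    (hr : ∀ {n x}, x ∈ W₀.deg n → r x ∈ W.deg n) (hk : ∀ {n x}, x ∈ K₀.deg n → k x ∈ K.deg n)
    (Ψ : W ⊗[Λ] C →ₗ[Λ] D) (z : W₀ ⊗[Λ] K₀) :
    pairOp a Ψ (TensorProduct.map r k z) =
      pairOp (a ∘ₗ k) (Ψ ∘ₗ TensorProduct.map r LinearMap.id) z := by
  have : pairOp a Ψ ∘ₗ TensorProduct.map r k =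
      pairOp (a ∘ₗ k) (Ψ ∘ₗ TensorProduct.map r LinearMap.id) :=
    Cx.tensor_hom_ext fun i j w hw f hf => LinearMap.ext fun x => by
      rw [LinearMap.comp_apply, TensorProduct.map_tmul, pairOp_tmul _ (hr hw) (hk hf),
        pairOp_tmul _ hw hf]
      rfl
  exact LinearMap.congr_fun this z

lemma pairOp_comp_right {C₀ : Cx.{g} Λ} (c : C₀ →ₗ[Λ] C) (Ψ : W ⊗[Λ] C →ₗ[Λ] D) (z : W ⊗[Λ] K)
    (x : C₀) : pairOp a (Ψ ∘ₗ TensorProduct.map LinearMap.id c) z x = pairOp a Ψ z (c x) := by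
  have : pairOp a (Ψ ∘ₗ TensorProduct.map LinearMap.id c) = LinearMap.lcomp Λ _ c ∘ₗ pairOp a Ψ :=
    Cx.tensor_hom_ext fun i j w hw f hf => LinearMap.ext fun x => by
      rw [LinearMap.comp_apply, LinearMap.lcomp_apply, pairOp_tmul _ hw hf, pairOp_tmul _ hw hf]
      rfl
  exact LinearMap.congr_fun (LinearMap.congr_fun this z) x

/-- Equivariance of `Ψ` carries the operator from `W` to `D`, where invariance of the pairing
removes it together with `s`. -/
lemma pairOp_invariant {r : W →ₗ[Λ] W} {s : K →ₗ[Λ] K} {t : D →ₗ[Λ] D}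
    (hr : ∀ {n x}, x ∈ W.deg n → r x ∈ W.deg n) (hs : ∀ {n x}, x ∈ K.deg n → s x ∈ K.deg n)
    (hst : ∀ f y, a (s f) (t y) = a f y) {Ψ : W ⊗[Λ] C →ₗ[Λ] D}
    (hΨ : ∀ z, Ψ (TensorProduct.map r LinearMap.id z) = t (Ψ z)) (z : W ⊗[Λ] K) :
    pairOp a Ψ (TensorProduct.map r s z) = pairOp a Ψ z := by
  rw [pairOp_map hr hs]
  congr 1
  refine Cx.tensor_hom_ext fun i j w hw f hf => LinearMap.ext fun x => ?_
  rw [pairOp_tmul _ hw hf, pairOp_tmul _ hw hf, LinearMap.comp_apply, LinearMap.comp_apply, hΨ, hst]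

/-- On pure tensors both sides are the tensor of the two separate values up to sign. This merges two
operations into one operation for the exterior pairing, as needed for the tensor product of
structure maps. -/
lemma extPairing_pairOp (ha : IsPairing a) (hb : IsPairing b) {Ψ : W ⊗[Λ] C →ₗ[Λ] D}
    {Ψ' : W' ⊗[Λ] C' →ₗ[Λ] D'} (hΨ : IsCxHom (K := W.tensor C) Ψ)
    (hΨ' : IsCxHom (K := W'.tensor C') Ψ') (z : (W ⊗[Λ] W') ⊗[Λ] (K ⊗[Λ] K')) (y : C ⊗[Λ] C') :
    extPairing (K := W.tensor K) (K' := W'.tensor K') (pairOp a Ψ) (pairOp b Ψ')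
        (Cx.interchange W W' K K' z) y =
      pairOp (W := W.tensor W') (K := K.tensor K') (C := C.tensor C') (D := D.tensor D')
        (extPairing a b) (TensorProduct.map Ψ Ψ' ∘ₗ Cx.interchange W W' C C') z y := by
  have : extPairing (K := W.tensor K) (K' := W'.tensor K') (pairOp a Ψ) (pairOp b Ψ') ∘ₗ
        Cx.interchange W W' K K' =
      pairOp (W := W.tensor W') (K := K.tensor K') (C := C.tensor C') (D := D.tensor D')
        (extPairing a b) (TensorProduct.map Ψ Ψ' ∘ₗ Cx.interchange W W' C C') := by
    refine Cx.tensor4_hom_ext fun i j k l w hw w' hw' f hf h hh => ?_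
    refine Cx.tensor_hom_ext fun m n x hx y hy => ?_
    have hwx := hΨ.mem (Cx.tmul_mem hw hx)
    have hwy := hΨ'.mem (Cx.tmul_mem hw' hy)
    rw [LinearMap.comp_apply, Cx.interchange_tmul _ _ hw' hf, map_zsmul, zsmul_linearMap_apply,
      extPairing_tmul_tmul _ _ hx hy, pairOp_tmul _ hw hf, pairOp_tmul _ hw' hh,
      pairOp_tmul _ (Cx.tmul_mem hw hw') (Cx.tmul_mem hf hh), LinearMap.comp_apply,
      Cx.interchange_tmul _ _ hw' hx, map_zsmul, map_zsmul, TensorProduct.map_tmul,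
      extPairing_tmul_tmul _ _ hwx hwy, zsmul_tmul_left, tmul_zsmul_right]
    push_cast
    simp only [psign_smul_psign_smul]
    -- Unless the degrees are opposite in both factors, both sides vanish; if they are, these
    -- equations read modulo 2 turn one exponent into the other.
    by_cases h1 : i + m = -k
    · by_cases h2 : j + n = -l
      · congr 2
        have e1 := congrArg (Int.cast : ℤ → ZMod 2) h1
        have e2 := congrArg (Int.cast : ℤ → ZMod 2) h2
        push_cast at e1 e2
        grind
      · rw [hb.deg hh hwy h2, tmul_zero]
        exact (smul_zero _).trans (smul_zero _).symm
    · rw [ha.deg hf hwx h1, zero_tmul]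
      exact (smul_zero _).trans (smul_zero _).symm
  exact LinearMap.congr_fun (LinearMap.congr_fun this z) y

end Pairing

/-! ### Quadratic forms over the field with two elements -/

section Parity

variable {n : ℕ}

/-- The indicator of `i < j`, as a parity. -/
def ltInd (i j : Fin n) : ZMod 2 := if i < j then 1 else 0

lemma ltInd_self (i : Fin n) : ltInd i i = 0 := if_neg (lt_irrefl i)

lemma ltInd_swap {i j : Fin n} (h : i ≠ j) : ltInd j i = 1 + ltInd i j := by
  rcases lt_or_gt_of_ne h with h | h <;> simp [ltInd, h, h.not_gt]
  rfl

/-- In characteristic two the terms at `(i, j)` and `(j, i)` cancel. Comparisons of Koszul signs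
under permutations are reduced to this. -/
lemma sum_eq_zero_of_symm (S : Fin n → Fin n → ZMod 2) (hS : ∀ i j, S i j = S j i)
    (h0 : ∀ i, S i i = 0) : ∑ i, ∑ j, S i j = 0 := by
  rw [← Finset.sum_product']
  refine Finset.sum_involution (fun a _ => (a.2, a.1)) ?_ ?_ ?_ ?_
  · rintro ⟨i, j⟩ _
    dsimp only
    rw [hS i j]
    exact CharTwo.add_self_eq_zero _
  · rintro ⟨i, j⟩ _ hne h
    simp only [Prod.mk.injEq] at h
    obtain ⟨rfl, -⟩ := h
    exact hne (h0 _)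
  · simp
  · simp

lemma sum_perm (σ : Equiv.Perm (Fin n)) (S : Fin n → Fin n → ZMod 2) :
    ∑ i, ∑ j, S i j = ∑ i, ∑ j, S (σ i) (σ j) := by
  rw [← Equiv.sum_comp σ]
  exact Finset.sum_congr rfl fun i _ => (Equiv.sum_comp σ _).symm

/-- The signs `pairSign`, `shuffleSign` and `permSign` are all products of this shape; as values of
`psign` on bilinear forms they can be compared by computing exponents in the field with two
elements. -/
lemma prod_ite_neg_one (R : Fin n → Fin n → Prop) [∀ i j, Decidable (R i j)] (s t : Fin n → ZMod 2) :
    (∏ i, ∏ j, if R i j then (-1 : ℤ) ^ ((s i).val * (t j).val) else 1) =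
      psign (∑ i, ∑ j, (if R i j then 1 else 0) * (s i * t j)) := by
  rw [psign_sum]
  refine Finset.prod_congr rfl fun i _ => ?_
  rw [psign_sum]
  refine Finset.prod_congr rfl fun j _ => ?_
  split_ifs
  · rw [pow_val_mul, one_mul]
  · rw [zero_mul, psign_zero]

lemma Cx.pairSign_eq (s : Fin n → ZMod 2) :
    Cx.pairSign s = psign (∑ i, ∑ j, ltInd i j * (s i * s j)) :=
  prod_ite_neg_one _ s s

lemma Cx.shuffleSign_eq (s t : Fin n → ZMod 2) :
    Cx.shuffleSign s t = psign (∑ i, ∑ j, ltInd j i * (s i * t j)) :=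
  prod_ite_neg_one _ s t

lemma Cx.permSign_eq (σ : Equiv.Perm (Fin n)) (s : Fin n → ZMod 2) :
    Cx.permSign σ s = psign (∑ i, ∑ j, ltInd i j * ltInd (σ j) (σ i) * (s i * s j)) := by
  refine (prod_ite_neg_one _ s s).trans ?_
  congr 1
  refine Finset.sum_congr rfl fun i _ => Finset.sum_congr rfl fun j _ => ?_
  simp only [ltInd]
  split_ifs <;> simp_all

/-- Applying a differential in position `i` raises the parity there by one. This and the lemmas on
updated bilinear and quadratic forms record how the exponent of a sign changes. -/
lemma sum_update (c s : Fin n → ZMod 2) (i : Fin n) :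
    ∑ j, c j * Function.update s i (s i + 1) j = ∑ j, c j * s j + c i := by
  rw [← sub_eq_iff_eq_add', ← Finset.sum_sub_distrib, Finset.sum_eq_single i]
  · simp; ring
  · intro j _ hj
    simp [hj]
  · simp

/-- For `j ≠ i` exactly one of `i < j` and `j < i` holds, so the coefficient is 1 off `i` and 0 at
`i`. -/
lemma sum_eq_add_sum_ltInd (s : Fin n → ZMod 2) (i : Fin n) :
    ∑ j, s j = s i + ∑ j, (ltInd i j + ltInd j i) * s j := by
  rw [← Finset.add_sum_erase _ _ (Finset.mem_univ i), ← Finset.add_sum_erase _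
    (fun j => (ltInd i j + ltInd j i) * s j) (Finset.mem_univ i), ltInd_self, add_zero, zero_mul,
    zero_add]
  congr 1
  refine Finset.sum_congr rfl fun j hj => ?_
  rw [ltInd_swap (Finset.ne_of_mem_erase hj)]
  grind

lemma sum_mul_sum_eq (s t : Fin n → ZMod 2) :
    (∑ i, s i) * ∑ j, t j = ∑ i, s i * t i + ∑ i, ∑ j, (ltInd i j + ltInd j i) * (s i * t j) := by
  rw [Finset.sum_mul, ← Finset.sum_add_distrib]
  refine Finset.sum_congr rfl fun i _ => ?_
  rw [sum_eq_add_sum_ltInd t i, mul_add, Finset.mul_sum]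
  congr 1
  exact Finset.sum_congr rfl fun j _ => by ring

lemma bilin_update_left (c : Fin n → Fin n → ZMod 2) (s t : Fin n → ZMod 2) (i : Fin n) :
    ∑ a, ∑ b, c a b * (Function.update s i (s i + 1) a * t b) =
      ∑ a, ∑ b, c a b * (s a * t b) + ∑ b, c i b * t b := by
  have := sum_update (fun a => ∑ b, c a b * t b) s i
  simp only [Finset.sum_mul] at this
  simpa only [mul_assoc, mul_comm (t _)] using this

lemma bilin_update_right (c : Fin n → Fin n → ZMod 2) (s t : Fin n → ZMod 2) (i : Fin n) :
    ∑ a, ∑ b, c a b * (s a * Function.update t i (t i + 1) b) =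
      ∑ a, ∑ b, c a b * (s a * t b) + ∑ a, c a i * s a := by
  rw [Finset.sum_comm, Finset.sum_comm (f := fun a b => c a b * (s a * t b))]
  have := bilin_update_left (fun a b => c b a) t s i
  simpa only [mul_comm (s _)] using this

/-- The only term quadratic in the change has coefficient `c i i`, which vanishes by `hc`; the
change is therefore linear in the old parities. -/
lemma quad_update (c : Fin n → Fin n → ZMod 2) (s : Fin n → ZMod 2) (i : Fin n) (hc : c i i = 0) :
    ∑ a, ∑ b, c a b * (Function.update s i (s i + 1) a * Function.update s i (s i + 1) b) =
      ∑ a, ∑ b, c a b * (s a * s b) + ∑ b, (c i b + c b i) * s b := by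
  rw [bilin_update_left, bilin_update_right, sum_update, hc, add_zero, add_assoc,
    ← Finset.sum_add_distrib]
  congr 1
  exact Finset.sum_congr rfl fun b _ => by ring

end Parity

lemma zsmul_sum {X : Type*} [AddCommGroup X] {ι : Type*} (c : ℤ) (S : Finset ι) (f : ι → X) :
    c • ∑ i ∈ S, f i = ∑ i ∈ S, c • f i :=
  Finset.smul_sum

namespace Cx

/-! ### Tensor products of finite families on homogeneous elements -/

section PiTensor

variable {n : ℕ} {K : Fin n → Cx.{v} Λ}

lemma tprod_mem_of_span {M : Fin n → Type v} [∀ i, AddCommGroup (M i)] [∀ i, Module Λ (M i)]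
    (S : ∀ i, Set (M i)) (P : Submodule Λ (⨂[Λ] i, M i))
    (h : ∀ x : ∀ i, M i, (∀ i, x i ∈ S i) → PiTensorProduct.tprod Λ x ∈ P) (x : ∀ i, M i)
    (hx : ∀ i, x i ∈ Submodule.span Λ (S i)) : PiTensorProduct.tprod Λ x ∈ P := by
  -- Induction on the set of positions whose entries are not yet known to be generators; each step
  -- expands one entry by multilinearity.
  have key : ∀ (s : Finset (Fin n)) (x : ∀ i, M i), (∀ i, x i ∈ Submodule.span Λ (S i)) →
      (∀ i, i ∉ s → x i ∈ S i) → PiTensorProduct.tprod Λ x ∈ P := by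
    intro s
    induction s using Finset.induction_on with
    | empty => exact fun x _ hx => h x fun i => hx i (Finset.notMem_empty i)
    | insert i s hi ih =>
      intro x hx hx'
      suffices hP : ∀ y ∈ Submodule.span Λ (S i),
          PiTensorProduct.tprod Λ (Function.update x i y) ∈ P by
        simpa using hP (x i) (hx i)
      intro y hy
      induction hy using Submodule.span_induction with
      | mem y hy =>
        refine ih _ (fun j => ?_) fun j hj => ?_
        · by_cases hji : j = i
          · subst hji; simpa using Submodule.subset_span hy
          · simpa [hji] using hx j
        · by_cases hji : j = i
          · subst hji; simpa using hy
          · simpa [hji] using hx' j (by simp [hji, hj])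
      | zero => rw [MultilinearMap.map_update_zero]; exact zero_mem _
      | add y y' _ _ hy hy' => rw [MultilinearMap.map_update_add]; exact add_mem hy hy'
      | smul r y _ hy => rw [MultilinearMap.map_update_smul]; exact P.smul_mem r hy
  exact key Finset.univ x hx (by simp)

lemma tprod_mem {e : Fin n → ℤ} {x : ∀ i, K i} (hx : ∀ i, x i ∈ (K i).deg (e i)) :
    PiTensorProduct.tprod Λ x ∈ (piTensor K).deg (∑ i, e i) :=
  Submodule.subset_span ⟨e, rfl, x, hx, rfl⟩

lemma piDeg_le {m : ℤ} (P : Submodule Λ (⨂[Λ] i, K i))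
    (h : ∀ e : Fin n → ℤ, ∑ i, e i = m → ∀ x : ∀ i, K i, (∀ i, x i ∈ (K i).deg (e i)) →
      PiTensorProduct.tprod Λ x ∈ P) : (piTensor K).deg m ≤ P := by
  refine Submodule.span_le.2 ?_
  rintro _ ⟨e, he, x, hx, rfl⟩
  exact h e he x hx

lemma pi_hom_ext {N : Type*} [AddCommGroup N] [Module Λ N] {f f' : (⨂[Λ] i, K i) →ₗ[Λ] N}
    (h : ∀ (e : Fin n → ℤ) (x : ∀ i, K i), (∀ i, x i ∈ (K i).deg (e i)) →
      f (PiTensorProduct.tprod Λ x) = f' (PiTensorProduct.tprod Λ x)) : f = f' :=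
  LinearMap.ext fun z => piTensor_span K (LinearMap.eqLocus f f') h z

lemma twist_tprod_of_mem (c : (Fin n → ZMod 2) → ℤ) {e : Fin n → ℤ} {x : ∀ i, K i}
    (hx : ∀ i, x i ∈ (K i).deg (e i)) :
    twist K c (PiTensorProduct.tprod Λ x) = c (fun i => e i) • PiTensorProduct.tprod Λ x := by
  rw [twist_tprod, Finset.sum_eq_single (fun i => (e i : ZMod 2))]
  · simp only [par_of_mem _ (hx _), if_pos]
  · intro s _ hs
    obtain ⟨i, hi⟩ := Function.ne_iff.1 hs
    rw [MultilinearMap.map_coord_zero _ i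
      (by rw [par_of_mem _ (hx i), if_neg (Ne.symm hi)])]
    exact zsmul_zero _
  · simp

lemma tprod_update_zsmul {M : Fin n → Type v} [∀ i, AddCommGroup (M i)] [∀ i, Module Λ (M i)]
    (x : ∀ i, M i) (i : Fin n) (c : ℤ) (y : M i) :
    PiTensorProduct.tprod Λ (Function.update x i (c • y)) =
      c • PiTensorProduct.tprod Λ (Function.update x i y) :=
  map_zsmul ((PiTensorProduct.tprod Λ).toLinearMap x i) c y

lemma tprod_zsmul {M : Fin n → Type v} [∀ i, AddCommGroup (M i)] [∀ i, Module Λ (M i)]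
    (c : Fin n → ℤ) (x : ∀ i, M i) :
    PiTensorProduct.tprod Λ (fun i => c i • x i) = (∏ i, c i) • PiTensorProduct.tprod Λ x := by
  have := (PiTensorProduct.tprod Λ (s := M)).map_smul_univ (fun i => (c i : Λ)) x
  simp only [← Int.cast_smul_eq_zsmul Λ, Int.cast_prod]
  exact this

lemma piD_tprod {e : Fin n → ℤ} {x : ∀ i, K i} (hx : ∀ i, x i ∈ (K i).deg (e i)) (i : Fin n) :
    piD K i (PiTensorProduct.tprod Λ x) = psign (∑ j, ltInd j i * (e j : ZMod 2)) •
      PiTensorProduct.tprod Λ (Function.update x i ((K i).d (x i))) := by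
  rw [piD, PiTensorProduct.map_tprod, psign_sum, ← tprod_zsmul]
  congr 1
  funext j
  rcases lt_trichotomy j i with h | h | h
  · simp [h, ltInd, h.ne, sgn_eq_smul (hx j)]
  · subst h
    simp [ltInd, psign_zero]
  · simp [h.not_gt, ltInd, h.ne', psign_zero]

lemma pi_d_tprod {e : Fin n → ℤ} {x : ∀ i, K i} (hx : ∀ i, x i ∈ (K i).deg (e i)) :
    (piTensor K).d (PiTensorProduct.tprod Λ x) = ∑ i, psign (∑ j, ltInd j i * (e j : ZMod 2)) •
      PiTensorProduct.tprod Λ (Function.update x i ((K i).d (x i))) := by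
  refine (LinearMap.sum_apply _ _ _).trans ?_
  exact Finset.sum_congr rfl fun i _ => piD_tprod hx i

lemma update_d_mem {e : Fin n → ℤ} {x : ∀ i, K i} (hx : ∀ i, x i ∈ (K i).deg (e i)) (i : Fin n)
    (j : Fin n) : Function.update x i ((K i).d (x i)) j ∈
      (K j).deg (Function.update e i (e i + 1) j) := by
  by_cases h : j = i
  · subst h
    simpa using (K j).d_mem (hx j)
  · simpa [h] using hx j

lemma cast_update (e : Fin n → ℤ) (i : Fin n) :
    (fun j => ((Function.update e i (e i + 1) j : ℤ) : ZMod 2)) =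
      Function.update (fun j => (e j : ZMod 2)) i ((e i : ZMod 2) + 1) := by
  funext j
  by_cases h : j = i
  · subst h; simp
  · simp [h]

lemma perm_tprod (σ : Equiv.Perm (Fin n)) {e : Fin n → ℤ} {x : ∀ i, K i}
    (hx : ∀ i, x i ∈ (K i).deg (e i)) :
    perm σ K (PiTensorProduct.tprod Λ x) = permSign σ (fun i => e i) •
      PiTensorProduct.tprod Λ fun i => x (σ.symm i) := by
  rw [perm, LinearMap.comp_apply, twist_tprod_of_mem _ hx, map_zsmul]
  exact congrArg _ (PiTensorProduct.reindex_tprod σ x)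

lemma perm_map (σ : Equiv.Perm (Fin n)) {K' : Fin n → Cx.{v} Λ} {h : ∀ i, K i →ₗ[Λ] K' i}
    (hh : ∀ i {m x}, x ∈ (K i).deg m → h i x ∈ (K' i).deg m) (z : ⨂[Λ] i, K i) :
    perm σ K' (PiTensorProduct.map h z) =
      PiTensorProduct.map (fun i => h (σ.symm i)) (perm σ K z) := by
  rw [perm, perm, LinearMap.comp_apply, LinearMap.comp_apply, twist_map _ hh]
  exact (PiTensorProduct.map_reindex h σ _).symm

end PiTensor

end Cx

lemma IsCxHom.piMap {n : ℕ} {K : Fin n → Cx.{v} Λ} {K' : Fin n → Cx.{w} Λ}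
    {f : ∀ i, K i →ₗ[Λ] K' i} (hf : ∀ i, IsCxHom (f i)) :
    IsCxHom (K := Cx.piTensor K) (L := Cx.piTensor K') (PiTensorProduct.map f) where
  mem {m z} hz := by
    refine Cx.piDeg_le (((Cx.piTensor K').deg m).comap (PiTensorProduct.map f)) ?_ hz
    rintro e rfl x hx
    rw [Submodule.mem_comap, PiTensorProduct.map_tprod]
    exact Cx.tprod_mem fun i => (hf i).mem (hx i)
  comm z := by
    have : PiTensorProduct.map f ∘ₗ (Cx.piTensor K).d =
        (Cx.piTensor K').d ∘ₗ PiTensorProduct.map f := Cx.pi_hom_ext fun e x hx => by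
      rw [LinearMap.comp_apply, LinearMap.comp_apply, Cx.pi_d_tprod hx, PiTensorProduct.map_tprod,
        Cx.pi_d_tprod fun i => (hf i).mem (hx i), map_sum]
      refine Finset.sum_congr rfl fun i _ => ?_
      rw [map_zsmul, PiTensorProduct.map_tprod]
      congr 2
      funext j
      by_cases h : j = i
      · subst h; simp [(hf j).comm]
      · simp [h]
    exact LinearMap.congr_fun this z

/-- After reindexing by `σ`, corresponding summands differentiate the same factor. The change of the
permutation sign when the parity of that factor goes up accounts for the factors that the
differential has to pass before the permutation but not after it, or conversely. -/
lemma isCxHom_perm {n : ℕ} (σ : Equiv.Perm (Fin n)) (K : Fin n → Cx.{v} Λ) :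
    IsCxHom (Cx.perm σ K) where
  mem {m z} hz := by
    refine Cx.piDeg_le (((Cx.piTensor fun i => K (σ.symm i)).deg m).comap (Cx.perm σ K)) ?_ hz
    rintro e rfl x hx
    rw [Submodule.mem_comap, Cx.perm_tprod σ hx, ← Equiv.sum_comp σ.symm]
    exact zsmul_mem (Cx.tprod_mem (K := fun i => K (σ.symm i)) (e := fun i => e (σ.symm i))
      fun i => hx _) _
  comm z := by
    have : Cx.perm σ K ∘ₗ (Cx.piTensor K).d =
        (Cx.piTensor fun i => K (σ.symm i)).d ∘ₗ Cx.perm σ K := Cx.pi_hom_ext fun e x hx => by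
      rw [LinearMap.comp_apply, LinearMap.comp_apply, Cx.pi_d_tprod hx, Cx.perm_tprod σ hx,
        map_zsmul, Cx.pi_d_tprod (K := fun i => K (σ.symm i)) (e := fun i => e (σ.symm i))
        (fun i => hx _), map_sum]
      refine Eq.trans ?_ (zsmul_sum _ _ _).symm
      rw [← Equiv.sum_comp σ.symm]
      refine Finset.sum_congr rfl fun i _ => ?_
      rw [map_zsmul, Cx.perm_tprod σ (Cx.update_d_mem hx _), Cx.cast_update, Cx.permSign_eq,
        Cx.permSign_eq, quad_update, psign_smul_psign_smul]
      · refine Eq.trans ?_ (psign_smul_psign_smul _ _ _).symm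
        congr 1
        · congr 1
          rw [add_left_comm]
          congr 1
          rw [← Equiv.sum_comp σ (fun j => ltInd j i * ((e (σ.symm j) : ℤ) : ZMod 2)),
            ← Finset.sum_add_distrib]
          refine Finset.sum_congr rfl fun j _ => ?_
          obtain ⟨k, rfl⟩ := σ.surjective i
          rw [Equiv.symm_apply_apply, Equiv.symm_apply_apply]
          by_cases h : j = k
          · subst h
            simp [ltInd_self]
          · rw [ltInd_swap h, ltInd_swap (fun h' => h (σ.injective h') : σ j ≠ σ k)]
            grind
        · congr 1
          funext k
          by_cases h : k = i
          · subst h; simp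
          · have h' : σ.symm k ≠ σ.symm i := fun h' => h (σ.symm.injective h')
            simp [h, h']
      · rw [ltInd_self, zero_mul]
    exact LinearMap.congr_fun this z

namespace Cx

/-! ### Permutations and shuffles of tensor powers -/

section Shuffle

variable {n : ℕ} {K : Cx.{u₁} Λ} {L : Cx.{u₂} Λ}

lemma perm_one (K : Cx.{v} Λ) (z : K.pow n) : perm 1 (fun _ => K) z = z := by
  have : perm 1 (fun _ : Fin n => K) = LinearMap.id := pi_hom_ext fun e x hx => by
    rw [perm_tprod _ hx, permSign_eq, Finset.sum_eq_zero, psign_zero]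
    · exact one_zsmul _
    · intro i _
      refine Finset.sum_eq_zero fun j _ => ?_
      rcases lt_trichotomy i j with h | h | h <;> simp [ltInd, h, h.not_gt]
  exact LinearMap.congr_fun this z

/-- A pair of factors that `τ` and then `σ` bring out of order is back in order for the product.
Hence the three exponents add up to a form that is symmetric in the two indices and zero on the
diagonal. -/
lemma perm_mul (σ τ : Equiv.Perm (Fin n)) (K : Cx.{v} Λ) (z : K.pow n) :
    perm (σ * τ) (fun _ => K) z = perm σ (fun _ => K) (perm τ (fun _ => K) z) := by
  have : perm (σ * τ) (fun _ : Fin n => K) = perm σ (fun _ => K) ∘ₗ perm τ (fun _ => K) :=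
    pi_hom_ext fun e x hx => by
      rw [LinearMap.comp_apply, perm_tprod _ hx, perm_tprod _ hx, map_zsmul,
        perm_tprod σ (K := fun _ => K) (e := fun i => e (τ.symm i)) (fun i => hx _),
        permSign_eq, permSign_eq, permSign_eq]
      refine Eq.trans ?_ (psign_smul_psign_smul _ _ _).symm
      congr 1
      congr 1
      rw [sum_perm τ fun i j => ltInd i j * ltInd (σ j) (σ i) * _, ← CharTwo.add_eq_zero,
        ← Finset.sum_add_distrib, ← Finset.sum_add_distrib]
      simp only [← Finset.sum_add_distrib, Equiv.symm_apply_apply, Equiv.Perm.mul_apply]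
      refine sum_eq_zero_of_symm _ (fun i j => ?_) fun i => ?_
      · by_cases h : i = j
        · rw [h]
        · rw [ltInd_swap h, ltInd_swap (fun h' => h (τ.injective h') : τ i ≠ τ j),
            ltInd_swap (fun h' => h (τ.injective (σ.injective h')) : σ (τ i) ≠ σ (τ j))]
          grind
      · simp [ltInd_self]
  exact LinearMap.congr_fun this z

lemma pow_tensor_hom_ext {N : Type*} [AddCommGroup N] [Module Λ N]
    {f f' : (⨂[Λ] _ : Fin n, K ⊗[Λ] L) →ₗ[Λ] N}
    (h : ∀ (a b : Fin n → ℤ) (x : Fin n → K) (y : Fin n → L), (∀ i, x i ∈ K.deg (a i)) →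
      (∀ i, y i ∈ L.deg (b i)) → f (PiTensorProduct.tprod Λ fun i => x i ⊗ₜ y i) =
        f' (PiTensorProduct.tprod Λ fun i => x i ⊗ₜ y i)) : f = f' := by
  refine PiTensorProduct.ext (MultilinearMap.ext fun z => ?_)
  refine tprod_mem_of_span (fun _ => {z | ∃ a b, ∃ x ∈ K.deg a, ∃ y ∈ L.deg b, z = x ⊗ₜ[Λ] y})
    (LinearMap.eqLocus f f') (fun z hz => ?_) z fun i => ?_
  · choose a b x hx y hy hz using hz
    rw [funext hz]
    exact h a b x y hx hy
  · refine tensor_span K L _ (fun a b x hx y hy => Submodule.subset_span ?_) (z i)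
    exact ⟨a, b, x, hx, y, hy, rfl⟩

lemma shuffle_tprod {a b : Fin n → ℤ} {x : Fin n → K} {y : Fin n → L}
    (hx : ∀ i, x i ∈ K.deg (a i)) (hy : ∀ i, y i ∈ L.deg (b i)) :
    shuffle n K L (PiTensorProduct.tprod Λ fun i => x i ⊗ₜ y i) =
      shuffleSign (fun i => a i) (fun i => b i) •
        PiTensorProduct.tprod Λ x ⊗ₜ PiTensorProduct.tprod Λ y := by
  rw [shuffle, LinearMap.comp_apply, unshuffle_tprod, LinearMap.sum_apply,
    Finset.sum_eq_single (fun i => (a i : ZMod 2)), LinearMap.sum_apply,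
    Finset.sum_eq_single (fun i => (b i : ZMod 2)), zsmul_linearMap_apply, TensorProduct.map_tmul,
    PiTensorProduct.map_tprod, PiTensorProduct.map_tprod]
  · simp only [par_of_mem K (hx _), par_of_mem L (hy _), if_pos]
  · intro t _ ht
    obtain ⟨i, hi⟩ := Function.ne_iff.1 ht
    rw [zsmul_linearMap_apply, TensorProduct.map_tmul, PiTensorProduct.map_tprod,
      PiTensorProduct.map_tprod, MultilinearMap.map_coord_zero
      (PiTensorProduct.tprod Λ (s := fun _ : Fin n => L.carrier)) i
      (by rw [par_of_mem _ (hy i), if_neg (Ne.symm hi)]), tmul_zero]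
    exact zsmul_zero _
  · exact fun h => absurd (Finset.mem_univ _) h
  · intro s _ hs
    obtain ⟨i, hi⟩ := Function.ne_iff.1 hs
    rw [LinearMap.sum_apply]
    refine Finset.sum_eq_zero fun t _ => ?_
    rw [zsmul_linearMap_apply, TensorProduct.map_tmul, PiTensorProduct.map_tprod,
      PiTensorProduct.map_tprod, MultilinearMap.map_coord_zero
      (PiTensorProduct.tprod Λ (s := fun _ : Fin n => K.carrier)) i
      (by rw [par_of_mem _ (hx i), if_neg (Ne.symm hi)]), zero_tmul]
    exact zsmul_zero _
  · exact fun h => absurd (Finset.mem_univ _) h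

lemma shuffle_map {K' : Cx.{v₁} Λ} {L' : Cx.{v₂} Λ} {f : K →ₗ[Λ] K'} {f' : L →ₗ[Λ] L'}
    (hf : ∀ {m x}, x ∈ K.deg m → f x ∈ K'.deg m) (hf' : ∀ {m x}, x ∈ L.deg m → f' x ∈ L'.deg m)
    (z : ⨂[Λ] _ : Fin n, K ⊗[Λ] L) :
    shuffle n K' L' (PiTensorProduct.map (fun _ => TensorProduct.map f f') z) =
      TensorProduct.map (PiTensorProduct.map fun _ => f) (PiTensorProduct.map fun _ => f')
        (shuffle n K L z) := by
  have : shuffle n K' L' ∘ₗ PiTensorProduct.map (fun _ => TensorProduct.map f f') =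
      TensorProduct.map (PiTensorProduct.map fun _ => f) (PiTensorProduct.map fun _ => f') ∘ₗ
        shuffle n K L := pow_tensor_hom_ext fun a b x y hx hy => by
    rw [LinearMap.comp_apply, LinearMap.comp_apply, shuffle_tprod hx hy, map_zsmul,
      PiTensorProduct.map_tprod, TensorProduct.map_tmul, PiTensorProduct.map_tprod,
      PiTensorProduct.map_tprod]
    exact shuffle_tprod (fun i => hf (hx i)) fun i => hf' (hy i)
  exact LinearMap.congr_fun this z

/-- The permutation sign of the products `x i ⊗ y i` expands into those of the `x i` and of the `y
i`, which cancel, and mixed terms. The mixed terms and the two shuffle signs add up to a symmetric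
form. -/
lemma shuffle_perm (σ : Equiv.Perm (Fin n)) (z : (K.tensor L).pow n) :
    shuffle n K L (perm σ (fun _ => K.tensor L) z) =
      TensorProduct.map (perm σ fun _ => K) (perm σ fun _ => L) (shuffle n K L z) := by
  have : shuffle n K L ∘ₗ perm σ (fun _ => K.tensor L) =
      TensorProduct.map (perm σ fun _ => K) (perm σ fun _ => L) ∘ₗ shuffle n K L :=
    pow_tensor_hom_ext fun a b x y hx hy => by
      rw [LinearMap.comp_apply, LinearMap.comp_apply, perm_tprod σ (K := fun _ => K.tensor L)
        (e := fun i => a i + b i) (fun i => tmul_mem (hx i) (hy i)), map_zsmul,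
        shuffle_tprod hx hy, map_zsmul, shuffle_tprod (a := fun i => a (σ.symm i))
        (b := fun i => b (σ.symm i)) (fun i => hx _) (fun i => hy _), TensorProduct.map_tmul,
        perm_tprod σ hx, perm_tprod σ hy, zsmul_tmul_left, tmul_zsmul_right, shuffleSign_eq,
        shuffleSign_eq, permSign_eq, permSign_eq, permSign_eq]
      refine (psign_smul_psign_smul _ _ _).trans ?_
      refine Eq.trans ?_ (congrArg _ (psign_smul_psign_smul _ _ _).symm)
      refine Eq.trans ?_ (psign_smul_psign_smul _ _ _).symm
      congr 1
      congr 1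
      rw [sum_perm σ fun i j => ltInd j i * _, ← CharTwo.add_eq_zero]
      simp only [← Finset.sum_add_distrib, Equiv.symm_apply_apply]
      push_cast
      refine (Finset.sum_congr rfl fun i _ => Finset.sum_congr rfl fun j _ => ?_ :
        _ = ∑ i, ∑ j, ((ltInd i j * ltInd (σ j) (σ i) + ltInd (σ j) (σ i) + ltInd j i) *
          ((a i : ZMod 2) * b j) + ltInd i j * ltInd (σ j) (σ i) * ((a j : ZMod 2) * b i))).trans
        (sum_eq_zero_of_symm _ (fun i j => ?_) fun i => ?_)
      · grind
      · by_cases h : i = j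
        · rw [h]
        · rw [ltInd_swap h, ltInd_swap (fun h' => h (σ.injective h') : σ i ≠ σ j)]
          grind
      · simp [ltInd_self]
  exact LinearMap.congr_fun this z

lemma pi_tensor_d {a b : Fin n → ℤ} {x : Fin n → K} {y : Fin n → L}
    (hx : ∀ i, x i ∈ K.deg (a i)) (hy : ∀ i, y i ∈ L.deg (b i)) :
    ((K.tensor L).pow n).d (PiTensorProduct.tprod Λ fun i => x i ⊗ₜ y i) =
      ∑ i, psign (∑ j, ltInd j i * ((a j : ZMod 2) + b j)) •
        ((PiTensorProduct.tprod Λ fun j => Function.update x i (K.d (x i)) j ⊗ₜ[Λ] y j) +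
          psign (a i : ZMod 2) •
            PiTensorProduct.tprod Λ fun j => x j ⊗ₜ[Λ] Function.update y i (L.d (y i)) j) := by
  rw [pi_d_tprod (K := fun _ => K.tensor L) (e := fun i => a i + b i)
    (fun i => tmul_mem (hx i) (hy i))]
  refine Finset.sum_congr rfl fun i _ => ?_
  push_cast
  congr 1
  rw [tensor_d_tmul _ (hx i), MultilinearMap.map_update_add, tprod_update_zsmul]
  congr 1
  · congr 1
    funext j
    by_cases h : j = i
    · subst h; simp
    · simp [h]
  · congr 2
    funext j
    by_cases h : j = i
    · subst h; simp
    · simp [h]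

end Shuffle

end Cx

lemma isCxHom_shuffle (n : ℕ) (K : Cx.{u₁} Λ) (L : Cx.{u₂} Λ) :
    IsCxHom (Cx.shuffle n K L) where
  mem {m z} hz := by
    let P : Submodule Λ (⨂[Λ] _ : Fin n, K ⊗[Λ] L) :=
      (((K.pow n).tensor (L.pow n)).deg m).comap (Cx.shuffle n K L)
    refine Cx.piDeg_le (K := fun _ => K.tensor L) P ?_ hz
    rintro e rfl z hz
    refine Cx.tprod_mem_of_span (fun i => {z | ∃ a b, a + b = e i ∧ ∃ x ∈ K.deg a, ∃ y ∈ L.deg b,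
      z = x ⊗ₜ[Λ] y}) P (fun z hz => ?_) z fun i => ?_
    · choose a b hab x hx y hy hz using hz
      rw [funext hz, Submodule.mem_comap, Cx.shuffle_tprod hx hy, ← funext hab,
        Finset.sum_add_distrib]
      exact zsmul_mem (Cx.tmul_mem (Cx.tprod_mem hx) (Cx.tprod_mem hy)) _
    · refine Cx.tensorDeg_le (K := K) (L := L) _ (fun a b hab x hx y hy => ?_) (hz i)
      exact Submodule.subset_span ⟨a, b, hab, x, hx, y, hy, rfl⟩
  comm z := by
    have : Cx.shuffle n K L ∘ₗ ((K.tensor L).pow n).d =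
        ((K.pow n).tensor (L.pow n)).d ∘ₗ Cx.shuffle n K L :=
      Cx.pow_tensor_hom_ext fun a b x y hx hy => by
        rw [LinearMap.comp_apply, LinearMap.comp_apply, Cx.pi_tensor_d hx hy,
          Cx.shuffle_tprod hx hy, map_zsmul, map_sum,
          Cx.tensor_d_tmul (K := K.pow n) (L := L.pow n) _ (Cx.tprod_mem hx), Cx.pi_d_tprod hx,
          Cx.pi_d_tprod hy, TensorProduct.sum_tmul, TensorProduct.tmul_sum, zsmul_sum]
        simp only [map_zsmul, map_add]
        refine Eq.trans ?_ (congrArg _ Finset.sum_add_distrib)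
        refine Eq.trans ?_ (zsmul_sum _ _ _).symm
        refine Finset.sum_congr rfl fun i _ => ?_
        rw [Cx.shuffle_tprod (Cx.update_d_mem (K := fun _ => K) hx i) hy,
          Cx.shuffle_tprod hx (Cx.update_d_mem (K := fun _ => L) hy i), Cx.cast_update,
          Cx.cast_update, Cx.shuffleSign_eq, Cx.shuffleSign_eq, Cx.shuffleSign_eq,
          bilin_update_left, bilin_update_right, zsmul_tmul_left, tmul_zsmul_right]
        push_cast
        -- Here `q` is the exponent of the shuffle sign, `A` and `B` are the parities of the `x j`
        -- and of the `y j` standing before position `i`, `C` that of the `x j` after it, `c` the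
        -- parity of `x i`, and `S` the total parity of the `x j`.
        have key : ∀ {X : Type (max u₁ u₂)} [AddCommGroup X] (s q A B C S c : ZMod 2) (t t' : X),
            s = A + B → S = A + c + C →
            psign s • (psign (q + B) • t + psign c • psign (q + C) • t') =
              psign q • (psign A • t + psign S • psign B • t') := by
          rintro X _ s q A B C S c t t' rfl rfl
          simp only [smul_add, psign_smul_psign_smul]
          congr 2
          · congr 1; grind
          · congr 1; grind
        refine key _ _ _ _ _ _ _ _ _ ?_ ?_
        · rw [← Finset.sum_add_distrib]
          exact Finset.sum_congr rfl fun j _ => mul_add _ _ _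
        · rw [sum_eq_add_sum_ltInd _ i, add_comm _ (a i : ZMod 2), add_assoc, ← Finset.sum_add_distrib]
          congr 1
          exact Finset.sum_congr rfl fun j _ => by ring
    exact LinearMap.congr_fun this z

/-! ### Powers of pairings -/

section PowPairing

variable {K : Cx.{u₁} Λ} {D : Cx.{v₁} Λ} {M : Type v} [CommRing M] [Algebra Λ M]

/-- The pairing of powers induced by a pairing with values in a commutative algebra:
`(f_1 ⊗ ⋯ ⊗ f_n, x_1 ⊗ ⋯ ⊗ x_n) ↦ (-1)^{∑_{i<j} deg x_i deg x_j} ∏ a f_i x_i`. -/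
def powPairing (a : K →ₗ[Λ] D →ₗ[Λ] M) (n : ℕ) : K.pow n →ₗ[Λ] D.pow n →ₗ[Λ] M :=
  LinearMap.lcomp Λ _ (Cx.twist (fun _ => D) Cx.pairSign) ∘ₗ
    LinearMap.compRight Λ (PiTensorProduct.lift (MultilinearMap.mkPiAlgebra Λ (Fin n) M)) ∘ₗ
      PiTensorProduct.piTensorHomMap ∘ₗ PiTensorProduct.map fun _ => a

variable {n : ℕ} (a : K →ₗ[Λ] D →ₗ[Λ] M)

lemma powPairing_tprod (f : Fin n → K) (z : D.pow n) :
    powPairing a n (PiTensorProduct.tprod Λ f) z =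
      PiTensorProduct.lift (MultilinearMap.mkPiAlgebra Λ (Fin n) M)
        (PiTensorProduct.map (fun i => a (f i)) (Cx.twist (fun _ => D) Cx.pairSign z)) := by
  simp only [powPairing, LinearMap.comp_apply, PiTensorProduct.map_tprod,
    PiTensorProduct.piTensorHomMap_tprod_eq_map]
  rfl

lemma powPairing_tprod_tprod (f : Fin n → K) {e : Fin n → ℤ} {x : Fin n → D}
    (hx : ∀ i, x i ∈ D.deg (e i)) :
    powPairing a n (PiTensorProduct.tprod Λ f) (PiTensorProduct.tprod Λ x) =
      psign (∑ i, ∑ j, ltInd i j * ((e i : ZMod 2) * e j)) • ∏ i, a (f i) (x i) := by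
  rw [powPairing_tprod, Cx.twist_tprod_of_mem _ hx, map_zsmul, map_zsmul,
    PiTensorProduct.map_tprod, PiTensorProduct.lift.tprod, MultilinearMap.mkPiAlgebra_apply,
    Cx.pairSign_eq]

variable {a}

lemma prod_pairing_eq_zero (ha : IsPairing a) {d e : Fin n → ℤ} {f : Fin n → K} {x : Fin n → D}
    (hf : ∀ i, f i ∈ K.deg (d i)) (hx : ∀ i, x i ∈ D.deg (e i)) (h : e ≠ fun i => -d i) :
    ∏ i, a (f i) (x i) = 0 := by
  obtain ⟨i, hi⟩ := Function.ne_iff.1 h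
  exact Finset.prod_eq_zero (Finset.mem_univ i) (ha.deg (hf i) (hx i) hi)

/-- The product vanishes unless every `e i` equals `-d i`, and then all parities agree; so a sign
may be computed from the degrees of the `f i` or of the `x i`. -/
lemma psign_smul_prod_pairing (ha : IsPairing a) {d e : Fin n → ℤ} {f : Fin n → K} {x : Fin n → D}
    (hf : ∀ i, f i ∈ K.deg (d i)) (hx : ∀ i, x i ∈ D.deg (e i)) (c c' : ZMod 2)
    (h : (∀ i, (e i : ZMod 2) = d i) → c = c') :
    psign c • ∏ i, a (f i) (x i) = psign c' • ∏ i, a (f i) (x i) := by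
  by_cases he : e = fun i => -d i
  · rw [h fun i => by rw [he]; push_cast; exact ZMod.neg_eq_self_mod_two _]
  · rw [prod_pairing_eq_zero ha hf hx he]
    exact (zsmul_zero _).trans (zsmul_zero _).symm

lemma IsPairing.pow (ha : IsPairing a) (n : ℕ) :
    IsPairing (K := K.pow n) (D := D.pow n) (powPairing a n) where
  deg {r m f y} hf hy h := by
    have h2 : (K.pow n).deg r ≤ LinearMap.ker ((powPairing a n).flip y) := by
      refine Cx.piDeg_le _ fun d hd f hf => ?_
      rw [LinearMap.mem_ker, LinearMap.flip_apply, ← LinearMap.mem_ker]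
      refine Cx.piDeg_le _ (fun e he x hx => ?_) hy
      rw [LinearMap.mem_ker, powPairing_tprod_tprod a f hx, prod_pairing_eq_zero ha hf hx]
      · exact zsmul_zero _
      · rintro rfl
        refine h ?_
        rw [← hd, ← he, Finset.sum_neg_distrib]
    exact h2 hf
  comm f y := by
    have : powPairing a n ∘ₗ (K.pow n).d =
        LinearMap.lcomp Λ _ ((D.pow n).d ∘ₗ (D.pow n).sgn) ∘ₗ powPairing a n := by
      refine Cx.pi_hom_ext fun d f hf => Cx.pi_hom_ext fun e x hx => ?_
      simp only [LinearMap.comp_apply, LinearMap.lcomp_apply]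
      rw [Cx.sgn_eq_smul (K := D.pow n) (Cx.tprod_mem hx), map_zsmul, map_zsmul,
        Cx.pi_d_tprod hf, Cx.pi_d_tprod hx, map_sum, map_sum, LinearMap.sum_apply, zsmul_sum]
      refine Finset.sum_congr rfl fun i _ => ?_
      have hx' := Cx.update_d_mem (K := fun _ => D) hx i
      rw [map_zsmul, map_zsmul, zsmul_linearMap_apply, powPairing_tprod_tprod a _ hx,
        powPairing_tprod_tprod a _ hx']
      have e1 : ∏ j, a (Function.update f i (K.d (f i)) j) (x j) =
          psign (e i : ZMod 2) • ∏ j, a (f j) (Function.update x i (D.d (x i)) j) := by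
        rw [← Finset.mul_prod_erase _ _ (Finset.mem_univ i),
          ← Finset.mul_prod_erase _ _ (Finset.mem_univ i), Function.update_self,
          Function.update_self, ha.comm_of_mem _ (hx i), smul_mul_assoc]
        congr 2
        refine Finset.prod_congr rfl fun j hj => ?_
        rw [Function.update_of_ne (Finset.ne_of_mem_erase hj),
          Function.update_of_ne (Finset.ne_of_mem_erase hj)]
      rw [e1]
      simp only [psign_smul_psign_smul]
      -- The degrees to compare are those after `x i` has been differentiated: the parities of `f j`
      -- and `x j` agree for `j ≠ i` and differ by one at `i`.
      refine psign_smul_prod_pairing ha hf hx' _ _ fun h => ?_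
      have hcu : ∀ j, ((Function.update e i (e i + 1) j : ℤ) : ZMod 2) =
        Function.update (fun j => (e j : ZMod 2)) i ((e i : ZMod 2) + 1) j :=
        fun j => congrFun (Cx.cast_update e i) j
      simp only [hcu] at h ⊢
      rw [quad_update (fun i j => ltInd i j) _ i (ltInd_self i)]
      push_cast
      rw [sum_eq_add_sum_ltInd (fun j => (e j : ZMod 2)) i,
        Finset.sum_congr rfl fun j _ => (show ltInd j i * (d j : ZMod 2) = ltInd j i * (e j : ZMod 2)
          from by
            by_cases hj : j = i
            · rw [hj, ltInd_self, zero_mul, zero_mul]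
            · rw [← h j, Function.update_of_ne hj])]
      grind
    exact LinearMap.congr_fun (LinearMap.congr_fun this f) y

/-- Where the value is nonzero, both arguments have the same parities and their permutation signs
cancel. The remaining exponent is a sum over unordered pairs of factors, which a permutation does
not change, and the product of values is independent of the order by commutativity. -/
lemma powPairing_perm (ha : IsPairing a) (σ : Equiv.Perm (Fin n)) (F : K.pow n) (z : D.pow n) :
    powPairing a n (Cx.perm σ (fun _ => K) F) (Cx.perm σ (fun _ => D) z) = powPairing a n F z := by
  have : LinearMap.lcomp Λ _ (Cx.perm σ fun _ => D) ∘ₗ powPairing a n ∘ₗ Cx.perm σ (fun _ => K) =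
      powPairing a n := by
    refine Cx.pi_hom_ext fun d f hf => Cx.pi_hom_ext fun e x hx => ?_
    simp only [LinearMap.comp_apply, LinearMap.lcomp_apply]
    rw [Cx.perm_tprod σ hf, Cx.perm_tprod σ hx, map_zsmul, map_zsmul, zsmul_linearMap_apply,
      powPairing_tprod_tprod a f hx, powPairing_tprod_tprod a _ (e := fun i => e (σ.symm i))
      (fun i => hx _), Equiv.prod_comp σ.symm (fun i => a (f i) (x i)), Cx.permSign_eq,
      Cx.permSign_eq]
    simp only [psign_smul_psign_smul]
    refine psign_smul_prod_pairing ha hf hx _ _ fun h => ?_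
    simp only [← h]
    rw [← add_assoc, CharTwo.add_self_eq_zero, zero_add, sum_perm σ, ← CharTwo.add_eq_zero,
      ← Finset.sum_add_distrib]
    simp only [← Finset.sum_add_distrib, Equiv.symm_apply_apply]
    refine sum_eq_zero_of_symm _ (fun i j => ?_) fun i => by simp [ltInd_self]
    by_cases h : i = j
    · rw [h]
    · rw [ltInd_swap h, ltInd_swap (fun h' => h (σ.injective h') : σ i ≠ σ j)]
      grind
  exact LinearMap.congr_fun (LinearMap.congr_fun this F) z

lemma powPairing_map {K₀ : Cx.{g} Λ} {D₀ : Cx.{w₁} Λ} {a₀ : K₀ →ₗ[Λ] D₀ →ₗ[Λ] M}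
    {k : K₀ →ₗ[Λ] K} {h : D₀ →ₗ[Λ] D} (hh : ∀ {m x}, x ∈ D₀.deg m → h x ∈ D.deg m)
    (hk : ∀ f x, a₀ f x = a (k f) (h x)) (F : K₀.pow n) (z : D₀.pow n) :
    powPairing a n (PiTensorProduct.map (fun _ => k) F) (PiTensorProduct.map (fun _ => h) z) =
      powPairing a₀ n F z := by
  have : LinearMap.lcomp Λ _ (PiTensorProduct.map fun _ => h) ∘ₗ powPairing a n ∘ₗ
      PiTensorProduct.map (fun _ => k) = powPairing a₀ n := by
    refine Cx.pi_hom_ext (K := fun _ => K₀) fun d f hf =>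
      Cx.pi_hom_ext (K := fun _ => D₀) fun e x hx => ?_
    simp only [LinearMap.comp_apply, LinearMap.lcomp_apply]
    rw [PiTensorProduct.map_tprod, PiTensorProduct.map_tprod, powPairing_tprod_tprod a₀ f hx,
      powPairing_tprod_tprod a _ (fun i => hh (hx i))]
    simp only [hk]
  exact LinearMap.congr_fun (LinearMap.congr_fun this F) z

variable {K' : Cx.{u₂} Λ} {D' : Cx.{v₂} Λ} {N : Type w} [CommRing N] [Algebra Λ N]
  {b : K' →ₗ[Λ] D' →ₗ[Λ] N}

lemma prod_tmul {ι : Type*} (S : Finset ι) (x : ι → M) (y : ι → N) :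
    ∏ i ∈ S, (x i ⊗ₜ[Λ] y i) = (∏ i ∈ S, x i) ⊗ₜ[Λ] ∏ i ∈ S, y i := by
  classical
  induction S using Finset.induction_on with
  | empty => rfl
  | insert i S hi ih =>
    rw [Finset.prod_insert hi, Finset.prod_insert hi, Finset.prod_insert hi, ih,
      Algebra.TensorProduct.tmul_mul_tmul]

lemma prod_psign_smul {ι : Type*} (S : Finset ι) (c : ι → ZMod 2) (x : ι → M) :
    ∏ i ∈ S, psign (c i) • x i = psign (∑ i ∈ S, c i) • ∏ i ∈ S, x i := by
  simp only [zsmul_eq_mul, Finset.prod_mul_distrib, psign_sum, Int.cast_prod]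

/-- Both sides are the tensor of two products of values up to sign. For opposite degrees the signs
agree by splitting the product of the two total parities into its diagonal part and the parts above
and below the diagonal. -/
lemma powPairing_extPairing (ha : IsPairing a) (hb : IsPairing b) (F : (K.tensor K').pow n)
    (z : (D.tensor D').pow n) :
    powPairing (K := K.tensor K') (D := D.tensor D') (extPairing a b) n F z =
      extPairing (powPairing a n) (powPairing b n) (Cx.shuffle n K K' F)
        (Cx.shuffle n D D' z) := by
  have : powPairing (K := K.tensor K') (D := D.tensor D') (extPairing a b) n =
      LinearMap.lcomp Λ _ (Cx.shuffle n D D') ∘ₗ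
        extPairing (powPairing a n) (powPairing b n) ∘ₗ Cx.shuffle n K K' := by
    refine Cx.pow_tensor_hom_ext fun c d f h hf hh =>
      Cx.pow_tensor_hom_ext fun i j x y hx hy => ?_
    simp only [LinearMap.comp_apply, LinearMap.lcomp_apply]
    rw [Cx.shuffle_tprod hf hh, Cx.shuffle_tprod hx hy, map_zsmul, map_zsmul,
      zsmul_linearMap_apply, extPairing_tmul_tmul _ _ (Cx.tprod_mem hx) (Cx.tprod_mem hy),
      powPairing_tprod_tprod a f hx, powPairing_tprod_tprod b h hy,
      powPairing_tprod_tprod (K := K.tensor K') (D := D.tensor D') _ _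
        (fun i => Cx.tmul_mem (hx i) (hy i)), zsmul_tmul_left, tmul_zsmul_right]
    simp only [extPairing_tmul_tmul _ _ (hx _) (hy _)]
    rw [prod_psign_smul, prod_tmul, Cx.shuffleSign_eq, Cx.shuffleSign_eq]
    by_cases h1 : i = fun k => -c k
    · by_cases h2 : j = fun k => -d k
      · push_cast
        simp only [psign_smul_psign_smul]
        congr 2
        simp only [h1, h2]
        push_cast
        simp only [ZMod.neg_eq_self_mod_two]
        rw [sum_mul_sum_eq, Finset.sum_congr rfl fun i _ => Finset.sum_congr rfl fun j _ =>
          (show ltInd i j * (((c i : ZMod 2) + d i) * ((c j : ZMod 2) + d j)) =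
            ltInd i j * ((c i : ZMod 2) * c j) + ltInd i j * ((d i : ZMod 2) * d j) +
              ltInd i j * ((c i : ZMod 2) * d j) + ltInd i j * ((c j : ZMod 2) * d i) by ring)]
        simp only [Finset.sum_add_distrib, add_mul]
        rw [Finset.sum_comm (f := fun i j => ltInd i j * ((c j : ZMod 2) * d i))]
        grind
      · rw [prod_pairing_eq_zero hb hh hy h2, tmul_zero]
        simp only [zsmul_zero]
    · rw [prod_pairing_eq_zero ha hf hx h1, zero_tmul]
      simp only [zsmul_zero]
  exact LinearMap.congr_fun (LinearMap.congr_fun this F) z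

end PowPairing

/-! ### Contractions -/

namespace Cx

/-- A contraction of a complex onto its part of degree `0`: a homotopy from the identity to an
operator `e` which vanishes outside degree `0`. -/
structure Contraction (K : Cx.{v} Λ) where
  h : K →ₗ[Λ] K
  e : K →ₗ[Λ] K
  h_mem : ∀ {n : ℤ} {x : K}, x ∈ K.deg n → h x ∈ K.deg (n - 1)
  e_mem : ∀ {n : ℤ} {x : K}, x ∈ K.deg n → e x ∈ K.deg n
  e_of_ne : ∀ {n : ℤ} {x : K}, x ∈ K.deg n → n ≠ 0 → e x = 0
  d_e : ∀ x, K.d (e x) = 0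
  e_d : ∀ x, e (K.d x) = 0
  homotopy : ∀ x, K.d (h x) + h (K.d x) = x - e x

namespace Contraction

lemma sgn_e {K : Cx.{v} Λ} (c : K.Contraction) (x : K) : K.sgn (c.e x) = c.e x := by
  have : K.sgn ∘ₗ c.e = c.e := K.hom_ext fun n x hx => by
    rw [LinearMap.comp_apply]
    by_cases hn : n = 0
    · subst hn
      rw [K.sgn_of_mem (c.e_mem hx), if_pos (by simp)]
    · rw [c.e_of_ne hx hn, map_zero]
  exact LinearMap.congr_fun this x

lemma e_sgn {K : Cx.{v} Λ} (c : K.Contraction) (x : K) : c.e (K.sgn x) = c.e x := by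
  rw [← sgn_e c x]
  exact sgn_comm c.e_mem x

lemma sgn_h {K : Cx.{v} Λ} (c : K.Contraction) (x : K) : K.sgn (c.h x) = -c.h (K.sgn x) := by
  have : K.sgn ∘ₗ c.h = -(c.h ∘ₗ K.sgn) := K.hom_ext fun n x hx => by
    simp only [LinearMap.comp_apply, LinearMap.neg_apply]
    rw [sgn_eq_smul (c.h_mem hx), sgn_eq_smul hx, map_zsmul, ← neg_smul]
    congr 1
    push_cast
    rcases parity_cases (n : ZMod 2) with h | h <;> rw [h] <;> rfl
  exact LinearMap.congr_fun this x

/-- The contraction `h ⊗ 1 + e ⊗ h` of a tensor product. -/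
def tensor {K : Cx.{u₁} Λ} {L : Cx.{u₂} Λ} (c : K.Contraction) (c' : L.Contraction) :
    (K.tensor L).Contraction where
  h := TensorProduct.map c.h LinearMap.id + TensorProduct.map c.e c'.h
  e := TensorProduct.map c.e c'.e
  h_mem {n x} hx := by
    refine tensorDeg_le (((K.tensor L).deg (n - 1)).comap
      (TensorProduct.map c.h LinearMap.id + TensorProduct.map c.e c'.h)) ?_ hx
    rintro i j rfl x hx y hy
    refine Submodule.add_mem ((K.tensor L).deg (i + j - 1)) ?_ ?_
    · rw [show i + j - 1 = (i - 1) + j by ring]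
      exact tmul_mem (c.h_mem hx) hy
    · rw [show i + j - 1 = i + (j - 1) by ring]
      exact tmul_mem (c.e_mem hx) (c'.h_mem hy)
  e_mem {n x} hx := by
    refine tensorDeg_le (((K.tensor L).deg n).comap (TensorProduct.map c.e c'.e)) ?_ hx
    rintro i j rfl x hx y hy
    exact tmul_mem (c.e_mem hx) (c'.e_mem hy)
  e_of_ne {n x} hx hn := by
    refine tensorDeg_le (LinearMap.ker (TensorProduct.map c.e c'.e)) ?_ hx
    rintro i j rfl x hx y hy
    rw [LinearMap.mem_ker, TensorProduct.map_tmul]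
    by_cases hi : i = 0
    · rw [c'.e_of_ne hy (by lia), tmul_zero]
    · rw [c.e_of_ne hx hi, zero_tmul]
  d_e x := by
    induction x using TensorProduct.induction_on with
    | zero => rw [map_zero, map_zero]
    | add x y hx hy => rw [map_add, map_add, hx, hy, add_zero]
    | tmul x y => simp [tensorD, c.d_e, c'.d_e]
  e_d x := by
    induction x using TensorProduct.induction_on with
    | zero => rw [map_zero, map_zero]
    | add x y hx hy => rw [map_add, map_add, hx, hy, add_zero]
    | tmul x y => simp [tensorD, c.e_d, c'.e_d]
  homotopy x := by
    induction x using TensorProduct.induction_on with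
    | zero => simp only [map_zero, add_zero, sub_zero]
    | add x y hx hy =>
      simp only [map_add]
      rw [add_add_add_comm, hx, hy]
      exact add_sub_add_comm _ _ _ _ |>.symm
    | tmul x y =>
      simp only [tensorD, LinearMap.add_apply, TensorProduct.map_tmul, map_add, LinearMap.id_apply,
        c.d_e, c.e_d, sgn_h, sgn_e, e_sgn, zero_tmul, neg_tmul]
      have h1 := congrArg (fun t => t ⊗ₜ[Λ] y) (c.homotopy x)
      have h2 := congrArg (fun t => c.e x ⊗ₜ[Λ] t) (c'.homotopy y)
      simp only [add_tmul, sub_tmul, tmul_add, tmul_sub] at h1 h2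
      rw [← eq_sub_iff_add_eq] at h1 h2
      rw [h1, h2]
      abel

variable {n : ℕ} {K : Fin n → Cx.{v} Λ}

/-- The operator `e ⊗ ⋯ ⊗ e ⊗ h ⊗ 1 ⊗ ⋯ ⊗ 1` with `h` in position `i`. -/
def piH (c : ∀ i, (K i).Contraction) (i : Fin n) : (⨂[Λ] i, K i) →ₗ[Λ] (⨂[Λ] i, K i) :=
  PiTensorProduct.map fun j => if j < i then (c j).e else if j = i then (c j).h else LinearMap.id

/-- The operator `e ⊗ ⋯ ⊗ e ⊗ 1 ⊗ ⋯ ⊗ 1` with `m` factors `e`. -/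
def piE (c : ∀ i, (K i).Contraction) (m : ℕ) : (⨂[Λ] i, K i) →ₗ[Λ] (⨂[Λ] i, K i) :=
  PiTensorProduct.map fun j => if (j : ℕ) < m then (c j).e else LinearMap.id

/-- In position `k` both composites contain a product of the differential with `e`, and these
vanish. -/
lemma piD_piH_of_lt (c : ∀ i, (K i).Contraction) {i k : Fin n} (h : k < i) (z) :
    piD K k (piH c i z) + piH c i (piD K k z) = 0 := by
  have : piD K k ∘ₗ piH c i + piH c i ∘ₗ piD K k = 0 := by
    rw [piD, piH, ← PiTensorProduct.map_comp, ← PiTensorProduct.map_comp]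
    ext x
    simp only [LinearMap.compMultilinearMap_apply, PiTensorProduct.map_tprod, LinearMap.zero_apply,
      LinearMap.add_apply]
    rw [MultilinearMap.map_coord_zero _ k (by simp [h, (c k).d_e]),
      MultilinearMap.map_coord_zero _ k (by simp [h, (c k).e_d]), add_zero]
  exact LinearMap.congr_fun this z

/-- The differential and `h` act in different positions, and the involution that accompanies the
differential anticommutes with `h` in position `i`; it commutes with the factors `e` before it. -/
lemma piD_piH_of_gt (c : ∀ i, (K i).Contraction) {i k : Fin n} (h : i < k) (z) :
    piD K k (piH c i z) + piH c i (piD K k z) = 0 := by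
  have : piD K k ∘ₗ piH c i + piH c i ∘ₗ piD K k = 0 := by
    rw [← eq_neg_iff_add_eq_zero, piD, piH, ← PiTensorProduct.map_comp, ← PiTensorProduct.map_comp]
    ext x
    simp only [LinearMap.compMultilinearMap_apply, PiTensorProduct.map_tprod, LinearMap.neg_apply]
    rw [← tprod_update_neg _ i]
    congr 1
    funext j
    by_cases hj : j = i
    · subst hj
      simp [h, sgn_h]
    · rw [Function.update_of_ne hj]
      rcases lt_or_gt_of_ne hj with h1 | h1
      · simp [h1, h1.trans h, sgn_e, e_sgn]
      · simp [h1.ne', h1.not_gt]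
  exact LinearMap.congr_fun this z

/-- The homotopy identity in position `i` replaces the identity by `e` there, so each position
contributes a difference of consecutive operators and the sum over positions telescopes. -/
lemma piD_piH_self (c : ∀ i, (K i).Contraction) (i : Fin n) (z) :
    piD K i (piH c i z) + piH c i (piD K i z) = piE c i z - piE c (i + 1) z := by
  have : piD K i ∘ₗ piH c i + piH c i ∘ₗ piD K i = piE c i - piE c (i + 1) := by
    rw [piD, piH, piE, piE, ← PiTensorProduct.map_comp, ← PiTensorProduct.map_comp]
    ext x
    simp only [LinearMap.compMultilinearMap_apply, LinearMap.add_apply, LinearMap.sub_apply]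
    let y : ∀ j, K j := fun j => if j < i then (c j).e (x j) else x j
    have h1 : ∀ F : ∀ j, K j →ₗ[Λ] K j, (∀ j < i, F j (x j) = (c j).e (x j)) →
        (∀ j > i, F j (x j) = x j) → PiTensorProduct.map F (PiTensorProduct.tprod Λ x) =
          PiTensorProduct.tprod Λ (Function.update y i (F i (x i))) := by
      intro F h1 h2
      rw [PiTensorProduct.map_tprod]
      congr 1
      funext j
      rcases lt_trichotomy j i with h | h | h
      · simp [h1 j h, h.ne, y, h]
      · subst h; simp
      · simp [h2 j h, h.ne', y, h.not_gt]
    refine (congrArg₂ (· + ·) (h1 _ (fun j hj => by simp [hj, sgn_e])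
        fun j hj => by simp [hj.ne', hj.not_gt])
      (h1 _ (fun j hj => by simp [hj, e_sgn])
        fun j hj => by simp [hj.ne', hj.not_gt])).trans
      (.trans ?_ (congrArg₂ (· - ·) (h1 _ (fun j hj => by simp [hj])
        fun j hj => by simp [(show i < j from hj).not_gt])
      (h1 _ (fun j hj => by simp [Nat.lt_succ_of_lt (show (j : ℕ) < i from hj)])
        fun j hj => by
          have : ¬ (j : ℕ) < i + 1 := by have : (i : ℕ) < j := hj; lia
          simp [this])).symm)
    rw [← MultilinearMap.map_update_add, ← MultilinearMap.map_update_sub]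
    simpa using congrArg (fun t => PiTensorProduct.tprod Λ (Function.update y i t))
      ((c i).homotopy (x i))
  exact LinearMap.congr_fun this z

/-- The contraction `∑_i e ⊗ ⋯ ⊗ e ⊗ h ⊗ 1 ⊗ ⋯ ⊗ 1` of a tensor product of a finite family. -/
def pi (c : ∀ i, (K i).Contraction) : (piTensor K).Contraction where
  h := ∑ i, piH c i
  e := PiTensorProduct.map fun i => (c i).e
  h_mem {m z} hz := by
    refine piDeg_le (((piTensor K).deg (m - 1)).comap (∑ i, piH c i)) ?_ hz
    rintro e rfl x hx
    rw [Submodule.mem_comap, LinearMap.sum_apply]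
    refine Submodule.sum_mem _ fun i _ => ?_
    rw [piH, PiTensorProduct.map_tprod]
    have : ∑ j, Function.update e i (e i - 1) j = ∑ j, e j - 1 := by
      rw [Finset.sum_update_of_mem (Finset.mem_univ i),
        ← Finset.add_sum_erase _ _ (Finset.mem_univ i), Finset.sdiff_singleton_eq_erase]
      ring
    rw [← this]
    refine tprod_mem fun j => ?_
    rcases lt_trichotomy j i with h | h | h
    · simpa [h, h.ne] using (c j).e_mem (hx j)
    · subst h
      simpa using (c j).h_mem (hx j)
    · simpa [h.not_gt, h.ne'] using hx j
  e_mem {m z} hz := by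
    refine piDeg_le (((piTensor K).deg m).comap (PiTensorProduct.map fun i => (c i).e)) ?_ hz
    rintro e rfl x hx
    rw [Submodule.mem_comap, PiTensorProduct.map_tprod]
    exact tprod_mem fun i => (c i).e_mem (hx i)
  e_of_ne {m z} hz hm := by
    refine piDeg_le (LinearMap.ker (PiTensorProduct.map fun i => (c i).e)) ?_ hz
    rintro e rfl x hx
    obtain ⟨i, -, hi⟩ := Finset.exists_ne_zero_of_sum_ne_zero hm
    rw [LinearMap.mem_ker, PiTensorProduct.map_tprod]
    exact MultilinearMap.map_coord_zero _ i ((c i).e_of_ne (hx i) hi)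
  d_e z := by
    refine (LinearMap.sum_apply _ _ _).trans (Finset.sum_eq_zero fun i _ => ?_)
    have : piD K i ∘ₗ PiTensorProduct.map (fun i => (c i).e) = 0 := by
      rw [piD, ← PiTensorProduct.map_comp]
      ext x
      simp only [LinearMap.compMultilinearMap_apply, PiTensorProduct.map_tprod,
        LinearMap.zero_apply]
      exact MultilinearMap.map_coord_zero _ i (by simp [(c i).d_e])
    exact LinearMap.congr_fun this z
  e_d z := by
    have h : ∀ i, PiTensorProduct.map (fun i => (c i).e) (piD K i z) = 0 := by
      intro i
      have : PiTensorProduct.map (fun i => (c i).e) ∘ₗ piD K i = 0 := by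
        rw [piD, ← PiTensorProduct.map_comp]
        ext x
        simp only [LinearMap.compMultilinearMap_apply, PiTensorProduct.map_tprod,
          LinearMap.zero_apply]
        exact MultilinearMap.map_coord_zero _ i (by simp [(c i).e_d])
      exact LinearMap.congr_fun this z
    rw [LinearMap.sum_apply, map_sum]
    exact Finset.sum_eq_zero fun i _ => h i
  homotopy z := by
    have h1 : ∀ k, ∑ i, (piD K k (piH c i z) + piH c i (piD K k z)) =
        piE c k z - piE c (k + 1) z := by
      intro k
      rw [Finset.sum_eq_single k, piD_piH_self]
      · intro i _ hik
        rcases lt_or_gt_of_ne hik with h | h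
        · exact piD_piH_of_gt c h z
        · exact piD_piH_of_lt c h z
      · exact fun h => absurd (Finset.mem_univ _) h
    have h2 : piE c n = PiTensorProduct.map fun i => (c i).e := by
      simp only [piE, Fin.is_lt, if_true]
    have h3 : piE c 0 = LinearMap.id := by
      simp only [piE, Nat.not_lt_zero, if_false]
      exact PiTensorProduct.map_id
    have h4 : ∑ k : Fin n, (piE c k z - piE c (k + 1) z) = z - PiTensorProduct.map
        (fun i => (c i).e) z := by
      rw [Fin.sum_univ_eq_sum_range (fun k => piE c k z - piE c (k + 1) z),
        Finset.sum_range_sub', h2, h3, LinearMap.id_apply]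
    rw [← h4, ← Finset.sum_congr rfl fun k _ => h1 k]
    simp only [LinearMap.sum_apply, map_sum, Finset.sum_add_distrib]
    congr 1
    exact Finset.sum_comm

end Contraction

end Cx

/-! ### The cone contraction of the chains of a standard simplex -/

section Cone

/-- The standard `n`-simplex. -/
abbrev stdSplx (n : ℕ) : SSet.{u} := SSet.stdSimplex.obj (SimplexCategory.mk n)

/-- The simplex of the standard simplex given by a monotone map. -/
abbrev mkSplx {n k : ℕ} (f : Fin (k + 1) →o Fin (n + 1)) : Splx (stdSplx.{u} n) k :=
  SSet.stdSimplex.objMk.{u} (n := SimplexCategory.mk n) (m := op (SimplexCategory.mk k)) f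

lemma mkSplx_surjective {n k : ℕ} (x : Splx (stdSplx.{u} n) k) : ∃ f, mkSplx f = x :=
  SSet.stdSimplex.objMk_bijective.2 x

/-- The monotone map obtained by adding `0` in front. -/
def consZero {n k : ℕ} (f : Fin (k + 1) →o Fin (n + 1)) : Fin (k + 2) →o Fin (n + 1) where
  toFun := Fin.cons 0 f
  monotone' := by
    intro i j hij
    induction i using Fin.cases with
    | zero => exact Fin.zero_le _
    | succ i =>
      induction j using Fin.cases with
      | zero => exact absurd hij (by simp)
      | succ j => simpa using f.monotone (Fin.succ_le_succ_iff.1 hij)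

@[simp]
lemma consZero_zero {n k : ℕ} (f : Fin (k + 1) →o Fin (n + 1)) : consZero f 0 = 0 := rfl

@[simp]
lemma consZero_succ {n k : ℕ} (f : Fin (k + 1) →o Fin (n + 1)) (i : Fin (k + 1)) :
    consZero f i.succ = f i := rfl

/-- The join of the vertex `0` with a simplex of the standard simplex. -/
def cone {n k : ℕ} (x : Splx (stdSplx.{u} n) k) : Splx (stdSplx.{u} n) (k + 1) :=
  mkSplx (consZero (SSet.stdSimplex.objEquiv x).toOrderHom)

lemma cone_mkSplx {n k : ℕ} (f : Fin (k + 1) →o Fin (n + 1)) :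
    cone (mkSplx.{u} f) = mkSplx (consZero f) := rfl

/-- The vertex `0` of the standard simplex. -/
def origin (n : ℕ) : Splx (stdSplx.{u} n) 0 := mkSplx (OrderHom.const _ 0)

lemma δ_mkSplx {n k : ℕ} (f : Fin (k + 2) →o Fin (n + 1)) (i : Fin (k + 2)) :
    (stdSplx.{u} n).δ i (mkSplx f) = mkSplx (f.comp (Fin.succAboveOrderEmb i).toOrderHom) := rfl

lemma σ_mkSplx {n k : ℕ} (f : Fin (k + 1) →o Fin (n + 1)) (i : Fin (k + 1)) :
    (stdSplx.{u} n).σ i (mkSplx f) =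
      mkSplx (f.comp ⟨i.predAbove, Fin.predAbove_right_monotone i⟩) := rfl

lemma map_mkSplx {n m k : ℕ} (g : Fin (n + 1) →o Fin (m + 1)) (f : Fin (k + 1) →o Fin (n + 1)) :
    (SSet.stdSimplex.{u}.map (SimplexCategory.Hom.mk g)).app _ (mkSplx f) = mkSplx (g.comp f) := rfl

lemma δ_zero_cone {n k : ℕ} (x : Splx (stdSplx.{u} n) k) : (stdSplx.{u} n).δ 0 (cone x) = x := by
  obtain ⟨f, rfl⟩ := mkSplx_surjective x
  rw [cone_mkSplx, δ_mkSplx]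
  congr 1

lemma δ_succ_cone {n k : ℕ} (x : Splx (stdSplx.{u} n) (k + 1)) (i : Fin (k + 2)) :
    (stdSplx.{u} n).δ i.succ (cone x) = cone ((stdSplx.{u} n).δ i x) := by
  obtain ⟨f, rfl⟩ := mkSplx_surjective x
  rw [cone_mkSplx, δ_mkSplx, δ_mkSplx, cone_mkSplx]
  congr 1
  ext j : 2
  induction j using Fin.cases with
  | zero => simp
  | succ j => simp

lemma δ_one_cone {n : ℕ} (x : Splx (stdSplx.{u} n) 0) :
    (stdSplx.{u} n).δ 1 (cone x) = origin n := by
  obtain ⟨f, rfl⟩ := mkSplx_surjective x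
  rw [cone_mkSplx, δ_mkSplx, origin]
  congr 1
  ext j : 2
  fin_cases j
  simp

lemma cone_σ {n k : ℕ} (x : Splx (stdSplx.{u} n) k) (i : Fin (k + 1)) :
    cone ((stdSplx.{u} n).σ i x) = (stdSplx.{u} n).σ i.succ (cone x) := by
  obtain ⟨f, rfl⟩ := mkSplx_surjective x
  rw [cone_mkSplx, σ_mkSplx, σ_mkSplx, cone_mkSplx]
  congr 1
  ext j : 2
  induction j using Fin.cases with
  | zero => simp
  | succ j => simp

lemma cone_degenerate {n k : ℕ} {x : Splx (stdSplx.{u} n) k}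
    (hx : x ∈ (stdSplx.{u} n).degenerate k) : cone x ∈ (stdSplx.{u} n).degenerate (k + 1) := by
  cases k with
  | zero => simp at hx
  | succ k =>
    rw [SSet.degenerate_eq_iUnion_range_σ, Set.mem_iUnion] at hx
    obtain ⟨i, y, rfl⟩ := hx
    rw [cone_σ]
    exact SSet.σ_mem_degenerate _ _ _

/-- A map respects cones with vertex 0 if it fixes that vertex. The codegeneracy maps do, which is
what makes solutions obtained from the cone contraction vanish on degenerate simplices. -/
lemma map_cone {n m k : ℕ} (g : Fin (n + 1) →o Fin (m + 1)) (hg : g 0 = 0)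
    (x : Splx (stdSplx.{u} n) k) :
    (SSet.stdSimplex.{u}.map (SimplexCategory.Hom.mk g)).app _ (cone x) =
      cone ((SSet.stdSimplex.{u}.map (SimplexCategory.Hom.mk g)).app _ x) := by
  obtain ⟨f, rfl⟩ := mkSplx_surjective x
  rw [cone_mkSplx, map_mkSplx, map_mkSplx, cone_mkSplx]
  congr 1
  ext j : 2
  induction j using Fin.cases with
  | zero => simp [hg]
  | succ j => simp

lemma map_origin {n m : ℕ} (g : Fin (n + 1) →o Fin (m + 1)) (hg : g 0 = 0) :
    (SSet.stdSimplex.{u}.map (SimplexCategory.Hom.mk g)).app _ (origin n) = origin m := by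
  rw [origin, map_mkSplx, origin]
  congr 1
  ext j : 2
  simp [hg]

variable (Λ) in
/-- The chain map `h` of degree one given by the cone operator. -/
def coneH (n : ℕ) : chains Λ (stdSplx.{u} n) →ₗ[Λ] chains Λ (stdSplx.{u} n) :=
  chainsLift fun _ x => cell Λ (cone x)

lemma coneH_cell {n k : ℕ} (x : Splx (stdSplx.{u} n) k) :
    coneH Λ n (cell Λ x) = cell Λ (cone x) :=
  chainsLift_cell _ (fun _ _ hx => cell_degenerate (cone_degenerate hx)) x

variable (Λ) in
/-- The augmentation, with values in the multiples of the vertex `0`. -/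
def coneE (n : ℕ) : chains Λ (stdSplx.{u} n) →ₗ[Λ] chains Λ (stdSplx.{u} n) :=
  chainsLift fun k _ => if k = 0 then cell Λ (origin n) else 0

lemma coneE_cell {n k : ℕ} (x : Splx (stdSplx.{u} n) k) :
    coneE Λ n (cell Λ x) = if k = 0 then cell Λ (origin n) else 0 :=
  chainsLift_cell (fun k _ => if k = 0 then cell Λ (origin n) else 0) (fun k x hx => by
    cases k with
    | zero => simp at hx
    | succ k => simp) x

variable (Λ) in
/-- The cone contraction of the chains of a standard simplex. -/
def coneContraction (n : ℕ) : (chains Λ (stdSplx.{u} n)).Contraction where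
  h := coneH Λ n
  e := coneE Λ n
  h_mem {m x} hx := by
    refine chains_span (((chains Λ (stdSplx.{u} n)).deg (m - 1)).comap (coneH Λ n))
      (fun k x hk => ?_) hx
    rw [Submodule.mem_comap, coneH_cell, ← hk, show -(k : ℤ) - 1 = -((k + 1 : ℕ) : ℤ) by
      push_cast; ring]
    exact cell_mem _
  e_mem {m x} hx := by
    refine chains_span (((chains Λ (stdSplx.{u} n)).deg m).comap (coneE Λ n))
      (fun k x hk => ?_) hx
    rw [Submodule.mem_comap, coneE_cell, ← hk]
    split_ifs with h
    · subst h
      exact cell_mem _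
    · exact zero_mem _
  e_of_ne {m x} hx hm := by
    refine chains_span (LinearMap.ker (coneE Λ n)) (fun k x hk => ?_) hx
    rw [LinearMap.mem_ker, coneE_cell, if_neg]
    rintro rfl
    exact hm (by simpa using hk.symm)
  d_e x := by
    have : (chains Λ (stdSplx.{u} n)).d ∘ₗ coneE Λ n = 0 := chains_hom_ext fun k x => by
      rw [LinearMap.comp_apply, coneE_cell, LinearMap.zero_apply]
      split_ifs
      · exact d_cell_zero _
      · exact map_zero _
    exact LinearMap.congr_fun this x
  e_d x := by
    have : coneE Λ n ∘ₗ (chains Λ (stdSplx.{u} n)).d = 0 := chains_hom_ext fun k x => by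
      rw [LinearMap.comp_apply, LinearMap.zero_apply]
      match k, x with
      | 0, x => rw [d_cell_zero, map_zero]
      | 1, x =>
        rw [d_cell_succ, map_sum, Fin.sum_univ_two, map_zsmul, map_zsmul, coneE_cell, coneE_cell]
        simp
      | k + 2, x =>
        rw [d_cell_succ, map_sum]
        refine Finset.sum_eq_zero fun i _ => ?_
        rw [map_zsmul, coneE_cell, if_neg (Nat.succ_ne_zero k)]
        exact zsmul_zero _
    exact LinearMap.congr_fun this x
  homotopy x := by
    have : (chains Λ (stdSplx.{u} n)).d ∘ₗ coneH Λ n + coneH Λ n ∘ₗ (chains Λ (stdSplx.{u} n)).d =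
        LinearMap.id - coneE Λ n := chains_hom_ext fun k x => by
      simp only [LinearMap.add_apply, LinearMap.comp_apply, LinearMap.sub_apply, LinearMap.id_apply]
      -- The face opposite to the cone vertex is the simplex itself. The other faces are the cones
      -- on its faces with the opposite sign, except for a vertex, where the other face is the
      -- vertex 0.
      rw [coneH_cell, d_cell_succ, Fin.sum_univ_succ, δ_zero_cone, coneE_cell]
      cases k with
      | zero =>
        rw [d_cell_zero, map_zero, add_zero, if_pos rfl, Fin.sum_univ_one]
        rw [sub_eq_add_neg, ← δ_one_cone x]
        simp
      | succ k =>
        rw [d_cell_succ, map_sum, if_neg (Nat.succ_ne_zero k), sub_zero, add_assoc,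
          ← Finset.sum_add_distrib, Finset.sum_eq_zero, add_zero]
        · simp
        · intro i _
          rw [δ_succ_cone, map_zsmul, coneH_cell, Fin.val_succ, pow_succ, mul_neg_one, neg_smul,
            neg_add_cancel]
    exact LinearMap.congr_fun this x

end Cone

/-! ### Natural operations on chains -/

section Model

/-- The map from the standard simplex that classifies a simplex. -/
def splxMap {X : SSet.{u}} {n : ℕ} (x : Splx X n) : stdSplx.{u} n ⟶ X := SSet.yonedaEquiv.symm x

/-- The generic simplex. -/
def generic (n : ℕ) : Splx (stdSplx.{u} n) n := mkSplx OrderHom.id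

lemma splxMap_generic {X : SSet.{u}} {n : ℕ} (x : Splx X n) :
    (splxMap x).app _ (generic n) = x :=
  SSet.yonedaEquiv.apply_symm_apply x

lemma splxMap_comp {X Y : SSet.{u}} {n : ℕ} (x : Splx X n) (f : X ⟶ Y) :
    splxMap x ≫ f = splxMap (f.app _ x) := by
  apply SSet.yonedaEquiv.injective
  rw [SSet.yonedaEquiv_comp]
  simp [splxMap]

lemma map_splxMap {X : SSet.{u}} {m n : ℕ} (f : SimplexCategory.mk m ⟶ SimplexCategory.mk n)
    (x : Splx X n) : SSet.stdSimplex.map f ≫ splxMap x = splxMap (X.map f.op x) :=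
  SSet.yonedaEquiv_symm_naturality_left f x

end Model

/-! ### Acyclic models -/

variable (Λ) in
/-- A functor from simplicial sets to complexes whose values on standard simplices are contracted,
compatibly with the simplicial operators that preserve the vertex `0`. -/
structure ModelFunctor where
  obj : SSet.{u} → Cx.{u} Λ
  map : ∀ {X Y : SSet.{u}}, (X ⟶ Y) → (obj X →ₗ[Λ] obj Y)
  isCxHom : ∀ {X Y : SSet.{u}} (f : X ⟶ Y), IsCxHom (map f)
  map_comp : ∀ {X Y Z : SSet.{u}} (f : X ⟶ Y) (f' : Y ⟶ Z), map (f ≫ f') = map f' ∘ₗ map f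
  contr : ∀ n, (obj (stdSplx n)).Contraction
  map_h : ∀ {n m : ℕ} (s : Fin (n + 1) →o Fin (m + 1)), s 0 = 0 →
    map (SSet.stdSimplex.map (SimplexCategory.Hom.mk s)) ∘ₗ (contr n).h =
      (contr m).h ∘ₗ map (SSet.stdSimplex.map (SimplexCategory.Hom.mk s))
  map_e : ∀ {n m : ℕ} (s : Fin (n + 1) →o Fin (m + 1)), s 0 = 0 →
    map (SSet.stdSimplex.map (SimplexCategory.Hom.mk s)) ∘ₗ (contr n).e =
      (contr m).e ∘ₗ map (SSet.stdSimplex.map (SimplexCategory.Hom.mk s))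

lemma isCxHom_chainsMap {L S : SSet.{u}} (f : L ⟶ S) : IsCxHom (chainsMap (Λ := Λ) f) :=
  ⟨chainsMap_mem f, chainsMap_d f⟩

lemma chainsMap_comp {L S T : SSet.{u}} (f : L ⟶ S) (f' : S ⟶ T) :
    chainsMap (Λ := Λ) (f ≫ f') = chainsMap f' ∘ₗ chainsMap f :=
  chains_hom_ext fun n x => by
    rw [LinearMap.comp_apply, chainsMap_cell, chainsMap_cell, chainsMap_cell]
    rfl

lemma chainsMap_id (L : SSet.{u}) : chainsMap (Λ := Λ) (𝟙 L) = LinearMap.id :=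
  chains_hom_ext fun n x => by
    rw [chainsMap_cell]
    rfl

namespace ModelFunctor

variable (Λ) in
/-- The functor of normalized chains. -/
abbrev ofChains : ModelFunctor.{u} Λ where
  obj := chains Λ
  map f := chainsMap f
  isCxHom := isCxHom_chainsMap
  map_comp := chainsMap_comp
  contr := coneContraction Λ
  map_h {n m} s hs := chains_hom_ext fun k x => by
    change chainsMap _ (coneH Λ n (cell Λ x)) = coneH Λ m (chainsMap _ (cell Λ x))
    rw [coneH_cell, chainsMap_cell, chainsMap_cell, coneH_cell, map_cone s hs]
  map_e {n m} s hs := chains_hom_ext fun k x => by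
    change chainsMap _ (coneE Λ n (cell Λ x)) = coneE Λ m (chainsMap _ (cell Λ x))
    rw [coneE_cell, chainsMap_cell, coneE_cell]
    split_ifs
    · rw [chainsMap_cell, map_origin s hs]
    · exact map_zero _

/-- The tensor product of two functors. -/
abbrev tensor (D D' : ModelFunctor.{u} Λ) : ModelFunctor.{u} Λ where
  obj X := (D.obj X).tensor (D'.obj X)
  map f := TensorProduct.map (D.map f) (D'.map f)
  isCxHom f := (D.isCxHom f).tensorMap (D'.isCxHom f)
  map_comp f f' := by rw [D.map_comp, D'.map_comp, TensorProduct.map_comp]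
  contr n := (D.contr n).tensor (D'.contr n)
  map_h s hs := by
    have h1 := D.map_h s hs
    have h2 := D.map_e s hs
    have h3 := D'.map_h s hs
    simp only [Cx.Contraction.tensor, LinearMap.comp_add, LinearMap.add_comp,
      ← TensorProduct.map_comp, h1, h2, h3, LinearMap.comp_id, LinearMap.id_comp]
  map_e s hs := by
    have h2 := D.map_e s hs
    have h3 := D'.map_e s hs
    simp only [Cx.Contraction.tensor, ← TensorProduct.map_comp, h2, h3]

/-- The tensor power of a functor. -/
abbrev pow (D : ModelFunctor.{u} Λ) (p : ℕ) : ModelFunctor.{u} Λ where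
  obj X := (D.obj X).pow p
  map f := PiTensorProduct.map fun _ => D.map f
  isCxHom f := IsCxHom.piMap fun _ => D.isCxHom f
  map_comp f f' := by rw [D.map_comp, PiTensorProduct.map_comp]
  contr n := Cx.Contraction.pi fun _ => D.contr n
  map_h s hs := by
    have h1 := D.map_h s hs
    have h2 := D.map_e s hs
    refine LinearMap.ext fun z => ?_
    simp only [Cx.Contraction.pi, LinearMap.comp_apply, LinearMap.sum_apply, map_sum]
    refine Finset.sum_congr rfl fun i _ => ?_
    rw [Cx.Contraction.piH, Cx.Contraction.piH, ← LinearMap.comp_apply, ← LinearMap.comp_apply,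
      ← PiTensorProduct.map_comp, ← PiTensorProduct.map_comp]
    congr 2
    funext j
    split_ifs
    exacts [h2, h1, rfl]
  map_e s hs := by
    have h2 := D.map_e s hs
    simp only [Cx.Contraction.pi, ← PiTensorProduct.map_comp, h2]

/-! ### Solving d S + (-1)^c S d = N on generic simplices -/

variable (D : ModelFunctor.{u} Λ)

/-- The alternating sum of the images of an element under the face operators. -/
def faceSum {n : ℕ} (s : D.obj (stdSplx n)) : D.obj (stdSplx (n + 1)) :=
  ∑ i : Fin (n + 2), (-1 : ℤ) ^ (i : ℕ) • D.map (SSet.stdSimplex.map (SimplexCategory.δ i)) s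

/-- Linear maps from the normalized chains of each simplicial set to the values of `D`. -/
abbrev Op : Type (u + 1) := ∀ X : SSet.{u}, chains Λ X →ₗ[Λ] D.obj X

variable {D}

/-- Naturality of a family of maps. -/
def IsNatural (N : D.Op) : Prop :=
  ∀ {X Y : SSet.{u}} (f : X ⟶ Y) (x : chains Λ X), N Y (chainsMap f x) = D.map f (N X x)

/-- The family lowers degrees by `c`. -/
def Lowers (N : D.Op) (c : ℤ) : Prop :=
  ∀ (X : SSet.{u}) (m : ℤ) (x : chains Λ X), x ∈ (chains Λ X).deg m → N X x ∈ (D.obj X).deg (m - c)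

variable (c : ℕ) (N : D.Op)

/-- The values on generic simplices of the operation `primitive`. -/
def primitiveGen : ∀ n, D.obj (stdSplx n)
  | 0 => (D.contr 0).h (N _ (cell Λ (generic 0)))
  -- The face sum of the previous value is the value of `primitive` on the boundary of the generic
  -- simplex. The contraction is thus applied to what the differential of the new value has to be.
  | n + 1 => (D.contr (n + 1)).h
      (N _ (cell Λ (generic (n + 1))) - psign (c : ZMod 2) • D.faceSum (primitiveGen n))

/-- A family `S` of operations with `d S + (-1)^c S d = N`. -/
def primitive : D.Op := fun _ => chainsLift fun n x => D.map (splxMap x) (primitiveGen c N n)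

lemma map_faceSum {n : ℕ} (s : D.obj (stdSplx n)) {X : SSet.{u}} (x : Splx X (n + 1)) :
    D.map (splxMap x) (D.faceSum s) =
      ∑ i : Fin (n + 2), (-1 : ℤ) ^ (i : ℕ) • D.map (splxMap (X.δ i x)) s := by
  rw [faceSum, map_sum]
  refine Finset.sum_congr rfl fun i _ => ?_
  rw [map_zsmul]
  congr 1
  have := LinearMap.congr_fun (D.map_comp (SSet.stdSimplex.map (SimplexCategory.δ i)) (splxMap x)) s
  rw [map_splxMap] at this
  exact this.symm

lemma stdSimplex_map_generic {n m : ℕ} (f : SimplexCategory.mk m ⟶ SimplexCategory.mk n) :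
    splxMap ((stdSplx.{u} n).map f.op (generic n)) = SSet.stdSimplex.map f := by
  rw [← map_splxMap]
  have : splxMap (generic.{u} n) = 𝟙 _ := by
    apply SSet.yonedaEquiv.injective
    rw [splxMap, Equiv.apply_symm_apply]
    rfl
  rw [this]
  exact Category.comp_id _

lemma chainsMap_splxMap {X : SSet.{u}} {n : ℕ} (x : Splx X n) :
    chainsMap (splxMap x) (cell Λ (generic n)) = cell Λ x := by
  rw [chainsMap_cell, splxMap_generic]

variable {c N}

/-- A degeneracy fixes the vertex 0 and so passes through the contraction. What is then contracted
is the value of `N` on a degenerate simplex, which is zero, and a face sum, which is zero by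
induction because the boundary of a degenerate simplex vanishes in normalized chains. -/
lemma primitive_degenerate (hN : IsNatural N) (n : ℕ) : ∀ (X : SSet.{u}) (x : Splx X n), x ∈ X.degenerate n →
    D.map (splxMap x) (primitiveGen c N n) = 0 := by
  induction n using Nat.strong_induction_on with
  | _ n ih =>
    intro X x hx
    cases n with
    | zero => simp at hx
    | succ n =>
      rw [SSet.degenerate_eq_iUnion_range_σ, Set.mem_iUnion] at hx
      obtain ⟨j, y, rfl⟩ := hx
      have e1 : splxMap (X.σ j y) =
          SSet.stdSimplex.map (SimplexCategory.Hom.mk ⟨j.predAbove, Fin.predAbove_right_monotone j⟩) ≫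
            splxMap y := (map_splxMap (SimplexCategory.σ j) y).symm
      have e2 : SSet.stdSimplex.map
            (SimplexCategory.Hom.mk ⟨j.predAbove, Fin.predAbove_right_monotone j⟩) =
          splxMap ((stdSplx.{u} n).σ j (generic n)) :=
        (stdSimplex_map_generic (SimplexCategory.σ j)).symm
      rw [e1, D.map_comp, LinearMap.comp_apply, primitiveGen]
      have e3 := LinearMap.congr_fun (D.map_h (n := n + 1) (m := n)
        ⟨j.predAbove, Fin.predAbove_right_monotone j⟩ (by simp))
        (N _ (cell Λ (generic (n + 1))) - psign (c : ZMod 2) • D.faceSum (primitiveGen c N n))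
      rw [LinearMap.comp_apply, LinearMap.comp_apply] at e3
      rw [e3, e2]
      have hdeg : (stdSplx.{u} n).σ j (generic n) ∈ (stdSplx.{u} n).degenerate (n + 1) :=
        SSet.σ_mem_degenerate _ _ _
      rw [map_sub, ← hN, chainsMap_splxMap, cell_degenerate hdeg, map_zero, map_zsmul, map_faceSum]
      -- Cutting off above dimension `n` lets the values on cells be computed from the induction
      -- hypothesis alone, since only dimensions at most `n` must be known to vanish on degenerate
      -- simplices.
      let T : chains Λ (stdSplx.{u} n) →ₗ[Λ] D.obj (stdSplx n) :=
        chainsLift fun k x => if k ≤ n then D.map (splxMap x) (primitiveGen c N k) else 0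
      have hT : ∀ x : Splx (stdSplx.{u} n) n,
          T (cell Λ x) = D.map (splxMap x) (primitiveGen c N n) := by
        intro x
        refine (chainsLift_cell _ (fun k x hx => ?_) x).trans (if_pos le_rfl)
        split_ifs with hk
        · exact ih k (by lia) _ x hx
        · rfl
      have h0 := congrArg T (d_cell_succ (Λ := Λ) ((stdSplx.{u} n).σ j (generic n)))
      rw [cell_degenerate hdeg, map_zero, map_zero, map_sum] at h0
      simp only [map_zsmul, hT] at h0
      rw [← h0, smul_zero, sub_zero, map_zero, map_zero]

lemma primitive_cell (hN : IsNatural N) {X : SSet.{u}} {n : ℕ} (x : Splx X n) :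
    primitive c N X (cell Λ x) = D.map (splxMap x) (primitiveGen c N n) :=
  chainsLift_cell _ (fun n x hx => primitive_degenerate hN n X x hx) x

lemma primitive_natural (hN : IsNatural N) : IsNatural (primitive c N) := by
  intro X Y f x
  have : primitive c N Y ∘ₗ chainsMap f = D.map f ∘ₗ primitive c N X :=
    chains_hom_ext fun n x => by
      rw [LinearMap.comp_apply, LinearMap.comp_apply, chainsMap_cell, primitive_cell hN,
        primitive_cell hN, ← splxMap_comp, D.map_comp, LinearMap.comp_apply]
  exact LinearMap.congr_fun this x

lemma map_splxMap_faceSum (hN : IsNatural N) {X : SSet.{u}} {n : ℕ} (x : Splx X (n + 1)) :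
    D.map (splxMap x) (D.faceSum (primitiveGen c N n)) =
      primitive c N X ((chains Λ X).d (cell Λ x)) := by
  rw [map_faceSum, d_cell_succ, map_sum]
  refine Finset.sum_congr rfl fun i _ => ?_
  rw [map_zsmul, primitive_cell hN]

lemma primitiveGen_mem (hc : Lowers N c) (n : ℕ) :
    primitiveGen c N n ∈ (D.obj (stdSplx n)).deg (-(n : ℤ) - (c + 1 : ℕ)) := by
  have h1 : ∀ n, N _ (cell Λ (generic n)) ∈ (D.obj (stdSplx n)).deg (-(n : ℤ) - c) := fun n =>
    hc _ _ _ (cell_mem _)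
  induction n with
  | zero =>
    rw [show -((0 : ℕ) : ℤ) - (c + 1 : ℕ) = (-((0 : ℕ) : ℤ) - c) - 1 by push_cast; ring]
    exact (D.contr 0).h_mem (h1 0)
  | succ n ih =>
    rw [show -((n + 1 : ℕ) : ℤ) - (c + 1 : ℕ) = (-((n + 1 : ℕ) : ℤ) - c) - 1 by push_cast; ring]
    refine (D.contr (n + 1)).h_mem (sub_mem (h1 _) (zsmul_mem (Submodule.sum_mem _ fun i _ =>
      zsmul_mem ?_ _) _))
    rw [show -((n + 1 : ℕ) : ℤ) - c = -(n : ℤ) - (c + 1 : ℕ) by push_cast; ring]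
    exact (D.isCxHom _).mem ih

lemma primitive_lowers (hN : IsNatural N) (hc : Lowers N c) : Lowers (primitive c N) (c + 1 : ℕ) := by
  intro X m x hx
  refine chains_span (((D.obj X).deg (m - (c + 1 : ℕ))).comap (primitive c N X)) (fun n x hn => ?_)
    hx
  rw [Submodule.mem_comap, primitive_cell hN, ← hn]
  exact (D.isCxHom _).mem (primitiveGen_mem hc n)

/-- By induction on dimension, the element contracted on the generic simplex is a cycle, so `h`
bounds it up to `e`. The operator `e` only sees degree 0, that is `c = 0` on vertices, where `h0`
makes `N` vanish. Naturality carries the equation to all simplices. -/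
lemma d_primitive (hN : IsNatural N) (hc : Lowers N c)
    (hd : ∀ X x, (D.obj X).d (N X x) = psign (c : ZMod 2) • N X ((chains Λ X).d x))
    (h0 : c = 0 → ∀ X (x : Splx X 0), N X (cell Λ x) = 0) (X : SSet.{u}) (x : chains Λ X) :
    (D.obj X).d (primitive c N X x) +
      psign (c : ZMod 2) • primitive c N X ((chains Λ X).d x) = N X x := by
  have key : ∀ (n : ℕ) (X : SSet.{u}) (x : Splx X n), (D.obj X).d (primitive c N X (cell Λ x)) +
      psign (c : ZMod 2) • primitive c N X ((chains Λ X).d (cell Λ x)) = N X (cell Λ x) := by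
    intro n
    induction n with
    | zero =>
      intro X x
      have h1 : (D.obj _).d (primitiveGen c N 0) = N _ (cell Λ (generic 0)) := by
        have h := (D.contr 0).homotopy (N _ (cell Λ (generic 0)))
        rw [hd, d_cell_zero, map_zero, smul_zero, map_zero, add_zero] at h
        rw [primitiveGen, h, sub_eq_self]
        by_cases hc0 : c = 0
        · rw [h0 hc0, map_zero]
        · exact (D.contr 0).e_of_ne (hc _ _ _ (cell_mem _)) (by lia)
      rw [d_cell_zero, map_zero, smul_zero, add_zero, primitive_cell hN, ← (D.isCxHom _).comm, h1,
        ← hN, chainsMap_splxMap]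
    | succ n ih =>
      intro X x
      have h2 : D.faceSum (primitiveGen c N n) =
          primitive c N _ ((chains Λ _).d (cell Λ (generic (n + 1)))) := by
        rw [← map_splxMap_faceSum hN]
        have : splxMap (generic.{u} (n + 1)) = 𝟙 _ := by
          apply SSet.yonedaEquiv.injective
          rw [splxMap, Equiv.apply_symm_apply]
          rfl
        have h3 := stdSimplex_map_generic.{u} (𝟙 (SimplexCategory.mk (n + 1)))
        rw [faceSum, map_sum]
        refine Finset.sum_congr rfl fun i _ => ?_
        rw [map_zsmul]
        congr 1
        have h4 := LinearMap.congr_fun (D.map_comp (SSet.stdSimplex.map (SimplexCategory.δ i))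
          (splxMap (generic.{u} (n + 1)))) (primitiveGen c N n)
        rw [this] at h4
        rw [this]
        exact (congrArg (fun t => D.map t (primitiveGen c N n)) (Category.comp_id _).symm).trans h4
      have h1 : (D.obj _).d (primitiveGen c N (n + 1)) = N _ (cell Λ (generic (n + 1))) -
          psign (c : ZMod 2) • D.faceSum (primitiveGen c N n) := by
        have h := (D.contr (n + 1)).homotopy
          (N _ (cell Λ (generic (n + 1))) - psign (c : ZMod 2) • D.faceSum (primitiveGen c N n))
        have h3 : (D.obj _).d (N _ (cell Λ (generic (n + 1))) -
            psign (c : ZMod 2) • D.faceSum (primitiveGen c N n)) = 0 := by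
          rw [map_sub, map_zsmul, hd, ← smul_sub, h2]
          -- The induction hypothesis is about simplices of dimension `n`; it is extended linearly
          -- to their span, which contains the boundary of the generic simplex.
          have h4 : ∀ y ∈ Submodule.span Λ (Set.range fun x : Splx (stdSplx.{u} (n + 1)) n =>
              cell Λ x), (D.obj _).d (primitive c N _ y) +
                psign (c : ZMod 2) • primitive c N _ ((chains Λ _).d y) = N _ y := by
            intro y hy
            induction hy using Submodule.span_induction with
            | mem y hy =>
              obtain ⟨z, rfl⟩ := hy
              exact ih _ z
            | zero => simp only [map_zero, smul_zero, add_zero]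
            | add y y' _ _ hy hy' =>
              simp only [map_add, smul_add]
              rw [← hy, ← hy']
              abel
            | smul r y _ hy =>
              simp only [map_smul]
              rw [← hy, smul_add, smul_comm]
          have h5 := h4 ((chains Λ _).d (cell Λ (generic (n + 1)))) (by
            rw [d_cell_succ]
            exact Submodule.sum_mem _ fun i _ => zsmul_mem (Submodule.subset_span (Set.mem_range_self _)) _)
          rw [Cx.d_d, map_zero, smul_zero, add_zero] at h5
          rw [h5, sub_self, smul_zero]
        rw [h3, map_zero, add_zero] at h
        rw [primitiveGen, h, sub_eq_self]
        refine (D.contr (n + 1)).e_of_ne (n := -((n + 1 : ℕ) : ℤ) - c) (sub_mem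
          (hc _ _ _ (cell_mem _)) (zsmul_mem (Submodule.sum_mem _ fun i _ => zsmul_mem ?_ _) _))
          (by push_cast; lia)
        rw [show -((n + 1 : ℕ) : ℤ) - c = -(n : ℤ) - (c + 1 : ℕ) by push_cast; ring]
        exact (D.isCxHom _).mem (primitiveGen_mem hc n)
      rw [primitive_cell hN, ← (D.isCxHom _).comm, h1, map_sub, ← hN, chainsMap_splxMap, map_zsmul,
        map_splxMap_faceSum hN, sub_add_cancel]
  have : (D.obj X).d ∘ₗ primitive c N X +
      psign (c : ZMod 2) • (primitive c N X ∘ₗ (chains Λ X).d) = N X :=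
    chains_hom_ext fun n x => by
      rw [LinearMap.add_apply, zsmul_linearMap_apply]
      exact key n X x
  rw [← this, LinearMap.add_apply, zsmul_linearMap_apply]
  rfl

end ModelFunctor

/-! ### Sequences of natural operations bounding a twisted cycle -/

namespace ModelFunctor

variable {D : ModelFunctor.{u} Λ}

/-- A natural family of endomorphisms of complexes. -/
structure IsNaturalEnd (B : ∀ X, D.obj X →ₗ[Λ] D.obj X) : Prop where
  isCxHom : ∀ X, IsCxHom (B X)
  natural : ∀ {X Y : SSet.{u}} (f : X ⟶ Y) (y : D.obj X), B Y (D.map f y) = D.map f (B X y)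

/-- A sequence of natural operations, of degrees `-i`, which solves a twisted cycle equation. -/
structure IsTwistedCycle (B : ℕ → ∀ X, D.obj X →ₗ[Λ] D.obj X) (E : ℕ → D.Op) : Prop where
  natural : ∀ i, IsNatural (E i)
  lowers : ∀ i, Lowers (E i) i
  d_zero : ∀ X x, (D.obj X).d (E 0 X x) = E 0 X ((chains Λ X).d x)
  d_succ : ∀ i X x, (D.obj X).d (E (i + 1) X x) =
    B i X (E i X x) + psign ((i + 1 : ℕ) : ZMod 2) • E (i + 1) X ((chains Λ X).d x)
  vertex : ∀ X (x : Splx X 0), E 0 X (cell Λ x) = 0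

/-- A sequence of operations which bounds a twisted cycle. -/
def bounding (B : ℕ → ∀ X, D.obj X →ₗ[Λ] D.obj X) (E : ℕ → D.Op) : ℕ → D.Op
  | 0 => primitive 0 (E 0)
  | i + 1 => primitive (i + 1) fun X => E (i + 1) X - B i X ∘ₗ bounding B E i X

variable {B : ℕ → ∀ X, D.obj X →ₗ[Λ] D.obj X} {E : ℕ → D.Op}

/-- The equation at stage `i` contains a correction from stage `i - 1` if `i > 0` and none if `i =
0`. Applying `B i` removes the correction, because consecutive operators compose to zero. The
induction therefore carries the image of the equation under `B i`, which has the same form at every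
stage and is just what makes the next right-hand side compatible with the differentials. -/
lemma IsTwistedCycle.bounding_spec (hE : IsTwistedCycle B E) (hB : ∀ i, IsNaturalEnd (B i))
    (hBB : ∀ i X y, B (i + 1) X (B i X y) = 0) (i : ℕ) :
    (IsNatural (bounding B E i) ∧ Lowers (bounding B E i) (i + 1 : ℕ)) ∧
    (IsNatural (bounding B E (i + 1)) ∧ Lowers (bounding B E (i + 1)) (i + 1 + 1 : ℕ)) ∧
    ((∀ X x, B i X ((D.obj X).d (bounding B E i X x)) +
        psign (i : ZMod 2) • B i X (bounding B E i X ((chains Λ X).d x)) = B i X (E i X x))) ∧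
    (∀ X x, (D.obj X).d (bounding B E (i + 1) X x) +
        psign ((i + 1 : ℕ) : ZMod 2) • bounding B E (i + 1) X ((chains Λ X).d x) =
          E (i + 1) X x - B i X (bounding B E i X x)) := by
  have step : ∀ i, (IsNatural (bounding B E i) ∧ Lowers (bounding B E i) (i + 1 : ℕ)) →
      (∀ X x, B i X ((D.obj X).d (bounding B E i X x)) +
        psign (i : ZMod 2) • B i X (bounding B E i X ((chains Λ X).d x)) = B i X (E i X x)) →
      (IsNatural (bounding B E (i + 1)) ∧ Lowers (bounding B E (i + 1)) (i + 1 + 1 : ℕ)) ∧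
      (∀ X x, (D.obj X).d (bounding B E (i + 1) X x) +
        psign ((i + 1 : ℕ) : ZMod 2) • bounding B E (i + 1) X ((chains Λ X).d x) =
          E (i + 1) X x - B i X (bounding B E i X x)) := by
    rintro i ⟨h1, h2⟩ h3
    have hN : IsNatural (D := D) fun X => E (i + 1) X - B i X ∘ₗ bounding B E i X := by
      intro X Y f x
      simp only [LinearMap.sub_apply, LinearMap.comp_apply, map_sub]
      rw [hE.natural, h1, (hB i).natural]
    have hL : Lowers (D := D) (fun X => E (i + 1) X - B i X ∘ₗ bounding B E i X) (i + 1 : ℕ) :=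
      fun X m x hx => sub_mem (hE.lowers _ X m x hx) (((hB i).isCxHom X).mem (h2 X m x hx))
    refine ⟨⟨primitive_natural hN, primitive_lowers hN hL⟩, d_primitive hN hL (fun X x => ?_)
      fun h => absurd h (Nat.succ_ne_zero i)⟩
    simp only [LinearMap.sub_apply, LinearMap.comp_apply, map_sub]
    rw [hE.d_succ, ← ((hB i).isCxHom X).comm, ← h3, smul_sub]
    push_cast
    rw [psign_add, psign_one, mul_neg_one, neg_smul, neg_smul]
    abel
  have key : ∀ i, (IsNatural (bounding B E i) ∧ Lowers (bounding B E i) (i + 1 : ℕ)) ∧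
      (∀ X x, B i X ((D.obj X).d (bounding B E i X x)) +
        psign (i : ZMod 2) • B i X (bounding B E i X ((chains Λ X).d x)) = B i X (E i X x)) := by
    intro i
    induction i with
    | zero =>
      refine ⟨⟨primitive_natural (hE.natural 0), primitive_lowers (hE.natural 0) (hE.lowers 0)⟩,
        fun X x => ?_⟩
      rw [← map_zsmul, ← map_add]
      exact congrArg _ (d_primitive (hE.natural 0) (hE.lowers 0) (fun X x => by
        rw [hE.d_zero]; exact (one_smul _ _).symm) (fun _ => hE.vertex) X x)
    | succ i ih =>
      obtain ⟨h1, h2⟩ := step i ih.1 ih.2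
      refine ⟨h1, fun X x => ?_⟩
      rw [← map_zsmul, ← map_add, h2, map_sub, hBB, sub_zero]
  exact ⟨(key i).1, (key (i + 1)).1, (key i).2, (step i (key i).1 (key i).2).2⟩

lemma IsTwistedCycle.bounding_natural (hE : IsTwistedCycle B E) (hB : ∀ i, IsNaturalEnd (B i))
    (hBB : ∀ i X y, B (i + 1) X (B i X y) = 0) (i : ℕ) : IsNatural (bounding B E i) :=
  (hE.bounding_spec hB hBB i).1.1

lemma IsTwistedCycle.bounding_lowers (hE : IsTwistedCycle B E) (hB : ∀ i, IsNaturalEnd (B i))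
    (hBB : ∀ i X y, B (i + 1) X (B i X y) = 0) (i : ℕ) : Lowers (bounding B E i) (i + 1 : ℕ) :=
  (hE.bounding_spec hB hBB i).1.2

lemma IsTwistedCycle.d_bounding_zero (hE : IsTwistedCycle B E) (X : SSet.{u}) (x : chains Λ X) :
    (D.obj X).d (bounding B E 0 X x) + bounding B E 0 X ((chains Λ X).d x) = E 0 X x := by
  have := d_primitive (hE.natural 0) (hE.lowers 0) (fun X x => by
    rw [hE.d_zero]; exact (one_smul _ _).symm) (fun _ => hE.vertex) X x
  rwa [Nat.cast_zero, psign_zero, one_smul] at this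

lemma IsTwistedCycle.d_bounding_succ (hE : IsTwistedCycle B E) (hB : ∀ i, IsNaturalEnd (B i))
    (hBB : ∀ i X y, B (i + 1) X (B i X y) = 0) (i : ℕ) (X : SSet.{u}) (x : chains Λ X) :
    (D.obj X).d (bounding B E (i + 1) X x) +
        psign ((i + 1 : ℕ) : ZMod 2) • bounding B E (i + 1) X ((chains Λ X).d x) =
      E (i + 1) X x - B i X (bounding B E i X x) :=
  (hE.bounding_spec hB hBB i).2.2.2 X x

/-- A natural operation of degree `0` is a chain map as soon as it is compatible with the
contractions on generic simplices. -/
lemma isCxHom_of_contr {N : D.Op} (hN : IsNatural N) (hc : Lowers N 0)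
    (h0 : (D.obj _).d (N _ (cell Λ (generic 0))) = 0)
    (h1 : (D.contr 1).e (N _ ((chains Λ _).d (cell Λ (generic 1)))) = 0)
    (h : ∀ n, N _ (cell Λ (generic (n + 1))) =
      (D.contr (n + 1)).h (N _ ((chains Λ _).d (cell Λ (generic (n + 1))))))
    (X : SSet.{u}) : IsCxHom (N X) := by
  refine ⟨fun hx => by simpa using hc X _ _ hx, fun x => ?_⟩
  have key : ∀ (n : ℕ) (X : SSet.{u}) (x : Splx X n),
      N X ((chains Λ X).d (cell Λ x)) = (D.obj X).d (N X (cell Λ x)) := by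
    intro n
    induction n with
    | zero =>
      intro X x
      rw [d_cell_zero, map_zero, ← chainsMap_splxMap x, hN, ← (D.isCxHom _).comm, h0, map_zero]
    | succ n ih =>
      intro X x
      -- By induction the value on the boundary of the generic simplex is a cycle; `h` of it is the
      -- value on the simplex, so the homotopy identity gives the differential of the latter once
      -- `e` is known to vanish.
      have h2 : (D.obj _).d (N _ ((chains Λ _).d (cell Λ (generic (n + 1))))) = 0 := by
        have h4 : ∀ y ∈ Submodule.span Λ (Set.range fun x : Splx (stdSplx.{u} (n + 1)) n =>
            cell Λ x), N _ ((chains Λ _).d y) = (D.obj _).d (N _ y) := by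
          intro y hy
          induction hy using Submodule.span_induction with
          | mem y hy =>
            obtain ⟨z, rfl⟩ := hy
            exact ih _ z
          | zero => simp only [map_zero]
          | add y y' _ _ hy hy' => simp only [map_add, hy, hy']
          | smul r y _ hy => simp only [map_smul, hy]
        rw [← h4, Cx.d_d, map_zero]
        rw [d_cell_succ]
        exact Submodule.sum_mem _ fun i _ =>
          zsmul_mem (Submodule.subset_span (Set.mem_range_self _)) _
      -- The value on the boundary has degree 0 only for the generic edge, where `h1` is used; in
      -- higher dimensions `e` vanishes for reasons of degree.
      have h3 : (D.contr (n + 1)).e (N _ ((chains Λ _).d (cell Λ (generic (n + 1))))) = 0 := by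
        cases n with
        | zero => exact h1
        | succ n =>
          refine (D.contr _).e_of_ne (n := -((n + 1 + 1 : ℕ) : ℤ) + 1 - 0)
            (hc _ _ _ (Cx.d_mem _ (cell_mem _))) (by push_cast; lia)
      have h4 := (D.contr (n + 1)).homotopy (N _ ((chains Λ _).d (cell Λ (generic (n + 1)))))
      rw [h2, h3, map_zero, add_zero, sub_zero, ← h] at h4
      rw [← chainsMap_splxMap x, ← chainsMap_d, hN, hN, ← (D.isCxHom _).comm, h4]
  have : N X ∘ₗ (chains Λ X).d = (D.obj X).d ∘ₗ N X := chains_hom_ext (key · X)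
  exact LinearMap.congr_fun this x

end ModelFunctor

/-! ### Alexander-Whitney maps are chain maps -/

section AlexanderWhitney

lemma exists_collapsed {n m : ℕ} (f : SimplexCategory.mk n ⟶ SimplexCategory.mk m) (hm : m < n) :
    ∃ j : ℕ, ∃ h : j + 1 < n + 1, f.toOrderHom ⟨j, by lia⟩ = f.toOrderHom ⟨j + 1, h⟩ := by
  by_contra! hne
  have hs : StrictMono f.toOrderHom := by
    rw [Fin.strictMono_iff_lt_succ]
    intro i
    exact lt_of_le_of_ne (f.toOrderHom.monotone (Fin.castSucc_le_succ i)) (hne i.1 (by lia))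
  have := Fintype.card_le_of_injective _ hs.injective
  simp at this
  lia

/-- The segment contains the vertices `j` and `j + 1`, which `f` identifies, so it is degenerate. -/
lemma seg_map_eq_zero {L : SSet.{u}} {n m : ℕ} (f : SimplexCategory.mk n ⟶ SimplexCategory.mk m)
    {j : ℕ} (hj : j + 1 < n + 1) (hjf : f.toOrderHom ⟨j, by lia⟩ = f.toOrderHom ⟨j + 1, hj⟩)
    (t : Splx L m) {a k : ℕ} (ha : a ≤ j) (hk : j + 1 ≤ a + k) :
    seg Λ (L.map f.op t) a k = 0 := by
  rw [seg]
  split_ifs with h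
  · have : L.map (SimplexCategory.subinterval a k h).op (L.map f.op t) =
        L.map (SimplexCategory.subinterval a k h ≫ f).op t := by
      rw [op_comp, Functor.map_comp]
      rfl
    rw [this]
    refine cell_degenerate (map_degenerate_of_not_injective _ (fun hinj => ?_) t)
    have := @hinj ⟨j - a, by lia⟩ ⟨j + 1 - a, by lia⟩ (by
      change f.toOrderHom ⟨j - a + a, _⟩ = f.toOrderHom ⟨j + 1 - a + a, _⟩
      simpa [show j - a + a = j by lia, show j + 1 - a + a = j + 1 by lia] using! hjf)
    simp only [Fin.mk.injEq] at this
    lia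
  · rfl

/-- The consecutive blocks of lengths `k i` fill the interval from 0 to `n`, so one of them contains
the edge from `j` to `j + 1`; otherwise no partial sum would ever exceed `j`. -/
lemma exists_block {p n j : ℕ} (k : Fin p → ℕ) (hk : ∑ i, k i = n) (hj : j < n) :
    ∃ i, ∑ l ∈ Finset.univ.filter (· < i), k l ≤ j ∧
      j + 1 ≤ ∑ l ∈ Finset.univ.filter (· < i), k l + k i := by
  by_contra! h
  have key : ∀ m ≤ p, ∑ l ∈ Finset.univ.filter (fun l : Fin p => (l : ℕ) < m), k l ≤ j := by
    intro m
    induction m with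
    | zero => simp
    | succ m ih =>
      intro hm
      have e : Finset.univ.filter (fun l : Fin p => (l : ℕ) < m + 1) =
          insert ⟨m, hm⟩ (Finset.univ.filter (fun l : Fin p => (l : ℕ) < m)) := by
        ext l
        simp [Fin.ext_iff]
        lia
      rw [e, Finset.sum_insert (by simp), add_comm]
      have h1 := ih (by lia)
      exact Nat.lt_succ_iff.1 (h ⟨m, hm⟩ h1)
  have := key p le_rfl
  rw [Finset.filter_true_of_mem (fun l _ => l.2), hk] at this
  lia

variable {p : ℕ}

variable (Λ) in
/-- The Alexander-Whitney image of a simplex of a product. -/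
def awPiFun {L : Fin p → SSet.{u}} (m : ℕ) (x : Splx (piProd L) m) : ⨂[Λ] i, chains Λ (L i) :=
  ∑ k ∈ Finset.piAntidiag (Finset.univ : Finset (Fin p)) m,
    PiTensorProduct.tprod Λ fun i =>
      seg Λ (L := L i) (x i) (∑ j ∈ Finset.univ.filter (· < i), k j) (k i)

/-- In every summand the edge collapsed by the degeneracy lies in one of the blocks, and the tensor
factor belonging to that block is degenerate. -/
lemma awPiFun_degenerate {L : Fin p → SSet.{u}} (m : ℕ) (x : Splx (piProd L) m)
    (hx : x ∈ (piProd L).degenerate m) : awPiFun Λ m x = 0 := by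
  obtain ⟨q, hq, f, y, rfl⟩ := hx
  obtain ⟨j, hj, hjf⟩ := exists_collapsed f hq
  refine Finset.sum_eq_zero fun k hk => ?_
  rw [Finset.mem_piAntidiag] at hk
  obtain ⟨i, h1, h2⟩ := exists_block k hk.1 (Nat.lt_of_succ_lt_succ hj)
  exact MultilinearMap.map_coord_zero _ i (seg_map_eq_zero f hj hjf (y i) h1 h2)

lemma awPi_cell {L : Fin p → SSet.{u}} {m : ℕ} (x : Splx (piProd L) m) :
    awPi L (cell Λ x) = awPiFun Λ m x :=
  chainsLift_cell _ awPiFun_degenerate x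

lemma awPi_naturality {L S : Fin p → SSet.{u}} (f : ∀ i, L i ⟶ S i) (z : chains Λ (piProd L)) :
    awPi S (chainsMap (piProdMap f) z) =
      PiTensorProduct.map (fun i => chainsMap (f i)) (awPi L z) := by
  have : awPi (Λ := Λ) S ∘ₗ chainsMap (piProdMap f) =
      PiTensorProduct.map (fun i => chainsMap (f i)) ∘ₗ awPi L := by
    refine chains_hom_ext fun n x => ?_
    rw [LinearMap.comp_apply, LinearMap.comp_apply, chainsMap_cell, awPi_cell, awPi_cell, awPiFun,
      awPiFun, map_sum]
    refine Finset.sum_congr rfl fun k _ => ?_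
    rw [PiTensorProduct.map_tprod]
    congr 1
    funext i
    exact (seg_naturality (f i) _ _ _).symm
  exact LinearMap.congr_fun this z

lemma awPi_mem {L : Fin p → SSet.{u}} {m : ℤ} {z : chains Λ (piProd L)}
    (hz : z ∈ (chains Λ (piProd L)).deg m) :
    awPi L z ∈ (Cx.piTensor fun i => chains Λ (L i)).deg m := by
  refine chains_span (((Cx.piTensor fun i => chains Λ (L i)).deg m).comap (awPi L))
    (fun n x hn => ?_) hz
  rw [Submodule.mem_comap, awPi_cell]
  refine Submodule.sum_mem _ fun k hk => ?_
  rw [Finset.mem_piAntidiag] at hk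
  have : m = ∑ i, -(k i : ℤ) := by
    rw [← hn, ← hk.1, Finset.sum_neg_distrib]
    push_cast
    rfl
  rw [this]
  exact Cx.tprod_mem fun i => seg_mem _ _ _

lemma aw_mem {L S : SSet.{u}} {m : ℤ} {z : chains Λ (prod L S)}
    (hz : z ∈ (chains Λ (prod L S)).deg m) :
    aw L S z ∈ ((chains Λ L).tensor (chains Λ S)).deg m := by
  refine chains_span ((((chains Λ L).tensor (chains Λ S)).deg m).comap (aw L S))
    (fun n x hn => ?_) hz
  rw [Submodule.mem_comap, aw_cell]
  refine Submodule.sum_mem _ fun k hk => ?_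
  rw [Finset.mem_range] at hk
  have : m = -(k : ℤ) + -((n - k : ℕ) : ℤ) := by lia
  rw [this]
  exact Cx.tmul_mem (seg_mem _ _ _) (seg_mem _ _ _)

/-! #### Segments of the generic simplex -/

lemma seg_δ_zero_generic (n a k : ℕ) :
    seg Λ ((stdSplx.{u} (n + 1)).δ 0 (generic (n + 1))) a k =
      seg Λ (generic.{u} (n + 1)) (a + 1) k := by
  rw [seg, seg]
  by_cases h : a + k ≤ n
  · rw [dif_pos h, dif_pos (by lia)]
    rfl
  · rw [dif_neg h, dif_neg (by lia)]

/-- The cone puts the vertex 0 in front of the vertices starting at 1; when the segment does not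
fit, both sides are zero by convention. -/
lemma coneH_seg_generic (n k : ℕ) :
    coneH Λ n (seg Λ (generic.{u} n) 1 k) = seg Λ (generic.{u} n) 0 (k + 1) := by
  rw [seg, seg]
  by_cases h : 1 + k ≤ n
  · rw [dif_pos h, dif_pos (by lia), coneH_cell]
    congr 1
    change mkSplx _ = mkSplx _
    congr 1
    ext j : 2
    induction j using Fin.cases with
    | zero => rfl
    | succ j => rfl
  · rw [dif_neg h, dif_neg (by lia), map_zero]

lemma seg_generic_zero (n : ℕ) : seg Λ (generic.{u} n) 0 0 = cell Λ (origin n) := by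
  rw [seg, dif_pos (by lia)]
  congr 1
  change mkSplx _ = mkSplx _
  congr 1
  ext j : 2
  have : j = 0 := Subsingleton.elim (α := Fin 1) _ _
  subst this
  rfl

lemma coneE_seg {n m : ℕ} (x : Splx (stdSplx.{u} n) m) {a k : ℕ} (h : a + k ≤ m) :
    coneE Λ n (seg Λ x a k) = if k = 0 then cell Λ (origin n) else 0 := by
  rw [seg, dif_pos h, coneE_cell]

lemma coneE_seg_of_ne {n m : ℕ} (x : Splx (stdSplx.{u} n) m) (a : ℕ) {k : ℕ} (hk : k ≠ 0) :
    coneE Λ n (seg Λ x a k) = 0 := by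
  rw [seg]
  split_ifs
  · rw [coneE_cell, if_neg hk]
  · exact map_zero _

/-- Putting 0 in front of a simplex that already starts with 0 repeats a vertex. -/
lemma coneH_cell_of_zero {n k : ℕ} (f : Fin (k + 1) →o Fin (n + 1)) (hf : f 0 = 0) :
    coneH Λ n (cell Λ (mkSplx.{u} f)) = 0 := by
  rw [coneH_cell, cone_mkSplx]
  have : mkSplx.{u} (consZero f) = (stdSplx n).σ 0 (mkSplx f) := by
    rw [σ_mkSplx]
    congr 1
    ext j : 2
    induction j using Fin.cases with
    | zero => simp [hf]
    | succ j =>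
      simp only [consZero_succ, OrderHom.comp_coe, Function.comp_apply, OrderHom.coe_mk]
      rw [Fin.predAbove_zero_succ]
  rw [this]
  exact cell_degenerate (SSet.σ_mem_degenerate _ _ _)

/-- The faces other than the one opposite to 0 still begin with the vertex 0, and so do their
initial segments. -/
lemma coneH_seg_δ_succ (n k : ℕ) (i : Fin (n + 1)) :
    coneH Λ (n + 1) (seg Λ ((stdSplx.{u} (n + 1)).δ i.succ (generic (n + 1))) 0 k) = 0 := by
  rw [seg]
  split_ifs with h
  · exact coneH_cell_of_zero (((OrderHom.id.comp (Fin.succAboveOrderEmb i.succ).toOrderHom)).comp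
      (SimplexCategory.subinterval 0 k h).toOrderHom) (Fin.succ_succAbove_zero i)
  · exact map_zero _

/-- The contraction applied to an operation on the boundary of the generic simplex only sees the
face opposite to the vertex `0`, if the other faces do not contribute. -/
lemma ModelFunctor.contr_d_generic {D : ModelFunctor.{u} Λ} (N : D.Op) (n : ℕ)
    (h : ∀ i : Fin (n + 1), (D.contr (n + 1)).h
      (N _ (cell Λ ((stdSplx.{u} (n + 1)).δ i.succ (generic (n + 1))))) = 0) :
    (D.contr (n + 1)).h (N _ ((chains Λ _).d (cell Λ (generic (n + 1))))) =
      (D.contr (n + 1)).h (N _ (cell Λ ((stdSplx.{u} (n + 1)).δ 0 (generic (n + 1))))) := by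
  rw [d_cell_succ, Fin.sum_univ_succ, map_add, map_add, map_sum, map_sum, Finset.sum_eq_zero]
  · simp
  · intro i _
    rw [map_zsmul, map_zsmul, h, smul_zero]

/-- The boundary of the edge is the difference of its two endpoints, on which the operator takes the
same value. -/
lemma ModelFunctor.e_d_generic {D : ModelFunctor.{u} Λ} (N : D.Op) (y : D.obj (stdSplx 1))
    (h : ∀ i : Fin 2, (D.contr 1).e (N _ (cell Λ ((stdSplx.{u} 1).δ i (generic 1)))) = y) :
    (D.contr 1).e (N _ ((chains Λ _).d (cell Λ (generic 1)))) = 0 := by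
  rw [d_cell_succ, Fin.sum_univ_two, map_add, map_add, map_zsmul, map_zsmul, map_zsmul, map_zsmul,
    h, h]
  simp

/-! #### Two factors -/

/-- The diagonal of a simplicial set. -/
def diagTwo (X : SSet.{u}) : X ⟶ prod X X := CartesianMonoidalCategory.lift (𝟙 X) (𝟙 X)

variable (Λ) in
/-- The Alexander-Whitney diagonal approximation. -/
def awDiagTwo (X : SSet.{u}) : chains Λ X →ₗ[Λ] (chains Λ X).tensor (chains Λ X) :=
  aw X X ∘ₗ chainsMap (diagTwo X)

lemma awDiagTwo_cell {X : SSet.{u}} {n : ℕ} (x : Splx X n) :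
    awDiagTwo Λ X (cell Λ x) = ∑ i ∈ Finset.range (n + 1), seg Λ x 0 i ⊗ₜ[Λ] seg Λ x i (n - i) := by
  rw [awDiagTwo, LinearMap.comp_apply, chainsMap_cell, aw_cell]
  rfl

lemma awDiagTwo_natural {X Y : SSet.{u}} (f : X ⟶ Y) (x : chains Λ X) :
    awDiagTwo Λ Y (chainsMap f x) =
      TensorProduct.map (chainsMap f) (chainsMap f) (awDiagTwo Λ X x) := by
  have : chainsMap (Λ := Λ) (diagTwo Y) ∘ₗ chainsMap f =
      chainsMap (prodMap f f) ∘ₗ chainsMap (diagTwo X) := by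
    rw [← chainsMap_comp, ← chainsMap_comp]
    rfl
  have h := LinearMap.congr_fun this x
  exact (congrArg (aw Y Y) h).trans (aw_naturality f f _)

lemma d_seg_zero {X : SSet.{u}} {n : ℕ} (x : Splx X n) (a : ℕ) :
    (chains Λ X).d (seg Λ x a 0) = 0 := by
  rw [seg]
  split_ifs
  · exact d_cell_zero _
  · exact map_zero _

/-- The criterion `isCxHom_of_contr` applies. In the contraction `h ⊗ 1 + e ⊗ h`, the first part
extends the left segments of the face opposite to 0 by the vertex 0, which gives all summands of the
value on the simplex but one. The missing summand, vertex 0 tensor the whole simplex, comes from the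
second part. -/
lemma isCxHom_awDiagTwo (X : SSet.{u}) : IsCxHom (awDiagTwo Λ X) := by
  refine ModelFunctor.isCxHom_of_contr (D := (ModelFunctor.ofChains Λ).tensor
    (ModelFunctor.ofChains Λ)) (N := awDiagTwo Λ) awDiagTwo_natural (fun X m x hx => ?_) ?_ ?_
    (fun n => ?_) X
  · rw [sub_zero]
    exact aw_mem (chainsMap_mem _ hx)
  · rw [awDiagTwo_cell, Finset.sum_range_one]
    refine (Cx.tensor_d_tmul _ (seg_mem _ _ _)).trans ?_
    rw [Nat.sub_zero, d_seg_zero, zero_tmul, tmul_zero, zero_add]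
    exact smul_zero _
  · refine ModelFunctor.e_d_generic (D := (ModelFunctor.ofChains Λ).tensor
      (ModelFunctor.ofChains Λ)) (awDiagTwo Λ) (cell Λ (origin 1) ⊗ₜ[Λ] cell Λ (origin 1))
      fun i => ?_
    rw [awDiagTwo_cell, Finset.sum_range_one]
    change coneE Λ 1 _ ⊗ₜ[Λ] coneE Λ 1 _ = _
    rw [coneE_seg _ (by lia), if_pos rfl]
  · have hh : ∀ a b : chains Λ (stdSplx.{u} (n + 1)), (((ModelFunctor.ofChains Λ).tensor
        (ModelFunctor.ofChains Λ)).contr (n + 1)).h (a ⊗ₜ[Λ] b) =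
          coneH Λ (n + 1) a ⊗ₜ[Λ] b + coneE Λ (n + 1) a ⊗ₜ[Λ] coneH Λ (n + 1) b := fun a b => rfl
    rw [ModelFunctor.contr_d_generic]
    · rw [awDiagTwo_cell, awDiagTwo_cell, map_sum, Finset.sum_congr rfl fun i _ => hh _ _,
        Finset.sum_add_distrib, Finset.sum_range_succ' _ (n + 1)]
      simp only [seg_δ_zero_generic, zero_add]
      congr 1
      · refine Finset.sum_congr rfl fun i hi => ?_
        rw [coneH_seg_generic]
        congr 2
        lia
      · rw [Finset.sum_range_succ', Finset.sum_eq_zero, zero_add, zero_add, coneH_seg_generic,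
          coneE_seg _ (by lia), if_pos rfl, seg_generic_zero, Nat.sub_zero, Nat.sub_zero]
        intro i _
        rw [coneE_seg_of_ne _ _ (Nat.succ_ne_zero i), zero_tmul]
    · intro i
      rw [awDiagTwo_cell, map_sum, Finset.sum_congr rfl fun i _ => hh _ _]
      refine Finset.sum_eq_zero fun j _ => ?_
      rw [coneH_seg_δ_succ, zero_tmul, zero_add]
      cases j with
      | zero => rw [coneH_seg_δ_succ, tmul_zero]
      | succ j => rw [coneE_seg_of_ne _ _ (Nat.succ_ne_zero j), zero_tmul]

/-- A product is recovered from its diagonal followed by the two projections, so naturality reduces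
the case of two simplicial sets to the diagonal of one. -/
lemma isCxHom_aw (L S : SSet.{u}) : IsCxHom (aw (Λ := Λ) L S) := by
  have : aw (Λ := Λ) L S = TensorProduct.map
      (chainsMap (SemiCartesianMonoidalCategory.fst L S))
      (chainsMap (SemiCartesianMonoidalCategory.snd L S)) ∘ₗ awDiagTwo Λ (prod L S) := by
    refine chains_hom_ext fun n x => ?_
    rw [LinearMap.comp_apply, awDiagTwo, LinearMap.comp_apply]
    refine Eq.trans ?_ (aw_naturality _ _ _)
    rw [← LinearMap.comp_apply (chainsMap (prodMap _ _)), ← chainsMap_comp]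
    have : diagTwo (prod L S) ≫ prodMap (SemiCartesianMonoidalCategory.fst L S)
      (SemiCartesianMonoidalCategory.snd L S) = 𝟙 _ := rfl
    rw [this, chainsMap_id, LinearMap.id_apply]
  rw [this]
  exact ((isCxHom_chainsMap _).tensorMap (isCxHom_chainsMap _)).comp (isCxHom_awDiagTwo _)

/-! #### Several factors -/

variable (Λ p) in
/-- The iterated Alexander-Whitney diagonal approximation. -/
def awDiag (X : SSet.{u}) : chains Λ X →ₗ[Λ] (chains Λ X).pow p :=
  awPi (fun _ => X) ∘ₗ chainsMap (diag p X)

lemma awDiag_cell {X : SSet.{u}} {n : ℕ} (x : Splx X n) :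
    awDiag Λ p X (cell Λ x) = ∑ k ∈ Finset.piAntidiag (Finset.univ : Finset (Fin p)) n,
      PiTensorProduct.tprod Λ fun i =>
        seg Λ x (∑ j ∈ Finset.univ.filter (· < i), k j) (k i) := by
  rw [awDiag, LinearMap.comp_apply, chainsMap_cell, awPi_cell]
  rfl

lemma awDiag_natural {X Y : SSet.{u}} (f : X ⟶ Y) (x : chains Λ X) :
    awDiag Λ p Y (chainsMap f x) =
      PiTensorProduct.map (fun _ => chainsMap f) (awDiag Λ p X x) := by
  have : chainsMap (Λ := Λ) (diag p Y) ∘ₗ chainsMap f =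
      chainsMap (piProdMap fun _ => f) ∘ₗ chainsMap (diag p X) := by
    rw [← chainsMap_comp, ← chainsMap_comp]
    rfl
  have h := LinearMap.congr_fun this x
  exact (congrArg (awPi fun _ => Y) h).trans (awPi_naturality (fun _ => f) _)

/-- As for two factors, the contraction of the value on the face opposite to 0 reproduces the value
on the generic simplex. The summand of the contraction with `h` in position `i`, applied to the
partition `k`, gives the summand of the partition obtained by raising `k i` by one. -/
lemma isCxHom_awDiag (X : SSet.{u}) : IsCxHom (awDiag Λ p X) := by
  refine ModelFunctor.isCxHom_of_contr (D := (ModelFunctor.ofChains Λ).pow p)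
    (N := awDiag Λ p) awDiag_natural (fun X m x hx => ?_) ?_ ?_ (fun n => ?_) X
  · rw [sub_zero]
    exact awPi_mem (chainsMap_mem _ hx)
  · rw [awDiag_cell, Finset.piAntidiag_zero, Finset.sum_singleton]
    refine (LinearMap.sum_apply _ _ _).trans (Finset.sum_eq_zero fun i _ => ?_)
    rw [Cx.piD, PiTensorProduct.map_tprod]
    refine MultilinearMap.map_coord_zero _ i ?_
    rw [if_neg (lt_irrefl i), if_pos rfl]
    exact d_seg_zero _ _
  · refine ModelFunctor.e_d_generic (D := (ModelFunctor.ofChains Λ).pow p) (awDiag Λ p)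
      (PiTensorProduct.tprod Λ fun _ => cell Λ (origin 1)) fun i => ?_
    rw [awDiag_cell, Finset.piAntidiag_zero, Finset.sum_singleton]
    refine (PiTensorProduct.map_tprod _ _).trans ?_
    congr 1
    funext i
    change coneE Λ 1 _ = _
    rw [coneE_seg _ (by simp)]
    exact if_pos rfl
  · have hh : ∀ x : Fin p → chains Λ (stdSplx.{u} (n + 1)),
        (((ModelFunctor.ofChains Λ).pow p).contr (n + 1)).h (PiTensorProduct.tprod Λ x) =
          ∑ i, PiTensorProduct.tprod Λ fun j => if j < i then coneE Λ (n + 1) (x j) else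
            if j = i then coneH Λ (n + 1) (x j) else x j := by
      intro x
      refine (LinearMap.sum_apply _ _ _).trans (Finset.sum_congr rfl fun i _ => ?_)
      rw [Cx.Contraction.piH, PiTensorProduct.map_tprod]
      congr 1
      funext j
      split_ifs <;> rfl
    have hs : ∀ (k : Fin p → ℕ) (i : Fin p), (∀ j < i, k j = 0) → ∀ j ≤ i,
        ∑ l ∈ Finset.univ.filter (· < j), k l = 0 := fun k i hk j hj =>
      Finset.sum_eq_zero fun l hl => hk l ((Finset.mem_filter.1 hl).2.trans_le hj)
    rw [ModelFunctor.contr_d_generic]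
    · rw [awDiag_cell, awDiag_cell, map_sum, Finset.sum_congr rfl fun k _ => hh _]
      simp only [seg_δ_zero_generic]
      -- In the positions before `i` stands `e`, which kills segments of positive dimension, so only
      -- pairs with `k j = 0` for all `j < i` contribute.
      rw [Finset.sum_sigma', ← Finset.sum_filter_of_ne (s := Finset.sigma _ _)
        (p := fun ki : (_ : Fin p → ℕ) × Fin p => ∀ j < ki.2, ki.1 j = 0)]
      · symm
        refine Finset.sum_bij (fun ki _ => ki.1 + Pi.single ki.2 1) ?_ ?_ ?_ ?_
        · rintro ⟨k, i⟩ hki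
          simp only [Finset.mem_filter, Finset.mem_sigma, Finset.mem_piAntidiag] at hki ⊢
          refine ⟨?_, by simp⟩
          simp [Finset.sum_add_distrib, hki.1.1.1]
        · rintro ⟨k, i⟩ hki ⟨k', i'⟩ hki' h
          have h1 := (Finset.mem_filter.1 hki).2
          have h2 := (Finset.mem_filter.1 hki').2
          dsimp only at h1 h2 h
          have : i = i' := by
            rcases lt_trichotomy i i' with hlt | rfl | hlt
            · have := congrFun h i
              simp [h2 i hlt, hlt.ne] at this
            · rfl
            · have := congrFun h i'
              simp [h1 i' hlt, hlt.ne] at this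
          subst this
          rw [add_right_cancel h]
        · intro k hk
          rw [Finset.mem_piAntidiag] at hk
          have hne : (Finset.univ.filter fun i => k i ≠ 0).Nonempty := by
            obtain ⟨i, -, hi⟩ := Finset.exists_ne_zero_of_sum_ne_zero
              (hk.1.trans_ne (Nat.succ_ne_zero n))
            exact ⟨i, by simpa using hi⟩
          -- For the inverse bijection, the position of `h` is the first nonzero entry of the raised
          -- partition.
          let i := (Finset.univ.filter fun i => k i ≠ 0).min' hne
          have hi : k i ≠ 0 := (Finset.mem_filter.1 (Finset.min'_mem _ hne)).2
          have hlt : ∀ j < i, k j = 0 := fun j hj => by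
            by_contra hj'
            exact absurd (Finset.min'_le _ j (by simpa using hj')) (not_le.2 hj)
          have hki : k - Pi.single i 1 + Pi.single i 1 = k := by
            funext j
            by_cases hj : j = i
            · subst hj
              simp only [Pi.add_apply, Pi.sub_apply, Pi.single_eq_same]
              lia
            · simp [hj]
          refine ⟨⟨k - Pi.single i 1, i⟩, ?_, hki⟩
          simp only [Finset.mem_filter, Finset.mem_sigma, Finset.mem_piAntidiag, Finset.mem_univ,
            and_true]
          refine ⟨⟨?_, by simp⟩, fun j hj => by simp [hlt j hj]⟩
          have := hk.1
          rw [← hki] at this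
          simpa [Finset.sum_add_distrib] using this
        · rintro ⟨k, i⟩ hki
          have h1 := (Finset.mem_filter.1 hki).2
          dsimp only at h1 ⊢
          congr 1
          funext j
          have e1 : ∑ l ∈ Finset.univ.filter (· < j), (k + Pi.single i 1 : Fin p → ℕ) l =
              ∑ l ∈ Finset.univ.filter (· < j), k l + if i < j then 1 else 0 := by
            simp only [Pi.add_apply, Finset.sum_add_distrib]
            congr 1
            simp only [Pi.single_apply]
            rw [Finset.sum_ite_eq']
            simp
          rw [e1]
          rcases lt_trichotomy j i with hj | rfl | hj
          · have := hs k i h1 j hj.le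
            rw [if_pos hj, this, h1 j hj, coneE_seg _ (by lia), if_pos rfl, if_neg hj.not_gt]
            simp [h1 j hj, hj.ne, seg_generic_zero]
          · have := hs k j h1 j le_rfl
            rw [if_neg (lt_irrefl j), if_pos rfl, this, coneH_seg_generic]
            simp
          · rw [if_neg hj.not_gt, if_neg hj.ne', if_pos hj]
            simp [hj.ne']
      · rintro ⟨k, i⟩ - hne j hj
        by_contra hkj
        refine hne (MultilinearMap.map_coord_zero _ j ?_)
        dsimp only at hj hkj ⊢
        rw [if_pos hj, coneE_seg_of_ne _ _ hkj]
    · intro i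
      rw [awDiag_cell, map_sum, Finset.sum_congr rfl fun k _ => hh _]
      refine Finset.sum_eq_zero fun k _ => Finset.sum_eq_zero fun a _ => ?_
      by_cases hk : ∀ j < a, k j = 0
      · refine MultilinearMap.map_coord_zero _ a ?_
        rw [if_neg (lt_irrefl a), if_pos rfl, hs k a hk a le_rfl, coneH_seg_δ_succ]
      · push Not at hk
        obtain ⟨j, hj, hkj⟩ := hk
        refine MultilinearMap.map_coord_zero _ j ?_
        rw [if_pos hj, coneE_seg_of_ne _ _ hkj]

/-- The projections of a product. -/
def piProdFst (L : Fin p → SSet.{u}) (i : Fin p) : piProd L ⟶ L i where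
  app m := TypeCat.ofHom fun x => x i

lemma diag_piProdMap (L : Fin p → SSet.{u}) :
    diag p (piProd L) ≫ piProdMap (piProdFst L) = 𝟙 _ := rfl

lemma awPi_eq (L : Fin p → SSet.{u}) : awPi (Λ := Λ) L =
    PiTensorProduct.map (fun i => chainsMap (piProdFst L i)) ∘ₗ awDiag Λ p (piProd L) := by
  refine LinearMap.ext fun x => ?_
  rw [LinearMap.comp_apply, awDiag, LinearMap.comp_apply]
  refine Eq.trans ?_ (awPi_naturality _ _)
  rw [← LinearMap.comp_apply (chainsMap (piProdMap _)), ← chainsMap_comp, diag_piProdMap,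
    chainsMap_id, LinearMap.id_apply]

end AlexanderWhitney

/-! ### The standard resolution and its coproduct -/

section Resolution

variable {p : ℕ}

lemma resBasis_mem (i : ℕ) (σ : Cyc p) : resBasis Λ i σ ∈ (res Λ p).deg (-(i : ℤ)) :=
  Finsupp.single_mem_supported Λ _ rfl

lemma res_hom_ext {N : Type w} [AddCommGroup N] [Module Λ N] {f f' : res Λ p →ₗ[Λ] N}
    (h : ∀ i σ, f (resBasis Λ i σ) = f' (resBasis Λ i σ)) : f = f' :=
  (res Λ p).hom_ext fun _ _ hx => res_span (LinearMap.eqLocus f f') (fun i σ _ => h i σ) hx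

lemma res_d_basis (i : ℕ) (σ : Cyc p) : (res Λ p).d (resBasis Λ i σ) = resD Λ p i σ := by
  change Finsupp.lift _ Λ _ (fun b : ℕ × Cyc p => resD Λ p b.1 b.2) (Finsupp.single (i, σ) 1) = _
  simp

lemma res_d_zero (σ : Cyc p) : (res Λ p).d (resBasis Λ 0 σ) = 0 := res_d_basis 0 σ

lemma res_d_odd {i : ℕ} (hi : Even i) (σ : Cyc p) : (res Λ p).d (resBasis Λ (i + 1) σ) =
    resBasis Λ i (σ * cycGen p) - resBasis Λ i σ :=
  (res_d_basis (i + 1) σ).trans (if_pos hi)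

lemma res_d_even {i : ℕ} (hi : ¬ Even i) (σ : Cyc p) : (res Λ p).d (resBasis Λ (i + 1) σ) =
    ∑ r ∈ Finset.range p, resBasis Λ i (σ * cycGen p ^ r) :=
  (res_d_basis (i + 1) σ).trans (if_neg hi)

lemma resAct_basis (τ : Cyc p) (i : ℕ) (σ : Cyc p) :
    resAct τ (resBasis Λ i σ) = resBasis Λ i (τ * σ) :=
  resLift_basis _ _ _

lemma resAct_mul (σ τ : Cyc p) : resAct (Λ := Λ) (σ * τ) = resAct σ ∘ₗ resAct τ :=
  res_hom_ext fun i g => by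
    rw [LinearMap.comp_apply, resAct_basis, resAct_basis, resAct_basis, mul_assoc]

lemma isCxHom_resAct (σ : Cyc p) : IsCxHom (resAct (Λ := Λ) σ) where
  mem {n x} hx := by
    refine res_span (((res Λ p).deg n).comap (resAct σ)) (fun i τ hi => ?_) hx
    rw [Submodule.mem_comap, resAct_basis, ← hi]
    exact resBasis_mem _ _
  comm x := by
    have : resAct σ ∘ₗ (res Λ p).d = (res Λ p).d ∘ₗ resAct σ := res_hom_ext fun i τ => by
      rw [LinearMap.comp_apply, LinearMap.comp_apply, resAct_basis]
      cases i with
      | zero => rw [res_d_zero, res_d_zero, map_zero]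
      | succ i =>
        by_cases hi : Even i
        · rw [res_d_odd hi, res_d_odd hi, map_sub, resAct_basis, resAct_basis, mul_assoc]
        · rw [res_d_even hi, res_d_even hi, map_sum]
          exact Finset.sum_congr rfl fun r _ => by rw [resAct_basis, mul_assoc]
    exact LinearMap.congr_fun this x

lemma aug_basis (i : ℕ) (σ : Cyc p) : aug Λ p (resBasis Λ i σ) = if i = 0 then 1 else 0 :=
  resLift_basis _ _ _

lemma aug_resAct (σ : Cyc p) (w : res Λ p) : aug Λ p (resAct σ w) = aug Λ p w := by
  have : aug Λ p ∘ₗ resAct σ = aug Λ p := res_hom_ext fun i τ => by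
    rw [LinearMap.comp_apply, resAct_basis, aug_basis, aug_basis]
  exact LinearMap.congr_fun this w

lemma aug_of_mem {i : ℤ} (hi : i ≠ 0) {w : res Λ p} (hw : w ∈ (res Λ p).deg i) : aug Λ p w = 0 := by
  have : w ∈ LinearMap.ker (aug Λ p) := res_span _ (fun j σ hj => by
    rw [LinearMap.mem_ker, aug_basis, if_neg]
    rintro rfl
    exact hi (by simpa using hj.symm)) hw
  exact this

lemma aug_d (w : res Λ p) : aug Λ p ((res Λ p).d w) = 0 := by
  have : aug Λ p ∘ₗ (res Λ p).d = 0 := res_hom_ext fun i τ => by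
    rw [LinearMap.comp_apply, LinearMap.zero_apply]
    match i with
    | 0 => rw [res_d_zero, map_zero]
    | 1 => rw [res_d_odd (by simp), map_sub, aug_basis, aug_basis, sub_self]
    | i + 2 =>
      exact aug_of_mem (i := -(i + 2 : ℕ) + 1) (by push_cast; lia)
        (Cx.d_mem _ (resBasis_mem _ _))
  exact LinearMap.congr_fun this w

lemma coprod_basis (i : ℕ) (σ : Cyc p) : coprod Λ p (resBasis Λ i σ) =
    TensorProduct.map (resAct σ) (resAct σ) (coprodGen Λ p i) :=
  resLift_basis _ _ _

lemma resAct_one : resAct (Λ := Λ) (1 : Cyc p) = LinearMap.id :=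
  res_hom_ext fun i σ => by rw [resAct_basis, one_mul]; rfl

lemma coprod_basis_one (i : ℕ) : coprod Λ p (resBasis Λ i 1) = coprodGen Λ p i := by
  rw [coprod_basis, resAct_one, TensorProduct.map_id, LinearMap.id_apply]

lemma coprod_resAct (σ : Cyc p) (w : res Λ p) :
    coprod Λ p (resAct σ w) = TensorProduct.map (resAct σ) (resAct σ) (coprod Λ p w) := by
  have : coprod Λ p ∘ₗ resAct σ = TensorProduct.map (resAct σ) (resAct σ) ∘ₗ coprod Λ p :=
    res_hom_ext fun i τ => by
      rw [LinearMap.comp_apply, LinearMap.comp_apply, resAct_basis, coprod_basis, coprod_basis,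
        resAct_mul, TensorProduct.map_comp, LinearMap.comp_apply]
  exact LinearMap.congr_fun this w

lemma coprodGen_odd (m : ℕ) : coprodGen Λ p (2 * m + 1) =
    ∑ jk ∈ Finset.HasAntidiagonal.antidiagonal m,
      (resBasis Λ (2 * jk.1) 1 ⊗ₜ resBasis Λ (2 * jk.2 + 1) 1 +
        resBasis Λ (2 * jk.1 + 1) 1 ⊗ₜ resBasis Λ (2 * jk.2) (cycGen p)) := by
  rw [coprodGen, if_neg (by simp), show (2 * m + 1) / 2 = m by lia]

lemma coprodGen_zero :
    coprodGen Λ p 0 = resBasis Λ 0 1 ⊗ₜ resBasis Λ 0 1 := by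
  rw [coprodGen, if_pos (by simp)]
  simp

lemma coprodGen_even (m : ℕ) : coprodGen Λ p (2 * (m + 1)) =
    ∑ jk ∈ Finset.HasAntidiagonal.antidiagonal (m + 1),
      resBasis Λ (2 * jk.1) 1 ⊗ₜ resBasis Λ (2 * jk.2) 1 +
      ∑ jk ∈ Finset.HasAntidiagonal.antidiagonal m,
        ∑ s ∈ Finset.range p, ∑ r ∈ Finset.range s,
          resBasis Λ (2 * jk.1 + 1) (cycGen p ^ r) ⊗ₜ resBasis Λ (2 * jk.2 + 1) (cycGen p ^ s) := by
  rw [coprodGen, if_pos (by simp), show 2 * (m + 1) / 2 = m + 1 by lia]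
  congr 1
  refine Finset.sum_congr ?_ fun _ _ => rfl
  ext ⟨j, k⟩
  simp only [Finset.mem_filter, Finset.mem_product, Finset.mem_range, Finset.HasAntidiagonal.mem_antidiagonal]
  lia

/-! ### Telescoping sums over the triangle r < s -/

section Sums

variable {M : Type*} [AddCommGroup M]

/-- The terms telescope along the diagonals of the triangle. It is applied to the effect of α - 1 on
the double sum in the coproduct of an even generator, where α acts on both indices at once. -/
lemma sum_triangle_diag (β : ℕ → ℕ → M) (n : ℕ) :
    ∑ s ∈ Finset.range n, ∑ r ∈ Finset.range s, (β (r + 1) (s + 1) - β r s) =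
      ∑ r ∈ Finset.range n, β r n - ∑ s ∈ Finset.range n, β 0 s - β 0 n + β 0 0 := by
  induction n with
  | zero => simp
  | succ n ih =>
    rw [Finset.sum_range_succ, ih, Finset.sum_sub_distrib, Finset.sum_range_succ' (β · (n + 1)),
      Finset.sum_range_succ (β 0)]
    abel

/-- For fixed `s` the inner sum telescopes in `r`; this corresponds to the differential acting on
the left factor of the double sum in the coproduct. -/
lemma sum_triangle_left (β : ℕ → ℕ → M) (n : ℕ) :
    ∑ s ∈ Finset.range n, ∑ r ∈ Finset.range s, (β (r + 1) s - β r s) =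
      ∑ s ∈ Finset.range n, β s s - ∑ s ∈ Finset.range n, β 0 s := by
  rw [← Finset.sum_sub_distrib]
  exact Finset.sum_congr rfl fun s _ => Finset.sum_range_sub (β · s) s

/-- For fixed `r` the terms telescope in `s`, from `r + 1` to `n`; this corresponds to the
differential acting on the right factor. -/
lemma sum_triangle_right (β : ℕ → ℕ → M) (n : ℕ) :
    ∑ s ∈ Finset.range n, ∑ r ∈ Finset.range s, (β r (s + 1) - β r s) =
      ∑ r ∈ Finset.range n, β r n - ∑ r ∈ Finset.range n, β r (r + 1) := by
  induction n with
  | zero => simp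
  | succ n ih =>
    rw [Finset.sum_range_succ, ih, Finset.sum_sub_distrib, Finset.sum_range_succ (β · (n + 1)),
      Finset.sum_range_succ (fun r => β r (r + 1))]
    abel

end Sums

lemma tmul_d_basis (i j : ℕ) (σ τ : Cyc p) :
    ((res Λ p).tensor (res Λ p)).d (resBasis Λ i σ ⊗ₜ resBasis Λ j τ) =
      (res Λ p).d (resBasis Λ i σ) ⊗ₜ resBasis Λ j τ +
        psign (i : ZMod 2) • resBasis Λ i σ ⊗ₜ (res Λ p).d (resBasis Λ j τ) := by
  rw [Cx.tensor_d_tmul _ (resBasis_mem i σ)]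
  congr 3
  push_cast
  exact ZMod.neg_eq_self_mod_two _

lemma psign_two_mul (i : ℕ) : psign ((2 * i : ℕ) : ZMod 2) = 1 := by
  have : ((2 * i : ℕ) : ZMod 2) = 0 := by
    rw [ZMod.natCast_eq_zero_iff]
    exact dvd_mul_right 2 i
  rw [this, psign_zero]

lemma psign_two_mul_add_one (i : ℕ) : psign ((2 * i + 1 : ℕ) : ZMod 2) = -1 := by
  rw [Nat.cast_add, psign_add, psign_two_mul, Nat.cast_one, psign_one, one_mul]

lemma tmul_d_even (i j : ℕ) (σ τ : Cyc p) :
    ((res Λ p).tensor (res Λ p)).d (resBasis Λ (2 * i) σ ⊗ₜ resBasis Λ j τ) =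
      (res Λ p).d (resBasis Λ (2 * i) σ) ⊗ₜ resBasis Λ j τ +
        resBasis Λ (2 * i) σ ⊗ₜ (res Λ p).d (resBasis Λ j τ) := by
  rw [tmul_d_basis, psign_two_mul, one_smul]

lemma tmul_d_odd (i j : ℕ) (σ τ : Cyc p) :
    ((res Λ p).tensor (res Λ p)).d (resBasis Λ (2 * i + 1) σ ⊗ₜ resBasis Λ j τ) =
      (res Λ p).d (resBasis Λ (2 * i + 1) σ) ⊗ₜ resBasis Λ j τ -
        resBasis Λ (2 * i + 1) σ ⊗ₜ (res Λ p).d (resBasis Λ j τ) := by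
  rw [tmul_d_basis, psign_two_mul_add_one, neg_smul, one_smul, sub_eq_add_neg]

lemma sum_pow_cycGen (i : ℕ) : ∑ r ∈ Finset.range p, resBasis Λ i (cycGen p ^ (r + 1)) =
    ∑ r ∈ Finset.range p, resBasis Λ i (cycGen p ^ r) := by
  have := Finset.sum_range_sub (fun r => resBasis Λ i (cycGen p ^ r)) p
  rw [Finset.sum_sub_distrib, cycGen_pow, pow_zero, sub_self, sub_eq_zero] at this
  exact this

/-- The differences in the odd factors give α - 1 on the part with two even generators. The
differential of the even factors gives norms of odd generators on either side, and these are exactly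
what α - 1 makes of the triangular double sum. -/
lemma d_coprodGen_odd (m : ℕ) : ((res Λ p).tensor (res Λ p)).d (coprodGen Λ p (2 * m + 1)) =
    TensorProduct.map (resAct (cycGen p)) (resAct (cycGen p)) (coprodGen Λ p (2 * m)) -
      coprodGen Λ p (2 * m) := by
  have h : ∀ j k, ((res Λ p).tensor (res Λ p)).d
      (resBasis Λ (2 * j) 1 ⊗ₜ resBasis Λ (2 * k + 1) 1 +
        resBasis Λ (2 * j + 1) 1 ⊗ₜ resBasis Λ (2 * k) (cycGen p)) =
      (resBasis Λ (2 * j) (cycGen p) ⊗ₜ resBasis Λ (2 * k) (cycGen p) -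
        resBasis Λ (2 * j) 1 ⊗ₜ resBasis Λ (2 * k) 1) +
      ((res Λ p).d (resBasis Λ (2 * j) 1) ⊗ₜ[Λ] resBasis Λ (2 * k + 1) 1 -
        resBasis Λ (2 * j + 1) 1 ⊗ₜ[Λ] (res Λ p).d (resBasis Λ (2 * k) (cycGen p))) := by
    intro j k
    rw [map_add, tmul_d_even, tmul_d_odd, res_d_odd (by simp), res_d_odd (by simp), one_mul,
      tmul_sub, sub_tmul]
    abel
  have h' : ∀ j k, TensorProduct.map (resAct (cycGen p)) (resAct (cycGen p))
      (resBasis Λ (2 * j) 1 ⊗ₜ[Λ] resBasis Λ (2 * k) 1) =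
        resBasis Λ (2 * j) (cycGen p) ⊗ₜ resBasis Λ (2 * k) (cycGen p) := by
    intro j k
    rw [TensorProduct.map_tmul, resAct_basis, resAct_basis, mul_one]
  rw [coprodGen_odd, map_sum, Finset.sum_congr rfl fun jk _ => h jk.1 jk.2]
  cases m with
  | zero =>
    rw [mul_zero, coprodGen_zero]
    have := h' 0 0
    rw [mul_zero] at this
    rw [this]
    simp only [Finset.Nat.antidiagonal_zero, Finset.sum_singleton, mul_zero, res_d_zero, zero_tmul,
      tmul_zero, sub_zero, add_zero]
  | succ m =>
    -- The term at `e_0` drops out because its differential is zero; shifting the index turns the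
    -- other terms into norms of odd generators.
    have h2 : ∑ jk ∈ Finset.HasAntidiagonal.antidiagonal (m + 1),
        (res Λ p).d (resBasis Λ (2 * jk.1) 1) ⊗ₜ[Λ] resBasis Λ (2 * jk.2 + 1) (1 : Cyc p) =
        ∑ jk ∈ Finset.HasAntidiagonal.antidiagonal m, ∑ r ∈ Finset.range p,
          resBasis Λ (2 * jk.1 + 1) (cycGen p ^ r) ⊗ₜ[Λ] resBasis Λ (2 * jk.2 + 1) 1 := by
      rw [Finset.Nat.sum_antidiagonal_succ, mul_zero, res_d_zero, zero_tmul, zero_add]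
      refine Finset.sum_congr rfl fun jk _ => ?_
      dsimp only
      rw [mul_add, mul_one, show 2 * jk.1 + 2 = 2 * jk.1 + 1 + 1 by ring, res_d_even (by simp),
        sum_tmul]
      simp only [one_mul]
    have h3 : ∑ jk ∈ Finset.HasAntidiagonal.antidiagonal (m + 1),
        resBasis Λ (2 * jk.1 + 1) (1 : Cyc p) ⊗ₜ[Λ] (res Λ p).d (resBasis Λ (2 * jk.2) (cycGen p)) =
        ∑ jk ∈ Finset.HasAntidiagonal.antidiagonal m, ∑ r ∈ Finset.range p,
          resBasis Λ (2 * jk.1 + 1) 1 ⊗ₜ[Λ] resBasis Λ (2 * jk.2 + 1) (cycGen p ^ r) := by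
      rw [Finset.Nat.sum_antidiagonal_succ', mul_zero, res_d_zero, tmul_zero, zero_add]
      refine Finset.sum_congr rfl fun jk _ => ?_
      dsimp only
      rw [mul_add, mul_one, show 2 * jk.2 + 2 = 2 * jk.2 + 1 + 1 by ring, res_d_even (by simp),
        ← tmul_sum]
      simp only [← pow_succ']
      rw [sum_pow_cycGen]
    -- After telescoping, only the edges of the triangle remain; since the generator has `p`-th
    -- power 1, they are the two norm terms.
    have h4 : ∀ j k, TensorProduct.map (resAct (cycGen p)) (resAct (cycGen p))
          (∑ s ∈ Finset.range p, ∑ r ∈ Finset.range s, resBasis Λ (2 * j + 1) (cycGen p ^ r) ⊗ₜ[Λ]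
            resBasis Λ (2 * k + 1) (cycGen p ^ s)) -
          ∑ s ∈ Finset.range p, ∑ r ∈ Finset.range s, resBasis Λ (2 * j + 1) (cycGen p ^ r) ⊗ₜ[Λ]
            resBasis Λ (2 * k + 1) (cycGen p ^ s) =
        ∑ r ∈ Finset.range p,
          resBasis Λ (2 * j + 1) (cycGen p ^ r) ⊗ₜ[Λ] resBasis Λ (2 * k + 1) 1 -
        ∑ r ∈ Finset.range p,
          resBasis Λ (2 * j + 1) 1 ⊗ₜ[Λ] resBasis Λ (2 * k + 1) (cycGen p ^ r) := by
      intro j k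
      have := sum_triangle_diag (fun r s => resBasis Λ (2 * j + 1) (cycGen p ^ r) ⊗ₜ[Λ]
        resBasis Λ (2 * k + 1) (cycGen p ^ s)) p
      simp only [cycGen_pow, pow_zero, sub_add_cancel] at this
      rw [← this]
      simp only [map_sum, TensorProduct.map_tmul, resAct_basis, ← pow_succ',
        ← Finset.sum_sub_distrib]
    have h5 := Finset.sum_congr (s₁ := Finset.HasAntidiagonal.antidiagonal (m + 1)) rfl
      fun jk _ => h' jk.1 jk.2
    rw [coprodGen_even, Finset.sum_add_distrib, Finset.sum_sub_distrib, Finset.sum_sub_distrib, h2,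
      h3, ← Finset.sum_sub_distrib (s := Finset.HasAntidiagonal.antidiagonal m),
      ← Finset.sum_congr (s₁ := Finset.HasAntidiagonal.antidiagonal m) rfl fun jk _ => h4 jk.1 jk.2,
      Finset.sum_sub_distrib, map_add, map_sum, map_sum, h5]
    abel

/-- Telescoping the triangular double sum leaves its diagonal edges and its outer edges. The outer
edges cancel the norm terms from the differential of the part with two even generators, and the
diagonal edges are the norm of the coproduct of the odd generator. -/
lemma d_coprodGen_even (m : ℕ) : ((res Λ p).tensor (res Λ p)).d (coprodGen Λ p (2 * (m + 1))) =
    ∑ r ∈ Finset.range p, TensorProduct.map (resAct (cycGen p ^ r)) (resAct (cycGen p ^ r))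
      (coprodGen Λ p (2 * m + 1)) := by
  have hA : ∀ j k, (res Λ p).d (resBasis Λ (2 * (j + 1)) 1) ⊗ₜ[Λ] resBasis Λ (2 * k) (1 : Cyc p) =
      ∑ r ∈ Finset.range p,
        resBasis Λ (2 * j + 1) (cycGen p ^ r) ⊗ₜ[Λ] resBasis Λ (2 * k) 1 := by
    intro j k
    rw [show 2 * (j + 1) = 2 * j + 1 + 1 by ring, res_d_even (by simp), sum_tmul]
    simp only [one_mul]
  have hB : ∀ j k, resBasis Λ (2 * j) (1 : Cyc p) ⊗ₜ[Λ] (res Λ p).d (resBasis Λ (2 * (k + 1)) 1) =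
      ∑ r ∈ Finset.range p,
        resBasis Λ (2 * j) 1 ⊗ₜ[Λ] resBasis Λ (2 * k + 1) (cycGen p ^ r) := by
    intro j k
    rw [show 2 * (k + 1) = 2 * k + 1 + 1 by ring, res_d_even (by simp), tmul_sum]
    simp only [one_mul]
  have hC : ∀ j k, ((res Λ p).tensor (res Λ p)).d (∑ s ∈ Finset.range p, ∑ r ∈ Finset.range s,
        resBasis Λ (2 * j + 1) (cycGen p ^ r) ⊗ₜ resBasis Λ (2 * k + 1) (cycGen p ^ s)) =
      (∑ s ∈ Finset.range p,
          resBasis Λ (2 * j) (cycGen p ^ s) ⊗ₜ[Λ] resBasis Λ (2 * k + 1) (cycGen p ^ s) -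
        ∑ s ∈ Finset.range p,
          resBasis Λ (2 * j) 1 ⊗ₜ[Λ] resBasis Λ (2 * k + 1) (cycGen p ^ s)) -
      (∑ r ∈ Finset.range p,
          resBasis Λ (2 * j + 1) (cycGen p ^ r) ⊗ₜ[Λ] resBasis Λ (2 * k) 1 -
        ∑ r ∈ Finset.range p,
          resBasis Λ (2 * j + 1) (cycGen p ^ r) ⊗ₜ[Λ] resBasis Λ (2 * k) (cycGen p ^ (r + 1))) := by
    intro j k
    have h1 := sum_triangle_left (fun r s => resBasis Λ (2 * j) (cycGen p ^ r) ⊗ₜ[Λ]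
      resBasis Λ (2 * k + 1) (cycGen p ^ s)) p
    have h2 := sum_triangle_right (fun r s => resBasis Λ (2 * j + 1) (cycGen p ^ r) ⊗ₜ[Λ]
      resBasis Λ (2 * k) (cycGen p ^ s)) p
    simp only [cycGen_pow, pow_zero] at h1 h2
    rw [← h1, ← h2, ← Finset.sum_sub_distrib, map_sum]
    refine Finset.sum_congr rfl fun s _ => ?_
    rw [← Finset.sum_sub_distrib, map_sum]
    refine Finset.sum_congr rfl fun r _ => ?_
    rw [tmul_d_odd, res_d_odd (by simp), res_d_odd (by simp), ← pow_succ, ← pow_succ, sub_tmul,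
      tmul_sub]
  have hD : ∀ j k, ∑ r ∈ Finset.range p,
      TensorProduct.map (resAct (cycGen p ^ r)) (resAct (cycGen p ^ r))
        (resBasis Λ (2 * j) 1 ⊗ₜ[Λ] resBasis Λ (2 * k + 1) 1 +
          resBasis Λ (2 * j + 1) 1 ⊗ₜ[Λ] resBasis Λ (2 * k) (cycGen p)) =
      ∑ s ∈ Finset.range p,
          resBasis Λ (2 * j) (cycGen p ^ s) ⊗ₜ[Λ] resBasis Λ (2 * k + 1) (cycGen p ^ s) +
        ∑ r ∈ Finset.range p, resBasis Λ (2 * j + 1) (cycGen p ^ r) ⊗ₜ[Λ]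
          resBasis Λ (2 * k) (cycGen p ^ (r + 1)) := by
    intro j k
    rw [← Finset.sum_add_distrib]
    refine Finset.sum_congr rfl fun r _ => ?_
    rw [map_add, TensorProduct.map_tmul, TensorProduct.map_tmul, resAct_basis, resAct_basis,
      resAct_basis, resAct_basis, mul_one, ← pow_succ]
  have hE : ∑ r ∈ Finset.range p,
      TensorProduct.map (resAct (cycGen p ^ r)) (resAct (cycGen p ^ r))
        (coprodGen Λ p (2 * m + 1)) =
      ∑ jk ∈ Finset.HasAntidiagonal.antidiagonal m, ∑ r ∈ Finset.range p,
        TensorProduct.map (resAct (cycGen p ^ r)) (resAct (cycGen p ^ r))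
          (resBasis Λ (2 * jk.1) 1 ⊗ₜ[Λ] resBasis Λ (2 * jk.2 + 1) 1 +
            resBasis Λ (2 * jk.1 + 1) 1 ⊗ₜ[Λ] resBasis Λ (2 * jk.2) (cycGen p)) := by
    rw [Finset.sum_comm, coprodGen_odd]
    exact Finset.sum_congr rfl fun r _ => map_sum _ _ _
  rw [hE, Finset.sum_congr rfl fun jk _ => hD jk.1 jk.2, coprodGen_even, map_add, map_sum, map_sum,
    Finset.sum_congr (s₁ := Finset.HasAntidiagonal.antidiagonal m) rfl fun jk _ => hC jk.1 jk.2,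
    Finset.sum_congr rfl fun jk _ => tmul_d_even jk.1 (2 * jk.2) 1 1, Finset.sum_add_distrib,
    Finset.Nat.sum_antidiagonal_succ (f := fun jk => (res Λ p).d (resBasis Λ (2 * jk.1) 1) ⊗ₜ[Λ]
      resBasis Λ (2 * jk.2) 1),
    Finset.Nat.sum_antidiagonal_succ' (f := fun jk => resBasis Λ (2 * jk.1) 1 ⊗ₜ[Λ]
      (res Λ p).d (resBasis Λ (2 * jk.2) 1))]
  simp only [hA, hB, mul_zero, res_d_zero, zero_tmul, tmul_zero, zero_add]
  rw [← Finset.sum_add_distrib, ← Finset.sum_add_distrib]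
  refine Finset.sum_congr rfl fun jk _ => ?_
  abel

/-- By equivariance the differential has to be checked only on the generators, where it is given by
`d_coprodGen_odd` and `d_coprodGen_even`. -/
lemma isCxHom_coprod : IsCxHom (coprod Λ p) where
  mem {n z} hz := by
    have key : ∀ i : ℕ, coprodGen Λ p i ∈ ((res Λ p).tensor (res Λ p)).deg (-(i : ℤ)) := by
      intro i
      have h : ∀ (j k : ℕ) (σ τ : Cyc p), j + k = i → resBasis Λ j σ ⊗ₜ[Λ] resBasis Λ k τ ∈
          ((res Λ p).tensor (res Λ p)).deg (-(i : ℤ)) := by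
        rintro j k σ τ rfl
        rw [Nat.cast_add, neg_add]
        exact Cx.tmul_mem (resBasis_mem _ _) (resBasis_mem _ _)
      rcases Nat.even_or_odd' i with ⟨m, rfl | rfl⟩
      · cases m with
        | zero =>
          rw [coprodGen_zero]
          exact h _ _ _ _ rfl
        | succ m =>
          rw [coprodGen_even]
          refine add_mem (Submodule.sum_mem _ fun jk hjk => h _ _ _ _ ?_)
            (Submodule.sum_mem _ fun jk hjk => Submodule.sum_mem _ fun s _ =>
              Submodule.sum_mem _ fun r _ => h _ _ _ _ ?_)
          · rw [Finset.HasAntidiagonal.mem_antidiagonal] at hjk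
            lia
          · rw [Finset.HasAntidiagonal.mem_antidiagonal] at hjk
            lia
      · rw [coprodGen_odd]
        refine Submodule.sum_mem _ fun jk hjk => ?_
        rw [Finset.HasAntidiagonal.mem_antidiagonal] at hjk
        exact add_mem (h _ _ _ _ (by lia)) (h _ _ _ _ (by lia))
    refine res_span ((((res Λ p).tensor (res Λ p)).deg n).comap (coprod Λ p)) (fun i σ hi => ?_) hz
    rw [Submodule.mem_comap, coprod_basis, ← hi]
    exact ((isCxHom_resAct σ).tensorMap (isCxHom_resAct σ)).mem (key i)
  comm z := by
    have h1 : ∀ i, coprod Λ p ((res Λ p).d (resBasis Λ i 1)) =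
        ((res Λ p).tensor (res Λ p)).d (coprod Λ p (resBasis Λ i 1)) := by
      intro i
      rw [coprod_basis_one]
      rcases Nat.even_or_odd' i with ⟨m, rfl | rfl⟩
      · cases m with
        | zero =>
          rw [res_d_zero, map_zero, coprodGen_zero]
          refine (Eq.trans (tmul_d_basis 0 0 1 1) ?_).symm
          rw [res_d_zero, zero_tmul, tmul_zero, zero_add]
          exact smul_zero _
        | succ m =>
          rw [d_coprodGen_even, show 2 * (m + 1) = 2 * m + 1 + 1 by ring,
            res_d_even (by simp), map_sum]
          refine Finset.sum_congr rfl fun r _ => ?_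
          rw [one_mul, coprod_basis]
      · rw [d_coprodGen_odd, res_d_odd (by simp), map_sub, coprod_basis, one_mul, coprod_basis_one]
    have : coprod Λ p ∘ₗ (res Λ p).d = ((res Λ p).tensor (res Λ p)).d ∘ₗ coprod Λ p :=
      res_hom_ext fun i σ => by
        have h2 : resBasis Λ i σ = resAct σ (resBasis Λ i 1) := by rw [resAct_basis, mul_one]
        rw [LinearMap.comp_apply, LinearMap.comp_apply, h2, ← (isCxHom_resAct σ).comm,
          coprod_resAct, coprod_resAct, h1]
        exact ((isCxHom_resAct σ).tensorMap (isCxHom_resAct σ)).comm _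
    exact LinearMap.congr_fun this z

/-- The coproduct is counital on the right. -/
lemma coprod_counit (w : res Λ p) :
    TensorProduct.rid Λ (res Λ p) (TensorProduct.map LinearMap.id (aug Λ p) (coprod Λ p w)) = w := by
  have key : ∀ i, TensorProduct.rid Λ (res Λ p)
      (TensorProduct.map LinearMap.id (aug Λ p) (coprodGen Λ p i)) = resBasis Λ i 1 := by
    intro i
    have h : ∀ (j k : ℕ) (σ τ : Cyc p), TensorProduct.rid Λ (res Λ p)
        (TensorProduct.map LinearMap.id (aug Λ p) (resBasis Λ j σ ⊗ₜ resBasis Λ k τ)) =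
          if k = 0 then resBasis Λ j σ else 0 := by
      intro j k σ τ
      rw [TensorProduct.map_tmul, TensorProduct.rid_tmul, aug_basis, LinearMap.id_apply]
      split_ifs
      · exact one_smul _ _
      · exact zero_smul _ _
    rcases Nat.even_or_odd' i with ⟨m, rfl | rfl⟩
    · cases m with
      | zero => rw [coprodGen_zero, h, if_pos rfl]
      | succ m =>
        rw [coprodGen_even]
        simp only [map_add, map_sum, h]
        rw [Finset.Nat.sum_antidiagonal_succ']
        simp
    · rw [coprodGen_odd]
      simp only [map_add, map_sum, h]
      cases m with
      | zero => simp
      | succ m =>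
        rw [Finset.Nat.sum_antidiagonal_succ']
        simp
  have : (TensorProduct.rid Λ (res Λ p)).toLinearMap ∘ₗ TensorProduct.map LinearMap.id (aug Λ p) ∘ₗ
      coprod Λ p = LinearMap.id := res_hom_ext fun i σ => by
    have h2 : resBasis Λ i σ = resAct σ (resBasis Λ i 1) := by rw [resAct_basis, mul_one]
    have h3 : ∀ z, TensorProduct.rid Λ (res Λ p) (TensorProduct.map LinearMap.id (aug Λ p)
        (TensorProduct.map (resAct σ) (resAct σ) z)) = resAct σ (TensorProduct.rid Λ (res Λ p)
          (TensorProduct.map LinearMap.id (aug Λ p) z)) := by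
      intro z
      induction z using TensorProduct.induction_on with
      | zero => simp only [map_zero]
      | add z z' hz hz' => simp only [map_add, hz, hz']
      | tmul x y =>
        simp only [TensorProduct.map_tmul, TensorProduct.rid_tmul, LinearMap.id_apply, aug_resAct,
          map_smul]
    simp only [LinearMap.comp_apply, LinearEquiv.coe_coe, LinearMap.id_apply]
    rw [h2, coprod_resAct, h3, coprod_basis_one, key]
  exact LinearMap.congr_fun this w

end Resolution

/-! ### Equivariant operations -/

namespace ModelFunctor

/-- A natural action of the cyclic group of order `p` on the values of a functor. -/
structure CycAction (D : ModelFunctor.{u} Λ) (p : ℕ) where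
  act : Cyc p → ∀ X : SSet.{u}, D.obj X →ₗ[Λ] D.obj X
  isNaturalEnd : ∀ σ, IsNaturalEnd (act σ)
  act_one : ∀ X y, act 1 X y = y
  act_mul : ∀ σ τ X y, act (σ * τ) X y = act σ X (act τ X y)

variable {D : ModelFunctor.{u} Λ} {p : ℕ}

lemma IsNaturalEnd.sub {B B' : ∀ X, D.obj X →ₗ[Λ] D.obj X} (h : IsNaturalEnd B)
    (h' : IsNaturalEnd B') : IsNaturalEnd fun X => B X - B' X where
  isCxHom X := ⟨fun hx => sub_mem ((h.isCxHom X).mem hx) ((h'.isCxHom X).mem hx), fun x => by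
    rw [LinearMap.sub_apply, LinearMap.sub_apply, map_sub, (h.isCxHom X).comm,
      (h'.isCxHom X).comm]⟩
  natural f y := by
    rw [LinearMap.sub_apply, LinearMap.sub_apply, map_sub, h.natural, h'.natural]

lemma isNaturalEnd_id : IsNaturalEnd (D := D) fun _ => LinearMap.id :=
  ⟨fun _ => isCxHom_id _, fun _ _ => rfl⟩

lemma isNaturalEnd_sum {ι : Type*} (S : Finset ι) {B : ι → ∀ X, D.obj X →ₗ[Λ] D.obj X}
    (h : ∀ i, IsNaturalEnd (B i)) : IsNaturalEnd fun X => ∑ i ∈ S, B i X where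
  isCxHom X := ⟨fun hx => by
      rw [LinearMap.sum_apply]
      exact Submodule.sum_mem _ fun i _ => ((h i).isCxHom X).mem hx, fun x => by
    rw [LinearMap.sum_apply, LinearMap.sum_apply, map_sum]
    exact Finset.sum_congr rfl fun i _ => ((h i).isCxHom X).comm x⟩
  natural f y := by
    rw [LinearMap.sum_apply, LinearMap.sum_apply, map_sum]
    exact Finset.sum_congr rfl fun i _ => (h i).natural f y

/-! ### Equivariant maps out of W ⊗ C(X) as sequences of operations -/

namespace CycAction

variable (a : D.CycAction p)

/-- The operator by which the differential of the standard resolution acts: `α - 1` or the norm. -/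
def diff (i : ℕ) (X : SSet.{u}) : D.obj X →ₗ[Λ] D.obj X :=
  if Even i then a.act (cycGen p) X - LinearMap.id
  else ∑ r ∈ Finset.range p, a.act (cycGen p ^ r) X

lemma diff_even {i : ℕ} (hi : Even i) (X : SSet.{u}) (y : D.obj X) :
    a.diff i X y = a.act (cycGen p) X y - y := by
  rw [diff, if_pos hi]
  rfl

lemma diff_odd {i : ℕ} (hi : ¬ Even i) (X : SSet.{u}) (y : D.obj X) :
    a.diff i X y = ∑ r ∈ Finset.range p, a.act (cycGen p ^ r) X y := by
  rw [diff, if_neg hi, LinearMap.sum_apply]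

lemma isNaturalEnd_diff (i : ℕ) : IsNaturalEnd (a.diff i) := by
  by_cases hi : Even i
  · have : a.diff i = fun X => a.act (cycGen p) X - LinearMap.id := funext fun X => if_pos hi
    rw [this]
    exact (a.isNaturalEnd _).sub isNaturalEnd_id
  · have : a.diff i = fun X => ∑ r ∈ Finset.range p, a.act (cycGen p ^ r) X :=
      funext fun X => if_neg hi
    rw [this]
    exact isNaturalEnd_sum _ fun r => a.isNaturalEnd _

/-- The norm and α - 1 annihilate each other in either order, since the resulting sum telescopes and
α^p = 1. -/
lemma diff_diff (i : ℕ) (X : SSet.{u}) (y : D.obj X) : a.diff (i + 1) X (a.diff i X y) = 0 := by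
  have h : ∑ r ∈ Finset.range p, (a.act (cycGen p ^ (r + 1)) X y - a.act (cycGen p ^ r) X y) =
      0 := by
    rw [Finset.sum_range_sub fun r => a.act (cycGen p ^ r) X y, cycGen_pow, pow_zero, sub_self]
  by_cases hi : Even i
  · rw [a.diff_even hi, a.diff_odd (by rw [Nat.even_add_one]; simpa using hi), ← h]
    refine Finset.sum_congr rfl fun r _ => ?_
    rw [map_sub, ← a.act_mul, ← pow_succ]
  · rw [a.diff_odd hi, a.diff_even (by rw [Nat.even_add_one]; simpa using hi), ← h, map_sum,
      ← Finset.sum_sub_distrib]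
    refine Finset.sum_congr rfl fun r _ => ?_
    rw [← a.act_mul, ← pow_succ']

/-- The equivariant map `W ⊗ C(X) → D(X)` with given values on the elements `e_i ⊗ x`. -/
def assemble (S : ℕ → D.Op) (X : SSet.{u}) :
    (res Λ p).tensor (chains Λ X) →ₗ[Λ] D.obj X :=
  TensorProduct.lift (resLift fun i σ => a.act σ X ∘ₗ S i X)

lemma assemble_tmul (S : ℕ → D.Op) (X : SSet.{u}) (i : ℕ) (σ : Cyc p) (x : chains Λ X) :
    a.assemble S X (resBasis Λ i σ ⊗ₜ x) = a.act σ X (S i X x) := by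
  rw [assemble]
  refine (TensorProduct.lift.tmul _ _).trans ?_
  rw [resLift_basis]
  rfl

lemma res_tensor_hom_ext {K : Cx.{v} Λ} {N : Type w} [AddCommGroup N] [Module Λ N]
    {f f' : res Λ p ⊗[Λ] K →ₗ[Λ] N}
    (h : ∀ i σ x, f (resBasis Λ i σ ⊗ₜ x) = f' (resBasis Λ i σ ⊗ₜ x)) : f = f' := by
  refine TensorProduct.ext (res_hom_ext fun i σ => LinearMap.ext fun x => ?_)
  exact h i σ x

lemma assemble_equivariant (S : ℕ → D.Op) (X : SSet.{u}) (σ : Cyc p)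
    (z : (res Λ p).tensor (chains Λ X)) :
    a.assemble S X (TensorProduct.map (resAct σ) LinearMap.id z) =
      a.act σ X (a.assemble S X z) := by
  have : a.assemble S X ∘ₗ TensorProduct.map (resAct σ) LinearMap.id =
      a.act σ X ∘ₗ a.assemble S X := res_tensor_hom_ext fun i τ x => by
    rw [LinearMap.comp_apply, LinearMap.comp_apply, TensorProduct.map_tmul, resAct_basis,
      LinearMap.id_apply, assemble_tmul, assemble_tmul, a.act_mul]
  exact LinearMap.congr_fun this z

variable {a}

lemma assemble_natural {S : ℕ → D.Op} (hS : ∀ i, IsNatural (S i)) {X Y : SSet.{u}} (f : X ⟶ Y)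
    (z : (res Λ p).tensor (chains Λ X)) :
    a.assemble S Y (TensorProduct.map LinearMap.id (chainsMap f) z) =
      D.map f (a.assemble S X z) := by
  have : a.assemble S Y ∘ₗ TensorProduct.map LinearMap.id (chainsMap f) =
      D.map f ∘ₗ a.assemble S X := res_tensor_hom_ext fun i τ x => by
    rw [LinearMap.comp_apply, LinearMap.comp_apply, TensorProduct.map_tmul, LinearMap.id_apply,
      assemble_tmul, assemble_tmul, hS, (a.isNaturalEnd τ).natural]
  exact LinearMap.congr_fun this z

lemma res_tensorDeg_le {K : Cx.{v} Λ} {n : ℤ} (P : Submodule Λ (res Λ p ⊗[Λ] K))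
    (h : ∀ (i : ℕ) (σ : Cyc p) (m : ℤ), -(i : ℤ) + m = n → ∀ x ∈ K.deg m,
      resBasis Λ i σ ⊗ₜ[Λ] x ∈ P) : ((res Λ p).tensor K).deg n ≤ P := by
  refine Cx.tensorDeg_le P fun k m hkm w hw x hx => ?_
  exact res_span (P.comap ((TensorProduct.mk Λ _ _).flip x))
    (fun i σ hi => h i σ m (by rw [hi, hkm]) x hx) hw

lemma assemble_mem {S : ℕ → D.Op} {c : ℤ} (hS : ∀ i : ℕ, Lowers (S i) (i + c)) {X : SSet.{u}}
    {n : ℤ} {z : (res Λ p).tensor (chains Λ X)}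
    (hz : z ∈ ((res Λ p).tensor (chains Λ X)).deg n) :
    a.assemble S X z ∈ (D.obj X).deg (n - c) := by
  refine res_tensorDeg_le (((D.obj X).deg (n - c)).comap (a.assemble S X)) (fun i σ m hm x hx => ?_)
    hz
  rw [Submodule.mem_comap, assemble_tmul, show n - c = m - (i + c) by lia]
  exact ((a.isNaturalEnd σ).isCxHom X).mem (hS i X m x hx)

lemma act_diff (i : ℕ) (σ : Cyc p) (X : SSet.{u}) (y : D.obj X) :
    a.act σ X (a.diff i X y) = if Even i then a.act (σ * cycGen p) X y - a.act σ X y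
      else ∑ r ∈ Finset.range p, a.act (σ * cycGen p ^ r) X y := by
  split_ifs with hi
  · rw [a.diff_even hi, map_sub, a.act_mul]
  · rw [a.diff_odd hi, map_sum]
    exact Finset.sum_congr rfl fun r _ => (a.act_mul _ _ _ _).symm

lemma assemble_d_basis (S : ℕ → D.Op) (X : SSet.{u}) (i : ℕ) (σ : Cyc p) (x : chains Λ X) :
    a.assemble S X ((res Λ p).d (resBasis Λ (i + 1) σ) ⊗ₜ x) =
      a.act σ X (a.diff i X (S i X x)) := by
  rw [act_diff]
  split_ifs with hi
  · rw [res_d_odd hi, sub_tmul, map_sub, assemble_tmul, assemble_tmul]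
  · rw [res_d_even hi, sum_tmul, map_sum]
    exact Finset.sum_congr rfl fun r _ => assemble_tmul _ _ _ _ _ _

lemma tensor_d_basis {K : Cx.{v} Λ} (i : ℕ) (σ : Cyc p) (x : K) :
    ((res Λ p).tensor K).d (resBasis Λ i σ ⊗ₜ x) =
      (res Λ p).d (resBasis Λ i σ) ⊗ₜ x + psign (i : ZMod 2) • resBasis Λ i σ ⊗ₜ K.d x := by
  rw [Cx.tensor_d_tmul _ (resBasis_mem i σ)]
  congr 3
  push_cast
  exact ZMod.neg_eq_self_mod_two _

/-- Because W is free, compatibility with differentials has to hold only on `e_i ⊗ x`; there the two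
hypotheses are that condition, with `diff` standing for the differential of the resolution. -/
lemma isCxHom_assemble {S : ℕ → D.Op} (hS : ∀ i : ℕ, Lowers (S i) i)
    (h0 : ∀ X x, (D.obj X).d (S 0 X x) = S 0 X ((chains Λ X).d x))
    (h : ∀ i X x, (D.obj X).d (S (i + 1) X x) = a.diff i X (S i X x) +
      psign ((i + 1 : ℕ) : ZMod 2) • S (i + 1) X ((chains Λ X).d x)) (X : SSet.{u}) :
    IsCxHom (K := (res Λ p).tensor (chains Λ X)) (a.assemble S X) where
  mem {n z} hz := by
    have := assemble_mem (a := a) (c := 0) (fun i => by rw [add_zero]; exact hS i) hz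
    rwa [sub_zero] at this
  comm z := by
    have : a.assemble S X ∘ₗ ((res Λ p).tensor (chains Λ X)).d = (D.obj X).d ∘ₗ a.assemble S X := by
      refine res_tensor_hom_ext fun i σ x => ?_
      rw [LinearMap.comp_apply, LinearMap.comp_apply, tensor_d_basis, map_add, map_zsmul,
        assemble_tmul, assemble_tmul, ← ((a.isNaturalEnd σ).isCxHom X).comm]
      cases i with
      | zero =>
        rw [res_d_zero, zero_tmul, map_zero, zero_add, Nat.cast_zero, psign_zero, one_smul, h0]
      | succ i => rw [assemble_d_basis, h, map_add, map_zsmul]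
    exact LinearMap.congr_fun this z

/-- Two natural equivariant chain maps `W ⊗ C(X) → D(X)` which agree on the elements `e_0 ⊗ x` for
vertices `x` are naturally and equivariantly homotopic. -/
theorem exists_homotopy (a : D.CycAction p)
    {Ψ Ψ' : ∀ X : SSet.{u}, (res Λ p).tensor (chains Λ X) →ₗ[Λ] D.obj X}
    (hΨ : ∀ X, IsCxHom (K := (res Λ p).tensor (chains Λ X)) (Ψ X))
    (hΨ' : ∀ X, IsCxHom (K := (res Λ p).tensor (chains Λ X)) (Ψ' X))
    (hn : ∀ {X Y : SSet.{u}} (f : X ⟶ Y) (z : (res Λ p).tensor (chains Λ X)),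
      Ψ Y (TensorProduct.map LinearMap.id (chainsMap f) z) = D.map f (Ψ X z))
    (hn' : ∀ {X Y : SSet.{u}} (f : X ⟶ Y) (z : (res Λ p).tensor (chains Λ X)),
      Ψ' Y (TensorProduct.map LinearMap.id (chainsMap f) z) = D.map f (Ψ' X z))
    (he : ∀ (σ : Cyc p) X z,
      Ψ X (TensorProduct.map (resAct σ) LinearMap.id z) = a.act σ X (Ψ X z))
    (he' : ∀ (σ : Cyc p) X z,
      Ψ' X (TensorProduct.map (resAct σ) LinearMap.id z) = a.act σ X (Ψ' X z))
    (h0 : ∀ X (x : Splx X 0), Ψ X (resBasis Λ 0 1 ⊗ₜ cell Λ x) =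
      Ψ' X (resBasis Λ 0 1 ⊗ₜ cell Λ x)) :
    ∃ H : ∀ X : SSet.{u}, (res Λ p).tensor (chains Λ X) →ₗ[Λ] D.obj X,
      (∀ {X Y : SSet.{u}} (f : X ⟶ Y) (z : (res Λ p).tensor (chains Λ X)),
        H Y (TensorProduct.map LinearMap.id (chainsMap f) z) = D.map f (H X z)) ∧
      (∀ (σ : Cyc p) X z,
        H X (TensorProduct.map (resAct σ) LinearMap.id z) = a.act σ X (H X z)) ∧
      (∀ X n, ∀ z ∈ ((res Λ p).tensor (chains Λ X)).deg n, H X z ∈ (D.obj X).deg (n - 1)) ∧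
      ∀ X z, Ψ X z - Ψ' X z =
        (D.obj X).d (H X z) + H X (((res Λ p).tensor (chains Λ X)).d z) := by
  -- The components of the difference on the generators `e_i`. Both maps commute with differentials
  -- and the group, so these components form a twisted cycle, and a sequence bounding it gives the
  -- homotopy.
  let E : ℕ → D.Op := fun i X => (Ψ X - Ψ' X) ∘ₗ TensorProduct.mk Λ (res Λ p) (chains Λ X)
    (resBasis Λ i 1)
  have hact : ∀ i σ X (x : chains Λ X), Ψ X (resBasis Λ i σ ⊗ₜ x) - Ψ' X (resBasis Λ i σ ⊗ₜ x) =
      a.act σ X (E i X x) := by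
    intro i σ X x
    have h := congrArg₂ (· - ·) (he σ X (resBasis Λ i 1 ⊗ₜ x)) (he' σ X (resBasis Λ i 1 ⊗ₜ x))
    dsimp only at h
    rw [← map_sub] at h
    simpa only [TensorProduct.map_tmul, resAct_basis, mul_one, LinearMap.id_apply] using! h
  have hE : IsTwistedCycle a.diff E := by
    refine ⟨fun i X Y f x => ?_, fun i X m x hx => ?_, fun X x => ?_, fun i X x => ?_,
      fun X x => ?_⟩
    · have h := congrArg₂ (· - ·) (hn f (resBasis Λ i 1 ⊗ₜ x)) (hn' f (resBasis Λ i 1 ⊗ₜ x))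
      dsimp only at h
      rw [← map_sub] at h
      exact h
    · rw [show m - (i : ℤ) = -(i : ℤ) + m by ring]
      exact sub_mem ((hΨ X).mem (Cx.tmul_mem (resBasis_mem i 1) hx))
        ((hΨ' X).mem (Cx.tmul_mem (resBasis_mem i 1) hx))
    · change (D.obj X).d (Ψ X _ - Ψ' X _) = _
      rw [map_sub, ← (hΨ X).comm, ← (hΨ' X).comm]
      refine (congrArg₂ (fun s t => Ψ X s - Ψ' X t) (tensor_d_basis 0 1 x)
        (tensor_d_basis 0 1 x)).trans ?_
      rw [res_d_zero, zero_tmul, zero_add, Nat.cast_zero, psign_zero, one_smul]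
      rfl
    · change (D.obj X).d (Ψ X _ - Ψ' X _) = _
      rw [map_sub, ← (hΨ X).comm, ← (hΨ' X).comm]
      refine (congrArg₂ (fun s t => Ψ X s - Ψ' X t) (tensor_d_basis (i + 1) 1 x)
        (tensor_d_basis (i + 1) 1 x)).trans ?_
      rw [map_add, map_add, map_zsmul, map_zsmul, add_sub_add_comm, ← smul_sub]
      refine congrArg₂ (· + ·) ?_ rfl
      have key := act_diff (a := a) i 1 X (E i X x)
      rw [a.act_one] at key
      rw [key]
      split_ifs with hi
      · rw [res_d_odd hi, sub_tmul, map_sub, map_sub, sub_sub_sub_comm, hact, hact]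
      · rw [res_d_even hi, sum_tmul, map_sum, map_sum, ← Finset.sum_sub_distrib]
        exact Finset.sum_congr rfl fun r _ => hact _ _ _ _
    · change Ψ X _ - Ψ' X _ = 0
      rw [sub_eq_zero]
      exact h0 X x
  have hB := a.isNaturalEnd_diff
  have hBB := a.diff_diff
  -- The homotopy on `e_i ⊗ x` is the `i`-th bounding operation, extended equivariantly to the other
  -- basis elements of W.
  refine ⟨a.assemble (bounding a.diff E), assemble_natural fun i => hE.bounding_natural hB hBB i,
    fun σ X z => a.assemble_equivariant _ X σ z, fun X n z hz => assemble_mem (c := 1) (fun i => ?_)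
    hz, fun X z => ?_⟩
  · have := hE.bounding_lowers hB hBB i
    rwa [Nat.cast_add, Nat.cast_one] at this
  · have : Ψ X - Ψ' X = (D.obj X).d ∘ₗ a.assemble (bounding a.diff E) X +
        a.assemble (bounding a.diff E) X ∘ₗ ((res Λ p).tensor (chains Λ X)).d := by
      refine res_tensor_hom_ext fun i σ x => ?_
      rw [LinearMap.add_apply, LinearMap.comp_apply, LinearMap.comp_apply, LinearMap.sub_apply,
        hact, tensor_d_basis, map_add, map_zsmul, assemble_tmul, assemble_tmul,
        ← ((a.isNaturalEnd σ).isCxHom X).comm]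
      cases i with
      | zero =>
        rw [res_d_zero, zero_tmul, map_zero, zero_add, Nat.cast_zero, psign_zero, one_smul,
          ← map_add, hE.d_bounding_zero]
      | succ i =>
        rw [assemble_d_basis, add_left_comm, ← map_zsmul, ← map_add, ← map_add,
          hE.d_bounding_succ hB hBB, add_sub_cancel]
    exact LinearMap.congr_fun this z

/-- A natural chain map `C(X) → D(X)` which is invariant on vertices extends to a natural
equivariant chain map `W ⊗ C(X) → D(X)`. -/
theorem exists_extension (a : D.CycAction p) {S₀ : D.Op} (hn : IsNatural S₀)
    (hc : ∀ X, IsCxHom (S₀ X))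
    (h0 : ∀ X (x : Splx X 0), a.act (cycGen p) X (S₀ X (cell Λ x)) = S₀ X (cell Λ x)) :
    ∃ Ψ : ∀ X : SSet.{u}, (res Λ p).tensor (chains Λ X) →ₗ[Λ] D.obj X,
      (∀ X, IsCxHom (K := (res Λ p).tensor (chains Λ X)) (Ψ X)) ∧
      (∀ {X Y : SSet.{u}} (f : X ⟶ Y) (z : (res Λ p).tensor (chains Λ X)),
        Ψ Y (TensorProduct.map LinearMap.id (chainsMap f) z) = D.map f (Ψ X z)) ∧
      (∀ (σ : Cyc p) X z,
        Ψ X (TensorProduct.map (resAct σ) LinearMap.id z) = a.act σ X (Ψ X z)) ∧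
      ∀ X x, Ψ X (resBasis Λ 0 1 ⊗ₜ x) = S₀ X x := by
  -- Only the operations after `S₀` are sought, so the operators are shifted by one. The initial
  -- datum is the failure of `S₀` to be invariant; the twisted cycle has no other components.
  let B : ℕ → ∀ X, D.obj X →ₗ[Λ] D.obj X := fun i => a.diff (i + 1)
  let E : ℕ → D.Op := fun i X => if i = 0 then a.diff 0 X ∘ₗ S₀ X else 0
  have hE : IsTwistedCycle B E := by
    refine ⟨fun i X Y f x => ?_, fun i X m x hx => ?_, fun X x => ?_, fun i X x => ?_,
      fun X x => ?_⟩
    · by_cases hi : i = 0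
      · subst hi
        change a.diff 0 Y (S₀ Y _) = D.map f (a.diff 0 X (S₀ X x))
        rw [hn, (a.isNaturalEnd_diff 0).natural]
      · simp only [E, if_neg hi, LinearMap.zero_apply, map_zero]
    · by_cases hi : i = 0
      · subst hi
        rw [Nat.cast_zero, sub_zero]
        exact ((a.isNaturalEnd_diff 0).isCxHom X).mem ((hc X).mem hx)
      · simp only [E, if_neg hi]
        exact zero_mem _
    · change (D.obj X).d (a.diff 0 X (S₀ X x)) = a.diff 0 X (S₀ X _)
      rw [(hc X).comm, ((a.isNaturalEnd_diff 0).isCxHom X).comm]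
    · simp only [E, if_neg (Nat.succ_ne_zero i), LinearMap.zero_apply, map_zero, smul_zero,
        add_zero]
      by_cases hi : i = 0
      · subst hi
        exact (a.diff_diff 0 X _).symm
      · simp only [if_neg hi, LinearMap.zero_apply, map_zero]
    · change a.diff 0 X (S₀ X _) = 0
      rw [a.diff_even (by simp), h0, sub_self]
  have hB : ∀ i, IsNaturalEnd (B i) := fun i => a.isNaturalEnd_diff (i + 1)
  have hBB : ∀ i X y, B (i + 1) X (B i X y) = 0 := fun i => a.diff_diff (i + 1)
  -- In a bounding sequence the previous term enters with a minus sign, but the differential of W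
  -- enters with a plus; the alternating sign makes up for this.
  let S : ℕ → D.Op
    | 0 => S₀
    | i + 1 => fun X => psign (i : ZMod 2) • bounding B E i X
  have hS : ∀ i X x, S (i + 1) X x = psign (i : ZMod 2) • bounding B E i X x := fun i X x =>
    zsmul_linearMap_apply _ _ _
  refine ⟨a.assemble S, isCxHom_assemble (fun i => ?_) (fun X x => ((hc X).comm x).symm)
    (fun i X x => ?_), assemble_natural fun i => ?_,
    fun σ X z => a.assemble_equivariant _ X σ z, fun X x => ?_⟩
  · cases i with
    | zero => exact fun X m x hx => by rw [Nat.cast_zero, sub_zero]; exact (hc X).mem hx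
    | succ i =>
      intro X m x hx
      rw [hS]
      exact zsmul_mem (hE.bounding_lowers hB hBB i X m x hx) _
  · rw [hS, hS, map_zsmul]
    cases i with
    | zero =>
      have := hE.d_bounding_zero X x
      rw [← eq_sub_iff_add_eq] at this
      rw [this, Nat.cast_zero, psign_zero, one_smul, one_smul, zero_add, Nat.cast_one, psign_one,
        neg_smul, one_smul, sub_eq_add_neg]
      rfl
    | succ i =>
      have := hE.d_bounding_succ hB hBB i X x
      rw [← eq_sub_iff_add_eq] at this
      have h0 : E (i + 1) X x = 0 := by
        simp only [E, if_neg (Nat.succ_ne_zero i), LinearMap.zero_apply]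
      have h1 : ∀ (s : ZMod 2) {M : Type u} [AddCommGroup M] (b v : M),
          psign (s + 1) • (0 - b - psign (s + 1) • v) =
            psign s • b + psign (s + 1 + 1) • psign (s + 1) • v := by
        intro s M _ b v
        rw [smul_sub, psign_smul_psign_smul, psign_smul_psign_smul, CharTwo.add_self_eq_zero,
          show s + 1 + 1 + (s + 1) = 1 by grind, psign_zero, psign_add, psign_one, one_smul,
          neg_smul, one_smul, zero_sub, smul_neg, mul_neg_one, neg_smul, neg_neg, sub_eq_add_neg]
      rw [this, hS, map_zsmul, h0]
      simp only [Nat.cast_succ]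
      exact h1 _ (M := D.obj X) _ _
  · cases i with
    | zero => exact hn
    | succ i =>
      intro X Y f x
      rw [hS, hS, hE.bounding_natural hB hBB i, map_zsmul]
  · rw [assemble_tmul, a.act_one]

end CycAction

end ModelFunctor

/-! ### Actions on tensor powers and tensor products -/

namespace ModelFunctor

variable (D : ModelFunctor.{u} Λ) (p : ℕ)

/-- The signed permutation action on a tensor power. -/
def powAction : (D.pow p).CycAction p where
  act σ X := Cx.perm σ.1 fun _ => D.obj X
  isNaturalEnd σ := ⟨fun X => isCxHom_perm σ.1 fun _ => D.obj X, fun f y =>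
    Cx.perm_map σ.1 (fun _ => (D.isCxHom f).mem) y⟩
  act_one X y := Cx.perm_one (D.obj X) y
  act_mul σ τ X y := Cx.perm_mul σ.1 τ.1 (D.obj X) y

variable {D p} {D' : ModelFunctor.{u} Λ}

/-- The diagonal action on a tensor product. -/
def CycAction.tensor (a : D.CycAction p) (a' : D'.CycAction p) : (D.tensor D').CycAction p where
  act σ X := TensorProduct.map (a.act σ X) (a'.act σ X)
  isNaturalEnd σ := ⟨fun X => ((a.isNaturalEnd σ).isCxHom X).tensorMap
      ((a'.isNaturalEnd σ).isCxHom X), fun {X Y} f y => by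
    induction y using TensorProduct.induction_on with
    | zero => simp only [map_zero]
    | add y y' hy hy' => simp only [map_add, hy, hy']
    | tmul x y =>
      simp only [TensorProduct.map_tmul, (a.isNaturalEnd σ).natural, (a'.isNaturalEnd σ).natural]⟩
  act_one X y := by
    have h1 : a.act 1 X = LinearMap.id := LinearMap.ext (a.act_one X)
    have h2 : a'.act 1 X = LinearMap.id := LinearMap.ext (a'.act_one X)
    rw [h1, h2, TensorProduct.map_id]
    rfl
  act_mul σ τ X y := by
    have h1 : a.act (σ * τ) X = a.act σ X ∘ₗ a.act τ X := LinearMap.ext (a.act_mul σ τ X)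
    have h2 : a'.act (σ * τ) X = a'.act σ X ∘ₗ a'.act τ X := LinearMap.ext (a'.act_mul σ τ X)
    rw [h1, h2, TensorProduct.map_comp]
    rfl

end ModelFunctor

/-! ### Values of id ⊗ Θ when the values of Θ are constrained -/

section LinearAlgebra

variable {M : Type u₁} {M' : Type u₂} {N : Type v} [AddCommGroup M] [Module Λ M] [AddCommGroup M']
  [Module Λ M'] [AddCommGroup N] [Module Λ N] {Θ : M' →ₗ[Λ] N}

lemma map_id_eq_rid_tmul (ε : M' →ₗ[Λ] Λ) {v : N} (h : ∀ b, Θ b = ε b • v) (y : M ⊗[Λ] M') :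
    TensorProduct.map LinearMap.id Θ y =
      TensorProduct.rid Λ M (TensorProduct.map LinearMap.id ε y) ⊗ₜ[Λ] v := by
  induction y with
  | zero => simp only [map_zero, zero_tmul]
  | add y y' hy hy' => simp only [map_add, hy, hy', add_tmul]
  | tmul a b =>
    rw [TensorProduct.map_tmul, TensorProduct.map_tmul, TensorProduct.rid_tmul,
      TensorProduct.smul_tmul, h]

lemma map_id_mem_span {T : Set N} (h : ∀ b, Θ b ∈ Submodule.span Λ T) (y : M ⊗[Λ] M') :
    TensorProduct.map LinearMap.id Θ y ∈
      Submodule.span Λ {z | ∃ a : M, ∃ t ∈ T, z = a ⊗ₜ[Λ] t} := by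
  induction y with
  | zero => simp only [map_zero, zero_mem]
  | add y y' hy hy' =>
    rw [map_add]
    exact add_mem hy hy'
  | tmul a b =>
    have h2 : Submodule.span Λ T ≤ (Submodule.span Λ {z | ∃ a : M, ∃ t ∈ T, z = a ⊗ₜ[Λ] t}).comap
        (TensorProduct.mk Λ M N a) :=
      Submodule.span_le.2 fun t ht => Submodule.subset_span ⟨a, t, ht, rfl⟩
    exact h2 (h b)

end LinearAlgebra

/-! ### Extension along the coproduct -/

lemma isCxHom_assoc (K : Cx.{u₁} Λ) (L : Cx.{u₂} Λ) (M : Cx.{v} Λ) :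
    IsCxHom (K := (K.tensor L).tensor M) (L := K.tensor (L.tensor M))
      (TensorProduct.assoc Λ K L M).toLinearMap where
  mem {n z} hz := by
    refine Cx.tensorDeg_le (((K.tensor (L.tensor M)).deg n).comap
      (TensorProduct.assoc Λ K L M).toLinearMap) (fun i j hij y hy x hx => ?_) hz
    refine Cx.tensorDeg_le ((((K.tensor (L.tensor M)).deg n).comap
      (TensorProduct.assoc Λ K L M).toLinearMap).comap ((TensorProduct.mk Λ (K ⊗[Λ] L) M).flip x))
      (fun k l hkl a ha b hb => ?_) hy
    change a ⊗ₜ[Λ] (b ⊗ₜ[Λ] x) ∈ (K.tensor (L.tensor M)).deg n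
    rw [← hij, ← hkl, add_assoc]
    exact Cx.tmul_mem ha (Cx.tmul_mem hb hx)
  comm z := by
    have : (TensorProduct.assoc Λ K L M).toLinearMap ∘ₗ ((K.tensor L).tensor M).d =
        (K.tensor (L.tensor M)).d ∘ₗ (TensorProduct.assoc Λ K L M).toLinearMap := by
      refine TensorProduct.ext (Cx.tensor_hom_ext fun i j a ha b hb => LinearMap.ext fun x => ?_)
      change TensorProduct.assoc Λ K L M (((K.tensor L).tensor M).d ((a ⊗ₜ b) ⊗ₜ x)) =
        (K.tensor (L.tensor M)).d (a ⊗ₜ (b ⊗ₜ x))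
      rw [Cx.tensor_d_tmul (K := K.tensor L) _ (Cx.tmul_mem ha hb), Cx.tensor_d_tmul _ ha,
        Cx.tensor_d_tmul (L := L.tensor M) _ ha, Cx.tensor_d_tmul _ hb, add_tmul, tmul_add,
        zsmul_tmul_left, tmul_zsmul_right]
      refine Eq.trans (b := K.d a ⊗ₜ[Λ] (b ⊗ₜ[Λ] x) + psign (i : ZMod 2) • a ⊗ₜ[Λ] (L.d b ⊗ₜ[Λ] x) +
        psign ((i + j : ℤ) : ZMod 2) • a ⊗ₜ[Λ] (b ⊗ₜ[Λ] M.d x)) ?_ ?_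
      · simp only [map_add, map_zsmul, TensorProduct.assoc_tmul]
      · rw [Int.cast_add, ← psign_smul_psign_smul, add_assoc, ← smul_add]
    exact LinearMap.congr_fun this z

variable {p : ℕ}

/-- The map `w ⊗ x ↦ ∑ w' ⊗ Θ (w'' ⊗ x)`, where `∑ w' ⊗ w''` is the coproduct of `w`. -/
def coextend {C : Cx.{u₁} Λ} {D : Cx.{u₂} Λ} (Θ : (res Λ p).tensor C →ₗ[Λ] D) :
    (res Λ p).tensor C →ₗ[Λ] (res Λ p).tensor D :=
  TensorProduct.map LinearMap.id Θ ∘ₗ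
    (TensorProduct.assoc Λ (res Λ p) (res Λ p) C).toLinearMap ∘ₗ
      TensorProduct.map (coprod Λ p) LinearMap.id

lemma coextend_tmul {C : Cx.{u₁} Λ} {D : Cx.{u₂} Λ} (Θ : (res Λ p).tensor C →ₗ[Λ] D) (w : res Λ p)
    (x : C) : coextend Θ (w ⊗ₜ x) =
      TensorProduct.map LinearMap.id (Θ ∘ₗ (TensorProduct.mk Λ (res Λ p) C).flip x)
        (coprod Λ p w) := by
  change TensorProduct.map LinearMap.id Θ
    (TensorProduct.assoc Λ (res Λ p) (res Λ p) C (coprod Λ p w ⊗ₜ x)) = _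
  induction coprod Λ p w using TensorProduct.induction_on with
  | zero =>
    rw [zero_tmul]
    simp only [map_zero]
  | add y y' hy hy' =>
    rw [add_tmul]
    simp only [map_add, hy, hy']
  | tmul a b => rfl

lemma isCxHom_coextend {C : Cx.{u₁} Λ} {D : Cx.{u₂} Λ} {Θ : (res Λ p).tensor C →ₗ[Λ] D}
    (h : IsCxHom (K := (res Λ p).tensor C) Θ) :
    IsCxHom (K := (res Λ p).tensor C) (L := (res Λ p).tensor D) (coextend Θ) :=
  (IsCxHom.tensorMap (L := (res Λ p).tensor C) (isCxHom_id _) h).comp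
    ((isCxHom_assoc _ _ _).comp (IsCxHom.tensorMap isCxHom_coprod (isCxHom_id _)))

lemma coextend_map {C : Cx.{u₁} Λ} {D : Cx.{u₂} Λ} {C' : Cx.{v₁} Λ} {D' : Cx.{v₂} Λ}
    {Θ : (res Λ p).tensor C →ₗ[Λ] D} {Θ' : (res Λ p).tensor C' →ₗ[Λ] D'} (σ : Cyc p)
    {c : C →ₗ[Λ] C'} {e : D →ₗ[Λ] D'}
    (h : ∀ z, Θ' (TensorProduct.map (resAct σ) c z) = e (Θ z)) (z : (res Λ p).tensor C) :
    coextend Θ' (TensorProduct.map (resAct σ) c z) =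
      TensorProduct.map (resAct σ) e (coextend Θ z) := by
  have : coextend Θ' ∘ₗ TensorProduct.map (resAct σ) c =
      TensorProduct.map (resAct σ) e ∘ₗ coextend Θ := TensorProduct.ext' fun w x => by
    rw [LinearMap.comp_apply, LinearMap.comp_apply, TensorProduct.map_tmul, coextend_tmul,
      coextend_tmul, coprod_resAct]
    induction coprod Λ p w using TensorProduct.induction_on with
    | zero => simp only [map_zero]
    | add y y' hy hy' => simp only [map_add, hy, hy']
    | tmul a b => exact congrArg (fun t => resAct σ a ⊗ₜ[Λ] t) (h (b ⊗ₜ x))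
  exact LinearMap.congr_fun this z

/-- If `Θ` sees only the augmentation of its first argument, the second half of the coproduct is
augmented away, and the counit property returns `w`. -/
lemma coextend_tmul_of_aug {C : Cx.{u₁} Λ} {D : Cx.{u₂} Λ} {Θ : (res Λ p).tensor C →ₗ[Λ] D} {x : C}
    {y : D} (h : ∀ b, Θ (b ⊗ₜ x) = aug Λ p b • y) (w : res Λ p) :
    coextend Θ (w ⊗ₜ x) = w ⊗ₜ y := by
  rw [coextend_tmul]
  refine (map_id_eq_rid_tmul (aug Λ p) h _).trans ?_
  rw [coprod_counit]

lemma coextend_tmul_mem_span {C : Cx.{u₁} Λ} {D : Cx.{u₂} Λ} {Θ : (res Λ p).tensor C →ₗ[Λ] D}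
    {x : C} {T : Set D} (h : ∀ b, Θ (b ⊗ₜ x) ∈ Submodule.span Λ T) (w : res Λ p) :
    coextend Θ (w ⊗ₜ x) ∈ Submodule.span Λ {z | ∃ a : res Λ p, ∃ t ∈ T, z = a ⊗ₜ[Λ] t} := by
  rw [coextend_tmul]
  exact map_id_mem_span h _

lemma coextend_bottom {C : Cx.{u₁} Λ} {D : Cx.{u₂} Λ} (Θ : (res Λ p).tensor C →ₗ[Λ] D) (x : C) :
    coextend Θ (resBasis Λ 0 1 ⊗ₜ x) = resBasis Λ 0 1 ⊗ₜ Θ (resBasis Λ 0 1 ⊗ₜ x) := by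
  rw [coextend_tmul, coprod_basis_one, coprodGen_zero]
  rfl

/-! ### Chains of standard simplices in large dimensions -/

lemma cell_stdSplx_eq_zero {n m : ℕ} (h : n < m) (x : Splx (stdSplx.{u} n) m) : cell Λ x = 0 := by
  obtain ⟨f, rfl⟩ := mkSplx_surjective x
  refine cell_degenerate ?_
  have := map_degenerate_of_not_injective (SimplexCategory.Hom.mk f) (fun hinj => ?_) (generic.{u} n)
  · exact this
  · have := Fintype.card_le_of_injective _ hinj
    simp at this
    lia

lemma chains_stdSplx_eq_zero {n : ℕ} {m : ℤ} (h : m < -(n : ℤ)) {x : chains Λ (stdSplx.{u} n)}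
    (hx : x ∈ (chains Λ (stdSplx n)).deg m) : x = 0 := by
  have : x ∈ (⊥ : Submodule Λ (chains Λ (stdSplx.{u} n))) := chains_span _ (fun k y hk => by
    rw [cell_stdSplx_eq_zero (by lia)]
    exact zero_mem _) hx
  exact this

/-- If the dimensions of `p` factors add up to more than `p * n`, one of them exceeds `n`, and the
normalized chains of the `n`-simplex vanish there. -/
lemma pow_chains_stdSplx_eq_zero {n : ℕ} {m : ℤ} (h : m < -((p * n : ℕ) : ℤ))
    {z : (chains Λ (stdSplx.{u} n)).pow p} (hz : z ∈ ((chains Λ (stdSplx n)).pow p).deg m) :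
    z = 0 := by
  have : ((chains Λ (stdSplx n)).pow p).deg m ≤ ⊥ := by
    refine Cx.piDeg_le (K := fun _ => chains Λ (stdSplx n)) _ fun e he x hx => ?_
    obtain ⟨i, -, hi⟩ : ∃ i ∈ (Finset.univ : Finset (Fin p)), e i < -(n : ℤ) :=
      Finset.exists_lt_of_sum_lt (by
        rw [he, Finset.sum_const, Finset.card_univ, Fintype.card_fin]
        push_cast at h
        simpa using h)
    rw [Submodule.mem_bot]
    exact MultilinearMap.map_coord_zero _ i (chains_stdSplx_eq_zero hi (hx i))
  exact this hz

lemma seg_vertex {X : SSet.{u}} (x : Splx X 0) : seg Λ x 0 0 = cell Λ x := by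
  rw [seg, dif_pos le_rfl]
  congr 1
  have : SimplexCategory.subinterval (n := 0) 0 0 le_rfl = 𝟙 _ := by
    ext i : 3
    exact Subsingleton.elim (α := Fin 1) _ _
  rw [this]
  exact X.map_id_apply _ x

lemma awDiag_vertex {X : SSet.{u}} (x : Splx X 0) :
    awDiag Λ p X (cell Λ x) = PiTensorProduct.tprod Λ fun _ => cell Λ x := by
  rw [awDiag_cell, Finset.piAntidiag_zero, Finset.sum_singleton]
  congr 1
  funext i
  simp only [Pi.zero_apply, Finset.sum_const_zero]
  exact seg_vertex x

/-- All factors have degree 0, so the permutation carries no sign. -/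
lemma perm_tprod_vertex {X : SSet.{u}} (σ : Equiv.Perm (Fin p)) (x : Splx X 0) :
    Cx.perm σ (fun _ => chains Λ X) (PiTensorProduct.tprod Λ fun _ => cell Λ x) =
      PiTensorProduct.tprod Λ fun _ => cell Λ x := by
  rw [Cx.perm_tprod σ (K := fun _ => chains Λ X) (e := fun _ => 0) (fun _ => by
    simpa using cell_mem x), Cx.permSign_eq]
  simp [psign_zero]

/-! ### Existence of equivariant diagonal approximations -/

/-- A natural equivariant diagonal approximation `W ⊗ C(X) → C(X)^p`. -/
structure EquivariantDiagonal (Λ : Type) [CommRing Λ] (p : ℕ) where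
  toFun : ∀ X : SSet.{u}, (res Λ p).tensor (chains Λ X) →ₗ[Λ] (chains Λ X).pow p
  isCxHom : ∀ X, IsCxHom (K := (res Λ p).tensor (chains Λ X)) (toFun X)
  natural : ∀ {X Y : SSet.{u}} (f : X ⟶ Y) (z : (res Λ p).tensor (chains Λ X)),
    toFun Y (TensorProduct.map LinearMap.id (chainsMap f) z) =
      PiTensorProduct.map (fun _ => chainsMap f) (toFun X z)
  equivariant : ∀ (σ : Cyc p) X z, toFun X (TensorProduct.map (resAct σ) LinearMap.id z) =
    Cx.perm σ.1 (fun _ => chains Λ X) (toFun X z)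
  bottom : ∀ X x, toFun X (resBasis Λ 0 1 ⊗ₜ x) = awDiag Λ p X x

variable (Λ p) in
-- On a vertex the Alexander-Whitney diagonal is the tensor power of that vertex, which the cyclic
-- group fixes; so `exists_extension` applies to it.
lemma nonempty_equivariantDiagonal : Nonempty (EquivariantDiagonal.{u} Λ p) := by
  obtain ⟨Ψ, h1, h2, h3, h4⟩ := ((ModelFunctor.ofChains.{u} Λ).powAction p).exists_extension
    (S₀ := awDiag Λ p) awDiag_natural isCxHom_awDiag fun X x => by
      rw [awDiag_vertex]
      exact perm_tprod_vertex _ x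
  exact ⟨⟨Ψ, h1, h2, h3, h4⟩⟩

namespace EquivariantDiagonal

variable (Ψ : EquivariantDiagonal.{u} Λ p)

/-- Naturality reduces to the generic `j`-simplex, where the value lies in a degree in which the
tensor power of chains is zero. Both the condition on vertices and the filtration condition depend
on this. -/
lemma toFun_cell_eq_zero {X : SSet.{u}} {j : ℕ} (x : Splx X j) {i : ℤ} {w : res Λ p}
    (hw : w ∈ (res Λ p).deg i) (hi : i - j < -((p * j : ℕ) : ℤ)) :
    Ψ.toFun X (w ⊗ₜ cell Λ x) = 0 := by
  have h := Ψ.natural (splxMap x) (w ⊗ₜ cell Λ (generic j))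
  rw [TensorProduct.map_tmul, ModelFunctor.chainsMap_splxMap] at h
  refine h.trans ?_
  rw [pow_chains_stdSplx_eq_zero hi ((Ψ.isCxHom _).mem (Cx.tmul_mem hw (cell_mem (generic j)))),
    map_zero]

/-- On generators of positive dimension the value vanishes for reasons of degree. In dimension zero
it is determined by `bottom` and equivariance, the power of a vertex being fixed. -/
lemma vertex {X : SSet.{u}} (w : res Λ p) (x : Splx X 0) :
    Ψ.toFun X (w ⊗ₜ cell Λ x) = aug Λ p w • PiTensorProduct.tprod Λ fun _ => cell Λ x := by
  have : Ψ.toFun X ∘ₗ (TensorProduct.mk Λ (res Λ p) (chains Λ X)).flip (cell Λ x) =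
      LinearMap.toSpanSingleton Λ _ (PiTensorProduct.tprod Λ fun _ => cell Λ x) ∘ₗ aug Λ p := by
    refine res_hom_ext fun i σ => ?_
    refine Eq.trans (b := aug Λ p (resBasis Λ i σ) •
      (PiTensorProduct.tprod Λ fun _ => cell Λ x : (chains Λ X).pow p)) ?_ rfl
    rw [aug_basis]
    change Ψ.toFun X (resBasis Λ i σ ⊗ₜ cell Λ x) = _
    split_ifs with hi
    · subst hi
      have h := Ψ.equivariant σ X (resBasis Λ 0 1 ⊗ₜ cell Λ x)
      rw [TensorProduct.map_tmul, resAct_basis, mul_one, Ψ.bottom, awDiag_vertex,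
        perm_tprod_vertex] at h
      exact h.trans (one_smul _ _).symm
    · rw [Ψ.toFun_cell_eq_zero x (resBasis_mem i σ) (by simp; lia), zero_smul]
  exact LinearMap.congr_fun this w

/-- The map `W ⊗ C(L_1 × ⋯ × L_p) → C(L_1) ⊗ ⋯ ⊗ C(L_p)` obtained by projecting to the factors. -/
def toPi (L : Fin p → SSet.{u}) :
    (res Λ p).tensor (chains Λ (piProd L)) →ₗ[Λ] Cx.piTensor fun i => chains Λ (L i) :=
  PiTensorProduct.map (fun i => chainsMap (piProdFst L i)) ∘ₗ Ψ.toFun (piProd L)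

lemma isCxHom_toPi (L : Fin p → SSet.{u}) :
    IsCxHom (K := (res Λ p).tensor (chains Λ (piProd L)))
      (L := Cx.piTensor fun i => chains Λ (L i)) (Ψ.toPi L) :=
  (IsCxHom.piMap fun _ => isCxHom_chainsMap _).comp (Ψ.isCxHom _)

lemma toPi_natural {L S : Fin p → SSet.{u}} (f : ∀ i, L i ⟶ S i)
    (z : (res Λ p).tensor (chains Λ (piProd L))) :
    Ψ.toPi S (TensorProduct.map LinearMap.id (chainsMap (piProdMap f)) z) =
      PiTensorProduct.map (fun i => chainsMap (f i)) (Ψ.toPi L z) := by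
  have : PiTensorProduct.map (fun i => chainsMap (Λ := Λ) (piProdFst S i)) ∘ₗ
      PiTensorProduct.map (fun _ => chainsMap (piProdMap f)) =
      PiTensorProduct.map (fun i => chainsMap (f i)) ∘ₗ
        PiTensorProduct.map (fun i => chainsMap (piProdFst L i)) := by
    rw [← PiTensorProduct.map_comp, ← PiTensorProduct.map_comp]
    simp only [← chainsMap_comp]
    rfl
  rw [toPi, toPi, LinearMap.comp_apply, LinearMap.comp_apply, Ψ.natural]
  exact LinearMap.congr_fun this _

lemma toPi_equivariant (σ : Cyc p) (L : Fin p → SSet.{u})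
    (z : (res Λ p).tensor (chains Λ (piProd L))) :
    Ψ.toPi (fun i => L (σ.1.symm i))
        (TensorProduct.map (resAct σ) (chainsMap (piProdPerm σ.1 L)) z) =
      Cx.perm σ.1 (fun i => chains Λ (L i)) (Ψ.toPi L z) := by
  have h : TensorProduct.map (resAct σ) (chainsMap (piProdPerm σ.1 L)) z =
      TensorProduct.map LinearMap.id (chainsMap (piProdPerm σ.1 L))
        (TensorProduct.map (resAct σ) LinearMap.id z) := by
    rw [← LinearMap.comp_apply, ← TensorProduct.map_comp, LinearMap.id_comp, LinearMap.comp_id]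
  rw [h, toPi, toPi, LinearMap.comp_apply, LinearMap.comp_apply, Ψ.natural, Ψ.equivariant]
  refine Eq.trans ?_ (Cx.perm_map σ.1 (K := fun _ => chains Λ (piProd L))
    (fun i => chainsMap_mem (piProdFst L i)) _).symm
  rw [← LinearMap.comp_apply, ← PiTensorProduct.map_comp]
  simp only [← chainsMap_comp]
  rfl

lemma toPi_vertex (L : Fin p → SSet.{u}) (w : res Λ p) (x : Splx (piProd L) 0) :
    Ψ.toPi L (w ⊗ₜ cell Λ x) =
      aug Λ p w • PiTensorProduct.tprod Λ fun i => cell Λ (L := L i) (x i) := by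
  rw [toPi, LinearMap.comp_apply, Ψ.vertex, map_smul, PiTensorProduct.map_tprod]
  simp only [chainsMap_cell]
  rfl

lemma toPi_cell_mem (L : Fin p → SSet.{u}) (w : res Λ p) {j : ℕ} (x : Splx (piProd L) j) :
    Ψ.toPi L (w ⊗ₜ cell Λ x) ∈ Submodule.span Λ
      {z | ∃ k : ℕ, z ∈ (Cx.piTensor fun i => chains Λ (L i)).deg (-(k : ℤ)) ∧ k ≤ p * j} := by
  refine (res Λ p).induction (P := fun w => Ψ.toPi L (w ⊗ₜ cell Λ x) ∈ Submodule.span Λ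
      {z | ∃ k : ℕ, z ∈ (Cx.piTensor fun i => chains Λ (L i)).deg (-(k : ℤ)) ∧ k ≤ p * j})
    (fun n w hw => ?_) (fun w w' hw hw' => ?_) w
  · by_cases hn : n - j < -((p * j : ℕ) : ℤ)
    · rw [toPi, LinearMap.comp_apply, Ψ.toFun_cell_eq_zero x hw hn, map_zero]
      exact zero_mem _
    -- The homological degree of the value is `j - n`, which is at most `p * j` in this case; if `n
    -- > j` it would be negative, but then `w` lies in a positive degree of W and is zero.
    · by_cases hn0 : n ≤ j
      · refine Submodule.subset_span ⟨(j - n).toNat, ?_, by lia⟩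
        rw [show -(((j - n).toNat : ℕ) : ℤ) = n + -(j : ℤ) by lia]
        exact (Ψ.isCxHom_toPi L).mem (Cx.tmul_mem hw (cell_mem x))
      · have : w ∈ (⊥ : Submodule Λ (res Λ p)) := res_span _ (fun i σ hi => by lia) hw
        rw [(Submodule.mem_bot Λ).1 this, zero_tmul, map_zero]
        exact zero_mem _
  · rw [add_tmul, map_add]
    exact add_mem hw hw'

/-- The maps `W ⊗ C(L_1 × ⋯ × L_p) → W ⊗ C(L_1) ⊗ ⋯ ⊗ C(L_p)` given by an equivariant diagonal
approximation. -/
def toDiag (L : Fin p → SSet.{u}) : (res Λ p).tensor (chains Λ (piProd L)) →ₗ[Λ]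
    (res Λ p).tensor (Cx.piTensor fun i => chains Λ (L i)) :=
  coextend (C := chains Λ (piProd L)) (D := Cx.piTensor fun i => chains Λ (L i)) (Ψ.toPi L)

lemma toDiag_natural {L S : Fin p → SSet.{u}} (f : ∀ i, L i ⟶ S i)
    (z : (res Λ p).tensor (chains Λ (piProd L))) :
    Ψ.toDiag S (TensorProduct.map LinearMap.id (chainsMap (piProdMap f)) z) =
      TensorProduct.map LinearMap.id (PiTensorProduct.map fun i => chainsMap (f i))
        (Ψ.toDiag L z) := by
  have := coextend_map (C := chains Λ (piProd L)) (D := Cx.piTensor fun i => chains Λ (L i))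
    (C' := chains Λ (piProd S)) (D' := Cx.piTensor fun i => chains Λ (S i)) (Θ := Ψ.toPi L)
    (Θ' := Ψ.toPi S) (e := PiTensorProduct.map fun i => chainsMap (f i)) 1
    (fun z => by rw [resAct_one]; exact Ψ.toPi_natural f z) z
  rw [resAct_one] at this
  exact this

lemma toDiag_equivariant (σ : Cyc p) (L : Fin p → SSet.{u})
    (z : (res Λ p).tensor (chains Λ (piProd L))) :
    Ψ.toDiag (fun i => L (σ.1.symm i))
        (TensorProduct.map (resAct σ) (chainsMap (piProdPerm σ.1 L)) z) =
      TensorProduct.map (resAct σ) (Cx.perm σ.1 fun i => chains Λ (L i)) (Ψ.toDiag L z) :=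
  coextend_map (C := chains Λ (piProd L)) (D := Cx.piTensor fun i => chains Λ (L i))
    (C' := chains Λ (piProd fun i => L (σ.1.symm i)))
    (D' := Cx.piTensor fun i => chains Λ (L (σ.1.symm i))) (Θ := Ψ.toPi L) σ
    (Ψ.toPi_equivariant σ L) z

lemma toDiag_vertex (L : Fin p → SSet.{u}) (w : res Λ p) (x : Splx (piProd L) 0) :
    Ψ.toDiag L (w ⊗ₜ cell Λ x) = w ⊗ₜ PiTensorProduct.tprod Λ fun i => cell Λ (L := L i) (x i) :=
  coextend_tmul_of_aug (C := chains Λ (piProd L)) (D := Cx.piTensor fun i => chains Λ (L i))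
    (fun b => Ψ.toPi_vertex L b x) w

lemma toDiag_bottom (L : Fin p → SSet.{u}) (z : chains Λ (piProd L)) :
    Ψ.toDiag L (resBasis Λ 0 1 ⊗ₜ z) = resBasis Λ 0 1 ⊗ₜ awPi L z := by
  refine (coextend_bottom (C := chains Λ (piProd L)) (D := Cx.piTensor fun i => chains Λ (L i))
    (Ψ.toPi L) z).trans ?_
  rw [awPi_eq, toPi, LinearMap.comp_apply, Ψ.bottom]
  rfl

lemma toDiag_cell_mem (L : Fin p → SSet.{u}) (w : res Λ p) (j : ℕ) (x : Splx (piProd L) j) :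
    Ψ.toDiag L (w ⊗ₜ cell Λ x) ∈ Submodule.span Λ {y | ∃ (k : ℕ) (w' : res Λ p),
      ∃ z ∈ (Cx.piTensor fun i => chains Λ (L i)).deg (-(k : ℤ)), k ≤ p * j ∧ y = w' ⊗ₜ[Λ] z} := by
  refine Submodule.span_mono ?_ (coextend_tmul_mem_span (C := chains Λ (piProd L))
    (D := Cx.piTensor fun i => chains Λ (L i)) (fun b => Ψ.toPi_cell_mem L b x) w)
  rintro _ ⟨w', z, ⟨k, hz, hk⟩, rfl⟩
  exact ⟨k, w', z, hz, hk, rfl⟩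

/-- The family of maps given by an equivariant diagonal approximation. -/
def diagApprox : DiagApprox.{u} Λ p where
  toFun := Ψ.toDiag
  isCxHom L := isCxHom_coextend (Ψ.isCxHom_toPi L)
  natural := Ψ.toDiag_natural
  equivariant := Ψ.toDiag_equivariant
  vertices := Ψ.toDiag_vertex
  bottom := Ψ.toDiag_bottom
  filtration := Ψ.toDiag_cell_mem

end EquivariantDiagonal

variable (Λ p) in
theorem nonempty_diagApprox : Nonempty (DiagApprox.{u} Λ p) :=
  (nonempty_equivariantDiagonal Λ p).map fun Ψ => Ψ.diagApprox

/-! ### The diagonal `Δ : W ⊗ C(L) → C(L)^p` -/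

section Diagonal

variable {p : ℕ}

lemma isCxHom_augTensor (D : Cx.{v} Λ) : IsCxHom (K := (res Λ p).tensor D) (L := D)
    ((TensorProduct.lid Λ D).toLinearMap ∘ₗ TensorProduct.map (aug Λ p) LinearMap.id) where
  mem {n z} hz := by
    refine Cx.tensorDeg_le ((D.deg n).comap ((TensorProduct.lid Λ D).toLinearMap ∘ₗ
      TensorProduct.map (aug Λ p) LinearMap.id)) (fun i j hij w hw x hx => ?_) hz
    change aug Λ p w • x ∈ D.deg n
    by_cases hi : i = 0
    · subst hi
      rw [zero_add] at hij
      rw [← hij]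
      exact Submodule.smul_mem _ _ hx
    · rw [aug_of_mem hi hw, zero_smul]
      exact zero_mem _
  comm z := by
    have : ((TensorProduct.lid Λ D).toLinearMap ∘ₗ TensorProduct.map (aug Λ p) LinearMap.id) ∘ₗ
        ((res Λ p).tensor D).d =
        D.d ∘ₗ ((TensorProduct.lid Λ D).toLinearMap ∘ₗ
          TensorProduct.map (aug Λ p) LinearMap.id) := by
      refine Cx.tensor_hom_ext fun i j w hw x hx => ?_
      rw [LinearMap.comp_apply, Cx.tensor_d_tmul _ hw, map_add, map_zsmul]
      change aug Λ p ((res Λ p).d w) • x + psign (i : ZMod 2) • aug Λ p w • D.d x =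
        D.d (aug Λ p w • x)
      rw [aug_d, zero_smul, zero_add, map_smul]
      by_cases hi : i = 0
      · subst hi
        rw [Int.cast_zero, psign_zero, one_smul]
      · rw [aug_of_mem hi hw, zero_smul, smul_zero]
    exact LinearMap.congr_fun this z

namespace DiagApprox

variable (Φ : DiagApprox.{u} Λ p)

lemma isCxHom_delta (L : SSet.{u}) : IsCxHom (K := (res Λ p).tensor (chains Λ L)) (Φ.delta L) :=
  (isCxHom_augTensor ((chains Λ L).pow p)).comp
    ((Φ.isCxHom fun _ => L).comp ((isCxHom_id _).tensorMap (isCxHom_chainsMap _)))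

lemma delta_map {L S : SSet.{u}} (f : L ⟶ S) (z : (res Λ p).tensor (chains Λ L)) :
    Φ.delta S (TensorProduct.map LinearMap.id (chainsMap f) z) =
      PiTensorProduct.map (fun _ => chainsMap f) (Φ.delta L z) := by
  induction z using TensorProduct.induction_on with
  | zero => simp only [map_zero]
  | add z z' hz hz' => simp only [map_add, hz, hz']
  | tmul w x => exact Φ.delta_naturality f w x

/-- The diagonal is unchanged by permuting the factors, so a permutation may be inserted after it
and equivariance of `Φ` applied; the augmentation is invariant. -/
lemma delta_equivariant (σ : Cyc p) (L : SSet.{u}) (z : (res Λ p).tensor (chains Λ L)) :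
    Φ.delta L (TensorProduct.map (resAct σ) LinearMap.id z) =
      Cx.perm σ.1 (fun _ => chains Λ L) (Φ.delta L z) := by
  have h1 : chainsMap (Λ := Λ) (diag p L) =
      chainsMap (piProdPerm σ.1 fun _ => L) ∘ₗ chainsMap (diag p L) := by
    rw [← chainsMap_comp]
    rfl
  have h2 : TensorProduct.map LinearMap.id (chainsMap (Λ := Λ) (diag p L)) ∘ₗ
      TensorProduct.map (resAct σ) LinearMap.id =
      TensorProduct.map (resAct σ) (chainsMap (piProdPerm σ.1 fun _ => L)) ∘ₗ
        TensorProduct.map LinearMap.id (chainsMap (diag p L)) := by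
    rw [← TensorProduct.map_comp, ← TensorProduct.map_comp, ← h1, LinearMap.comp_id,
      LinearMap.comp_id, LinearMap.id_comp]
  have h3 : ∀ y : (res Λ p).tensor ((chains Λ L).pow p),
      TensorProduct.lid Λ ((chains Λ L).pow p) (TensorProduct.map (aug Λ p) LinearMap.id
        (TensorProduct.map (resAct σ) (Cx.perm σ.1 fun _ => chains Λ L) y)) =
      Cx.perm σ.1 (fun _ => chains Λ L) (TensorProduct.lid Λ ((chains Λ L).pow p)
        (TensorProduct.map (aug Λ p) LinearMap.id y)) := by
    intro y
    induction y using TensorProduct.induction_on with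
    | zero => simp only [map_zero]
    | add y y' hy hy' => simp only [map_add, hy, hy']
    | tmul a b =>
      simp only [TensorProduct.map_tmul, TensorProduct.lid_tmul, LinearMap.id_apply, aug_resAct,
        map_smul]
  have h4 := Φ.equivariant σ (fun _ => L) (TensorProduct.map LinearMap.id (chainsMap (diag p L)) z)
  have h5 := LinearMap.congr_fun h2 z
  rw [LinearMap.comp_apply, LinearMap.comp_apply] at h5
  rw [← h5] at h4
  exact (congrArg (fun y => TensorProduct.lid Λ ((chains Λ L).pow p)
    (TensorProduct.map (aug Λ p) LinearMap.id y)) h4).trans (h3 _)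

lemma delta_vertex {L : SSet.{u}} (x : Splx L 0) : Φ.delta L (resBasis Λ 0 1 ⊗ₜ cell Λ x) =
    PiTensorProduct.tprod Λ fun _ => cell Λ x := by
  have h := Φ.vertices (fun _ => L) (resBasis Λ 0 1) ((diag p L).app _ x)
  rw [← chainsMap_cell] at h
  refine (congrArg (fun y => TensorProduct.lid Λ ((chains Λ L).pow p)
    (TensorProduct.map (aug Λ p) LinearMap.id y)) h).trans ?_
  rw [TensorProduct.map_tmul, aug_basis, if_pos rfl]
  exact one_smul Λ (PiTensorProduct.tprod Λ fun _ => cell Λ x : (chains Λ L).pow p)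

end DiagApprox

end Diagonal

/-! ### Cochains as pairings -/

lemma IsPairing.lcomp {K : Cx.{u₁} Λ} {D : Cx.{u₂} Λ} {C : Cx.{v₁} Λ} {M : Type v}
    [AddCommGroup M] [Module Λ M] {a : K →ₗ[Λ] D →ₗ[Λ] M} (ha : IsPairing a) {c : C →ₗ[Λ] D}
    (hc : IsCxHom c) : IsPairing (LinearMap.lcomp Λ M c ∘ₗ a) where
  deg hf hy h := ha.deg hf (hc.mem hy) h
  comm f y := by
    change a (K.d f) (c y) = a f (c (C.d (C.sgn y)))
    rw [ha.comm, hc.comm, Cx.sgn_comm hc.mem]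

section Cochains

variable {G : Type g} [Group G] (A : Triple.{u, v, w, g} G Λ)

/-- The coboundary is by definition precomposition with the boundary after the degree involution,
which is the form the compatibility takes here. -/
lemma isPairing_ev (X : (OrbitCat G)ᵒᵖ) : IsPairing (ev A X) where
  deg hf hy h := hf X _ h _ hy
  comm _ _ := rfl

variable {A}

/-- Cochains are determined by their evaluations, and degree and differential of cochains are
defined by evaluation; so everything can be tested orbit by orbit. -/
lemma isCxHom_of_isPairing {K : Cx.{v₁} Λ} {f : K →ₗ[Λ] cochains A}
    (h : ∀ X, IsPairing (ev A X ∘ₗ f)) : IsCxHom f where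
  mem hx := fun X _ hm _ hy => (h X).deg hx hy hm
  comm x := cochain_ext A fun X _ y _ => (h X).comm x y

lemma ev_ext {f f' : cochains A} (h : ∀ X x, ev A X f x = ev A X f' x) : f = f' :=
  cochain_ext A fun X _ x _ => h X x

variable {p : ℕ} (A) (Φ : DiagApprox.{u} Λ p)

/-- The map `alpha` is the power of the evaluation pairing, so the structure map falls under the
general results on `pairOp`. -/
lemma ev_theta (X : (OrbitCat G)ᵒᵖ) (z : (res Λ p).tensor ((cochains A).pow p)) :
    ev A X (theta A Φ z) = pairOp (W := res Λ p) (K := (cochains A).pow p)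
      (D := (chains Λ (A.T.obj X)).pow p) (powPairing (ev A X) p) (Φ.delta (A.T.obj X)) z :=
  rfl

theorem isPiHom_theta : IsPiHom (theta A Φ) where
  toIsCxHom := isCxHom_of_isPairing (K := (res Λ p).tensor ((cochains A).pow p)) fun X =>
    ((isPairing_ev A X).pow p).pairOp (Φ.isCxHom_delta _)
  act σ z := ev_ext fun X x => by
    rw [ev_theta, ev_theta]
    exact LinearMap.congr_fun (pairOp_invariant (K := (cochains A).pow p)
      (D := (chains Λ (A.T.obj X)).pow p) (t := Cx.perm σ.1 fun _ => chains Λ (A.T.obj X))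
      (isCxHom_resAct σ).mem (isCxHom_perm σ.1 fun _ => cochains A).mem
      (powPairing_perm (isPairing_ev A X) σ.1) (Φ.delta_equivariant σ _) z) x

variable (B : Triple.{u, v₂, w₂, g} G Λ)

/-- Each constituent is a chain map and commutes with the diagonal actions: the coproduct, the
shuffle, the interchange, and the two structure maps, which end in trivial actions. -/
theorem isPiHom_thetaTensor : IsPiHom (thetaTensor A Φ B) where
  toIsCxHom := ((isPiHom_theta A Φ).toIsCxHom.tensorMap (isPiHom_theta B Φ).toIsCxHom).comp
    ((isCxHom_interchange _ _ _ _).comp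
      (isCxHom_coprod.tensorMap (isCxHom_shuffle p (cochains A) (cochains B))))
  act σ z := by
    have h1 : TensorProduct.map (coprod Λ p) (Cx.shuffle p (cochains A) (cochains B)) ∘ₗ
        TensorProduct.map (resAct σ) (Cx.perm σ.1 fun _ => (cochains A).tensor (cochains B)) =
        TensorProduct.map (TensorProduct.map (resAct σ) (resAct σ))
          (TensorProduct.map (Cx.perm σ.1 fun _ => cochains A)
            (Cx.perm σ.1 fun _ => cochains B)) ∘ₗ
        TensorProduct.map (coprod Λ p) (Cx.shuffle p (cochains A) (cochains B)) := by
      rw [← TensorProduct.map_comp, ← TensorProduct.map_comp]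
      exact congrArg₂ TensorProduct.map (LinearMap.ext fun w => coprod_resAct σ w)
        (LinearMap.ext fun F => Cx.shuffle_perm σ.1 F)
    have h2 : theta A Φ ∘ₗ TensorProduct.map (resAct σ) (Cx.perm σ.1 fun _ => cochains A) =
        theta A Φ := LinearMap.ext fun z => (isPiHom_theta A Φ).act σ z
    have h3 : theta B Φ ∘ₗ TensorProduct.map (resAct σ) (Cx.perm σ.1 fun _ => cochains B) =
        theta B Φ := LinearMap.ext fun z => (isPiHom_theta B Φ).act σ z
    have h4 := LinearMap.congr_fun h1 z
    rw [LinearMap.comp_apply, LinearMap.comp_apply] at h4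
    rw [thetaTensor, LinearMap.comp_apply, LinearMap.comp_apply, LinearMap.comp_apply,
      LinearMap.comp_apply]
    refine (congrArg (fun t => TensorProduct.map (theta A Φ) (theta B Φ)
      (Cx.interchange _ _ _ _ t)) h4).trans ?_
    dsimp only
    rw [Cx.interchange_map (isCxHom_resAct σ).mem (isCxHom_perm σ.1 fun _ => cochains A).mem,
      ← LinearMap.comp_apply, ← TensorProduct.map_comp, h2, h3]

lemma ev_xiAlpha (X : (OrbitCat G)ᵒᵖ) (z : (cochains A).tensor (cochains B))
    (x : chains Λ (prod (A.T.obj X) (B.T.obj X))) :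
    ev (A.prod B) X (xiAlpha A B z) x = extPairing (ev A X) (ev B X) z (aw _ _ x) :=
  rfl

theorem isCxHom_xiAlpha : IsCxHom (xiAlpha A B) :=
  isCxHom_of_isPairing (K := (cochains A).tensor (cochains B)) fun X =>
    ((isPairing_ev A X).ext (isPairing_ev B X)).lcomp (isCxHom_aw (A.T.obj X) (B.T.obj X))

end Cochains

/-! ### The two diagonals of a product -/

namespace DiagApprox

variable {p : ℕ} (Φ : DiagApprox.{u} Λ p)

/-- The map `W ⊗ C(L × S) → C(L)^p ⊗ C(S)^p` obtained by applying the diagonals of the factors after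
the Alexander-Whitney map and the coproduct. -/
def awThenDelta (L S : SSet.{u}) : (res Λ p).tensor (chains Λ (prod L S)) →ₗ[Λ]
    ((chains Λ L).pow p).tensor ((chains Λ S).pow p) :=
  TensorProduct.map (Φ.delta L) (Φ.delta S) ∘ₗ
    Cx.interchange (res Λ p) (res Λ p) (chains Λ L) (chains Λ S) ∘ₗ
      TensorProduct.map (coprod Λ p) (aw L S)

/-- The map `W ⊗ C(L × S) → C(L)^p ⊗ C(S)^p` obtained by applying the Alexander-Whitney map after the
diagonal of the product. -/
def deltaThenAw (L S : SSet.{u}) : (res Λ p).tensor (chains Λ (prod L S)) →ₗ[Λ]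
    ((chains Λ L).pow p).tensor ((chains Λ S).pow p) :=
  Cx.shuffle p (chains Λ L) (chains Λ S) ∘ₗ
    PiTensorProduct.map (R := Λ) (s := fun _ : Fin p => chains Λ (prod L S))
      (t := fun _ => (chains Λ L).tensor (chains Λ S)) (fun _ => aw L S) ∘ₗ
        Φ.delta (prod L S)

lemma isCxHom_awThenDelta (L S : SSet.{u}) :
    IsCxHom (K := (res Λ p).tensor (chains Λ (prod L S)))
      (L := ((chains Λ L).pow p).tensor ((chains Λ S).pow p)) (Φ.awThenDelta L S) :=
  ((Φ.isCxHom_delta L).tensorMap (Φ.isCxHom_delta S)).comp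
    ((isCxHom_interchange _ _ _ _).comp (isCxHom_coprod.tensorMap (isCxHom_aw L S)))

lemma isCxHom_deltaThenAw (L S : SSet.{u}) :
    IsCxHom (K := (res Λ p).tensor (chains Λ (prod L S)))
      (L := ((chains Λ L).pow p).tensor ((chains Λ S).pow p)) (Φ.deltaThenAw L S) :=
  (isCxHom_shuffle p _ _).comp ((IsCxHom.piMap (K := fun _ : Fin p => chains Λ (prod L S))
    (K' := fun _ => (chains Λ L).tensor (chains Λ S)) fun _ => isCxHom_aw L S).comp
      (Φ.isCxHom_delta _))

lemma awThenDelta_map {L L' S S' : SSet.{u}} (f : L ⟶ L') (f' : S ⟶ S')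
    (z : (res Λ p).tensor (chains Λ (prod L S))) :
    Φ.awThenDelta L' S' (TensorProduct.map LinearMap.id (chainsMap (prodMap f f')) z) =
      TensorProduct.map (PiTensorProduct.map fun _ => chainsMap f)
        (PiTensorProduct.map fun _ => chainsMap f') (Φ.awThenDelta L S z) := by
  have h1 : TensorProduct.map (coprod Λ p) (aw L' S') ∘ₗ
        TensorProduct.map LinearMap.id (chainsMap (prodMap f f')) =
      TensorProduct.map (TensorProduct.map LinearMap.id LinearMap.id)
        (TensorProduct.map (chainsMap f) (chainsMap f')) ∘ₗ
          TensorProduct.map (coprod Λ p) (aw L S) := by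
    rw [← TensorProduct.map_comp, ← TensorProduct.map_comp, TensorProduct.map_id]
    exact congrArg₂ TensorProduct.map rfl (LinearMap.ext fun x => aw_naturality f f' x)
  have h2 : ∀ {X Y : SSet.{u}} (f : X ⟶ Y), Φ.delta Y ∘ₗ TensorProduct.map LinearMap.id (chainsMap f) =
      PiTensorProduct.map (fun _ => chainsMap f) ∘ₗ Φ.delta X := fun f =>
    LinearMap.ext fun z => Φ.delta_map f z
  have h4 := LinearMap.congr_fun h1 z
  rw [LinearMap.comp_apply, LinearMap.comp_apply] at h4
  rw [awThenDelta, awThenDelta, LinearMap.comp_apply, LinearMap.comp_apply, LinearMap.comp_apply,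
    LinearMap.comp_apply]
  refine (congrArg (fun t => TensorProduct.map (Φ.delta L') (Φ.delta S')
    (Cx.interchange _ _ _ _ t)) h4).trans ?_
  dsimp only
  rw [Cx.interchange_map (fun h => h) (chainsMap_mem f), ← LinearMap.comp_apply,
    ← TensorProduct.map_comp, h2, h2, TensorProduct.map_comp]
  rfl

lemma deltaThenAw_map {L L' S S' : SSet.{u}} (f : L ⟶ L') (f' : S ⟶ S')
    (z : (res Λ p).tensor (chains Λ (prod L S))) :
    Φ.deltaThenAw L' S' (TensorProduct.map LinearMap.id (chainsMap (prodMap f f')) z) =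
      TensorProduct.map (PiTensorProduct.map fun _ => chainsMap f)
        (PiTensorProduct.map fun _ => chainsMap f') (Φ.deltaThenAw L S z) := by
  have h1 : PiTensorProduct.map (R := Λ) (s := fun _ : Fin p => chains Λ (prod L' S'))
        (t := fun _ => (chains Λ L').tensor (chains Λ S')) (fun _ => aw L' S') ∘ₗ
      PiTensorProduct.map (fun _ => chainsMap (prodMap f f')) =
      PiTensorProduct.map (R := Λ) (s := fun _ : Fin p => (chains Λ L).tensor (chains Λ S))
        (t := fun _ => (chains Λ L').tensor (chains Λ S'))
        (fun _ => TensorProduct.map (chainsMap f) (chainsMap f')) ∘ₗ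
      PiTensorProduct.map (R := Λ) (s := fun _ : Fin p => chains Λ (prod L S))
        (t := fun _ => (chains Λ L).tensor (chains Λ S)) (fun _ => aw L S) := by
    rw [← PiTensorProduct.map_comp, ← PiTensorProduct.map_comp]
    exact congrArg PiTensorProduct.map (funext fun _ => LinearMap.ext fun x => aw_naturality f f' x)
  have h2 := LinearMap.congr_fun h1 (Φ.delta (prod L S) z)
  rw [LinearMap.comp_apply, LinearMap.comp_apply] at h2
  rw [deltaThenAw, deltaThenAw, LinearMap.comp_apply, LinearMap.comp_apply, LinearMap.comp_apply,
    LinearMap.comp_apply, Φ.delta_map]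
  refine (congrArg (Cx.shuffle p _ _) h2).trans ?_
  exact Cx.shuffle_map (chainsMap_mem f) (chainsMap_mem f') _

lemma awThenDelta_equivariant (σ : Cyc p) (L S : SSet.{u})
    (z : (res Λ p).tensor (chains Λ (prod L S))) :
    Φ.awThenDelta L S (TensorProduct.map (resAct σ) LinearMap.id z) =
      TensorProduct.map (Cx.perm σ.1 fun _ => chains Λ L) (Cx.perm σ.1 fun _ => chains Λ S)
        (Φ.awThenDelta L S z) := by
  have h1 : TensorProduct.map (coprod Λ p) (aw L S) ∘ₗ
        TensorProduct.map (resAct σ) LinearMap.id =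
      TensorProduct.map (TensorProduct.map (resAct σ) (resAct σ))
        (TensorProduct.map LinearMap.id LinearMap.id) ∘ₗ
          TensorProduct.map (coprod Λ p) (aw L S) := by
    rw [← TensorProduct.map_comp, ← TensorProduct.map_comp, TensorProduct.map_id]
    exact congrArg₂ TensorProduct.map (LinearMap.ext fun w => coprod_resAct σ w) rfl
  have h2 : ∀ X : SSet.{u}, Φ.delta X ∘ₗ TensorProduct.map (resAct σ) LinearMap.id =
      Cx.perm σ.1 (fun _ => chains Λ X) ∘ₗ Φ.delta X := fun X =>
    LinearMap.ext fun z => Φ.delta_equivariant σ X z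
  have h4 := LinearMap.congr_fun h1 z
  rw [LinearMap.comp_apply, LinearMap.comp_apply] at h4
  rw [awThenDelta, LinearMap.comp_apply, LinearMap.comp_apply, LinearMap.comp_apply,
    LinearMap.comp_apply]
  refine (congrArg (fun t => TensorProduct.map (Φ.delta L) (Φ.delta S)
    (Cx.interchange _ _ _ _ t)) h4).trans ?_
  dsimp only
  rw [Cx.interchange_map (isCxHom_resAct σ).mem (fun h => h), ← LinearMap.comp_apply,
    ← TensorProduct.map_comp, h2, h2, TensorProduct.map_comp]
  rfl

lemma deltaThenAw_equivariant (σ : Cyc p) (L S : SSet.{u})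
    (z : (res Λ p).tensor (chains Λ (prod L S))) :
    Φ.deltaThenAw L S (TensorProduct.map (resAct σ) LinearMap.id z) =
      TensorProduct.map (Cx.perm σ.1 fun _ => chains Λ L) (Cx.perm σ.1 fun _ => chains Λ S)
        (Φ.deltaThenAw L S z) := by
  rw [deltaThenAw, LinearMap.comp_apply, LinearMap.comp_apply, LinearMap.comp_apply,
    LinearMap.comp_apply, Φ.delta_equivariant]
  refine (congrArg (Cx.shuffle p _ _) (Cx.perm_map σ.1 (K := fun _ => chains Λ (prod L S))
    (K' := fun _ => (chains Λ L).tensor (chains Λ S)) (fun _ => aw_mem) _).symm).trans ?_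
  exact Cx.shuffle_perm σ.1 _

lemma aw_vertex {L S : SSet.{u}} (x : Splx (prod L S) 0) :
    aw L S (cell Λ x) = cell Λ (L := L) x.1 ⊗ₜ cell Λ (L := S) x.2 := by
  rw [aw_cell, awFun, Finset.sum_range_one]
  exact congrArg₂ (· ⊗ₜ[Λ] ·) (seg_vertex (X := L) x.1) (seg_vertex (X := S) x.2)

lemma cell_vertex_mem {X : SSet.{u}} (x : Splx X 0) : cell Λ x ∈ (chains Λ X).deg 0 := by
  simpa using cell_mem x

lemma awThenDelta_vertex {L S : SSet.{u}} (x : Splx (prod L S) 0) :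
    Φ.awThenDelta L S (resBasis Λ 0 1 ⊗ₜ cell Λ x) =
      (PiTensorProduct.tprod Λ fun _ => cell Λ (L := L) x.1) ⊗ₜ
        PiTensorProduct.tprod Λ fun _ => cell Λ (L := S) x.2 := by
  rw [awThenDelta, LinearMap.comp_apply, LinearMap.comp_apply, TensorProduct.map_tmul,
    coprod_basis_one, coprodGen_zero, aw_vertex,
    Cx.interchange_tmul _ _ (resBasis_mem 0 1) (cell_vertex_mem (X := L) x.1)]
  have : psign (((-((0 : ℕ) : ℤ) : ℤ) : ZMod 2) * ((0 : ℤ) : ZMod 2)) = 1 := rfl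
  rw [this]
  refine (congrArg _ (one_zsmul _)).trans ?_
  exact congrArg₂ (· ⊗ₜ[Λ] ·) (Φ.delta_vertex (L := L) x.1) (Φ.delta_vertex (L := S) x.2)

lemma deltaThenAw_vertex {L S : SSet.{u}} (x : Splx (prod L S) 0) :
    Φ.deltaThenAw L S (resBasis Λ 0 1 ⊗ₜ cell Λ x) =
      (PiTensorProduct.tprod Λ fun _ => cell Λ (L := L) x.1) ⊗ₜ
        PiTensorProduct.tprod Λ fun _ => cell Λ (L := S) x.2 := by
  have h : PiTensorProduct.map (R := Λ) (s := fun _ : Fin p => chains Λ (prod L S))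
      (t := fun _ => (chains Λ L).tensor (chains Λ S)) (fun _ => aw L S)
      (PiTensorProduct.tprod Λ fun _ => cell Λ x) =
      PiTensorProduct.tprod Λ fun _ => cell Λ (L := L) x.1 ⊗ₜ cell Λ (L := S) x.2 :=
    (PiTensorProduct.map_tprod _ _).trans (congrArg _ (funext fun _ => aw_vertex x))
  rw [deltaThenAw, LinearMap.comp_apply, LinearMap.comp_apply, Φ.delta_vertex]
  refine (congrArg (Cx.shuffle p _ _) h).trans ?_
  refine (Cx.shuffle_tprod (K := chains Λ L) (L := chains Λ S) (a := fun _ => 0) (b := fun _ => 0)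
    (fun _ => cell_vertex_mem (X := L) x.1) (fun _ => cell_vertex_mem (X := S) x.2)).trans ?_
  have : Cx.shuffleSign (fun _ : Fin p => ((0 : ℤ) : ZMod 2)) (fun _ => ((0 : ℤ) : ZMod 2)) = 1 := by
    rw [Cx.shuffleSign_eq]
    simp [psign_zero]
  rw [this]
  exact one_zsmul _

/-- The two diagonals of a product are naturally and equivariantly homotopic. -/
theorem exists_diagonal_homotopy :
    ∃ H : ∀ L S : SSet.{u}, (res Λ p).tensor (chains Λ (prod L S)) →ₗ[Λ]
        ((chains Λ L).pow p).tensor ((chains Λ S).pow p),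
      (∀ {L L' S S' : SSet.{u}} (f : L ⟶ L') (f' : S ⟶ S')
        (z : (res Λ p).tensor (chains Λ (prod L S))),
        H L' S' (TensorProduct.map LinearMap.id (chainsMap (prodMap f f')) z) =
          TensorProduct.map (PiTensorProduct.map fun _ => chainsMap f)
            (PiTensorProduct.map fun _ => chainsMap f') (H L S z)) ∧
      (∀ (σ : Cyc p) L S z, H L S (TensorProduct.map (resAct σ) LinearMap.id z) =
        TensorProduct.map (Cx.perm σ.1 fun _ => chains Λ L) (Cx.perm σ.1 fun _ => chains Λ S)
          (H L S z)) ∧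
      (∀ L S n, ∀ z ∈ ((res Λ p).tensor (chains Λ (prod L S))).deg n,
        H L S z ∈ (((chains Λ L).pow p).tensor ((chains Λ S).pow p)).deg (n - 1)) ∧
      ∀ L S z, Φ.awThenDelta L S z - Φ.deltaThenAw L S z =
        (((chains Λ L).pow p).tensor ((chains Λ S).pow p)).d (H L S z) +
          H L S (((res Λ p).tensor (chains Λ (prod L S))).d z) := by
  let a := ((ModelFunctor.ofChains.{u} Λ).powAction p).tensor
    ((ModelFunctor.ofChains.{u} Λ).powAction p)
  have hd : ∀ {X Y : SSet.{u}} (f : X ⟶ Y) (z : (res Λ p).tensor (chains Λ X)),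
      TensorProduct.map LinearMap.id (chainsMap (diagTwo Y))
        (TensorProduct.map LinearMap.id (chainsMap f) z) =
      TensorProduct.map LinearMap.id (chainsMap (prodMap f f))
        (TensorProduct.map LinearMap.id (chainsMap (diagTwo X)) z) := by
    intro X Y f z
    rw [← LinearMap.comp_apply, ← LinearMap.comp_apply, ← TensorProduct.map_comp,
      ← TensorProduct.map_comp, ← chainsMap_comp, ← chainsMap_comp]
    rfl
  have he : ∀ (σ : Cyc p) (X : SSet.{u}) (z : (res Λ p).tensor (chains Λ X)),
      TensorProduct.map LinearMap.id (chainsMap (diagTwo X))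
        (TensorProduct.map (resAct σ) LinearMap.id z) =
      TensorProduct.map (resAct σ) LinearMap.id
        (TensorProduct.map LinearMap.id (chainsMap (diagTwo X)) z) := by
    intro σ X z
    rw [← LinearMap.comp_apply, ← LinearMap.comp_apply, ← TensorProduct.map_comp,
      ← TensorProduct.map_comp]
    rfl
  have hdiag : ∀ X : SSet.{u}, IsCxHom (K := (res Λ p).tensor (chains Λ X))
      (L := (res Λ p).tensor (chains Λ (prod X X)))
      (TensorProduct.map LinearMap.id (chainsMap (diagTwo X))) := fun X =>
    (isCxHom_id _).tensorMap (isCxHom_chainsMap _)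
  -- The acyclic model argument has a single variable, so both maps are first restricted along the
  -- diagonal of `X`.
  obtain ⟨H, h1, h2, h3, h4⟩ := a.exists_homotopy
    (Ψ := fun X => Φ.awThenDelta X X ∘ₗ TensorProduct.map LinearMap.id (chainsMap (diagTwo X)))
    (Ψ' := fun X => Φ.deltaThenAw X X ∘ₗ TensorProduct.map LinearMap.id (chainsMap (diagTwo X)))
    (fun X => (Φ.isCxHom_awThenDelta X X).comp (hdiag X))
    (fun X => (Φ.isCxHom_deltaThenAw X X).comp (hdiag X))
    (fun f z => (congrArg (Φ.awThenDelta _ _) (hd f z)).trans (Φ.awThenDelta_map f f _))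
    (fun f z => (congrArg (Φ.deltaThenAw _ _) (hd f z)).trans (Φ.deltaThenAw_map f f _))
    (fun σ X z => (congrArg (Φ.awThenDelta _ _) (he σ X z)).trans
      (Φ.awThenDelta_equivariant σ X X _))
    (fun σ X z => (congrArg (Φ.deltaThenAw _ _) (he σ X z)).trans
      (Φ.deltaThenAw_equivariant σ X X _))
    (fun X x => by
      rw [LinearMap.comp_apply, LinearMap.comp_apply, TensorProduct.map_tmul, chainsMap_cell]
      exact (Φ.awThenDelta_vertex (L := X) (S := X) _).trans
        (Φ.deltaThenAw_vertex (L := X) (S := X) _).symm)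
  -- The homotopy for `L` and `S` is the one for `X = L × S` followed by the projections to the
  -- factors.
  let q : ∀ L S : SSet.{u},
      ((chains Λ (prod L S)).pow p).tensor ((chains Λ (prod L S)).pow p) →ₗ[Λ]
        ((chains Λ L).pow p).tensor ((chains Λ S).pow p) := fun L S =>
    TensorProduct.map
      (PiTensorProduct.map fun _ => chainsMap (SemiCartesianMonoidalCategory.fst L S))
      (PiTensorProduct.map fun _ => chainsMap (SemiCartesianMonoidalCategory.snd L S))
  have hq : ∀ L S : SSet.{u}, IsCxHom
      (K := ((chains Λ (prod L S)).pow p).tensor ((chains Λ (prod L S)).pow p))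
      (L := ((chains Λ L).pow p).tensor ((chains Λ S).pow p)) (q L S) := fun L S =>
    (IsCxHom.piMap fun _ => isCxHom_chainsMap _).tensorMap
      (IsCxHom.piMap fun _ => isCxHom_chainsMap _)
  -- The diagonal of `L × S` followed by the product of the two projections is the identity, so
  -- naturality recovers both maps from their restrictions.
  have hid : ∀ (L S : SSet.{u}) (z : (res Λ p).tensor (chains Λ (prod L S))),
      TensorProduct.map LinearMap.id (chainsMap (prodMap (SemiCartesianMonoidalCategory.fst L S)
        (SemiCartesianMonoidalCategory.snd L S)))
        (TensorProduct.map LinearMap.id (chainsMap (diagTwo (prod L S))) z) = z := by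
    intro L S z
    have : diagTwo (prod L S) ≫ prodMap (SemiCartesianMonoidalCategory.fst L S)
      (SemiCartesianMonoidalCategory.snd L S) = 𝟙 _ := rfl
    rw [← LinearMap.comp_apply, ← TensorProduct.map_comp, ← chainsMap_comp, this, chainsMap_id,
      LinearMap.id_comp, TensorProduct.map_id]
    rfl
  refine ⟨fun L S => q L S ∘ₗ H (prod L S), fun {L L' S S'} f f' z => ?_, fun σ L S z => ?_,
    fun L S n z hz => (hq L S).mem (h3 _ n z hz), fun L S z => ?_⟩
  · have h5 : q L' S' ∘ₗ TensorProduct.map (PiTensorProduct.map fun _ => chainsMap (prodMap f f'))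
          (PiTensorProduct.map fun _ => chainsMap (prodMap f f')) =
        TensorProduct.map (PiTensorProduct.map fun _ => chainsMap f)
          (PiTensorProduct.map fun _ => chainsMap f') ∘ₗ q L S := by
      rw [← TensorProduct.map_comp, ← TensorProduct.map_comp, ← PiTensorProduct.map_comp,
        ← PiTensorProduct.map_comp, ← PiTensorProduct.map_comp, ← PiTensorProduct.map_comp]
      simp only [← chainsMap_comp]
      rfl
    exact (congrArg (q L' S') (h1 (prodMap f f') z)).trans (LinearMap.congr_fun h5 _)
  · refine (congrArg (q L S) (h2 σ (prod L S) z)).trans ?_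
    have h5 : q L S ∘ₗ TensorProduct.map (Cx.perm σ.1 fun _ => chains Λ (prod L S))
          (Cx.perm σ.1 fun _ => chains Λ (prod L S)) =
        TensorProduct.map (Cx.perm σ.1 fun _ => chains Λ L) (Cx.perm σ.1 fun _ => chains Λ S) ∘ₗ
          q L S := by
      rw [← TensorProduct.map_comp, ← TensorProduct.map_comp]
      exact congrArg₂ TensorProduct.map
        (LinearMap.ext fun y => (Cx.perm_map σ.1 (K := fun _ => chains Λ (prod L S))
          (K' := fun _ => chains Λ L) (fun _ => chainsMap_mem _) y).symm)
        (LinearMap.ext fun y => (Cx.perm_map σ.1 (K := fun _ => chains Λ (prod L S))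
          (K' := fun _ => chains Λ S) (fun _ => chainsMap_mem _) y).symm)
    exact LinearMap.congr_fun h5 _
  · have h5 := congrArg (q L S) (h4 (prod L S) z)
    rw [map_sub, map_add] at h5
    rw [LinearMap.comp_apply, LinearMap.comp_apply, ← (hq L S).comm, ← h5]
    refine congrArg₂ (· - ·) ?_ ?_
    · exact ((Φ.awThenDelta_map _ _ _).symm.trans (congrArg _ (hid L S z))).symm
    · exact ((Φ.deltaThenAw_map _ _ _).symm.trans (congrArg _ (hid L S z))).symm

end DiagApprox

/-! ### The homotopy -/

lemma extPairing_natural {K : Cx.{u₁} Λ} {K' : Cx.{u₂} Λ} {D E : Cx.{v₁} Λ} {D' E' : Cx.{v₂} Λ}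
    {M N : Type v} {M' N' : Type w} [AddCommGroup M] [Module Λ M] [AddCommGroup N] [Module Λ N]
    [AddCommGroup M'] [Module Λ M'] [AddCommGroup N'] [Module Λ N']
    {a : K →ₗ[Λ] D →ₗ[Λ] M} {a' : K →ₗ[Λ] E →ₗ[Λ] N} {b : K' →ₗ[Λ] D' →ₗ[Λ] M'}
    {b' : K' →ₗ[Λ] E' →ₗ[Λ] N'} {s : K →ₗ[Λ] K} {s' : K' →ₗ[Λ] K'} {k : D →ₗ[Λ] E}
    {k' : D' →ₗ[Λ] E'} {m : M →ₗ[Λ] N} {m' : M' →ₗ[Λ] N'}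
    (hk : ∀ {n x}, x ∈ D.deg n → k x ∈ E.deg n) (hk' : ∀ {n x}, x ∈ D'.deg n → k' x ∈ E'.deg n)
    (h : ∀ f x, a' (s f) (k x) = m (a f x)) (h' : ∀ f x, b' (s' f) (k' x) = m' (b f x))
    (F : K ⊗[Λ] K') (z : D ⊗[Λ] D') :
    extPairing a' b' (TensorProduct.map s s' F) (TensorProduct.map k k' z) =
      TensorProduct.map m m' (extPairing a b F z) := by
  have : LinearMap.lcomp Λ _ (TensorProduct.map k k') ∘ₗ extPairing a' b' ∘ₗ
      TensorProduct.map s s' = LinearMap.compRight Λ (TensorProduct.map m m') ∘ₗ extPairing a b := by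
    refine TensorProduct.ext' fun f f' => Cx.tensor_hom_ext fun i j x hx y hy => ?_
    change extPairing a' b' (s f ⊗ₜ s' f') (k x ⊗ₜ k' y) =
      TensorProduct.map m m' (extPairing a b (f ⊗ₜ f') (x ⊗ₜ y))
    rw [extPairing_tmul_tmul _ _ (hk hx) (hk' hy), extPairing_tmul_tmul _ _ hx hy, map_zsmul,
      TensorProduct.map_tmul, h, h']
  exact LinearMap.congr_fun (LinearMap.congr_fun this F) z

lemma pairOp_natural {W : Cx.{u} Λ} {K : Cx.{u₁} Λ} {C C' : Cx.{u₂} Λ} {D : Cx.{v₁} Λ}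
    {D' : Cx.{v₂} Λ} {M : Type v} {M' : Type w} [AddCommGroup M] [Module Λ M] [AddCommGroup M']
    [Module Λ M'] {a : K →ₗ[Λ] D →ₗ[Λ] M} {a' : K →ₗ[Λ] D' →ₗ[Λ] M'} {Ψ : W ⊗[Λ] C →ₗ[Λ] D}
    {Ψ' : W ⊗[Λ] C' →ₗ[Λ] D'} {c : C →ₗ[Λ] C'} {k : D →ₗ[Λ] D'} {m : M →ₗ[Λ] M'}
    (hΨ : ∀ z, Ψ' (TensorProduct.map LinearMap.id c z) = k (Ψ z))
    (h : ∀ f y, a' f (k y) = m (a f y)) (z : W ⊗[Λ] K) (x : C) :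
    pairOp a' Ψ' z (c x) = m (pairOp a Ψ z x) := by
  have : (pairOp a' Ψ').flip (c x) = m ∘ₗ (pairOp a Ψ).flip x :=
    Cx.tensor_hom_ext fun i j w hw f hf => by
      rw [LinearMap.comp_apply, LinearMap.flip_apply, LinearMap.flip_apply, pairOp_tmul _ hw hf,
        pairOp_tmul _ hw hf, map_zsmul, ← h, ← hΨ]
      rfl
  exact LinearMap.congr_fun this z

lemma pairOp_map_right {W : Cx.{u} Λ} {K : Cx.{u₁} Λ} {K₀ : Cx.{g} Λ} {C : Cx.{u₂} Λ} {D : Cx.{v₁} Λ}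
    {M : Type v} [AddCommGroup M] [Module Λ M] {a : K →ₗ[Λ] D →ₗ[Λ] M} {k : K₀ →ₗ[Λ] K}
    (hk : ∀ {n x}, x ∈ K₀.deg n → k x ∈ K.deg n) (Ψ : W ⊗[Λ] C →ₗ[Λ] D) (z : W ⊗[Λ] K₀) :
    pairOp a Ψ (TensorProduct.map LinearMap.id k z) = pairOp (a ∘ₗ k) Ψ z := by
  rw [pairOp_map (fun h => h) hk, TensorProduct.map_id, LinearMap.comp_id]

lemma powPairing_natural {K : Cx.{u₁} Λ} {D : Cx.{v₁} Λ} {D' : Cx.{v₁} Λ} {M : Type v} {M' : Type w}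
    [CommRing M] [Algebra Λ M] [CommRing M'] [Algebra Λ M'] {a : K →ₗ[Λ] D →ₗ[Λ] M}
    {a' : K →ₗ[Λ] D' →ₗ[Λ] M'} {k : D →ₗ[Λ] D'} {n : ℕ} (m : M →ₐ[Λ] M')
    (hk : ∀ {n x}, x ∈ D.deg n → k x ∈ D'.deg n) (h : ∀ f y, a' f (k y) = m (a f y))
    (F : K.pow n) (z : D.pow n) :
    powPairing a' n F (PiTensorProduct.map (fun _ => k) z) = m (powPairing a n F z) := by
  have : LinearMap.lcomp Λ _ (PiTensorProduct.map fun _ => k) ∘ₗ powPairing a' n =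
      LinearMap.compRight Λ m.toLinearMap ∘ₗ powPairing a n := by
    refine PiTensorProduct.ext (MultilinearMap.ext fun f => Cx.pi_hom_ext fun e x hx => ?_)
    change powPairing a' n (PiTensorProduct.tprod Λ f)
      (PiTensorProduct.map (fun _ => k) (PiTensorProduct.tprod Λ x)) =
        m (powPairing a n (PiTensorProduct.tprod Λ f) (PiTensorProduct.tprod Λ x))
    rw [PiTensorProduct.map_tprod, powPairing_tprod_tprod a' f fun i => hk (hx i),
      powPairing_tprod_tprod a f hx, map_zsmul, map_prod]
    simp only [h]
  exact LinearMap.congr_fun (LinearMap.congr_fun this F) z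

lemma Cx.map_id_sgn_mem {K : Cx.{u₁} Λ} {L : Cx.{u₂} Λ} {n : ℤ} {z : K ⊗[Λ] L}
    (hz : z ∈ (K.tensor L).deg n) :
    TensorProduct.map LinearMap.id L.sgn z ∈ (K.tensor L).deg n := by
  refine Cx.tensorDeg_le (((K.tensor L).deg n).comap (TensorProduct.map LinearMap.id L.sgn)) ?_ hz
  rintro i j rfl x hx y hy
  exact Cx.tmul_mem hx (L.sgn_mem hy)

lemma Cx.map_id_sgn_map {K K' : Cx.{u₁} Λ} {L L' : Cx.{u₂} Λ} {f : K →ₗ[Λ] K'} {h : L →ₗ[Λ] L'}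
    (hh : ∀ {n x}, x ∈ L.deg n → h x ∈ L'.deg n) (z : K ⊗[Λ] L) :
    TensorProduct.map LinearMap.id L'.sgn (TensorProduct.map f h z) =
      TensorProduct.map f h (TensorProduct.map LinearMap.id L.sgn z) := by
  have : TensorProduct.map LinearMap.id L'.sgn ∘ₗ TensorProduct.map f h =
      TensorProduct.map f h ∘ₗ TensorProduct.map LinearMap.id L.sgn :=
    TensorProduct.ext' fun x y => congrArg (f x ⊗ₜ[Λ] ·) (Cx.sgn_comm hh y).symm
  exact LinearMap.congr_fun this z

/-! ### Both composites of the square as operations for one pairing -/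

section Operations

variable {G : Type g} [Group G] (A : Triple.{u, v, w, g} G Λ) (B : Triple.{u, v₂, w₂, g} G Λ)
  (p : ℕ)

/-- The pairing of `(C_ρ^*(T; M) ⊗ C_ρ'^*(T'; M'))^p` with `C(T)^p ⊗ C(T')^p`, at an object of the
orbit category. -/
def shufflePairing (X : (OrbitCat G)ᵒᵖ) :
    ((cochains A).tensor (cochains B)).pow p →ₗ[Λ]
      ((chains Λ (A.T.obj X)).pow p).tensor ((chains Λ (B.T.obj X)).pow p) →ₗ[Λ]
        A.M.obj X ⊗[Λ] B.M.obj X :=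
  extPairing (powPairing (ev A X) p) (powPairing (ev B X) p) ∘ₗ
    Cx.shuffle p (cochains A) (cochains B)

lemma isPairing_shufflePairing (X : (OrbitCat G)ᵒᵖ) :
    IsPairing (K := ((cochains A).tensor (cochains B)).pow p)
      (D := ((chains Λ (A.T.obj X)).pow p).tensor ((chains Λ (B.T.obj X)).pow p))
      (shufflePairing A B p X) :=
  (((isPairing_ev A X).pow p).ext ((isPairing_ev B X).pow p)).comp
    (isCxHom_shuffle p (cochains A) (cochains B))

variable {p}

lemma shufflePairing_perm (σ : Equiv.Perm (Fin p)) (X : (OrbitCat G)ᵒᵖ)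
    (F : ((cochains A).tensor (cochains B)).pow p)
    (z : ((chains Λ (A.T.obj X)).pow p).tensor ((chains Λ (B.T.obj X)).pow p)) :
    shufflePairing A B p X (Cx.perm σ (fun _ => (cochains A).tensor (cochains B)) F)
        (TensorProduct.map (Cx.perm σ fun _ => chains Λ (A.T.obj X))
          (Cx.perm σ fun _ => chains Λ (B.T.obj X)) z) =
      shufflePairing A B p X F z := by
  rw [shufflePairing, LinearMap.comp_apply, LinearMap.comp_apply, Cx.shuffle_perm]
  refine (extPairing_natural (a := powPairing (ev A X) p) (a' := powPairing (ev A X) p)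
    (b := powPairing (ev B X) p) (b' := powPairing (ev B X) p)
    (s := Cx.perm σ fun _ => cochains A) (s' := Cx.perm σ fun _ => cochains B)
    (k := Cx.perm σ fun _ => chains Λ (A.T.obj X)) (k' := Cx.perm σ fun _ => chains Λ (B.T.obj X))
    (m := LinearMap.id) (m' := LinearMap.id)
    (isCxHom_perm σ fun _ => chains Λ (A.T.obj X)).mem
    (isCxHom_perm σ fun _ => chains Λ (B.T.obj X)).mem
    (powPairing_perm (isPairing_ev A X) σ) (powPairing_perm (isPairing_ev B X) σ) _ _).trans ?_
  rw [TensorProduct.map_id]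
  rfl

lemma shufflePairing_map {X Y : (OrbitCat G)ᵒᵖ} (c : A.T.obj X ⟶ A.T.obj Y)
    (c' : B.T.obj X ⟶ B.T.obj Y) (m : A.M.obj X →ₐ[Λ] A.M.obj Y) (m' : B.M.obj X →ₐ[Λ] B.M.obj Y)
    (h : ∀ f x, ev A Y f (chainsMap c x) = m (ev A X f x))
    (h' : ∀ f x, ev B Y f (chainsMap c' x) = m' (ev B X f x))
    (F : ((cochains A).tensor (cochains B)).pow p)
    (z : ((chains Λ (A.T.obj X)).pow p).tensor ((chains Λ (B.T.obj X)).pow p)) :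
    shufflePairing A B p Y F (TensorProduct.map (PiTensorProduct.map fun _ => chainsMap c)
      (PiTensorProduct.map fun _ => chainsMap c') z) =
      Algebra.TensorProduct.map m m' (shufflePairing A B p X F z) := by
  have := extPairing_natural (s := LinearMap.id) (s' := LinearMap.id)
    (a := powPairing (ev A X) p) (a' := powPairing (ev A Y) p)
    (b := powPairing (ev B X) p) (b' := powPairing (ev B Y) p)
    (k := PiTensorProduct.map fun _ => chainsMap c) (k' := PiTensorProduct.map fun _ => chainsMap c')
    (m := m.toLinearMap) (m' := m'.toLinearMap)
    (IsCxHom.piMap fun _ => isCxHom_chainsMap c).mem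
    (IsCxHom.piMap fun _ => isCxHom_chainsMap c').mem
    (powPairing_natural m (chainsMap_mem c) h) (powPairing_natural m' (chainsMap_mem c') h')
    (Cx.shuffle p (cochains A) (cochains B) F) z
  rw [TensorProduct.map_id] at this
  exact this

/-- Natural maps `W ⊗ C(L × S) → C(L)^p ⊗ C(S)^p` define operations `W ⊗ (K ⊗ K')^p → K''` with
values in equivariant cochains. -/
lemma pairOp_shufflePairing_mem {H : ∀ L S : SSet.{u}, (res Λ p).tensor (chains Λ (prod L S)) →ₗ[Λ]
      ((chains Λ L).pow p).tensor ((chains Λ S).pow p)}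
    (hn : ∀ {L L' S S' : SSet.{u}} (f : L ⟶ L') (f' : S ⟶ S')
      (z : (res Λ p).tensor (chains Λ (prod L S))),
      H L' S' (TensorProduct.map LinearMap.id (chainsMap (prodMap f f')) z) =
        TensorProduct.map (PiTensorProduct.map fun _ => chainsMap f)
          (PiTensorProduct.map fun _ => chainsMap f') (H L S z))
    {c : ℤ} (hc : ∀ L S n, ∀ z ∈ ((res Λ p).tensor (chains Λ (prod L S))).deg n,
      H L S z ∈ (((chains Λ L).pow p).tensor ((chains Λ S).pow p)).deg (n + c))
    (z : (res Λ p).tensor (((cochains A).tensor (cochains B)).pow p)) :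
    (fun X => pairOp (W := res Λ p) (K := ((cochains A).tensor (cochains B)).pow p)
      (C := chains Λ (prod (A.T.obj X) (B.T.obj X)))
      (D := ((chains Λ (A.T.obj X)).pow p).tensor ((chains Λ (B.T.obj X)).pow p))
      (shufflePairing A B p X) (H (A.T.obj X) (B.T.obj X)) z) ∈ cochainModule (A.prod B) := by
  refine ((res Λ p).tensor (((cochains A).tensor (cochains B)).pow p)).induction
    (P := fun z => (fun X => pairOp (W := res Λ p) (K := ((cochains A).tensor (cochains B)).pow p)
      (C := chains Λ (prod (A.T.obj X) (B.T.obj X)))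
      (D := ((chains Λ (A.T.obj X)).pow p).tensor ((chains Λ (B.T.obj X)).pow p))
      (shufflePairing A B p X) (H (A.T.obj X) (B.T.obj X)) z) ∈ cochainModule (A.prod B))
    -- For `z` of degree `n` the only chains with a nonzero value are those of degree `-n - c`, so
    -- the cochain vanishes below that degree.
    (fun n z hz => ⟨fun {X Y} a x => ?_, fun X r x => ?_, -n - c, fun X m hm x hx => ?_⟩)
    (fun z z' hz hz' => ?_) z
  · exact pairOp_natural (c := chainsMap (prodMap (A.T.map a) (B.T.map a)))
      (hn (A.T.map a) (B.T.map a))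
      (m := (Algebra.TensorProduct.map (A.M.map a).hom (B.M.map a).hom).toLinearMap)
      (shufflePairing_map A B (A.T.map a) (B.T.map a) (A.M.map a).hom (B.M.map a).hom
        (fun f => f.2.1 a) (fun f => f.2.1 a)) z x
  · exact pairOp_natural (c := chainsMap (prodMap (A.actT X r.1) (B.actT X r.2)))
      (hn (A.actT X r.1) (B.actT X r.2))
      (m := (Algebra.TensorProduct.map (CommAlgCat.Hom.hom (A.actM X r.1))
        (CommAlgCat.Hom.hom (B.actM X r.2))).toLinearMap)
      (shufflePairing_map A B (A.actT X r.1) (B.actT X r.2) (CommAlgCat.Hom.hom (A.actM X r.1))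
        (CommAlgCat.Hom.hom (B.actM X r.2)) (fun f => f.2.2.1 X r.1) (fun f => f.2.2.1 X r.2)) z x
  · exact pairOp_eq_zero (isPairing_shufflePairing A B p X) c (hc _ _) hz hx (by lia)
  · have : (fun X => pairOp (W := res Λ p) (K := ((cochains A).tensor (cochains B)).pow p)
        (C := chains Λ (prod (A.T.obj X) (B.T.obj X)))
        (D := ((chains Λ (A.T.obj X)).pow p).tensor ((chains Λ (B.T.obj X)).pow p))
        (shufflePairing A B p X) (H (A.T.obj X) (B.T.obj X)) (z + z')) = _ :=
      funext fun X => map_add _ z z'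
    rw [this]
    exact add_mem hz hz'

variable (Φ : DiagApprox.{u} Λ p)

/-- Merging the two structure maps by `extPairing_pairOp` puts the interchange on the side of
chains. The coproduct and the Alexander-Whitney map are then absorbed into the map of chains, and
the shuffle into the pairing. -/
lemma ev_xiAlpha_thetaTensor (X : (OrbitCat G)ᵒᵖ)
    (z : (res Λ p).tensor (((cochains A).tensor (cochains B)).pow p))
    (x : chains Λ (prod (A.T.obj X) (B.T.obj X))) :
    ev (A.prod B) X (xiAlpha A B (thetaTensor A Φ B z)) x =
      pairOp (W := res Λ p) (K := ((cochains A).tensor (cochains B)).pow p)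
        (D := ((chains Λ (A.T.obj X)).pow p).tensor ((chains Λ (B.T.obj X)).pow p))
        (shufflePairing A B p X) (Φ.awThenDelta (A.T.obj X) (B.T.obj X)) z x := by
  rw [ev_xiAlpha, thetaTensor, LinearMap.comp_apply, LinearMap.comp_apply, extPairing_map]
  refine (extPairing_pairOp ((isPairing_ev A X).pow p) ((isPairing_ev B X).pow p)
    (Φ.isCxHom_delta _) (Φ.isCxHom_delta _) _ _).trans ?_
  rw [pairOp_map (K₀ := ((cochains A).tensor (cochains B)).pow p) isCxHom_coprod.mem
    (isCxHom_shuffle p (cochains A) (cochains B)).mem, ← pairOp_comp_right]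
  have : TensorProduct.map (coprod Λ p) (aw (A.T.obj X) (B.T.obj X)) =
      TensorProduct.map (coprod Λ p) LinearMap.id ∘ₗ
        TensorProduct.map LinearMap.id (aw (A.T.obj X) (B.T.obj X)) := by
    rw [← TensorProduct.map_comp]
    rfl
  rw [DiagApprox.awThenDelta, this]
  rfl

/-- Both `h1` and `h2` compare with the power of `alphaTensorAw`: one absorbs the external product
into the pairing, the other moves the Alexander-Whitney map out onto the chains. The power of the
exterior pairing is then the exterior pairing of the powers after shuffling. -/
lemma powPairing_xiAlpha (X : (OrbitCat G)ᵒᵖ) (F : ((cochains A).tensor (cochains B)).pow p)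
    (y : (chains Λ (prod (A.T.obj X) (B.T.obj X))).pow p) :
    powPairing (D := chains Λ (prod (A.T.obj X) (B.T.obj X))) (M := A.M.obj X ⊗[Λ] B.M.obj X)
        (ev (A.prod B) X) p (PiTensorProduct.map (fun _ => xiAlpha A B) F) y =
      shufflePairing A B p X F (Cx.shuffle p _ _
        (PiTensorProduct.map (R := Λ) (s := fun _ : Fin p => chains Λ (prod (A.T.obj X) (B.T.obj X)))
          (t := fun _ => (chains Λ (A.T.obj X)).tensor (chains Λ (B.T.obj X)))
          (fun _ => aw (A.T.obj X) (B.T.obj X)) y)) := by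
  have h1 := powPairing_map (K := cochains (A.prod B))
    (D := chains Λ (prod (A.T.obj X) (B.T.obj X)))
    (K₀ := (cochains A).tensor (cochains B)) (D₀ := chains Λ (prod (A.T.obj X) (B.T.obj X)))
    (M := A.M.obj X ⊗[Λ] B.M.obj X) (n := p)
    (a₀ := alphaTensorAw A B X)
    (a := ev (A.prod B) X) (k := xiAlpha A B) (h := LinearMap.id) (fun h => h)
    (fun f x => (ev_xiAlpha A B X f x).symm) F y
  have h2 := powPairing_map (K := (cochains A).tensor (cochains B))
    (D := (chains Λ (A.T.obj X)).tensor (chains Λ (B.T.obj X)))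
    (K₀ := (cochains A).tensor (cochains B)) (D₀ := chains Λ (prod (A.T.obj X) (B.T.obj X)))
    (M := A.M.obj X ⊗[Λ] B.M.obj X) (n := p)
    (a₀ := alphaTensorAw A B X)
    (a := extPairing (ev A X) (ev B X)) (k := LinearMap.id) (h := aw (A.T.obj X) (B.T.obj X)) aw_mem
    (fun f x => rfl) F y
  rw [PiTensorProduct.map_id] at h1 h2
  refine (h1.trans h2.symm).trans ?_
  exact powPairing_extPairing (isPairing_ev A X) (isPairing_ev B X) _ _

lemma ev_theta_xiAlpha (X : (OrbitCat G)ᵒᵖ)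
    (z : (res Λ p).tensor (((cochains A).tensor (cochains B)).pow p))
    (x : chains Λ (prod (A.T.obj X) (B.T.obj X))) :
    ev (A.prod B) X (theta (A.prod B) Φ
        (TensorProduct.map LinearMap.id (PiTensorProduct.map fun _ => xiAlpha A B) z)) x =
      pairOp (W := res Λ p) (K := ((cochains A).tensor (cochains B)).pow p)
        (D := ((chains Λ (A.T.obj X)).pow p).tensor ((chains Λ (B.T.obj X)).pow p))
        (shufflePairing A B p X) (Φ.deltaThenAw (A.T.obj X) (B.T.obj X)) z x := by
  rw [ev_theta]
  refine (LinearMap.congr_fun (pairOp_map_right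
    (K₀ := ((cochains A).tensor (cochains B)).pow p)
    (IsCxHom.piMap fun _ => isCxHom_xiAlpha A B).mem _ z) x).trans ?_
  exact (pairOp_natural (W := res Λ p) (K := ((cochains A).tensor (cochains B)).pow p)
    (D := (chains Λ (prod (A.T.obj X) (B.T.obj X))).pow p)
    (D' := ((chains Λ (A.T.obj X)).pow p).tensor ((chains Λ (B.T.obj X)).pow p))
    (c := LinearMap.id) (m := LinearMap.id)
    (k := Cx.shuffle p _ _ ∘ₗ PiTensorProduct.map (R := Λ)
      (s := fun _ : Fin p => chains Λ (prod (A.T.obj X) (B.T.obj X)))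
      (t := fun _ => (chains Λ (A.T.obj X)).tensor (chains Λ (B.T.obj X)))
      (fun _ => aw (A.T.obj X) (B.T.obj X)))
    (fun z => by rw [TensorProduct.map_id]; rfl)
    (fun F y => (powPairing_xiAlpha A B X F y).symm) z x).symm

/-- Both composites are the operations of `awThenDelta` and `deltaThenAw` for the same pairing, so
the natural equivariant homotopy between these two maps dualizes by `pairOp_homotopy`. -/
theorem piHomotopic_xiAlpha : PiHomotopic (xiAlpha A B ∘ₗ thetaTensor A Φ B)
    (theta (A.prod B) Φ ∘ₗ
      TensorProduct.map LinearMap.id (PiTensorProduct.map fun _ => xiAlpha A B)) := by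
  obtain ⟨H, hn, he, hd, hH⟩ := Φ.exists_diagonal_homotopy
  let P := ((cochains A).tensor (cochains B)).pow p
  let O : ∀ X, (res Λ p).tensor P →ₗ[Λ] chains Λ ((A.prod B).T.obj X) →ₗ[Λ] (A.prod B).M.obj X :=
    fun X => pairOp (W := res Λ p) (K := P) (C := chains Λ (prod (A.T.obj X) (B.T.obj X)))
      (D := ((chains Λ (A.T.obj X)).pow p).tensor ((chains Λ (B.T.obj X)).pow p))
      (shufflePairing A B p X) (H (A.T.obj X) (B.T.obj X))
  -- The twist by the degree involution required by `pairOp_homotopy`; it preserves degrees and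
  -- commutes with the group action, so it does not affect the other conditions on a homotopy.
  let S : (res Λ p).tensor P →ₗ[Λ] (res Λ p).tensor P := TensorProduct.map LinearMap.id P.sgn
  let H' : (res Λ p).tensor P →ₗ[Λ] cochains (A.prod B) :=
    LinearMap.codRestrict (cochainModule (A.prod B)) (LinearMap.pi O)
      (pairOp_shufflePairing_mem A B hn hd) ∘ₗ S
  refine ⟨H', fun n z hz X m hm x hx => ?_, fun σ z => ev_ext fun X x => ?_,
    fun z => ev_ext fun X x => ?_⟩
  · exact pairOp_eq_zero (isPairing_shufflePairing A B p X) (-1) (hd _ _)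
      (Cx.map_id_sgn_mem hz) hx (by lia)
  · have hS : S (piAct ((cochains A).tensor (cochains B)) σ z) =
        TensorProduct.map (resAct σ) (Cx.perm σ.1 fun _ => (cochains A).tensor (cochains B)) (S z) :=
      Cx.map_id_sgn_map (isCxHom_perm σ.1 fun _ => (cochains A).tensor (cochains B)).mem z
    refine (congrArg (fun z => O X z x) hS).trans (LinearMap.congr_fun (pairOp_invariant
      (W := res Λ p) (K := ((cochains A).tensor (cochains B)).pow p)
      (C := chains Λ (prod (A.T.obj X) (B.T.obj X)))
      (D := ((chains Λ (A.T.obj X)).pow p).tensor ((chains Λ (B.T.obj X)).pow p))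
      (isCxHom_resAct σ).mem (isCxHom_perm σ.1 fun _ => (cochains A).tensor (cochains B)).mem
      (shufflePairing_perm A B σ.1 X) (he σ _ _) (S z)) x)
  · have := pairOp_homotopy (W := res Λ p) (K := ((cochains A).tensor (cochains B)).pow p)
      (C := chains Λ (prod (A.T.obj X) (B.T.obj X)))
      (D := ((chains Λ (A.T.obj X)).pow p).tensor ((chains Λ (B.T.obj X)).pow p))
      (isPairing_shufflePairing A B p X) (hd _ _) (hH _ _) z x
    exact (congrArg₂ (· - ·) (ev_xiAlpha_thetaTensor A B Φ X z x)
      (ev_theta_xiAlpha A B Φ X z x)).trans this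

end Operations

end Bredon

end

theorem lemma5p10 {p : ℕ} [Fact p.Prime] (hp : p ≠ 2) {G : Type g} [Group G]
    (A : Bredon.Triple.{u, v₁, w₁, g} G (ZMod p)) (B : Bredon.Triple.{u, v₂, w₂, g} G (ZMod p)) :
    Nonempty (Bredon.DiagApprox.{u} (ZMod p) p) ∧
      ∀ Φ : Bredon.DiagApprox.{u} (ZMod p) p,
        Bredon.IsPiHom (Bredon.theta (A.prod B) Φ) ∧
        Bredon.IsPiHom (Bredon.thetaTensor A Φ B) ∧
        Bredon.IsCxHom (Bredon.xiAlpha A B) ∧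
        Bredon.PiHomotopic
          (Bredon.xiAlpha A B ∘ₗ Bredon.thetaTensor A Φ B)
          (Bredon.theta (A.prod B) Φ ∘ₗ
            TensorProduct.map LinearMap.id (PiTensorProduct.map fun _ => Bredon.xiAlpha A B)) := by
  exact ⟨Bredon.nonempty_diagApprox _ _, fun Φ => ⟨Bredon.isPiHom_theta (A.prod B) Φ,
    Bredon.isPiHom_thetaTensor A Φ B, Bredon.isCxHom_xiAlpha A B, Bredon.piHomotopic_xiAlpha A B Φ⟩⟩
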